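/- Conventions. $[Y]$ denotes the closed linear span of a subset $Y$ of a normed space; all inner products are conjugate-linear in the first and linear in the second variable; $\operatorname{Id}$ is the identity of $B$. **Partial automorphisms.** Let $B$ be a $C^*$-algebra. A partial automorphism of $B$ is a $*$-isomorphism $\theta\colon \operatorname{Dom}\theta\to\operatorname{Img}\theta$ between closed two-sided ideals of $B$; these form an inverse semigroup $\mathrm{PAut}(B)$ with involution $\theta^*=\theta^{-1}$; write $\theta'\le\theta$ if $\theta$ extends $\theta'$, and let $\theta\wedge\theta'$ be the largest partial automorphism extended by both $\theta$ and $\theta'$. **Bimodules over $B$.** A right $C^*$-$B$-$B$-bimodule is a full right Hilbert $C^*$-module $E$ over $B$ with a nondegenerate representation of $B$ by adjointable operators; morphisms are the adjointable operators that commute with the left actions of $B$. Put $E_\theta=\{\xi\in E\operatorname{Dom}\theta : \xi b=\theta(b)\xi \text{ for all } b\in\operatorname{Dom}\theta\}$ for $\theta\in\mathrm{PAut}(B)$. For an inverse subsemigroup $\Theta\subseteq\mathrm{PAut}(B)$, $E$ is decomposable ($\Theta$-decomposable) if the $E_\theta$ with $\theta\in\mathrm{PAut}(B)$ ($\theta\in\Theta$)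 are linearly dense in $E$, and $\Theta$-supported if $E_\theta=[\bigcup\{E_{\theta'}:\theta'\in\Theta,\theta'\le\theta\}]$ for all $\theta\in\mathrm{PAut}(B)$. $B$ is regarded as a bimodule over itself; $\Theta$ is admissible if $B$ is $\Theta$-supported, $\operatorname{Id}\in\Theta$, and $\theta\wedge\theta'\in\Theta$ for all $\theta,\theta'\in\Theta$. For $\xi\in E_\theta$ let $|\xi\rangle,|\xi]\colon B\to E$ be the operators $b\mapsto\xi b$ and $b\mapsto b\xi$; they are homogeneous of degree $(\theta,\operatorname{Id})$ and $(\operatorname{Id},\theta^*)$, respectively. An operator $T\colon E\to F$ of degree $(\rho,\sigma)$ has an adjoint $T^*\colon F\to E$ of degree $(\rho^*,\sigma^*)$, characterized by $\langle T^*\eta|\xi\rangle\in\operatorname{Dom}\sigma$ and $\langle\eta|T\xi\rangle=\sigma(\langle T^*\eta|\xi\rangle)$. Let $|E\rangle$ and $|E]$ be the families of operators whose only possibly non-zero components are $|E\rangle^{\theta}_{\operatorname{Id}}=\{|\xi\rangle:\xi\in E_\theta\}$ and $|E]^{\operatorname{Id}}_{\theta}=\{|\xi]:\xi\in E_{\theta^*}\}$.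 For families $\mathcal D,\mathcal C$ let $(\mathcal C^*)^\rho_\sigma=(\mathcal C^{\rho^*}_{\sigma^*})^*$ and let $[\mathcal D\mathcal C]^{\rho''}_{\sigma''}$ be the closed linear span of all $T'T$ with $T'\in\mathcal D^{\rho'}_{\sigma'}$, $T\in\mathcal C^{\rho}_{\sigma}$, $\rho'\rho\le\rho''$, $\sigma'\sigma\le\sigma''$. For admissible $\Theta$, $E$ is $\Theta$-admissible if it is $\Theta$-decomposable, $[|E\rangle^*|E\rangle]=|B\rangle$ and $[|E]^*|E]]=|B]$. The internal tensor product $E\otimes F$ is the separated completion of the algebraic tensor product with respect to $\langle\xi\otimes\eta|\xi'\otimes\eta'\rangle=\langle\eta|\langle\xi|\xi'\rangle\eta'\rangle$, with actions $b(\xi\otimes\eta)c=b\xi\otimes\eta c$. **Bimodules over a $C^*$-base.** A $C^*$-base $(\mathfrak H,\mathfrak B,\mathfrak B^\dagger)$ consists of a Hilbert space and two commuting nondegenerate $C^*$-algebras on it. A $C^*$-factorization of a Hilbert space $H$ with respect to it is a closed subspace $\alpha\subseteq\mathcal L(\mathfrak H,H)$ with $[\alpha^*\alpha]=\mathfrak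 B$, $[\alpha\mathfrak B]=\alpha$, $[\alpha\mathfrak H]=H$; then $\rho_\alpha\colon\mathfrak B^\dagger\to\mathcal L(H)$ is given by $\rho_\alpha(b)\xi\zeta=\xi b\zeta$ for $\xi\in\alpha$, $\zeta\in\mathfrak H$. A $C^*$-bimodule ${}_\beta H_\alpha$ over the $C^*$-base is a Hilbert space $H$ with $C^*$-factorizations $\alpha$ and $\beta$ with respect to $(\mathfrak H,\mathfrak B,\mathfrak B^\dagger)$ and $(\mathfrak H,\mathfrak B^\dagger,\mathfrak B)$ such that $[\rho_\alpha(\mathfrak B^\dagger)\beta]=\beta$ and $[\rho_\beta(\mathfrak B)\alpha]=\alpha$; a morphism ${}_\beta H_\alpha\to{}_\delta K_\gamma$ is a $T\in\mathcal L(H,K)$ with $T\alpha\subseteq\gamma$, $T^*\gamma\subseteq\alpha$, $T\beta\subseteq\delta$, $T^*\delta\subseteq\beta$. The relative tensor product of ${}_\beta H_\alpha$ and ${}_\delta K_\gamma$ is the separated completion of the algebraic tensor product $\alpha\otimes\mathfrak H\otimes\delta$ with respect to $\langle\xi\otimes\zeta\otimes\eta|\xi'\otimes\zeta'\otimes\eta'\rangle=\langle\zeta|(\xi^*\xi')(\eta^*\eta')\zeta'\rangle$,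 together with $\beta\triangleleft\delta=[|\delta\rangle_2\beta]$ and $\alpha\triangleright\gamma=[|\alpha\rangle_1\gamma]$, where $|\xi\rangle_1\eta\zeta=\xi\otimes\zeta\otimes\eta=|\eta\rangle_2\xi\zeta$ for $\xi\in\alpha$, $\zeta\in\mathfrak H$, $\eta\in\delta$. **Covariant representations.** A covariant representation of $(B,\Theta)$ on a Hilbert space $\mathfrak K$ is a pair of a $*$-homomorphism $\pi\colon B\to\mathcal L(\mathfrak K)$ and a map $\upsilon\colon\Theta\to\mathcal L(\mathfrak K)$ with $\upsilon(\theta)\upsilon(\theta')=\upsilon(\theta\theta')$, $\upsilon(\theta)^*=\upsilon(\theta^*)$, $\upsilon(\theta)\mathfrak K=[\pi(\operatorname{Img}\theta)\mathfrak K]$ and $\upsilon(\theta)\pi(b)\upsilon(\theta)^*=\pi(\theta(b))$ for $\theta,\theta'\in\Theta$, $b\in\operatorname{Dom}\theta$. Let $E\otimes_\pi\mathfrak K$ be the Hilbert space obtained from the algebraic tensor product and $\langle\xi\otimes\zeta|\xi'\otimes\zeta'\rangle=\langle\zeta|\pi(\langle\xi|\xi'\rangle)\zeta'\rangle$, and let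 $\alpha(E)$ and $\beta(E)$ be the closed linear spans in $\mathcal L(B\otimes_\pi\mathfrak K,E\otimes_\pi\mathfrak K)$ of all operators $|\xi\rangle\otimes\upsilon(\operatorname{Id})$ and $|\xi]\otimes\upsilon(\theta^*)$, respectively, where $\xi\in E_\theta$, $\theta\in\Theta$. **Theorem.** Let $B$ be a decomposable $C^*$-algebra, $\Theta\subseteq\mathrm{PAut}(B)$ an admissible inverse semigroup, and $(\pi,\upsilon)$ a covariant representation of $(B,\Theta)$ on a Hilbert space $\mathfrak K$ with $\pi$ faithful. Put $\mathfrak H=B\otimes_\pi\mathfrak K$, $\mathfrak B=\alpha(B)$, $\mathfrak B^\dagger=\beta(B)$. 1. $(\mathfrak H,\mathfrak B,\mathfrak B^\dagger)$ is a $C^*$-base, and ${}_{\beta(E)}(E\otimes_\pi\mathfrak K)_{\alpha(E)}$ is a $C^*$-bimodule over it for every $\Theta$-admissible right $C^*$-$B$-$B$-bimodule $E$. 2. The right $C^*$-$B$-$B$-bimodules form a monoidal category with the internal tensor product, unit $B$, $(S\otimes T)(\xi\otimes\eta)=S\xi\otimes T\eta$, associator $(\xi\otimes\eta)\otimes\zeta\mapsto\xi\otimes(\eta\otimes\zeta)$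 and unit isomorphisms $b\otimes\xi\mapsto b\xi$, $\xi\otimes b\mapsto\xi b$; the $\Theta$-admissible ones form a monoidal full subcategory. The $C^*$-bimodules over $(\mathfrak H,\mathfrak B,\mathfrak B^\dagger)$ form a monoidal category with the relative tensor product (in particular, this is well defined), unit ${}_{\mathfrak B^\dagger}\mathfrak H_{\mathfrak B}$, $(S\otimes T)(\xi\otimes\zeta\otimes\eta)=S\xi\otimes\zeta\otimes T\eta$, associators $a$ determined by $a\,|\vartheta\rangle_2|\xi\rangle_1\omega=|\xi\rangle_1|\vartheta\rangle_2\,\omega$ (for bimodules ${}_\beta H_\alpha,{}_\delta K_\gamma,{}_\phi L_\epsilon$ and $\xi\in\alpha$, $\omega\in K$, $\vartheta\in\phi$), and unit isomorphisms $b\otimes\zeta\otimes\xi\mapsto\xi b\zeta$ and $\eta\otimes\zeta\otimes b^\dagger\mapsto\eta b^\dagger\zeta$. 3. $E\mapsto{}_{\beta(E)}(E\otimes_\pi\mathfrak K)_{\alpha(E)}$, $T\mapsto T\otimes\operatorname{Id}$ defines a full and faithful functor from the category of $\Theta$-admissible right $C^*$-$B$-$B$-bimodules to the category of $C^*$-bimodules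 over $(\mathfrak H,\mathfrak B,\mathfrak B^\dagger)$. 4. There are natural isomorphisms of $C^*$-bimodules $\tau_{E,F}$ from the relative tensor product of ${}_{\beta(E)}(E\otimes_\pi\mathfrak K)_{\alpha(E)}$ and ${}_{\beta(F)}(F\otimes_\pi\mathfrak K)_{\alpha(F)}$ to ${}_{\beta(E\otimes F)}(E\otimes F\otimes_\pi\mathfrak K)_{\alpha(E\otimes F)}$ such that $$\tau_{E,F}\big((|\xi\rangle\otimes\operatorname{Id})\otimes(b\otimes\zeta)\otimes(|\eta]\otimes\upsilon(\theta)^*)\big)=(\xi\otimes b\eta)\otimes\upsilon(\theta)^*\zeta$$ for all $\xi\in E$, $b\in B$, $\zeta\in\mathfrak K$, $\eta\in F_\theta$, $\theta\in\Theta$. Together with $\tau$ and $\epsilon=\operatorname{Id}_{\mathfrak H}$, the functor in 3. is a monoidal functor (with invertible structure morphisms). -/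

import Mathlib

open CategoryTheory TensorProduct
open scoped InnerProductSpace ComplexOrder

universe u v w

noncomputable section

/-! ### Partial automorphisms of a C*-algebra -/

/-- A partial automorphism of the C*-algebra `B`: a `*`-isomorphism between two closed two-sided
ideals of `B`, given by its graph. -/
@[ext] structure PAut (B : Type u) [NonUnitalCStarAlgebra B] where
  graph : NonUnitalStarSubalgebra ℂ (B × B)
  right_unique : ∀ {a c c' : B}, (a, c) ∈ graph → (a, c') ∈ graph → c = c'
  left_unique : ∀ {a a' c : B}, (a, c) ∈ graph → (a', c) ∈ graph → a = a'
  isClosed_dom : IsClosed {a : B | ∃ c, (a, c) ∈ graph}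
  mul_dom : ∀ (b : B) {a c : B}, (a, c) ∈ graph → ∃ c', (b * a, c') ∈ graph
  dom_mul : ∀ (b : B) {a c : B}, (a, c) ∈ graph → ∃ c', (a * b, c') ∈ graph
  isClosed_img : IsClosed {c : B | ∃ a, (a, c) ∈ graph}
  mul_img : ∀ (b : B) {a c : B}, (a, c) ∈ graph → ∃ a', (a', b * c) ∈ graph
  img_mul : ∀ (b : B) {a c : B}, (a, c) ∈ graph → ∃ a', (a', c * b) ∈ graph

namespace PAut

variable {B : Type u} [NonUnitalCStarAlgebra B]

/-- `θ.Maps a c` means `a ∈ Dom(θ)` and `θ(a) = c`. -/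
def Maps (θ : PAut B) (a c : B) : Prop := (a, c) ∈ θ.graph

def dom (θ : PAut B) : Set B := {a | ∃ c, θ.Maps a c}

def img (θ : PAut B) : Set B := {c | ∃ a, θ.Maps a c}

/-- `θ ≤ θ'` means that `θ'` extends `θ`. -/
instance : PartialOrder (PAut B) where
  le θ θ' := ∀ a c, θ.Maps a c → θ'.Maps a c
  le_refl _ _ _ h := h
  le_trans _ _ _ h h' a c x := h' a c (h a c x)
  le_antisymm θ θ' h h' := by
    ext ⟨a, c⟩
    exact ⟨h a c, h' a c⟩

/-- The identity automorphism of `B`. -/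
instance : One (PAut B) where
  one :=
    { graph :=
        { carrier := {p | p.1 = p.2}
          add_mem' := by rintro ⟨a, b⟩ ⟨c, d⟩ h h'; simp_all
          zero_mem' := by simp
          mul_mem' := by rintro ⟨a, b⟩ ⟨c, d⟩ h h'; simp_all
          smul_mem' := by rintro z ⟨a, b⟩ h; simp_all
          star_mem' := by rintro ⟨a, b⟩ h; simp_all }
      right_unique := fun {a c c'} (h : a = c) (h' : a = c') => h.symm.trans h'
      left_unique := fun {a a' c} (h : a = c) (h' : a' = c) => h.trans h'.symm
      isClosed_dom := by
        convert isClosed_univ using 1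
        exact Set.eq_univ_of_forall fun a => ⟨a, rfl⟩
      mul_dom := fun b a _ _ => ⟨b * a, rfl⟩
      dom_mul := fun b a _ _ => ⟨a * b, rfl⟩
      isClosed_img := by
        convert isClosed_univ using 1
        exact Set.eq_univ_of_forall fun a => ⟨a, rfl⟩
      mul_img := fun b _ c _ => ⟨b * c, rfl⟩
      img_mul := fun b _ c _ => ⟨c * b, rfl⟩ }

/-- The inverse partial automorphism, with domain `Img(θ)` and image `Dom(θ)`. -/
instance : Star (PAut B) where
  star θ :=
    { graph :=
        { carrier := {p | (p.2, p.1) ∈ θ.graph}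
          add_mem' := fun h h' => add_mem (S := NonUnitalStarSubalgebra ℂ (B × B)) h h'
          zero_mem' := zero_mem θ.graph
          mul_mem' := fun h h' => mul_mem (S := NonUnitalStarSubalgebra ℂ (B × B)) h h'
          smul_mem' := fun z _ h => θ.graph.smul_mem' z h
          star_mem' := fun h => θ.graph.star_mem' h }
      right_unique := fun h h' => θ.left_unique h h'
      left_unique := fun h h' => θ.right_unique h h'
      isClosed_dom := θ.isClosed_img
      mul_dom := fun b _ _ h => θ.mul_img b h
      dom_mul := fun b _ _ h => θ.img_mul b h
      isClosed_img := θ.isClosed_dom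
      mul_img := fun b _ _ h => θ.mul_dom b h
      img_mul := fun b _ _ h => θ.dom_mul b h }

/-- The graph of the composition `θ ∘ θ'`, defined on `θ'⁻¹(Img(θ') ∩ Dom(θ))`. -/
def compGraph (θ θ' : PAut B) : NonUnitalStarSubalgebra ℂ (B × B) where
  carrier := {p | ∃ m, θ'.Maps p.1 m ∧ θ.Maps m p.2}
  add_mem' := by
    rintro p q ⟨m, h, h'⟩ ⟨n, k, k'⟩
    exact ⟨m + n, add_mem (S := NonUnitalStarSubalgebra ℂ (B × B)) h k,
      add_mem (S := NonUnitalStarSubalgebra ℂ (B × B)) h' k'⟩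
  zero_mem' := ⟨0, zero_mem θ'.graph, zero_mem θ.graph⟩
  mul_mem' := by
    rintro p q ⟨m, h, h'⟩ ⟨n, k, k'⟩
    exact ⟨m * n, mul_mem (S := NonUnitalStarSubalgebra ℂ (B × B)) h k,
      mul_mem (S := NonUnitalStarSubalgebra ℂ (B × B)) h' k'⟩
  smul_mem' := by
    rintro z p ⟨m, h, h'⟩
    exact ⟨z • m, θ'.graph.smul_mem' z h, θ.graph.smul_mem' z h'⟩
  star_mem' := by
    rintro p ⟨m, h, h'⟩
    exact ⟨star m, θ'.graph.star_mem' h, θ.graph.star_mem' h'⟩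

/-- The domain of a partial automorphism as a C*-subalgebra. -/
def domAlg (θ : PAut B) : NonUnitalStarSubalgebra ℂ B where
  carrier := θ.dom
  add_mem' := by
    rintro _ _ ⟨c, h⟩ ⟨d, k⟩
    exact ⟨c + d, add_mem (S := NonUnitalStarSubalgebra ℂ (B × B)) h k⟩
  zero_mem' := ⟨0, zero_mem θ.graph⟩
  mul_mem' := by
    rintro _ _ ⟨c, h⟩ ⟨d, k⟩
    exact ⟨c * d, mul_mem (S := NonUnitalStarSubalgebra ℂ (B × B)) h k⟩
  smul_mem' := by
    rintro z _ ⟨c, h⟩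
    exact ⟨z • c, θ.graph.smul_mem' z h⟩
  star_mem' := by
    rintro _ ⟨c, h⟩
    exact ⟨star c, θ.graph.star_mem' h⟩

/-- A partial automorphism as a function on its domain. -/
def toHom (θ : PAut B) : θ.domAlg →⋆ₙₐ[ℂ] B where
  toFun a := a.2.choose
  map_smul' z a := θ.right_unique (z • a).2.choose_spec (θ.graph.smul_mem' z a.2.choose_spec)
  map_zero' := θ.right_unique (0 : θ.domAlg).2.choose_spec (zero_mem θ.graph)
  map_add' a b := θ.right_unique (a + b).2.choose_spec
    (add_mem (S := NonUnitalStarSubalgebra ℂ (B × B)) a.2.choose_spec b.2.choose_spec)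
  map_mul' a b := θ.right_unique (a * b).2.choose_spec
    (mul_mem (S := NonUnitalStarSubalgebra ℂ (B × B)) a.2.choose_spec b.2.choose_spec)
  map_star' a := θ.right_unique (star a).2.choose_spec (θ.graph.star_mem' a.2.choose_spec)

lemma isometry_toHom (θ : PAut B) : Isometry θ.toHom := by
  have : IsClosed (θ.domAlg : Set B) := θ.isClosed_dom
  let : NonUnitalCStarAlgebra θ.domAlg :=
    NonUnitalStarSubalgebra.nonUnitalCStarAlgebra (h_closed := this) θ.domAlg
  refine NonUnitalStarAlgHom.isometry θ.toHom fun a b h => Subtype.ext ?_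
  have ha := a.2.choose_spec
  have hb := b.2.choose_spec
  change a.2.choose = b.2.choose at h
  rw [← h] at hb
  exact θ.left_unique ha hb

lemma isClosed_comp_dom (θ θ' : PAut B) :
    IsClosed {a : B | ∃ c, (a, c) ∈ compGraph θ θ'} := by
  have h1 : IsClosed (θ'.toHom ⁻¹' θ.dom) := θ.isClosed_dom.preimage θ'.isometry_toHom.continuous
  have h2 := (IsClosed.isClosedEmbedding_subtypeVal
    (θ'.isClosed_dom : IsClosed {a | a ∈ θ'.domAlg})).isClosedMap _ h1
  convert h2 using 1
  ext a
  constructor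
  · rintro ⟨c, m, h, h'⟩
    have ha : a ∈ θ'.domAlg := ⟨m, h⟩
    refine ⟨⟨a, ha⟩, ⟨c, ?_⟩, rfl⟩
    have : θ'.toHom ⟨a, ha⟩ = m := θ'.right_unique ha.choose_spec h
    exact (congrArg (fun y => θ.Maps y c) this).mpr h'
  · rintro ⟨⟨a, ha⟩, ⟨c, h'⟩, rfl⟩
    exact ⟨c, _, ha.choose_spec, h'⟩

lemma comp_dom_mul (θ θ' : PAut B) (b : B) {a c : B} (h : (a, c) ∈ compGraph θ θ') :
    (∃ c', (b * a, c') ∈ compGraph θ θ') ∧ ∃ c', (a * b, c') ∈ compGraph θ θ' := by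
  let J : NonUnitalStarSubalgebra ℂ B :=
    { carrier := {a : B | ∃ c, (a, c) ∈ compGraph θ θ'}
      add_mem' := fun ⟨c, h⟩ ⟨d, k⟩ =>
        ⟨c + d, add_mem (S := NonUnitalStarSubalgebra ℂ (B × B)) h k⟩
      zero_mem' := ⟨0, zero_mem (compGraph θ θ')⟩
      mul_mem' := fun ⟨c, h⟩ ⟨d, k⟩ =>
        ⟨c * d, mul_mem (S := NonUnitalStarSubalgebra ℂ (B × B)) h k⟩
      smul_mem' := fun z _ ⟨c, h⟩ => ⟨z • c, (compGraph θ θ').smul_mem' z h⟩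
      star_mem' := fun ⟨c, h⟩ => ⟨star c, (compGraph θ θ').star_mem' h⟩ }
  have hJ : IsClosed (J : Set B) := isClosed_comp_dom θ θ'
  let : NonUnitalCStarAlgebra J :=
    NonUnitalStarSubalgebra.nonUnitalCStarAlgebra (h_closed := hJ) J
  let := CStarAlgebra.spectralOrder J
  have := CStarAlgebra.spectralOrderedRing J
  have hu := (CStarAlgebra.increasingApproximateUnit J).toIsApproximateUnit
  have := hu.neBot
  have key : ∀ e ∈ J, (b * a) * e ∈ J ∧ e * (a * b) ∈ J := by
    rintro e ⟨e', n, hn, hn'⟩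
    obtain ⟨m, hm, hm'⟩ := h
    obtain ⟨p, hp⟩ := θ'.mul_dom b hm
    obtain ⟨q, hq⟩ := θ'.dom_mul b hm
    obtain ⟨r, hr⟩ := θ.mul_dom p hn'
    obtain ⟨s, hs⟩ := θ.dom_mul q hn'
    exact ⟨⟨r, p * n, mul_mem (S := NonUnitalStarSubalgebra ℂ (B × B)) hp hn, hr⟩,
      ⟨s, n * q, mul_mem (S := NonUnitalStarSubalgebra ℂ (B × B)) hn hq, hs⟩⟩
  let x : J := ⟨a, c, h⟩
  have t1 : Filter.Tendsto (fun e : J => (b * a) * (e : B)) (CStarAlgebra.approximateUnit J)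
      (nhds (b * a)) := by
    have := ((continuous_subtype_val.tendsto _).comp (hu.tendsto_mul_left x)).const_mul b
    simpa [Function.comp_def, mul_assoc, x] using this
  have t2 : Filter.Tendsto (fun e : J => (e : B) * (a * b)) (CStarAlgebra.approximateUnit J)
      (nhds (a * b)) := by
    have := ((continuous_subtype_val.tendsto _).comp (hu.tendsto_mul_right x)).mul_const b
    simpa [Function.comp_def, mul_assoc, x] using this
  exact ⟨hJ.mem_of_tendsto t1 (Filter.Eventually.of_forall fun e => (key e e.2).1),
    hJ.mem_of_tendsto t2 (Filter.Eventually.of_forall fun e => (key e e.2).2)⟩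

/-- Composition of partial automorphisms. -/
instance : Mul (PAut B) where
  mul θ θ' :=
    { graph := compGraph θ θ'
      right_unique := by
        rintro a c c' ⟨m, h, h'⟩ ⟨n, k, k'⟩
        obtain rfl := θ'.right_unique h k
        exact θ.right_unique h' k'
      left_unique := by
        rintro a a' c ⟨m, h, h'⟩ ⟨n, k, k'⟩
        obtain rfl := θ.left_unique h' k'
        exact θ'.left_unique h k
      isClosed_dom := isClosed_comp_dom θ θ'
      mul_dom := fun b _ _ h => (comp_dom_mul θ θ' b h).1
      dom_mul := fun b _ _ h => (comp_dom_mul θ θ' b h).2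
      isClosed_img := by
        have h := isClosed_comp_dom (star θ') (star θ)
        have e : {c : B | ∃ a, (a, c) ∈ compGraph θ θ'} =
            {a : B | ∃ c, (a, c) ∈ compGraph (star θ') (star θ)} :=
          Set.ext fun c => ⟨fun ⟨a, m, h, h'⟩ => ⟨a, m, h', h⟩, fun ⟨a, m, h, h'⟩ => ⟨a, m, h', h⟩⟩
        exact e ▸ h
      mul_img := by
        rintro b a c ⟨m, h, h'⟩
        obtain ⟨c', n, k, k'⟩ := (comp_dom_mul (star θ') (star θ) b (a := c) (c := a) ⟨m, h', h⟩).1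
        exact ⟨c', n, k', k⟩
      img_mul := by
        rintro b a c ⟨m, h, h'⟩
        obtain ⟨c', n, k, k'⟩ := (comp_dom_mul (star θ') (star θ) b (a := c) (c := a) ⟨m, h', h⟩).2
        exact ⟨c', n, k', k⟩ }

lemma maps_mul {θ θ' : PAut B} {a c : B} :
    (θ * θ').Maps a c ↔ ∃ m, θ'.Maps a m ∧ θ.Maps m c := Iff.rfl

lemma maps_star {θ : PAut B} {a c : B} : (star θ).Maps a c ↔ θ.Maps c a := Iff.rfl

lemma maps_one {a c : B} : (1 : PAut B).Maps a c ↔ a = c := Iff.rfl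

end PAut

/-- An inverse subsemigroup of the inverse semigroup of all partial automorphisms of `B`. -/
structure InvSemigroup (B : Type u) [NonUnitalCStarAlgebra B] where
  carrier : Set (PAut B)
  mul_mem : ∀ {θ θ'}, θ ∈ carrier → θ' ∈ carrier → θ * θ' ∈ carrier
  star_mem : ∀ {θ}, θ ∈ carrier → star θ ∈ carrier

/-! ### Positivity of Gram matrices and sesquilinear forms on algebraic tensor products -/

lemma exists_factor_of_compressions {M : Type w} [NonUnitalCStarAlgebra M] [PartialOrder M]
    [StarOrderedRing M] (G : M) (hG : IsSelfAdjoint G)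
    (h : ∀ N R : M, star N * G * N = -(star R * R) → R = 0) :
    ∃ S : M, star S * S = G ∧ ∀ D, Commute G D → Commute S D := by
  set N := G⁻ with hN
  have hN0 : 0 ≤ N := CFC.negPart_nonneg G
  have hNs : star N = N := (IsSelfAdjoint.of_nonneg hN0).star_eq
  have hNG : N * G = -(N * N) := by
    conv_lhs => rw [← CFC.posPart_sub_negPart G hG]
    rw [mul_sub, hN, CFC.negPart_mul_posPart, zero_sub]
  have hcube : 0 ≤ star N * N * N := star_left_conjugate_nonneg hN0 N
  obtain ⟨R, hR⟩ := CStarAlgebra.nonneg_iff_eq_star_mul_self.1 hcube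
  have hR0 : R = 0 := h N R (by rw [← hR, hNs, hNG, neg_mul])
  have hN3 : N * N * N = 0 := by rw [hNs] at hR; rw [hR, hR0]; simp
  have hNN : N * N = 0 := by
    rw [← CStarRing.star_mul_self_eq_zero_iff, star_mul, hNs, ← mul_assoc, hN3, zero_mul]
  have hNz : N = 0 := by
    rw [← CStarRing.star_mul_self_eq_zero_iff, hNs, hNN]
  have hG0 : 0 ≤ G := by
    rw [← CFC.posPart_sub_negPart G hG, ← hN, hNz, sub_zero]
    exact CFC.posPart_nonneg G
  refine ⟨CFC.sqrt G, ?_, fun D hD => Commute.cfcₙ_nnreal hD _⟩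
  rw [(IsSelfAdjoint.of_nonneg (CFC.sqrt_nonneg G)).star_eq, CFC.sqrt_mul_sqrt_self G hG0]

/-- A self-adjoint matrix `G` over a C*-algebra with `∑ bᵢ* Gᵢⱼ bⱼ ≥ 0` for all `b` is of the form
`S* S`, where `S` commutes with everything that commutes with `G`. -/
lemma exists_gram_factor {A : Type w} [NonUnitalCStarAlgebra A] [PartialOrder A] [StarOrderedRing A]
    {n : ℕ} (G : CStarMatrix (Fin n) (Fin n) A) (hG : IsSelfAdjoint G)
    (hpos : ∀ b : Fin n → A, 0 ≤ ∑ i, ∑ j, star (b i) * G i j * b j) :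
    ∃ S : CStarMatrix (Fin n) (Fin n) A, star S * S = G ∧ ∀ D, Commute G D → Commute S D := by
  have entry : ∀ (X Y : CStarMatrix (Fin n) (Fin n) A) (i j : Fin n),
      (X * Y) i j = ∑ k, X i k * Y k j := fun X Y i j => by simp [CStarMatrix.mul_apply]
  refine exists_factor_of_compressions G hG fun N R hR => ?_
  ext k j
  have h1 : (star R * R) j j = ∑ k, star (R k j) * R k j := by
    rw [entry]; rfl
  have h0 : 0 ≤ -((star R * R) j j) := by
    have h2 : -((star R * R) j j) = (star N * G * N) j j := by rw [hR]; rfl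
    rw [h2, entry]
    simp only [entry, Finset.sum_mul]
    rw [Finset.sum_comm]
    exact hpos fun i => N i j
  have h2 : 0 ≤ ∑ k, star (R k j) * R k j :=
    Finset.sum_nonneg fun k _ => star_mul_self_nonneg _
  have h3 : ∑ k, star (R k j) * R k j = 0 :=
    le_antisymm (by simpa [h1] using h0) h2
  have h4 := (Finset.sum_eq_zero_iff_of_nonneg fun k _ => star_mul_self_nonneg (R k j)).1 h3 k
    (Finset.mem_univ _)
  simpa using (CStarRing.star_mul_self_eq_zero_iff _).1 h4

section TensorForm

variable {E W : Type*} {A : Type*} [AddCommGroup E] [Module ℂ E] [AddCommGroup W] [Module ℂ W]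
  [AddCommGroup A] [Module ℂ A]

/-- The sesquilinear form on `E ⊗ W` given by
`(ξ ⊗ w, ξ' ⊗ w') ↦ b w (a ξ ξ' w')`. -/
def tensorForm (a : E →ₗ⋆[ℂ] E →ₗ[ℂ] (W →ₗ[ℂ] W)) (b : W →ₗ⋆[ℂ] W →ₗ[ℂ] A) :
    E ⊗[ℂ] W →ₗ⋆[ℂ] E ⊗[ℂ] W →ₗ[ℂ] A :=
  TensorProduct.lift
    (LinearMap.mk₂'ₛₗ (starRingEnd ℂ) (starRingEnd ℂ)
      (fun ξ w => TensorProduct.lift ((a ξ).compr₂ (b w)))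
      (fun ξ ξ' w => by ext; simp) (fun z ξ w => by ext; simp)
      (fun ξ w w' => by ext; simp) (fun z ξ w => by ext; simp))

@[simp] lemma tensorForm_tmul (a : E →ₗ⋆[ℂ] E →ₗ[ℂ] (W →ₗ[ℂ] W)) (b : W →ₗ⋆[ℂ] W →ₗ[ℂ] A)
    (ξ ξ' : E) (w w' : W) : tensorForm a b (ξ ⊗ₜ w) (ξ' ⊗ₜ w') = b w (a ξ ξ' w') := by
  simp [tensorForm]

lemma tensorForm_star [StarAddMonoid A] [StarModule ℂ A]
    (a : E →ₗ⋆[ℂ] E →ₗ[ℂ] (W →ₗ[ℂ] W)) (b : W →ₗ⋆[ℂ] W →ₗ[ℂ] A)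
    (h : ∀ ξ ξ' w w', star (b w (a ξ ξ' w')) = b w' (a ξ' ξ w)) (x y : E ⊗[ℂ] W) :
    star (tensorForm a b x y) = tensorForm a b y x := by
  induction x with
  | zero => simp
  | add x x' hx hx' => simp [hx, hx']
  | tmul ξ w =>
    induction y with
    | zero => simp
    | add y y' hy hy' => simp [hy, hy']
    | tmul ξ' w' => simp [h]

lemma tensorForm_nonneg [PartialOrder A] [IsOrderedAddMonoid A]
    (a : E →ₗ⋆[ℂ] E →ₗ[ℂ] (W →ₗ[ℂ] W)) (b : W →ₗ⋆[ℂ] W →ₗ[ℂ] A)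
    (hb : ∀ w, 0 ≤ b w w)
    (h : ∀ (n : ℕ) (ξ : Fin n → E), ∃ S T : Fin n → Fin n → W →ₗ[ℂ] W,
      (∀ i j w, a (ξ i) (ξ j) w = ∑ k, T k i (S k j w)) ∧
      ∀ k i w w', b w (T k i w') = b (S k i w) w') (x : E ⊗[ℂ] W) :
    0 ≤ tensorForm a b x x := by
  obtain ⟨n, ξ, w, rfl⟩ : ∃ (n : ℕ) (ξ : Fin n → E) (w : Fin n → W), x = ∑ i, ξ i ⊗ₜ w i := by
    induction x with
    | zero => exact ⟨0, Fin.elim0, Fin.elim0, by simp⟩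
    | tmul ξ w => exact ⟨1, fun _ => ξ, fun _ => w, by simp⟩
    | add x y hx hy =>
      obtain ⟨n, ξ, w, rfl⟩ := hx
      obtain ⟨m, ξ', w', rfl⟩ := hy
      exact ⟨n + m, Fin.append ξ ξ', Fin.append w w', by simp [Fin.sum_univ_add]⟩
  obtain ⟨S, T, h1, h2⟩ := h n ξ
  have : tensorForm a b (∑ i, ξ i ⊗ₜ w i) (∑ i, ξ i ⊗ₜ w i) =
      ∑ k, b (∑ i, S k i (w i)) (∑ j, S k j (w j)) := by
    simp only [map_sum, LinearMap.sum_apply, tensorForm_tmul, h1, h2]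
    conv_lhs => enter [2, i]; rw [Finset.sum_comm]
    rw [Finset.sum_comm]
  rw [this]
  exact Finset.sum_nonneg fun k _ => hb _

end TensorForm

/-! ### Semi-inner-product modules over a C*-algebra -/

section PreInner

variable {A : Type*} [NonUnitalCStarAlgebra A] [PartialOrder A] [StarOrderedRing A]
  {V : Type*} [AddCommGroup V] [Module ℂ V]

/-- An `A`-valued semi-inner product `s`, linear in the second variable, on a complex vector space
with a right multiplication `r` by elements of `A`. -/
structure IsPreInner (s : V →ₗ⋆[ℂ] V →ₗ[ℂ] A) (r : A → V →ₗ[ℂ] V) : Prop where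
  star_eq : ∀ x y, star (s x y) = s y x
  nonneg : ∀ x, 0 ≤ s x x
  right_mul : ∀ x y a, s x (r a y) = s x y * a

namespace IsPreInner

variable {s : V →ₗ⋆[ℂ] V →ₗ[ℂ] A} {r : A → V →ₗ[ℂ] V}

lemma left_mul (h : IsPreInner s r) (x y : V) (a : A) : s (r a x) y = star a * s x y := by
  rw [← h.star_eq, h.right_mul, star_mul, h.star_eq]

lemma norm_sq_le (h : IsPreInner s r) (x y : V) : ‖s x y‖ ^ 2 ≤ ‖s x x‖ * ‖s y y‖ := by
  have key : ∀ c : ℝ, 0 < c → ‖s x x‖ ≤ c → ‖s x y‖ ^ 2 ≤ c * ‖s y y‖ := by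
    intro c hc hx
    set a := s x y with ha
    have h0 : 0 ≤ s (r a x - (c : ℂ) • y) (r a x - (c : ℂ) • y) := h.nonneg _
    have h1 : s (r a x - (c : ℂ) • y) (r a x - (c : ℂ) • y) =
        star a * s x x * a - (2 * c) • (star a * a) + (c ^ 2) • s y y := by
      have e1 : s y x = star a := by rw [ha, h.star_eq]
      simp only [map_sub, LinearMap.sub_apply, map_smulₛₗ, LinearMap.smul_apply,
        h.right_mul, h.left_mul, ← ha, e1, Complex.conj_ofReal, RingHom.id_apply]
      simp only [Complex.coe_smul]
      module
    have h2 : star a * s x x * a ≤ c • (star a * a) :=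
      (CStarAlgebra.star_left_conjugate_le_norm_smul (h.star_eq x x)).trans
        (smul_le_smul_of_nonneg_right hx (star_mul_self_nonneg a))
    have h3 : star a * a ≤ c • s y y := by
      rw [h1] at h0
      have h4 : c • (star a * a) ≤ c • (c • s y y) := by
        have h5 := add_le_add_right h2 (-(2 * c) • (star a * a) + (c ^ 2) • s y y)
        have h6 := le_trans (by convert h0 using 1; module) h5
        rw [← sub_nonneg]
        convert h6 using 1
        module
      exact (smul_le_smul_iff_of_pos_left hc).1 h4
    calc ‖a‖ ^ 2 = ‖star a * a‖ := by rw [CStarRing.norm_star_mul_self, sq]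
      _ ≤ ‖c • s y y‖ := CStarAlgebra.norm_le_norm_of_nonneg_of_le (star_mul_self_nonneg a) h3
      _ = c * ‖s y y‖ := by rw [norm_smul, Real.norm_of_nonneg hc.le]
  have hlim : Filter.Tendsto (fun ε : ℝ => (‖s x x‖ + ε) * ‖s y y‖) (nhdsWithin 0 (Set.Ioi 0))
      (nhds ((‖s x x‖ + 0) * ‖s y y‖)) :=
    (Continuous.tendsto (by fun_prop) 0).mono_left nhdsWithin_le_nhds
  rw [add_zero] at hlim
  refine ge_of_tendsto hlim ?_
  filter_upwards [self_mem_nhdsWithin] with ε hε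
  exact key _ (add_pos_of_nonneg_of_pos (norm_nonneg _) hε) (le_add_of_nonneg_right (le_of_lt hε))

lemma norm_le (h : IsPreInner s r) (x y : V) : ‖s x y‖ ≤ √‖s x x‖ * √‖s y y‖ := by
  rw [← Real.sqrt_mul (norm_nonneg _)]
  exact Real.le_sqrt_of_sq_le (h.norm_sq_le x y)

lemma triangle (h : IsPreInner s r) (x y : V) :
    √‖s (x + y) (x + y)‖ ≤ √‖s x x‖ + √‖s y y‖ := by
  rw [Real.sqrt_le_left (by positivity)]
  have h1 : s (x + y) (x + y) = s x x + s x y + (s y x + s y y) := by simp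
  have h2 := h.norm_le x y
  have h3 := h.norm_le y x
  have h4 := Real.sq_sqrt (norm_nonneg (s x x))
  have h5 := Real.sq_sqrt (norm_nonneg (s y y))
  calc ‖s (x + y) (x + y)‖ ≤ ‖s x x‖ + ‖s x y‖ + (‖s y x‖ + ‖s y y‖) := by
        rw [h1]
        exact (norm_add_le _ _).trans (add_le_add (norm_add_le _ _) (norm_add_le _ _))
    _ ≤ (√‖s x x‖ + √‖s y y‖) ^ 2 := by nlinarith

/-- The seminorm `x ↦ ‖s x x‖ ^ (1/2)`. -/
lemma core (h : IsPreInner s r) :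
    letI : Norm V := ⟨fun x => √‖s x x‖⟩
    SeminormedSpace.Core ℂ V :=
  letI : Norm V := ⟨fun x => √‖s x x‖⟩
  { norm_nonneg := fun _ => Real.sqrt_nonneg _
    norm_smul := fun c x => by
      change √‖s (c • x) (c • x)‖ = ‖c‖ * √‖s x x‖
      simp only [map_smulₛₗ, LinearMap.smul_apply, norm_smul, RCLike.norm_conj,
        RingHom.id_apply]
      rw [← mul_assoc, Real.sqrt_mul (by positivity), Real.sqrt_mul_self (norm_nonneg _)]
    norm_triangle := h.triangle }

lemma norm_right_mul_le (h : IsPreInner s r) (a : A) (x : V) :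
    √‖s (r a x) (r a x)‖ ≤ ‖a‖ * √‖s x x‖ := by
  rw [Real.sqrt_le_left (by positivity), mul_pow, Real.sq_sqrt (norm_nonneg _), h.right_mul,
    h.left_mul]
  calc ‖star a * s x x * a‖ ≤ ‖star a‖ * ‖s x x‖ * ‖a‖ :=
        (norm_mul_le _ _).trans (by gcongr; exact norm_mul_le _ _)
    _ = ‖a‖ ^ 2 * ‖s x x‖ := by rw [norm_star]; ring

/-- A `*`-representation of a C*-algebra on a semi-inner-product module is contractive. -/
lemma norm_rep_le {C : Type*} [NonUnitalCStarAlgebra C] (h : IsPreInner s r)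
    (l : C →ₗ[ℂ] V →ₗ[ℂ] V) (hmul : ∀ a b x, l (a * b) x = l a (l b x))
    (hstar : ∀ a x y, s (l a x) y = s x (l (star a) y)) (b : C) (x : V) :
    √‖s (l b x) (l b x)‖ ≤ ‖b‖ * √‖s x x‖ := by
  let := CStarAlgebra.spectralOrder (Unitization ℂ C)
  have := CStarAlgebra.spectralOrderedRing (Unitization ℂ C)
  have h1 : 0 ≤ algebraMap ℝ (Unitization ℂ C) (‖(b : Unitization ℂ C)‖ ^ 2) -
      star (b : Unitization ℂ C) * b :=
    sub_nonneg.2 CStarAlgebra.star_mul_le_algebraMap_norm_sq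
  obtain ⟨c, hc⟩ := CStarAlgebra.nonneg_iff_eq_star_mul_self.1 h1
  have halg : algebraMap ℝ (Unitization ℂ C) (‖(b : Unitization ℂ C)‖ ^ 2) =
      Unitization.inl ((‖b‖ ^ 2 : ℝ) : ℂ) := by rw [Unitization.norm_inr]; rfl
  rw [halg] at hc
  have hc' : (Unitization.inl ((‖b‖ ^ 2 : ℝ) : ℂ) : Unitization ℂ C) =
      star c * c + star (b : Unitization ℂ C) * b := by rw [← hc, sub_add_cancel]
  have hfst : ((‖b‖ ^ 2 : ℝ) : ℂ) = star c.fst * c.fst := by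
    simpa using congrArg (fun z => z.fst) hc'
  have hsnd : -(star b * b) = star c.fst • c.snd + c.fst • star c.snd + star c.snd * c.snd := by
    have h3 := congrArg (fun z => z.snd) hc'
    simp only [Unitization.snd_add, Unitization.snd_inl, Unitization.snd_mul, Unitization.snd_star,
      Unitization.fst_star, Unitization.snd_inr, Unitization.fst_inr, star_zero, zero_smul,
      zero_add] at h3
    exact (eq_neg_of_add_eq_zero_left h3.symm).symm
  have h2 : s (c.fst • x + l c.snd x) (c.fst • x + l c.snd x) =
      (‖b‖ ^ 2) • s x x - s (l b x) (l b x) := by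
    have e1 : s (l b x) (l b x) = s x (l (star b * b) x) := by rw [hstar, hmul]
    rw [e1]
    have e3 : ((‖b‖ ^ 2 : ℝ)) • s x x = (c.fst * star c.fst) • s x x := by
      rw [mul_comm, ← hfst, Complex.coe_smul]
    rw [e3]
    have e4 : - s x (l (star b * b) x) = s x (l (-(star b * b)) x) := by simp
    rw [sub_eq_add_neg, e4, hsnd]
    simp only [map_add, LinearMap.add_apply, map_smulₛₗ, LinearMap.smul_apply, hstar,
      hmul, RingHom.id_apply, smul_add, smul_smul, starRingEnd_apply]
    abel
  have h3 : s (l b x) (l b x) ≤ (‖b‖ ^ 2) • s x x := by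
    rw [← sub_nonneg, ← h2]
    exact h.nonneg _
  rw [Real.sqrt_le_left (by positivity), mul_pow, Real.sq_sqrt (norm_nonneg _)]
  calc ‖s (l b x) (l b x)‖ ≤ ‖(‖b‖ ^ 2) • s x x‖ :=
        CStarAlgebra.norm_le_norm_of_nonneg_of_le (h.nonneg _) h3
    _ = ‖b‖ ^ 2 * ‖s x x‖ := by rw [norm_smul, Real.norm_of_nonneg (by positivity)]

end IsPreInner

end PreInner

section CompletionForm

open UniformSpace

variable {A : Type*} [NormedAddCommGroup A] [NormedSpace ℂ A] [CompleteSpace A]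
  {V : Type*} [SeminormedAddCommGroup V] [NormedSpace ℂ V]

/-- The extension of a sesquilinear map to the completion by continuity. -/
def extForm (s : V →ₗ⋆[ℂ] V →ₗ[ℂ] A) (x y : Completion V) : A :=
  ((Completion.isDenseInducing_toCompl V).prodMap (Completion.isDenseInducing_toCompl V)).extend
    (fun p : V × V => s p.1 p.2) (x, y)

lemma continuous_of_form_bound {s : V →ₗ⋆[ℂ] V →ₗ[ℂ] A} (hs : ∀ x y, ‖s x y‖ ≤ ‖x‖ * ‖y‖) :
    Continuous fun p : V × V => s p.1 p.2 := by
  let t := LinearMap.mkContinuous₂ s 1 fun x y => by simpa using hs x y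
  exact (t.continuous.comp continuous_fst).clm_apply continuous_snd

lemma continuous_extForm {s : V →ₗ⋆[ℂ] V →ₗ[ℂ] A} (hs : ∀ x y, ‖s x y‖ ≤ ‖x‖ * ‖y‖) :
    Continuous fun p : Completion V × Completion V => extForm s p.1 p.2 := by
  let s' : V →+ V →+ A :=
    { toFun := fun x => (s x).toAddMonoidHom
      map_zero' := by ext x; simp
      map_add' := fun x y => by ext z; simp }
  have : Continuous fun p : V × V => s' p.1 p.2 := continuous_of_form_bound hs
  exact (Completion.isDenseInducing_toCompl V).extend_Z_bilin
    (Completion.isDenseInducing_toCompl V) this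

lemma extForm_coe {s : V →ₗ⋆[ℂ] V →ₗ[ℂ] A} (hs : ∀ x y, ‖s x y‖ ≤ ‖x‖ * ‖y‖) (x y : V) :
    extForm s (x : Completion V) (y : Completion V) = s x y :=
  ((Completion.isDenseInducing_toCompl V).prodMap (Completion.isDenseInducing_toCompl V)).extend_eq
    (continuous_of_form_bound hs) (x, y)

lemma continuous_extForm_left {s : V →ₗ⋆[ℂ] V →ₗ[ℂ] A} (hs : ∀ x y, ‖s x y‖ ≤ ‖x‖ * ‖y‖)
    (y : Completion V) : Continuous fun x => extForm s x y :=
  (continuous_extForm hs).comp (Continuous.prodMk_left y)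

lemma continuous_extForm_right {s : V →ₗ⋆[ℂ] V →ₗ[ℂ] A} (hs : ∀ x y, ‖s x y‖ ≤ ‖x‖ * ‖y‖)
    (x : Completion V) : Continuous fun y => extForm s x y :=
  (continuous_extForm hs).comp (Continuous.prodMk_right x)

lemma extForm_add_left {s : V →ₗ⋆[ℂ] V →ₗ[ℂ] A} (hs : ∀ x y, ‖s x y‖ ≤ ‖x‖ * ‖y‖)
    (x x' y : Completion V) : extForm s (x + x') y = extForm s x y + extForm s x' y := by
  have cl := continuous_extForm_left hs
  have cr := continuous_extForm_right hs
  refine Completion.induction_on y (isClosed_eq (cr _) ((cr _).add (cr _))) fun y => ?_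
  refine Completion.induction_on x (isClosed_eq ((cl _).comp (continuous_add_const _))
    ((cl _).add continuous_const)) fun x => ?_
  refine Completion.induction_on x' (isClosed_eq ((cl _).comp (continuous_const_add _))
    (continuous_const.add (cl _))) fun x' => ?_
  rw [← Completion.coe_add, extForm_coe hs, extForm_coe hs, extForm_coe hs, map_add,
    LinearMap.add_apply]

lemma extForm_smul_left {s : V →ₗ⋆[ℂ] V →ₗ[ℂ] A} (hs : ∀ x y, ‖s x y‖ ≤ ‖x‖ * ‖y‖)
    (c : ℂ) (x y : Completion V) : extForm s (c • x) y = starRingEnd ℂ c • extForm s x y := by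
  have cl := continuous_extForm_left hs
  have cr := continuous_extForm_right hs
  refine Completion.induction_on y (isClosed_eq (cr _) ((cr _).const_smul _)) fun y => ?_
  refine Completion.induction_on x (isClosed_eq ((cl _).comp (continuous_const_smul c))
    ((cl _).const_smul _)) fun x => ?_
  rw [← Completion.coe_smul, extForm_coe hs, extForm_coe hs, map_smulₛₗ, LinearMap.smul_apply]

lemma extForm_add_right {s : V →ₗ⋆[ℂ] V →ₗ[ℂ] A} (hs : ∀ x y, ‖s x y‖ ≤ ‖x‖ * ‖y‖)
    (x y y' : Completion V) : extForm s x (y + y') = extForm s x y + extForm s x y' := by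
  have cl := continuous_extForm_left hs
  have cr := continuous_extForm_right hs
  refine Completion.induction_on x (isClosed_eq (cl _) ((cl _).add (cl _))) fun x => ?_
  refine Completion.induction_on y (isClosed_eq ((cr _).comp (continuous_add_const _))
    ((cr _).add continuous_const)) fun y => ?_
  refine Completion.induction_on y' (isClosed_eq ((cr _).comp (continuous_const_add _))
    (continuous_const.add (cr _))) fun y' => ?_
  rw [← Completion.coe_add, extForm_coe hs, extForm_coe hs, extForm_coe hs, map_add]

lemma extForm_smul_right {s : V →ₗ⋆[ℂ] V →ₗ[ℂ] A} (hs : ∀ x y, ‖s x y‖ ≤ ‖x‖ * ‖y‖)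
    (c : ℂ) (x y : Completion V) : extForm s x (c • y) = c • extForm s x y := by
  have cl := continuous_extForm_left hs
  have cr := continuous_extForm_right hs
  refine Completion.induction_on x (isClosed_eq (cl _) ((cl _).const_smul _)) fun x => ?_
  refine Completion.induction_on y (isClosed_eq ((cr _).comp (continuous_const_smul c))
    ((cr _).const_smul _)) fun y => ?_
  rw [← Completion.coe_smul, extForm_coe hs, extForm_coe hs, map_smul]

/-- The extended sesquilinear map as a bundled map. -/
def extFormₗ (s : V →ₗ⋆[ℂ] V →ₗ[ℂ] A) (hs : ∀ x y, ‖s x y‖ ≤ ‖x‖ * ‖y‖) :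
    Completion V →ₗ⋆[ℂ] Completion V →ₗ[ℂ] A :=
  LinearMap.mk₂'ₛₗ (starRingEnd ℂ) (RingHom.id ℂ) (extForm s) (extForm_add_left hs)
    (extForm_smul_left hs) (extForm_add_right hs) (extForm_smul_right hs)

lemma extFormₗ_coe (s : V →ₗ⋆[ℂ] V →ₗ[ℂ] A) (hs : ∀ x y, ‖s x y‖ ≤ ‖x‖ * ‖y‖) (x y : V) :
    extFormₗ s hs (x : Completion V) (y : Completion V) = s x y := extForm_coe hs x y

lemma continuous_extFormₗ (s : V →ₗ⋆[ℂ] V →ₗ[ℂ] A) (hs : ∀ x y, ‖s x y‖ ≤ ‖x‖ * ‖y‖) :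
    Continuous fun p : Completion V × Completion V => extFormₗ s hs p.1 p.2 :=
  continuous_extForm hs

end CompletionForm

section SepCompl

open UniformSpace

variable {A : Type*} [NonUnitalCStarAlgebra A] [PartialOrder A] [StarOrderedRing A]
  {V : Type*} [AddCommGroup V] [Module ℂ V] {s : V →ₗ⋆[ℂ] V →ₗ[ℂ] A} {r : A → V →ₗ[ℂ] V}

/-- The space `V` with the seminorm `x ↦ ‖s x x‖ ^ (1/2)`. -/
def Pre (_ : IsPreInner s r) : Type _ := V

variable (h : IsPreInner s r)

namespace Pre

instance : SeminormedAddCommGroup (Pre h) :=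
  letI : Norm V := ⟨fun x => √‖s x x‖⟩
  (SeminormedAddCommGroup.ofCore h.core : SeminormedAddCommGroup V)

lemma norm_def (x : Pre h) : ‖x‖ = √‖s x x‖ := rfl

instance : NormedSpace ℂ (Pre h) where
  smul c x := (c • (show V from x) : V)
  one_smul x := one_smul ℂ (show V from x)
  mul_smul c d x := mul_smul c d (show V from x)
  smul_zero c := smul_zero (A := V) c
  smul_add c x y := smul_add c (show V from x) (show V from y)
  add_smul c d x := add_smul c d (show V from x)
  zero_smul x := zero_smul ℂ (show V from x)
  norm_smul_le c x :=
    letI : Norm V := ⟨fun x => √‖s x x‖⟩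
    (h.core.norm_smul c x).le

/-- The identity map of `V`, viewed as a map to `Pre h`. -/
def mk : V →ₗ[ℂ] Pre h where
  toFun x := x
  map_add' _ _ := rfl
  map_smul' _ _ := rfl

/-- The identity map of `V`, viewed as a map from `Pre h`. -/
def out : Pre h →ₗ[ℂ] V where
  toFun x := x
  map_add' _ _ := rfl
  map_smul' _ _ := rfl

lemma norm_mk (x : V) : ‖mk h x‖ = √‖s x x‖ := rfl

/-- The form of `Pre h`. -/
def form : Pre h →ₗ⋆[ℂ] Pre h →ₗ[ℂ] A := 
  LinearMap.mk₂'ₛₗ (starRingEnd ℂ) (RingHom.id ℂ) (fun x y => s (out h x) (out h y))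
    (fun _ _ _ => by simp) (fun _ _ _ => by simp) (fun _ _ _ => by simp) (fun _ _ _ => by simp)

lemma norm_form_le (x y : Pre h) : ‖form h x y‖ ≤ ‖x‖ * ‖y‖ := h.norm_le x y

end Pre

/-- The separated completion of `V` with respect to the seminorm `x ↦ ‖s x x‖ ^ (1/2)`. -/
abbrev SepCompl : Type _ := Completion (Pre h)

namespace SepCompl

/-- The canonical map into the separated completion. -/
def of : V →ₗ[ℂ] SepCompl h := Completion.toComplₗᵢ.toLinearMap ∘ₗ Pre.mk h

/-- The inner product on the separated completion. -/
def form : SepCompl h →ₗ⋆[ℂ] SepCompl h →ₗ[ℂ] A :=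
  extFormₗ (Pre.form h) (Pre.norm_form_le h)

lemma form_of (x y : V) : form h (of h x) (of h y) = s x y :=
  extFormₗ_coe (Pre.form h) (Pre.norm_form_le h) x y

lemma induction {p : SepCompl h → Prop} (x : SepCompl h) (hc : IsClosed {x | p x})
    (hp : ∀ x, p (of h x)) : p x :=
  Completion.induction_on x hc hp

lemma continuous_form : Continuous fun p : SepCompl h × SepCompl h => form h p.1 p.2 :=
  continuous_extFormₗ _ _

lemma continuous_form_left (y : SepCompl h) : Continuous fun x => form h x y :=
  (continuous_form h).comp (Continuous.prodMk_left y)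

lemma continuous_form_right (x : SepCompl h) : Continuous fun y => form h x y :=
  (continuous_form h).comp (Continuous.prodMk_right x)

lemma norm_of (x : V) : ‖of h x‖ = √‖s x x‖ := Completion.norm_coe (Pre.mk h x)

lemma denseRange_of : DenseRange (of h) :=
  Completion.denseRange_coe (α := Pre h)

lemma star_form (x y : SepCompl h) : star (form h x y) = form h y x := by
  refine induction h x (isClosed_eq (continuous_form_left h y).star (continuous_form_right h y))
    fun x => ?_
  refine induction h y (isClosed_eq (continuous_form_right h _).star (continuous_form_left h _))
    fun y => ?_
  rw [form_of, form_of, h.star_eq]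

lemma form_self_nonneg (x : SepCompl h) : 0 ≤ form h x x := by
  have hc : Continuous fun x => form h x x :=
    (continuous_form h).comp (continuous_id.prodMk continuous_id)
  have hcl : IsClosed {a : A | 0 ≤ a} := CStarAlgebra.isClosed_nonneg
  refine induction h x (hcl.preimage hc) fun x => ?_
  have := h.nonneg x
  rwa [← form_of h] at this

lemma norm_sq (x : SepCompl h) : ‖x‖ ^ 2 = ‖form h x x‖ := by
  have hc : Continuous fun x => form h x x :=
    (continuous_form h).comp (continuous_id.prodMk continuous_id)
  refine induction h x (isClosed_eq (f := fun x => ‖x‖ ^ 2) (by fun_prop) hc.norm) fun x => ?_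
  rw [form_of, norm_of, Real.sq_sqrt (norm_nonneg _)]

/-- The extension of a bounded linear map to separated completions. -/
def map {A' : Type*} [NonUnitalCStarAlgebra A'] [PartialOrder A'] [StarOrderedRing A']
    {V' : Type*} [AddCommGroup V'] [Module ℂ V'] {s' : V' →ₗ⋆[ℂ] V' →ₗ[ℂ] A'}
    {r' : A' → V' →ₗ[ℂ] V'} (h' : IsPreInner s' r') (T : V →ₗ[ℂ] V') (C : ℝ)
    (hT : ∀ x, √‖s' (T x) (T x)‖ ≤ C * √‖s x x‖) : SepCompl h →L[ℂ] SepCompl h' :=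
  (LinearMap.mkContinuous (Pre.mk h' ∘ₗ T ∘ₗ Pre.out h) C hT).completion

lemma map_of {A' : Type*} [NonUnitalCStarAlgebra A'] [PartialOrder A'] [StarOrderedRing A']
    {V' : Type*} [AddCommGroup V'] [Module ℂ V'] {s' : V' →ₗ⋆[ℂ] V' →ₗ[ℂ] A'}
    {r' : A' → V' →ₗ[ℂ] V'} (h' : IsPreInner s' r') (T : V →ₗ[ℂ] V') (C : ℝ)
    (hT : ∀ x, √‖s' (T x) (T x)‖ ≤ C * √‖s x x‖) (x : V) :
    map h h' T C hT (of h x) = of h' (T x) :=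
  ContinuousLinearMap.completion_apply_coe _ _

/-- A separated completion with respect to a scalar-valued form is a Hilbert space. -/
instance {V : Type*} [AddCommGroup V] [Module ℂ V] {s : V →ₗ⋆[ℂ] V →ₗ[ℂ] ℂ}
    {r : ℂ → V →ₗ[ℂ] V} (h : IsPreInner s r) : InnerProductSpace ℂ (SepCompl h) where
  inner x y := form h x y
  norm_sq_eq_re_inner x := by
    have h1 := form_self_nonneg h x
    have h2 := norm_sq h x
    obtain ⟨r, hr, h3⟩ := RCLike.nonneg_iff_exists_ofReal.1 h1
    rw [h2, ← h3]
    simp [abs_of_nonneg hr]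
  conj_inner_symm x y := star_form h y x
  add_left x y z := by simp
  smul_left x y c := by simp

end SepCompl

end SepCompl

namespace SepCompl

variable {A : Type*} [NonUnitalCStarAlgebra A] [PartialOrder A] [StarOrderedRing A]
  {V : Type*} [AddCommGroup V] [Module ℂ V] {s : V →ₗ⋆[ℂ] V →ₗ[ℂ] A} {r : A → V →ₗ[ℂ] V}

lemma induction_span {E W : Type*} [AddCommGroup E] [Module ℂ E] [AddCommGroup W] [Module ℂ W]
    {s : E ⊗[ℂ] W →ₗ⋆[ℂ] E ⊗[ℂ] W →ₗ[ℂ] A} {r : A → E ⊗[ℂ] W →ₗ[ℂ] E ⊗[ℂ] W}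
    (h : IsPreInner s r) (M : Submodule ℂ (SepCompl h)) (hM : IsClosed (M : Set (SepCompl h)))
    (h1 : ∀ ξ w, of h (ξ ⊗ₜ w) ∈ M) (x : SepCompl h) : x ∈ M := by
  refine induction h x hM fun x => ?_
  induction x with
  | zero => simp
  | add x y hx hy => rw [map_add]; exact M.add_mem hx hy
  | tmul ξ w => exact h1 ξ w

lemma ext_of (h : IsPreInner s r) {V' : Type*} [NormedAddCommGroup V'] [NormedSpace ℂ V']
    {S T : SepCompl h →L[ℂ] V'} (hST : ∀ x, S (of h x) = T (of h x)) : S = T := by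
  ext x
  exact induction h x (isClosed_eq S.continuous T.continuous) hST

end SepCompl

/-! ### Right C*-bimodules -/

/-- A right C*-`B`-`B`-bimodule: a full right Hilbert C*-module over `B` (with inner product
linear in the second variable) with a nondegenerate representation of `B` by adjointable
operators. -/
structure CStarBimod (B : Type u) [NonUnitalCStarAlgebra B] [PartialOrder B] [StarOrderedRing B] where
  carrier : Type u
  [normedAddCommGroup : NormedAddCommGroup carrier]
  [normedSpace : NormedSpace ℂ carrier]
  [completeSpace : CompleteSpace carrier]
  inner : carrier →ₗ⋆[ℂ] carrier →ₗ[ℂ] B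
  /-- `rmul b ξ` is `ξ b`. -/
  rmul : B →ₗ[ℂ] carrier →ₗ[ℂ] carrier
  /-- `lmul b ξ` is `b ξ`. -/
  lmul : B →ₗ[ℂ] carrier →ₗ[ℂ] carrier
  star_inner : ∀ ξ η, star (inner ξ η) = inner η ξ
  inner_self_nonneg : ∀ ξ, 0 ≤ inner ξ ξ
  norm_sq : ∀ ξ, ‖ξ‖ ^ 2 = ‖inner ξ ξ‖
  inner_rmul : ∀ ξ η b, inner ξ (rmul b η) = inner ξ η * b
  rmul_mul : ∀ b c ξ, rmul (b * c) ξ = rmul c (rmul b ξ)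
  lmul_mul : ∀ b c ξ, lmul (b * c) ξ = lmul b (lmul c ξ)
  inner_lmul : ∀ b ξ η, inner (lmul b ξ) η = inner ξ (lmul (star b) η)
  lmul_dense : Dense (Submodule.span ℂ {ζ | ∃ b ξ, ζ = lmul b ξ} : Set carrier)
  full : Dense (Submodule.span ℂ {b | ∃ ξ η, b = inner ξ η} : Set B)

namespace CStarBimod

variable {B : Type u} [NonUnitalCStarAlgebra B] [PartialOrder B] [StarOrderedRing B]

instance : CoeSort (CStarBimod B) (Type u) := ⟨CStarBimod.carrier⟩

instance (E : CStarBimod B) : NormedAddCommGroup E := E.normedAddCommGroup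

instance (E : CStarBimod B) : NormedSpace ℂ E := E.normedSpace

instance (E : CStarBimod B) : CompleteSpace E := E.completeSpace

lemma isPreInner (E : CStarBimod B) : IsPreInner E.inner fun b => E.rmul b :=
  ⟨E.star_inner, E.inner_self_nonneg, E.inner_rmul⟩

lemma sqrt_norm_inner (E : CStarBimod B) (ξ : E) : √‖E.inner ξ ξ‖ = ‖ξ‖ := by
  rw [← E.norm_sq, Real.sqrt_sq (norm_nonneg _)]

lemma norm_inner_le (E : CStarBimod B) (ξ η : E) : ‖E.inner ξ η‖ ≤ ‖ξ‖ * ‖η‖ := by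
  simpa [sqrt_norm_inner] using E.isPreInner.norm_le ξ η

lemma norm_lmul_le (E : CStarBimod B) (b : B) (ξ : E) : ‖E.lmul b ξ‖ ≤ ‖b‖ * ‖ξ‖ := by
  simpa [sqrt_norm_inner] using E.isPreInner.norm_rep_le E.lmul E.lmul_mul E.inner_lmul b ξ

lemma norm_rmul_le (E : CStarBimod B) (b : B) (ξ : E) : ‖E.rmul b ξ‖ ≤ ‖b‖ * ‖ξ‖ := by
  simpa [sqrt_norm_inner] using E.isPreInner.norm_right_mul_le b ξ

lemma continuous_inner_right (E : CStarBimod B) (ξ : E) : Continuous fun η => E.inner ξ η :=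
  ((E.inner ξ).mkContinuous ‖ξ‖ (E.norm_inner_le ξ)).continuous

lemma continuous_lmul_left (E : CStarBimod B) (ξ : E) : Continuous fun b => E.lmul b ξ :=
  ((E.lmul.flip ξ).mkContinuous ‖ξ‖ fun b => by
    simpa [mul_comm] using E.norm_lmul_le b ξ).continuous

/-- A morphism of right C*-bimodules: an adjointable operator that is linear for the left
action. -/
structure Hom (E F : CStarBimod B) where
  toCLM : E →L[ℂ] F
  adjointable : ∃ S : F →L[ℂ] E, ∀ ξ η, F.inner (toCLM ξ) η = E.inner ξ (S η)
  map_lmul : ∀ b ξ, toCLM (E.lmul b ξ) = F.lmul b (toCLM ξ)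

@[ext] lemma Hom.ext' {E F : CStarBimod B} {S T : Hom E F} (h : S.toCLM = T.toCLM) : S = T := by
  cases S; cases T; congr

instance : Category (CStarBimod B) where
  Hom := Hom
  id E := ⟨.id ℂ E, ⟨.id ℂ E, fun _ _ => rfl⟩, fun _ _ => rfl⟩
  comp {E F G} S T := ⟨T.toCLM ∘L S.toCLM, by
    obtain ⟨S', hS⟩ := S.adjointable
    obtain ⟨T', hT⟩ := T.adjointable
    exact ⟨S' ∘L T', fun ξ η => by simp [hS, hT]⟩, fun b ξ => by simp [S.map_lmul, T.map_lmul]⟩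

/-- The underlying operator of a morphism. -/
abbrev op {E F : CStarBimod B} (T : E ⟶ F) : E →L[ℂ] F := Hom.toCLM T

lemma mem_closure_mul (b : B) (M : Submodule ℂ B) (hM : IsClosed (M : Set B))
    (h : ∀ c, b * c ∈ M) : b ∈ M := by
  have hu := (CStarAlgebra.increasingApproximateUnit B).toIsApproximateUnit
  have := hu.neBot
  exact hM.mem_of_tendsto (hu.tendsto_mul_left b) (Filter.Eventually.of_forall fun e => h e)

/-- The C*-algebra `B` as a right C*-bimodule over itself. -/
def unit (B : Type u) [NonUnitalCStarAlgebra B] [PartialOrder B] [StarOrderedRing B] : CStarBimod B where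
  carrier := B
  inner := LinearMap.mk₂'ₛₗ (starRingEnd ℂ) (RingHom.id ℂ) (fun a b => star a * b)
    (fun a a' b => by simp [add_mul]) (fun c a b => by simp [smul_mul_assoc])
    (fun a b b' => by simp [mul_add]) (fun c a b => by simp [mul_smul_comm])
  rmul := (LinearMap.mul ℂ B).flip
  lmul := LinearMap.mul ℂ B
  star_inner ξ η := by simp
  inner_self_nonneg ξ := star_mul_self_nonneg ξ
  norm_sq ξ := by simp [CStarRing.norm_star_mul_self, sq]
  inner_rmul ξ η b := by simp [mul_assoc]
  rmul_mul b c ξ := by simp [mul_assoc]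
  lmul_mul b c ξ := by simp [mul_assoc]
  inner_lmul b ξ η := by simp [mul_assoc]
  lmul_dense := fun b => by
    refine mem_closure_mul b (Submodule.topologicalClosure _)
      (Submodule.isClosed_topologicalClosure _) fun c => ?_
    exact subset_closure (Submodule.subset_span ⟨b, c, rfl⟩)
  full := fun b => by
    refine mem_closure_mul b (Submodule.topologicalClosure _)
      (Submodule.isClosed_topologicalClosure _) fun c => ?_
    exact subset_closure (Submodule.subset_span ⟨star b, c, by simp⟩)

section Itp

variable (E F : CStarBimod B)

/-- The `B`-valued form on the algebraic tensor product,
`⟨ξ ⊗ η | ξ' ⊗ η'⟩ = ⟨η | ⟨ξ|ξ'⟩ η'⟩`. -/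
def itpForm : E ⊗[ℂ] F →ₗ⋆[ℂ] E ⊗[ℂ] F →ₗ[ℂ] B :=
  tensorForm (LinearMap.mk₂'ₛₗ (starRingEnd ℂ) (RingHom.id ℂ) (fun ξ ξ' => F.lmul (E.inner ξ ξ'))
    (fun _ _ _ => by simp) (fun _ _ _ => by simp) (fun _ _ _ => by simp) (fun _ _ _ => by simp))
    F.inner

lemma itpForm_tmul (ξ ξ' : E) (η η' : F) :
    itpForm E F (ξ ⊗ₜ η) (ξ' ⊗ₜ η') = F.inner η (F.lmul (E.inner ξ ξ') η') := by
  simp [itpForm]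

/-- The Gram matrix of finitely many elements of a right C*-bimodule factors as `S* S`. -/
lemma exists_gram {n : ℕ} (ξ : Fin n → E) :
    ∃ S : Fin n → Fin n → B, ∀ i j, E.inner (ξ i) (ξ j) = ∑ k, star (S k i) * S k j := by
  let G : CStarMatrix (Fin n) (Fin n) B := CStarMatrix.ofMatrix fun i j => E.inner (ξ i) (ξ j)
  have hG : IsSelfAdjoint G := by
    ext i j
    exact E.star_inner (ξ j) (ξ i)
  obtain ⟨S, hS, -⟩ := exists_gram_factor G hG fun b => by
    have h := E.inner_self_nonneg (∑ i, E.rmul (b i) (ξ i))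
    simp only [map_sum, LinearMap.sum_apply, E.inner_rmul, E.isPreInner.left_mul] at h
    rw [Finset.sum_comm] at h
    exact h
  refine ⟨fun k i => S k i, fun i j => ?_⟩
  have h1 : G i j = (star S * S) i j := by rw [hS]
  rw [CStarMatrix.mul_apply] at h1
  exact h1

lemma isPreInner_itp : IsPreInner (itpForm E F) fun b => (F.rmul b).lTensor E where
  star_eq := tensorForm_star _ _ fun ξ ξ' w w' => by
    simp [F.star_inner, F.inner_lmul, E.star_inner]
  nonneg := tensorForm_nonneg _ _ F.inner_self_nonneg fun n ξ => by
    obtain ⟨S, hS⟩ := E.exists_gram ξ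
    refine ⟨fun k i => F.lmul (S k i), fun k i => F.lmul (star (S k i)), fun i j w => ?_,
      fun k i w w' => (F.inner_lmul _ _ _).symm⟩
    simp [hS, F.lmul_mul]
  right_mul x y b := by
    induction x with
    | zero => simp
    | add x x' hx hx' => simp only [map_add, LinearMap.add_apply, hx, hx', add_mul]
    | tmul ξ η =>
      induction y with
      | zero => simp
      | add y y' hy hy' => simp only [map_add, hy, hy', add_mul]
      | tmul ξ' η' =>
        rw [LinearMap.lTensor_tmul, itpForm_tmul, itpForm_tmul, ← star_star (E.inner ξ ξ'),
          ← F.inner_lmul, ← F.inner_lmul, F.inner_rmul]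

/-- The form on the algebraic tensor product is compatible with the left action. -/
lemma itpForm_lmul (b : B) (x y : E ⊗[ℂ] F) :
    itpForm E F ((E.lmul b).rTensor F x) y = itpForm E F x ((E.lmul (star b)).rTensor F y) := by
  induction x with
  | zero => simp
  | add x x' hx hx' => simp only [map_add, LinearMap.add_apply, hx, hx']
  | tmul ξ η =>
    induction y with
    | zero => simp
    | add y y' hy hy' => simp only [map_add, hy, hy']
    | tmul ξ' η' => simp [itpForm_tmul, E.inner_lmul]

/-- The left action on the algebraic tensor product. -/
def itpL : B →ₗ[ℂ] (E ⊗[ℂ] F →ₗ[ℂ] E ⊗[ℂ] F) := (LinearMap.rTensorHom F) ∘ₗ E.lmul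

lemma itpL_mul (a b : B) (x : E ⊗[ℂ] F) : itpL E F (a * b) x = itpL E F a (itpL E F b x) := by
  induction x with
  | zero => simp
  | add x y hx hy => rw [map_add, hx, hy, map_add, map_add]
  | tmul ξ η => simp [itpL, E.lmul_mul]

lemma itp_norm_lmul (b : B) (x : E ⊗[ℂ] F) :
    √‖itpForm E F (itpL E F b x) (itpL E F b x)‖ ≤ ‖b‖ * √‖itpForm E F x x‖ :=
  (isPreInner_itp E F).norm_rep_le (itpL E F) (itpL_mul E F) (itpForm_lmul E F) b x

/-- The operator of left multiplication on the completed tensor product. -/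
def itpLmul (b : B) : SepCompl (isPreInner_itp E F) →L[ℂ] SepCompl (isPreInner_itp E F) :=
  SepCompl.map _ _ (itpL E F b) ‖b‖ (itp_norm_lmul E F b)

/-- The operator of right multiplication on the completed tensor product. -/
def itpRmul (b : B) : SepCompl (isPreInner_itp E F) →L[ℂ] SepCompl (isPreInner_itp E F) :=
  SepCompl.map _ _ ((F.rmul b).lTensor E) ‖b‖ ((isPreInner_itp E F).norm_right_mul_le b)

lemma itpLmul_of (b : B) (x : E ⊗[ℂ] F) :
    itpLmul E F b (SepCompl.of _ x) = SepCompl.of _ (itpL E F b x) := SepCompl.map_of _ _ _ _ _ _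

lemma itpRmul_of (b : B) (x : E ⊗[ℂ] F) :
    itpRmul E F b (SepCompl.of _ x) = SepCompl.of _ ((F.rmul b).lTensor E x) :=
  SepCompl.map_of _ _ _ _ _ _

/-- The elementary tensor `ξ ⊗ η` in the completed tensor product. -/
def itpTmul (ξ : E) (η : F) : SepCompl (isPreInner_itp E F) := SepCompl.of _ (ξ ⊗ₜ η)

lemma norm_itpTmul_le (ξ : E) (η : F) : ‖itpTmul E F ξ η‖ ≤ ‖ξ‖ * ‖η‖ := by
  refine abs_le_of_sq_le_sq' ?_ (by positivity) |>.2
  rw [SepCompl.norm_sq, itpTmul, SepCompl.form_of, itpForm_tmul]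
  calc _ ≤ ‖η‖ * ‖F.lmul (E.inner ξ ξ) η‖ := F.norm_inner_le _ _
    _ ≤ ‖η‖ * (‖E.inner ξ ξ‖ * ‖η‖) := by gcongr; exact F.norm_lmul_le _ _
    _ = (‖ξ‖ * ‖η‖) ^ 2 := by rw [← E.norm_sq]; ring

lemma continuous_itpTmul_left (η : F) : Continuous fun ξ => itpTmul E F ξ η :=
  (LinearMap.mkContinuous (SepCompl.of (isPreInner_itp E F) ∘ₗ
    (TensorProduct.mk ℂ E F).flip η) ‖η‖ fun ξ => by
      rw [mul_comm]; exact norm_itpTmul_le E F ξ η).continuous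

lemma itp_full : Dense (Submodule.span ℂ {b | ∃ ξ η : SepCompl (isPreInner_itp E F),
    b = SepCompl.form _ ξ η} : Set B) := by
  set M := (Submodule.span ℂ {b | ∃ ξ η : SepCompl (isPreInner_itp E F),
    b = SepCompl.form _ ξ η}).topologicalClosure
  have hM : IsClosed (M : Set B) := Submodule.isClosed_topologicalClosure _
  have h1 : ∀ η η' b, F.inner η (F.lmul b η') ∈ M := by
    intro η η' b
    have hc : Continuous fun b => F.inner η (F.lmul b η') :=
      (F.continuous_inner_right η).comp (F.continuous_lmul_left η')
    let N : Submodule ℂ B := M.comap ((F.inner η) ∘ₗ F.lmul.flip η')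
    have : (Submodule.span ℂ {b | ∃ ξ η, b = E.inner ξ η}) ≤ N := by
      refine Submodule.span_le.2 ?_
      rintro _ ⟨ξ, ξ', rfl⟩
      refine subset_closure (Submodule.subset_span ⟨itpTmul E F ξ η, itpTmul E F ξ' η', ?_⟩)
      rw [itpTmul, itpTmul, SepCompl.form_of, itpForm_tmul]
      rfl
    exact (closure_minimal (t := (N : Set B)) this (hM.preimage hc)) (E.full b)
  have h2 : ∀ η η', F.inner η η' ∈ M := by
    intro η η'
    let N : Submodule ℂ F := M.comap (F.inner η)
    have : (Submodule.span ℂ {ζ | ∃ b ξ, ζ = F.lmul b ξ}) ≤ N := by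
      refine Submodule.span_le.2 ?_
      rintro _ ⟨b, ξ, rfl⟩
      exact h1 η ξ b
    exact (closure_minimal (t := (N : Set F)) this (hM.preimage (F.continuous_inner_right η)))
      (F.lmul_dense η')
  intro b
  refine (closure_minimal (t := (M : Set B)) ?_ hM) (F.full b)
  refine Submodule.span_le.2 ?_
  rintro _ ⟨ξ, ξ', rfl⟩
  exact h2 ξ ξ'

lemma itp_lmul_dense : Dense (Submodule.span ℂ {ζ | ∃ b ξ, ζ = itpLmul E F b ξ} :
    Set (SepCompl (isPreInner_itp E F))) := by
  set M := (Submodule.span ℂ {ζ | ∃ b ξ, ζ = itpLmul E F b ξ}).topologicalClosure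
  have hM : IsClosed (M : Set (SepCompl (isPreInner_itp E F))) :=
    Submodule.isClosed_topologicalClosure _
  refine SepCompl.induction_span _ M hM fun ξ η => ?_
  let N : Submodule ℂ E := M.comap (SepCompl.of _ ∘ₗ (TensorProduct.mk ℂ E F).flip η)
  have : (Submodule.span ℂ {ζ | ∃ b ξ, ζ = E.lmul b ξ}) ≤ N := by
    refine Submodule.span_le.2 ?_
    rintro _ ⟨b, ξ, rfl⟩
    refine subset_closure (Submodule.subset_span ⟨b, itpTmul E F ξ η, ?_⟩)
    rw [itpTmul, itpLmul_of]
    simp [itpL]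
  exact (closure_minimal (t := (N : Set E)) this (hM.preimage (continuous_itpTmul_left E F η)))
      (E.lmul_dense ξ)

/-- The internal tensor product of right C*-bimodules: the separated completion of the algebraic
tensor product with respect to `⟨ξ ⊗ η | ξ' ⊗ η'⟩ = ⟨η | ⟨ξ|ξ'⟩ η'⟩`. -/
def itp : CStarBimod B where
  carrier := SepCompl (isPreInner_itp E F)
  inner := SepCompl.form _
  rmul :=
    { toFun := fun b => (itpRmul E F b).toLinearMap
      map_add' := fun b c => congrArg _ (SepCompl.ext_of _
        (T := itpRmul E F b + itpRmul E F c) fun x => by simp [itpRmul_of])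
      map_smul' := fun z b => congrArg _ (SepCompl.ext_of _ (T := z • itpRmul E F b) fun x => by
        simp [itpRmul_of]) }
  lmul :=
    { toFun := fun b => (itpLmul E F b).toLinearMap
      map_add' := fun b c => congrArg _ (SepCompl.ext_of _
        (T := itpLmul E F b + itpLmul E F c) fun x => by simp [itpLmul_of])
      map_smul' := fun z b => congrArg _ (SepCompl.ext_of _ (T := z • itpLmul E F b) fun x => by
        simp [itpLmul_of]) }
  star_inner := SepCompl.star_form _
  inner_self_nonneg := SepCompl.form_self_nonneg _
  norm_sq := SepCompl.norm_sq _
  inner_rmul ξ η b := by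
    have c1 := (SepCompl.continuous_form_right (isPreInner_itp E F) ξ).comp
      (itpRmul E F b).continuous
    have c2 := (SepCompl.continuous_form_right (isPreInner_itp E F) ξ).mul_const b
    refine SepCompl.induction _ η (isClosed_eq c1 c2) fun y => ?_
    have c1 := SepCompl.continuous_form_left (isPreInner_itp E F)
      (itpRmul E F b (SepCompl.of _ y))
    have c2 := (SepCompl.continuous_form_left (isPreInner_itp E F) (SepCompl.of _ y)).mul_const b
    refine SepCompl.induction _ ξ (isClosed_eq c1 c2) fun x => ?_
    rw [itpRmul_of, SepCompl.form_of, SepCompl.form_of]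
    exact (isPreInner_itp E F).right_mul x y b
  rmul_mul b c ξ := by
    refine congrArg (fun T : SepCompl (isPreInner_itp E F) →L[ℂ] _ => T ξ) (SepCompl.ext_of _
      (S := itpRmul E F (b * c)) (T := itpRmul E F c ∘L itpRmul E F b) fun x => ?_)
    simp only [ContinuousLinearMap.comp_apply, itpRmul_of]
    have : F.rmul (b * c) = F.rmul c ∘ₗ F.rmul b := LinearMap.ext (F.rmul_mul b c)
    rw [this, LinearMap.lTensor_comp, LinearMap.comp_apply]
  lmul_mul b c ξ := by
    refine congrArg (fun T : SepCompl (isPreInner_itp E F) →L[ℂ] _ => T ξ) (SepCompl.ext_of _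
      (S := itpLmul E F (b * c)) (T := itpLmul E F b ∘L itpLmul E F c) fun x => ?_)
    simp only [ContinuousLinearMap.comp_apply, itpLmul_of, itpL_mul]
  inner_lmul b ξ η := by
    have c1 := (SepCompl.continuous_form_right (isPreInner_itp E F) (itpLmul E F b ξ))
    have c2 := (SepCompl.continuous_form_right (isPreInner_itp E F) ξ).comp
      (itpLmul E F (star b)).continuous
    refine SepCompl.induction _ η (isClosed_eq c1 c2) fun y => ?_
    have c1 := (SepCompl.continuous_form_left (isPreInner_itp E F) (SepCompl.of _ y)).comp
      (itpLmul E F b).continuous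
    have c2 := SepCompl.continuous_form_left (isPreInner_itp E F)
      (itpLmul E F (star b) (SepCompl.of _ y))
    refine SepCompl.induction _ ξ (isClosed_eq c1 c2) fun x => ?_
    change SepCompl.form _ (itpLmul E F b _) _ = SepCompl.form _ _ (itpLmul E F _ _)
    rw [itpLmul_of, itpLmul_of, SepCompl.form_of, SepCompl.form_of]
    exact itpForm_lmul E F b x y
  lmul_dense := itp_lmul_dense E F
  full := itp_full E F

variable {E F}

/-- The elementary tensor `ξ ⊗ η` in the internal tensor product. -/
def tmul (ξ : E) (η : F) : itp E F := itpTmul E F ξ η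

end Itp

end CStarBimod

/-! ### Homogeneous elements, families of homogeneous operators, admissibility -/

namespace CStarBimod

variable {B : Type u} [NonUnitalCStarAlgebra B] [PartialOrder B] [StarOrderedRing B]

/-- `ξ` is `θ`-homogeneous: `ξ ∈ E Dom(θ)` and `ξ b = θ(b) ξ` for all `b ∈ Dom(θ)`. -/
def homog (E : CStarBimod B) (θ : PAut B) : Set E :=
  {ξ | ξ ∈ closure (Submodule.span ℂ {ζ : E | ∃ η, ∃ b ∈ θ.dom, ζ = E.rmul b η} : Set E) ∧
    ∀ b c, θ.Maps b c → E.rmul b ξ = E.lmul c ξ}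

/-- The closed linear span of the homogeneous subspaces of degree in `S`. -/
def homogSpan (E : CStarBimod B) (S : Set (PAut B)) : Set E :=
  closure (Submodule.span ℂ (⋃ θ ∈ S, E.homog θ) : Set E)

/-- `E` is decomposable: its homogeneous elements are linearly dense. -/
def IsDecomposable (E : CStarBimod B) : Prop := E.homogSpan Set.univ = Set.univ

/-- `E` is `Θ`-decomposable. -/
def IsDecomposableOver (Θ : InvSemigroup B) (E : CStarBimod B) : Prop :=
  E.homogSpan Θ.carrier = Set.univ

/-- `E` is `Θ`-supported. -/
def IsSupported (Θ : InvSemigroup B) (E : CStarBimod B) : Prop :=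
  ∀ θ, E.homog θ = E.homogSpan {θ' | θ' ∈ Θ.carrier ∧ θ' ≤ θ}

/-- The operator `|ξ⟩ : B → E`, `b ↦ ξ b`. -/
def ket {E : CStarBimod B} (ξ : E) : unit B →L[ℂ] E :=
  LinearMap.mkContinuous (E := (unit B : Type u)) (E.rmul.flip ξ) ‖ξ‖ fun b => by
    rw [mul_comm]; exact E.norm_rmul_le b ξ

/-- The operator `|ξ] : B → E`, `b ↦ b ξ`. -/
def ket' {E : CStarBimod B} (ξ : E) : unit B →L[ℂ] E :=
  LinearMap.mkContinuous (E := (unit B : Type u)) (E.lmul.flip ξ) ‖ξ‖ fun b => by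
    rw [mul_comm]; exact E.norm_lmul_le b ξ

/-- A family of sets of operators indexed by pairs of partial automorphisms; the set with index
`(ρ, σ)` is meant to consist of `(ρ, σ)`-homogeneous operators. -/
abbrev Fam (E F : CStarBimod B) := PAut B → PAut B → Set (E →L[ℂ] F)

/-- `S` is the adjoint of the operator `T`, which is homogeneous of degree `σ` with respect to
the inner products: `⟨Sη|ξ⟩ ∈ Dom(σ)` and `⟨η|Tξ⟩ = σ(⟨Sη|ξ⟩)`. -/
def IsHomogAdjoint {E F : CStarBimod B} (σ : PAut B) (T : E →L[ℂ] F) (S : F →L[ℂ] E) : Prop :=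
  ∀ ξ η, σ.Maps (E.inner (S η) ξ) (F.inner η (T ξ))

/-- The family `C*`, whose `(ρ, σ)`-component consists of the adjoints of the elements of the
`(ρ*, σ*)`-component of `C`. -/
def Fam.adj {E F : CStarBimod B} (C : Fam E F) : Fam F E :=
  fun ρ σ => {S | ∃ T ∈ C (star ρ) (star σ), IsHomogAdjoint (star σ) T S}

/-- The product family `[DC]`. -/
def Fam.mul {E F G : CStarBimod B} (D : Fam F G) (C : Fam E F) : Fam E G :=
  fun ρ'' σ'' => closure (Submodule.span ℂ {R : E →L[ℂ] G | ∃ ρ' σ' ρ σ, ∃ T' ∈ D ρ' σ',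
    ∃ T ∈ C ρ σ, ρ' * ρ ≤ ρ'' ∧ σ' * σ ≤ σ'' ∧ R = T' ∘L T} : Set (E →L[ℂ] G))

/-- The family of all `|ξ⟩`, where `ξ` is homogeneous; if `ξ` is `θ`-homogeneous, then `|ξ⟩` is
`(θ, Id)`-homogeneous. -/
def ketFam (E : CStarBimod B) : Fam (unit B) E :=
  fun ρ σ => {T | T = 0 ∨ (σ = 1 ∧ ∃ ξ ∈ E.homog ρ, T = ket ξ)}

/-- The family of all `|ξ]`, where `ξ` is homogeneous; if `ξ` is `θ`-homogeneous, then `|ξ]` is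
`(Id, θ*)`-homogeneous. -/
def ketFam' (E : CStarBimod B) : Fam (unit B) E :=
  fun ρ σ => {T | T = 0 ∨ (ρ = 1 ∧ ∃ ξ ∈ E.homog (star σ), T = ket' ξ)}

/-- `Θ`-admissible right C*-bimodules. -/
structure IsAdmissible (Θ : InvSemigroup B) (E : CStarBimod B) : Prop where
  decomposable : IsDecomposableOver Θ E
  ket_mul : E.ketFam.adj.mul E.ketFam = (unit B).ketFam
  ket'_mul : E.ketFam'.adj.mul E.ketFam' = (unit B).ketFam'

end CStarBimod

/-- An inverse semigroup `Θ` of partial automorphisms is admissible if `B` is `Θ`-supported,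
`Id ∈ Θ`, and `θ ∧ θ' ∈ Θ` for all `θ, θ' ∈ Θ`, where `θ ∧ θ'` is the largest partial automorphism
that is extended by `θ` and `θ'`. -/
structure InvSemigroup.IsAdmissible {B : Type u} [NonUnitalCStarAlgebra B] [PartialOrder B]
    [StarOrderedRing B] (Θ : InvSemigroup B) : Prop where
  supported : (CStarBimod.unit B).IsSupported Θ
  one_mem : 1 ∈ Θ.carrier
  inf_mem : ∀ θ ∈ Θ.carrier, ∀ θ' ∈ Θ.carrier, ∃ φ ∈ Θ.carrier, IsGLB {θ, θ'} φ

/-! ### Covariant representations and the spaces `E ⊗_π 𝔎` -/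

section Covariant

variable {B : Type u} [NonUnitalCStarAlgebra B] [PartialOrder B] [StarOrderedRing B]
  {K : Type v} [NormedAddCommGroup K] [InnerProductSpace ℂ K] [CompleteSpace K]

/-- Covariant representations of `(B, Θ)` on a Hilbert space. -/
structure IsCovariant (Θ : InvSemigroup B) (π : B →⋆ₙₐ[ℂ] (K →L[ℂ] K))
    (υ : Θ.carrier → (K →L[ℂ] K)) : Prop where
  map_mul : ∀ θ θ' : Θ.carrier, υ θ * υ θ' = υ ⟨θ * θ', Θ.mul_mem θ.2 θ'.2⟩
  map_star : ∀ θ : Θ.carrier, star (υ θ) = υ ⟨star θ.1, Θ.star_mem θ.2⟩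
  range_eq : ∀ θ : Θ.carrier, Set.range (υ θ) =
    closure (Submodule.span ℂ {y : K | ∃ c ∈ θ.1.img, ∃ x, y = π c x} : Set K)
  conj : ∀ (θ : Θ.carrier) (b c : B), θ.1.Maps b c → υ θ * π b * star (υ θ) = π c

variable (π : B →⋆ₙₐ[ℂ] (K →L[ℂ] K)) (E F : CStarBimod B)

/-- The scalar-valued form `⟨ξ ⊗ ζ | ξ' ⊗ ζ'⟩ = ⟨ζ | π(⟨ξ|ξ'⟩) ζ'⟩` on the algebraic tensor
product. -/
def indForm : E ⊗[ℂ] K →ₗ⋆[ℂ] E ⊗[ℂ] K →ₗ[ℂ] ℂ :=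
  tensorForm (LinearMap.mk₂'ₛₗ (starRingEnd ℂ) (RingHom.id ℂ)
    (fun ξ ξ' => (π (E.inner ξ ξ')).toLinearMap)
    (fun _ _ _ => by ext; simp) (fun _ _ _ => by ext; simp) (fun _ _ _ => by ext; simp)
    (fun _ _ _ => by ext; simp)) (innerₛₗ ℂ)

lemma isPreInner_ind : IsPreInner (indForm π E) fun c => c • LinearMap.id where
  star_eq := tensorForm_star _ _ fun ξ ξ' w w' => by
    have h : π (E.inner ξ' ξ) = ContinuousLinearMap.adjoint (π (E.inner ξ ξ')) := by
      rw [← E.star_inner, map_star]; rfl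
    simp [h, ContinuousLinearMap.adjoint_inner_right]
  nonneg := tensorForm_nonneg _ _ (fun w => by
      rw [innerₛₗ_apply_apply, inner_self_eq_norm_sq_to_K]; positivity) fun n ξ => by
    obtain ⟨S, hS⟩ := E.exists_gram ξ
    refine ⟨fun k i => (π (S k i)).toLinearMap, fun k i => (π (star (S k i))).toLinearMap,
      fun i j w => ?_, fun k i w w' => ?_⟩
    · simp [hS]
    · have h : π (star (S k i)) = ContinuousLinearMap.adjoint (π (S k i)) := by
        rw [map_star]; rfl
      simp [h, ContinuousLinearMap.adjoint_inner_right]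
  right_mul x y c := by simp [mul_comm]

/-- The Hilbert space `E ⊗_π 𝔎`. -/
def IndSpace : Type (max u v) := SepCompl (isPreInner_ind π E)

instance : NormedAddCommGroup (IndSpace π E) :=
  inferInstanceAs (NormedAddCommGroup (SepCompl (isPreInner_ind π E)))

instance : InnerProductSpace ℂ (IndSpace π E) :=
  inferInstanceAs (InnerProductSpace ℂ (SepCompl (isPreInner_ind π E)))

instance : CompleteSpace (IndSpace π E) :=
  inferInstanceAs (CompleteSpace (SepCompl (isPreInner_ind π E)))

variable {E F}

/-- The elementary tensor `ξ ⊗ ζ ∈ E ⊗_π 𝔎`. -/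
def indTmul (ξ : E) (ζ : K) : IndSpace π E := SepCompl.of (isPreInner_ind π E) (ξ ⊗ₜ ζ)

/-- `R` is the operator `T ⊗ V : E ⊗_π 𝔎 → F ⊗_π 𝔎`. -/
def IsIndMap (T : E →L[ℂ] F) (V : K →L[ℂ] K) (R : IndSpace π E →L[ℂ] IndSpace π F) : Prop :=
  ∀ ξ ζ, R (indTmul π ξ ζ) = indTmul π (T ξ) (V ζ)

variable {Θ : InvSemigroup B} (υ : Θ.carrier → (K →L[ℂ] K))

/-- The closed linear span of all untwisted operators `T ⊗ υ(σ)`, where `T` belongs to the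
`(ρ, σ)`-component of the family `C` and `ρ, σ ∈ Θ`. -/
def untwist (C : CStarBimod.Fam E F) : Submodule ℂ (IndSpace π E →L[ℂ] IndSpace π F) :=
  (Submodule.span ℂ {R | ∃ ρ σ : Θ.carrier, ∃ T ∈ C ρ σ, IsIndMap π T (υ σ) R}).topologicalClosure

variable (E) in
/-- The space `α(E)` of operators from `B ⊗_π 𝔎` to `E ⊗_π 𝔎`. -/
def indAlpha : Submodule ℂ (IndSpace π (CStarBimod.unit B) →L[ℂ] IndSpace π E) := untwist π υ E.ketFam

variable (E) in
/-- The space `β(E)` of operators from `B ⊗_π 𝔎` to `E ⊗_π 𝔎`. -/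
def indBeta : Submodule ℂ (IndSpace π (CStarBimod.unit B) →L[ℂ] IndSpace π E) := untwist π υ E.ketFam'

end Covariant

/-! ### C*-bases, C*-factorizations and C*-bimodules over C*-bases -/

open scoped InnerProduct

section Base

variable {𝔥 : Type w} [NormedAddCommGroup 𝔥] [InnerProductSpace ℂ 𝔥] [CompleteSpace 𝔥]

/-- `M` is a nondegenerate C*-algebra of operators on `𝔥`. -/
structure IsNondegCStarAlg (M : Submodule ℂ (𝔥 →L[ℂ] 𝔥)) : Prop where
  isClosed : IsClosed (M : Set (𝔥 →L[ℂ] 𝔥))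
  mul_mem : ∀ a ∈ M, ∀ b ∈ M, a ∘L b ∈ M
  adjoint_mem : ∀ a ∈ M, a† ∈ M
  nondeg : Dense (Submodule.span ℂ {x : 𝔥 | ∃ a ∈ M, ∃ y, x = a y} : Set 𝔥)

/-- `(𝔥, M, N)` is a C*-base. -/
structure IsCStarBase (M N : Submodule ℂ (𝔥 →L[ℂ] 𝔥)) : Prop where
  left : IsNondegCStarAlg M
  right : IsNondegCStarAlg N
  commute : ∀ a ∈ M, ∀ b ∈ N, a ∘L b = b ∘L a

variable (𝔥) in
/-- A C*-base with underlying Hilbert space `𝔥`. -/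
structure CStarBase where
  alg : Submodule ℂ (𝔥 →L[ℂ] 𝔥)
  alg' : Submodule ℂ (𝔥 →L[ℂ] 𝔥)
  isBase : IsCStarBase alg alg'

/-- `X` is a C*-factorization of the Hilbert space `H` with respect to a C*-base `(𝔥, M, N)`: a
closed subspace with `[X* X] = M`, `[X M] = X` and `[X 𝔥] = H`. -/
structure IsCStarFact {H : Type w} [NormedAddCommGroup H] [InnerProductSpace ℂ H] [CompleteSpace H]
    (M : Submodule ℂ (𝔥 →L[ℂ] 𝔥)) (X : Submodule ℂ (𝔥 →L[ℂ] H)) : Prop where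
  isClosed : IsClosed (X : Set (𝔥 →L[ℂ] H))
  adjoint_mul : (Submodule.span ℂ {a : 𝔥 →L[ℂ] 𝔥 | ∃ ξ ∈ X, ∃ η ∈ X,
    a = ξ† ∘L η}).topologicalClosure = M
  mul_alg : (Submodule.span ℂ {ξ : 𝔥 →L[ℂ] H | ∃ η ∈ X, ∃ a ∈ M,
    ξ = η ∘L a}).topologicalClosure = X
  dense : Dense (Submodule.span ℂ {x : H | ∃ ξ ∈ X, ∃ ζ, x = ξ ζ} : Set H)

/-- `R = ρ_X(b)`, that is, `R ξ ζ = ξ b ζ` for all `ξ ∈ X` and `ζ ∈ 𝔥`. -/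
def IsRho {H : Type w} [NormedAddCommGroup H] [InnerProductSpace ℂ H]
    (X : Submodule ℂ (𝔥 →L[ℂ] H)) (b : 𝔥 →L[ℂ] 𝔥) (R : H →L[ℂ] H) : Prop :=
  ∀ ξ ∈ X, ∀ ζ, R (ξ ζ) = ξ (b ζ)

/-- `[ρ_X(N) Y] = Y`. -/
def RhoStable {H : Type w} [NormedAddCommGroup H] [InnerProductSpace ℂ H]
    (N : Submodule ℂ (𝔥 →L[ℂ] 𝔥)) (X Y : Submodule ℂ (𝔥 →L[ℂ] H)) : Prop :=
  (Submodule.span ℂ {η : 𝔥 →L[ℂ] H | ∃ b ∈ N, ∃ R, IsRho X b R ∧ ∃ η' ∈ Y,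
    η = R ∘L η'}).topologicalClosure = Y

/-- `(H, β, α)` is a C*-bimodule over the C*-base `(𝔥, M, N)`: `α` and `β` are compatible
C*-factorizations of `H` with respect to `(𝔥, M, N)` and `(𝔥, N, M)`, respectively. -/
structure IsCStarBaseBimod (𝔟 : CStarBase 𝔥) (H : Type w) [NormedAddCommGroup H]
    [InnerProductSpace ℂ H] [CompleteSpace H] (β α : Submodule ℂ (𝔥 →L[ℂ] H)) : Prop where
  alpha_fact : IsCStarFact 𝔟.alg α
  beta_fact : IsCStarFact 𝔟.alg' β
  beta_stable : RhoStable 𝔟.alg' α β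
  alpha_stable : RhoStable 𝔟.alg β α

/-- A C*-bimodule over a C*-base. -/
structure CStarBaseBimod (𝔟 : CStarBase 𝔥) where
  carrier : Type w
  [normedAddCommGroup : NormedAddCommGroup carrier]
  [innerProductSpace : InnerProductSpace ℂ carrier]
  [completeSpace : CompleteSpace carrier]
  beta : Submodule ℂ (𝔥 →L[ℂ] carrier)
  alpha : Submodule ℂ (𝔥 →L[ℂ] carrier)
  isBimod : IsCStarBaseBimod 𝔟 carrier beta alpha

namespace CStarBaseBimod

variable {𝔟 : CStarBase 𝔥}

instance : CoeSort (CStarBaseBimod 𝔟) (Type w) := ⟨carrier⟩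

instance (X : CStarBaseBimod 𝔟) : NormedAddCommGroup X := X.normedAddCommGroup

instance (X : CStarBaseBimod 𝔟) : InnerProductSpace ℂ X := X.innerProductSpace

instance (X : CStarBaseBimod 𝔟) : CompleteSpace X := X.completeSpace

/-- Morphisms of C*-bimodules over a C*-base. -/
@[ext] structure Hom (X Y : CStarBaseBimod 𝔟) where
  toCLM : X →L[ℂ] Y
  map_alpha : ∀ ξ ∈ X.alpha, toCLM ∘L ξ ∈ Y.alpha
  adjoint_alpha : ∀ ξ ∈ Y.alpha, toCLM† ∘L ξ ∈ X.alpha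
  map_beta : ∀ ξ ∈ X.beta, toCLM ∘L ξ ∈ Y.beta
  adjoint_beta : ∀ ξ ∈ Y.beta, toCLM† ∘L ξ ∈ X.beta

/-- The identity morphism. -/
def Hom.id (X : CStarBaseBimod 𝔟) : Hom X X where
  toCLM := .id ℂ X
  map_alpha _ h := h
  adjoint_alpha ξ h := by rw [ContinuousLinearMap.adjoint_id]; exact h
  map_beta _ h := h
  adjoint_beta ξ h := by rw [ContinuousLinearMap.adjoint_id]; exact h

/-- Composition of morphisms. -/
def Hom.comp {X Y Z : CStarBaseBimod 𝔟} (S : Hom X Y) (T : Hom Y Z) : Hom X Z where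
  toCLM := T.toCLM ∘L S.toCLM
  map_alpha ξ h := T.map_alpha (S.toCLM ∘L ξ) (S.map_alpha ξ h)
  adjoint_alpha ξ h := by
    rw [ContinuousLinearMap.adjoint_comp, ContinuousLinearMap.comp_assoc]
    exact S.adjoint_alpha (T.toCLM† ∘L ξ) (T.adjoint_alpha ξ h)
  map_beta ξ h := T.map_beta (S.toCLM ∘L ξ) (S.map_beta ξ h)
  adjoint_beta ξ h := by
    rw [ContinuousLinearMap.adjoint_comp, ContinuousLinearMap.comp_assoc]
    exact S.adjoint_beta (T.toCLM† ∘L ξ) (T.adjoint_beta ξ h)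

instance : Category (CStarBaseBimod 𝔟) where
  Hom := Hom
  id := Hom.id
  comp := Hom.comp
  id_comp _ := rfl
  comp_id _ := rfl
  assoc _ _ _ := rfl

/-- The underlying operator of a morphism. -/
abbrev op {X Y : CStarBaseBimod 𝔟} (T : X ⟶ Y) : X →L[ℂ] Y := Hom.toCLM T

section RelTensor

variable (X Y : CStarBaseBimod 𝔟)

/-- The map `𝔥 ⊗ δ → K`, `ζ ⊗ η ↦ η ζ`, for a C*-bimodule `K` with second factorization `δ`. -/
def evalMap : 𝔥 ⊗[ℂ] Y.beta →ₗ[ℂ] Y :=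
  TensorProduct.lift (LinearMap.mk₂ ℂ (fun ζ (η : Y.beta) => η.1 ζ)
    (by simp) (by simp) (by simp) (by simp))

@[simp] lemma evalMap_tmul (ζ : 𝔥) (η : Y.beta) : evalMap Y (ζ ⊗ₜ η) = η.1 ζ := by
  simp [evalMap]

/-- The form `⟨ζ ⊗ η | ζ' ⊗ η'⟩ = ⟨ζ | (η* η') ζ'⟩` on `𝔥 ⊗ δ`. -/
def rightForm : 𝔥 ⊗[ℂ] Y.beta →ₗ⋆[ℂ] 𝔥 ⊗[ℂ] Y.beta →ₗ[ℂ] ℂ :=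
  LinearMap.mk₂'ₛₗ (starRingEnd ℂ) (RingHom.id ℂ) (fun w w' => ⟪evalMap Y w, evalMap Y w'⟫_ℂ)
    (by simp) (by simp [mul_comm]) (by simp) (by simp)

lemma rightForm_apply (w w' : 𝔥 ⊗[ℂ] Y.beta) :
    rightForm Y w w' = ⟪evalMap Y w, evalMap Y w'⟫_ℂ := rfl

/-- The map `(ξ, ξ') ↦ ξ* ξ' ⊗ id` with values in the linear operators on `𝔥 ⊗ δ`. -/
def alphaAct : X.alpha →ₗ⋆[ℂ] X.alpha →ₗ[ℂ] (𝔥 ⊗[ℂ] Y.beta →ₗ[ℂ] 𝔥 ⊗[ℂ] Y.beta) :=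
  LinearMap.mk₂'ₛₗ (starRingEnd ℂ) (RingHom.id ℂ)
    (fun ξ ξ' => ((ξ.1† ∘L ξ'.1).toLinearMap).rTensor Y.beta)
    (fun _ _ _ => by simp [LinearMap.rTensor_add])
    (fun c ξ ξ' => by
      rw [← LinearMap.rTensor_smul]
      congr 1
      ext x
      simp [map_smulₛₗ])
    (fun _ _ _ => by simp [LinearMap.rTensor_add])
    (fun _ _ _ => by simp)

lemma alphaAct_apply (ξ ξ' : X.alpha) :
    alphaAct X Y ξ ξ' = ((ξ.1† ∘L ξ'.1).toLinearMap).rTensor Y.beta := rfl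

/-- The form `⟨ξ ⊗ ζ ⊗ η | ξ' ⊗ ζ' ⊗ η'⟩ = ⟨ζ | (ξ* ξ') (η* η') ζ'⟩` on the algebraic tensor product
`α ⊗ (𝔥 ⊗ δ)`. -/
def relForm : X.alpha ⊗[ℂ] (𝔥 ⊗[ℂ] Y.beta) →ₗ⋆[ℂ] X.alpha ⊗[ℂ] (𝔥 ⊗[ℂ] Y.beta) →ₗ[ℂ] ℂ :=
  tensorForm (alphaAct X Y) (rightForm Y)

lemma alpha_adjoint_mem {ξ ξ' : 𝔥 →L[ℂ] X} (h : ξ ∈ X.alpha) (h' : ξ' ∈ X.alpha) :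
    ξ† ∘L ξ' ∈ 𝔟.alg := by
  rw [← X.isBimod.alpha_fact.adjoint_mul]
  exact subset_closure (Submodule.subset_span ⟨ξ, h, ξ', h', rfl⟩)

lemma beta_adjoint_mem {ξ ξ' : 𝔥 →L[ℂ] X} (h : ξ ∈ X.beta) (h' : ξ' ∈ X.beta) :
    ξ† ∘L ξ' ∈ 𝔟.alg' := by
  rw [← X.isBimod.beta_fact.adjoint_mul]
  exact subset_closure (Submodule.subset_span ⟨ξ, h, ξ', h', rfl⟩)

lemma commute_adjoint {ξ ξ' : 𝔥 →L[ℂ] X} {η η' : 𝔥 →L[ℂ] Y} (h : ξ ∈ X.alpha) (h' : ξ' ∈ X.alpha)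
    (k : η ∈ Y.beta) (k' : η' ∈ Y.beta) : Commute (ξ† ∘L ξ') (η† ∘L η') :=
  𝔟.isBase.commute _ (alpha_adjoint_mem X h h') _ (beta_adjoint_mem Y k k')

lemma relForm_tmul (ξ ξ' : X.alpha) (ζ ζ' : 𝔥) (η η' : Y.beta) :
    relForm X Y (ξ ⊗ₜ (ζ ⊗ₜ η)) (ξ' ⊗ₜ (ζ' ⊗ₜ η')) =
      ⟪ζ, (ξ.1† ∘L ξ'.1) ((η.1† ∘L η'.1) ζ')⟫_ℂ := by
  have := commute_adjoint X Y ξ.2 ξ'.2 η.2 η'.2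
  rw [← mul_apply_eq_comp, this.eq]
  simp [relForm, alphaAct_apply, rightForm_apply, ContinuousLinearMap.adjoint_inner_right]

lemma rightForm_rTensor (c : 𝔥 →L[ℂ] 𝔥)
    (hc : ∀ η ∈ Y.beta, ∀ η' ∈ Y.beta, Commute c (η† ∘L η')) (w w' : 𝔥 ⊗[ℂ] Y.beta) :
    rightForm Y w (c.toLinearMap.rTensor Y.beta w') =
      rightForm Y ((c†).toLinearMap.rTensor Y.beta w) w' := by
  induction w with
  | zero => simp
  | add x x' hx hx' => simp only [map_add, LinearMap.add_apply, hx, hx']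
  | tmul ζ η =>
    induction w' with
    | zero => simp
    | add y y' hy hy' => simp only [map_add, hy, hy']
    | tmul ζ' η' =>
      have := congrArg (fun T => T ζ') (hc η.1 η.2 η'.1 η'.2).eq
      simp only [mul_apply_eq_comp, ContinuousLinearMap.comp_apply] at this
      simp only [LinearMap.rTensor_tmul, rightForm_apply, evalMap_tmul,
        ContinuousLinearMap.coe_coe]
      rw [← ContinuousLinearMap.adjoint_inner_right, ← this,
        ← ContinuousLinearMap.adjoint_inner_left, ContinuousLinearMap.adjoint_inner_right]

lemma exists_gram_operators {n : ℕ} (ξ : Fin n → X.alpha) :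
    ∃ S : Fin n → Fin n → (𝔥 →L[ℂ] 𝔥),
      (∀ i j, (ξ i).1† ∘L (ξ j).1 = ∑ k, (S k i)† ∘L S k j) ∧
      ∀ k i, ∀ η ∈ Y.beta, ∀ η' ∈ Y.beta, Commute (S k i) (η† ∘L η') := by
  let G : CStarMatrix (Fin n) (Fin n) (𝔥 →L[ℂ] 𝔥) :=
    CStarMatrix.ofMatrix fun i j => (ξ i).1† ∘L (ξ j).1
  have hG : IsSelfAdjoint G := by
    refine CStarMatrix.ext fun i j => ?_
    change ((ξ j).1† ∘L (ξ i).1)† = (ξ i).1† ∘L (ξ j).1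
    rw [ContinuousLinearMap.adjoint_comp, ContinuousLinearMap.adjoint_adjoint]
  obtain ⟨S, hS, hc⟩ := exists_gram_factor G hG fun b => by
    have h : 0 ≤ (∑ i, (ξ i).1 ∘L b i)† ∘L (∑ i, (ξ i).1 ∘L b i) := by
      rw [ContinuousLinearMap.nonneg_iff_isPositive]
      exact ContinuousLinearMap.isPositive_adjoint_comp_self _
    simp only [map_sum, ContinuousLinearMap.adjoint_comp, ContinuousLinearMap.finsetSum_comp,
      ContinuousLinearMap.comp_finsetSum] at h
    rw [Finset.sum_comm] at h
    refine h.trans_eq (Finset.sum_congr rfl fun i _ => Finset.sum_congr rfl fun j _ => rfl)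
  refine ⟨fun k i => S k i, fun i j => ?_, fun k i η hη η' hη' => ?_⟩
  · have h1 : G i j = (star S * S) i j := by rw [hS]
    rw [CStarMatrix.mul_apply] at h1
    exact h1
  · let D : CStarMatrix (Fin n) (Fin n) (𝔥 →L[ℂ] 𝔥) :=
      CStarMatrix.ofMatrix (Matrix.diagonal fun _ => η† ∘L η')
    have hD : Commute G D := by
      refine CStarMatrix.ext fun i j => ?_
      have := commute_adjoint X Y (ξ i).2 (ξ j).2 hη hη'
      suffices G i j * (η† ∘L η') = (η† ∘L η') * G i j by
        simpa [D, CStarMatrix.mul_apply, Matrix.diagonal_apply] using this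
      exact this.eq
    have := congrArg (fun T => T k i) (hc D hD).eq
    have h2 : S k i * (η† ∘L η') = (η† ∘L η') * S k i := by
      simpa [D, CStarMatrix.mul_apply, Matrix.diagonal_apply] using this
    exact h2

lemma isPreInner_rel : IsPreInner (A := ℂ) (V := X.alpha ⊗[ℂ] (𝔥 ⊗[ℂ] Y.beta)) (relForm X Y)
    fun c => c • LinearMap.id where
  star_eq := tensorForm_star _ _ fun ξ ξ' w w' => by
    have h := rightForm_rTensor Y (ξ.1† ∘L ξ'.1)
      (fun η hη η' hη' => commute_adjoint X Y ξ.2 ξ'.2 hη hη') w w'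
    rw [ContinuousLinearMap.adjoint_comp, ContinuousLinearMap.adjoint_adjoint] at h
    rw [alphaAct_apply, alphaAct_apply, h]
    exact inner_conj_symm _ _
  nonneg := tensorForm_nonneg _ _ (fun w => by
      rw [rightForm_apply, inner_self_eq_norm_sq_to_K]; positivity) fun n ξ => by
    obtain ⟨S, hS, hc⟩ := exists_gram_operators X Y ξ
    refine ⟨fun k i => (S k i).toLinearMap.rTensor Y.beta,
      fun k i => ((S k i)†).toLinearMap.rTensor Y.beta, fun i j w => ?_, fun k i w w' => ?_⟩
    · rw [alphaAct_apply, hS]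
      induction w with
      | zero => simp
      | add x x' hx hx' => simp only [map_add, hx, hx', Finset.sum_add_distrib]
      | tmul ζ η => simp [TensorProduct.sum_tmul]
    · have := rightForm_rTensor Y ((S k i)†) (fun η hη η' hη' => by
        have := (hc k i η' hη' η hη).star_star
        simp only [ContinuousLinearMap.star_eq_adjoint, ContinuousLinearMap.adjoint_comp,
          ContinuousLinearMap.adjoint_adjoint] at this
        exact this) w w'
      rwa [ContinuousLinearMap.adjoint_adjoint] at this
  right_mul x y c := by simp [mul_comm]

/-- The relative tensor product of Hilbert spaces over a C*-base. -/
def RelTensor : Type w := SepCompl (isPreInner_rel X Y)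

instance : NormedAddCommGroup (RelTensor X Y) :=
  inferInstanceAs (NormedAddCommGroup (SepCompl (isPreInner_rel X Y)))

instance : InnerProductSpace ℂ (RelTensor X Y) :=
  inferInstanceAs (InnerProductSpace ℂ (SepCompl (isPreInner_rel X Y)))

instance : CompleteSpace (RelTensor X Y) :=
  inferInstanceAs (CompleteSpace (SepCompl (isPreInner_rel X Y)))

variable {X Y}

/-- The elementary tensor `ξ ⊗ ζ ⊗ η` in the relative tensor product. -/
def relTmul (ξ : X.alpha) (ζ : 𝔥) (η : Y.beta) : RelTensor X Y :=
  SepCompl.of (isPreInner_rel X Y) (ξ ⊗ₜ (ζ ⊗ₜ η))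

/-- `T = |ξ⟩₁ : K → H ⊗ K`, `η ζ ↦ ξ ⊗ ζ ⊗ η`. -/
def IsKet₁ (ξ : X.alpha) (T : Y →L[ℂ] RelTensor X Y) : Prop :=
  ∀ (ζ : 𝔥) (η : Y.beta), T (η.1 ζ) = relTmul ξ ζ η

/-- `T = |η⟩₂ : H → H ⊗ K`, `ξ ζ ↦ ξ ⊗ ζ ⊗ η`. -/
def IsKet₂ (η : Y.beta) (T : X →L[ℂ] RelTensor X Y) : Prop :=
  ∀ (ζ : 𝔥) (ξ : X.alpha), T (ξ.1 ζ) = relTmul ξ ζ η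

variable (X Y)

/-- The space `β ◁ δ = [|δ⟩₂ β]`. -/
def relBeta : Submodule ℂ (𝔥 →L[ℂ] RelTensor X Y) :=
  (Submodule.span ℂ {ω : 𝔥 →L[ℂ] RelTensor X Y | ∃ (η : Y.beta) (T : X →L[ℂ] RelTensor X Y),
    IsKet₂ η T ∧ ∃ ξ ∈ X.beta, ω = T ∘L ξ}).topologicalClosure

/-- The space `α ▷ γ = [|α⟩₁ γ]`. -/
def relAlpha : Submodule ℂ (𝔥 →L[ℂ] RelTensor X Y) :=
  (Submodule.span ℂ {ω : 𝔥 →L[ℂ] RelTensor X Y | ∃ (ξ : X.alpha) (T : Y →L[ℂ] RelTensor X Y),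
    IsKet₁ ξ T ∧ ∃ η ∈ Y.alpha, ω = T ∘L η}).topologicalClosure

end RelTensor

end CStarBaseBimod

end Base

namespace CStarBaseBimod

variable {𝔥 : Type w} [NormedAddCommGroup 𝔥] [InnerProductSpace ℂ 𝔥] [CompleteSpace 𝔥]

/-- The relative tensor product over the C*-base `𝔟` is well defined: the operators `|ξ⟩₁` and
`|η⟩₂` exist, relative tensor products of C*-bimodules are C*-bimodules, and so is the unit. -/
structure RelWellDefined (𝔟 : CStarBase 𝔥) : Prop where
  exists_ket₁ : ∀ (X Y : CStarBaseBimod 𝔟) (ξ : X.alpha), ∃ T : Y →L[ℂ] RelTensor X Y, IsKet₁ ξ T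
  exists_ket₂ : ∀ (X Y : CStarBaseBimod 𝔟) (η : Y.beta), ∃ T : X →L[ℂ] RelTensor X Y, IsKet₂ η T
  isBimod_tensor : ∀ X Y : CStarBaseBimod 𝔟,
    IsCStarBaseBimod 𝔟 (RelTensor X Y) (relBeta X Y) (relAlpha X Y)
  isBimod_unit : IsCStarBaseBimod 𝔟 𝔥 𝔟.alg' 𝔟.alg

/-- The relative tensor product `(H ⊗ K, β ◁ δ, α ▷ γ)` of C*-bimodules `(H, β, α)` and
`(K, δ, γ)`. -/
def RelWellDefined.tensor {𝔟 : CStarBase 𝔥} (h : RelWellDefined 𝔟) (X Y : CStarBaseBimod 𝔟) :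
    CStarBaseBimod 𝔟 where
  carrier := RelTensor X Y
  beta := relBeta X Y
  alpha := relAlpha X Y
  isBimod := h.isBimod_tensor X Y

/-- The unit C*-bimodule. -/
def RelWellDefined.unit {𝔟 : CStarBase 𝔥} (h : RelWellDefined 𝔟) : CStarBaseBimod 𝔟 where
  carrier := 𝔥
  beta := 𝔟.alg'
  alpha := 𝔟.alg
  isBimod := h.isBimod_unit

end CStarBaseBimod

/-! ### Monoidal structures and functors with given values on objects -/

/-- A monoidal structure on the category `C` with the given tensor product of objects and the given
unit. -/
structure MonoidalData (C : Type*) [Category C] (tensor : C → C → C) (unit : C) where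
  tensorHom : ∀ {X₁ Y₁ X₂ Y₂ : C}, (X₁ ⟶ Y₁) → (X₂ ⟶ Y₂) → (tensor X₁ X₂ ⟶ tensor Y₁ Y₂)
  associator : ∀ X Y Z : C, tensor (tensor X Y) Z ≅ tensor X (tensor Y Z)
  leftUnitor : ∀ X : C, tensor unit X ≅ X
  rightUnitor : ∀ X : C, tensor X unit ≅ X
  id_tensorHom_id : ∀ X₁ X₂ : C, tensorHom (𝟙 X₁) (𝟙 X₂) = 𝟙 (tensor X₁ X₂)
  tensorHom_comp_tensorHom : ∀ {X₁ Y₁ Z₁ X₂ Y₂ Z₂ : C} (f₁ : X₁ ⟶ Y₁) (f₂ : X₂ ⟶ Y₂) (g₁ : Y₁ ⟶ Z₁)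
    (g₂ : Y₂ ⟶ Z₂), tensorHom f₁ f₂ ≫ tensorHom g₁ g₂ = tensorHom (f₁ ≫ g₁) (f₂ ≫ g₂)
  associator_naturality : ∀ {X₁ X₂ X₃ Y₁ Y₂ Y₃ : C} (f₁ : X₁ ⟶ Y₁) (f₂ : X₂ ⟶ Y₂) (f₃ : X₃ ⟶ Y₃),
    tensorHom (tensorHom f₁ f₂) f₃ ≫ (associator Y₁ Y₂ Y₃).hom =
      (associator X₁ X₂ X₃).hom ≫ tensorHom f₁ (tensorHom f₂ f₃)
  leftUnitor_naturality : ∀ {X Y : C} (f : X ⟶ Y),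
    tensorHom (𝟙 unit) f ≫ (leftUnitor Y).hom = (leftUnitor X).hom ≫ f
  rightUnitor_naturality : ∀ {X Y : C} (f : X ⟶ Y),
    tensorHom f (𝟙 unit) ≫ (rightUnitor Y).hom = (rightUnitor X).hom ≫ f
  pentagon : ∀ W X Y Z : C, tensorHom (associator W X Y).hom (𝟙 Z) ≫
      (associator W (tensor X Y) Z).hom ≫ tensorHom (𝟙 W) (associator X Y Z).hom =
    (associator (tensor W X) Y Z).hom ≫ (associator W X (tensor Y Z)).hom
  triangle : ∀ X Y : C, (associator X unit Y).hom ≫ tensorHom (𝟙 X) (leftUnitor Y).hom =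
    tensorHom (rightUnitor X).hom (𝟙 Y)

/-- The monoidal category given by a monoidal structure. -/
@[reducible] def MonoidalData.toMonoidalCategory {C : Type*} [Category C] {tensor : C → C → C}
    {unit : C} (d : MonoidalData C tensor unit) : MonoidalCategory C :=
  letI : MonoidalCategoryStruct C :=
    { tensorObj := tensor
      tensorHom := d.tensorHom
      whiskerLeft := fun X _ _ f => d.tensorHom (𝟙 X) f
      whiskerRight := fun f Y => d.tensorHom f (𝟙 Y)
      tensorUnit := unit
      associator := d.associator
      leftUnitor := d.leftUnitor
      rightUnitor := d.rightUnitor }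
  MonoidalCategory.ofTensorHom
    (id_tensorHom_id := d.id_tensorHom_id)
    (id_tensorHom := fun _ _ _ _ => rfl)
    (tensorHom_id := fun _ _ => rfl)
    (tensorHom_comp_tensorHom := d.tensorHom_comp_tensorHom)
    (associator_naturality := d.associator_naturality)
    (leftUnitor_naturality := d.leftUnitor_naturality)
    (rightUnitor_naturality := d.rightUnitor_naturality)
    (pentagon := d.pentagon)
    (triangle := d.triangle)

/-- A functor with the given values on objects. -/
structure FunctorData (C D : Type*) [Category C] [Category D] (obj : C → D) where
  map : ∀ {X Y : C}, (X ⟶ Y) → (obj X ⟶ obj Y)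
  map_id : ∀ X, map (𝟙 X) = 𝟙 (obj X)
  map_comp : ∀ {X Y Z : C} (f : X ⟶ Y) (g : Y ⟶ Z), map (f ≫ g) = map f ≫ map g

/-- The functor given by its values on objects and morphisms. -/
@[reducible] def FunctorData.toFunctor {C D : Type*} [Category C] [Category D] {obj : C → D}
    (φ : FunctorData C D obj) : C ⥤ D where
  obj := obj
  map := φ.map
  map_id := φ.map_id
  map_comp := φ.map_comp

namespace CStarBimod

variable {B : Type u} [NonUnitalCStarAlgebra B] [PartialOrder B] [StarOrderedRing B]

/-- The monoidal structure on right C*-bimodules that is given by the internal tensor product. -/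
structure IsItpStructure (d : MonoidalData (CStarBimod B) itp (unit B)) : Prop where
  tensorHom : ∀ {E E' F F' : CStarBimod B} (S : E ⟶ E') (T : F ⟶ F') (ξ : E) (η : F),
    op (d.tensorHom S T) (tmul ξ η) = tmul (op S ξ) (op T η)
  associator : ∀ {E F G : CStarBimod B} (ξ : E) (η : F) (ζ : G),
    op (d.associator E F G).hom (tmul (tmul ξ η) ζ) = tmul ξ (tmul η ζ)
  leftUnitor : ∀ {E : CStarBimod B} (b : B) (ξ : E),
    op (d.leftUnitor E).hom (tmul (E := unit B) b ξ) = E.lmul b ξ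
  rightUnitor : ∀ {E : CStarBimod B} (ξ : E) (b : B),
    op (d.rightUnitor E).hom (tmul (F := unit B) ξ b) = E.rmul b ξ

end CStarBimod

namespace CStarBaseBimod

variable {𝔥 : Type w} [NormedAddCommGroup 𝔥] [InnerProductSpace ℂ 𝔥] [CompleteSpace 𝔥]
  {𝔟 : CStarBase 𝔥}

/-- The monoidal structure on C*-bimodules over a C*-base that is given by the relative tensor
product. The associator is determined by the relation `a |ϑ⟩₂ |ξ⟩₁ ω = |ξ⟩₁ |ϑ⟩₂ ω`. -/
structure IsRelStructure (h : RelWellDefined 𝔟)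
    (d : MonoidalData (CStarBaseBimod 𝔟) h.tensor h.unit) : Prop where
  tensorHom : ∀ {X X' Y Y' : CStarBaseBimod 𝔟} (S : X ⟶ X') (T : Y ⟶ Y') (ξ : X.alpha) (ζ : 𝔥)
    (η : Y.beta), op (d.tensorHom S T) (relTmul ξ ζ η : RelTensor X Y) =
      (relTmul ⟨op S ∘L ξ.1, S.map_alpha ξ.1 ξ.2⟩ ζ ⟨op T ∘L η.1, T.map_beta η.1 η.2⟩ :
        RelTensor X' Y')
  associator : ∀ {X Y Z : CStarBaseBimod 𝔟} (ξ : X.alpha) (ϑ : Z.beta)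
    (ξ₁ : Y →L[ℂ] h.tensor X Y) (ϑ₂ : h.tensor X Y →L[ℂ] h.tensor (h.tensor X Y) Z)
    (ϑ₂' : Y →L[ℂ] h.tensor Y Z) (ξ₁' : h.tensor Y Z →L[ℂ] h.tensor X (h.tensor Y Z)),
    IsKet₁ ξ ξ₁ → IsKet₂ ϑ ϑ₂ → IsKet₂ ϑ ϑ₂' → IsKet₁ ξ ξ₁' →
    ∀ ω : Y, op (d.associator X Y Z).hom (ϑ₂ (ξ₁ ω)) = ξ₁' (ϑ₂' ω)
  leftUnitor : ∀ {X : CStarBaseBimod 𝔟} (b : 𝔟.alg) (ζ : 𝔥) (ξ : X.beta),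
    op (d.leftUnitor X).hom (relTmul (X := h.unit) b ζ ξ : RelTensor h.unit X) = ξ.1 (b.1 ζ)
  rightUnitor : ∀ {X : CStarBaseBimod 𝔟} (η : X.alpha) (ζ : 𝔥) (b : 𝔟.alg'),
    op (d.rightUnitor X).hom (relTmul (Y := h.unit) η ζ b : RelTensor X h.unit) = η.1 (b.1 ζ)

end CStarBaseBimod

/-- The full subcategory of `Θ`-admissible right C*-bimodules is given by this property. -/
abbrev CStarBimod.admissible {B : Type u} [NonUnitalCStarAlgebra B] [PartialOrder B]
    [StarOrderedRing B] (Θ : InvSemigroup B) : ObjectProperty (CStarBimod B) :=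
  fun E => E.IsAdmissible Θ

section IndBimod

variable {B : Type u} [NonUnitalCStarAlgebra B] [PartialOrder B] [StarOrderedRing B]
  {Θ : InvSemigroup B} {K : Type v} [NormedAddCommGroup K] [InnerProductSpace ℂ K]
  [CompleteSpace K] (π : B →⋆ₙₐ[ℂ] (K →L[ℂ] K)) (υ : Θ.carrier → (K →L[ℂ] K))

/-- The C*-base `(B ⊗_π 𝔎, α(B), β(B))`. -/
def indBase (h : IsCStarBase (indAlpha π (CStarBimod.unit B) υ)
    (indBeta π (CStarBimod.unit B) υ)) : CStarBase (IndSpace π (CStarBimod.unit B)) where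
  alg := indAlpha π (CStarBimod.unit B) υ
  alg' := indBeta π (CStarBimod.unit B) υ
  isBase := h

/-- The C*-bimodule `(E ⊗_π 𝔎, β(E), α(E))` over a C*-base with Hilbert space `B ⊗_π 𝔎`. -/
def indBimod (𝔟 : CStarBase (IndSpace π (CStarBimod.unit B))) (E : CStarBimod B)
    (h : IsCStarBaseBimod 𝔟 (IndSpace π E) (indBeta π E υ) (indAlpha π E υ)) : CStarBaseBimod 𝔟 where
  carrier := IndSpace π E
  beta := indBeta π E υ
  alpha := indAlpha π E υ
  isBimod := h

end IndBimod

end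

/-!
All Hilbert spaces, operators and isomorphisms involved are determined by their values on total
families of vectors, and all verifications reduce to identities between inner products of such
vectors. Two facts turn these identities into operators: families with equal Gram matrices are
related by a unitary (`exists_linearIsometryEquiv_of_gram`), and a map of index sets that has a
formal adjoint and exponentially bounded iterates extends to a bounded operator
(`exists_clm_of_adjoint`). The latter replaces the usual positivity arguments for `S ⊗ T`, for the
representations `ρ_α` and for the operators `|ξ⟩₁`, `|η⟩₂`.

**Bimodules over a C*-base.** The operators `|ξ⟩₁` and `|η⟩₂` satisfy `|ξ⟩₁* |ξ'⟩₁ = ρ_δ(ξ* ξ')`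
and `|η⟩₂* |η'⟩₂ = ρ_α(η* η')`. Hence `|α⟩₁ γ` and `|δ⟩₂ β` span C*-factorizations
(`isCStarFact_push`), and `ρ_{α ▷ γ}(b) |η⟩₂ = |ρ_γ(b) η⟩₂` shows that they are compatible
(`CStarBaseBimod.relWellDefined`). The associator exists because the vectors `|ϑ⟩₂ |ξ⟩₁ ω` and
`|ξ⟩₁ |ϑ⟩₂ ω` have the same Gram matrix, the representations `ρ_γ` and `ρ_δ` of a bimodule being
commuting.

**Homogeneous elements.** An element `c ∈ B` of degree `θ` is normal and is fixed by `θ`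
(`CStarBimod.maps_self_of_mem_hB`). It follows that `⟨ξ|η⟩` and `θ(⟨ξ|η⟩)` have the degrees `θ* φ`
and `φ θ*` if `ξ` and `η` have the degrees `θ` and `φ`. Both admissibility conditions then become
statements on linear spans of such elements in `B` (`CStarBimod.ket_mul_iff`,
`CStarBimod.ket'_mul_iff`), and these pass to internal tensor products
(`CStarBimod.isAdmissible_itp`). The approximation theorem `mem_closedSpan_of_total` shows that
homogeneous elements of any degree `τ` are approximated by elements, taken from any total family of
elements with degree in `Θ` that is stable under right multiplication, whose degree lies below `τ`;
it rests on an approximate unit of an algebra of rank-one operators of degree at most `1`.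

**The functor.** The map `b ⊗ ζ ↦ π(b) ζ` is an isometry `V` from `B ⊗_π 𝔎` to `𝔎` with range
projection `υ(Id)`. With `κ_ξ : 𝔎 → E ⊗_π 𝔎`, `ζ ↦ ξ ⊗ ζ` (`indKet`), the generators of `α(E)` and
`β(E)` are `κ_ξ V` and `κ_ξ υ(θ)* V` (`indA`, `indB`), and covariance yields all their products;
for example, `(κ_ξ υ(θ)* V)* (κ_η υ(φ)* V) = V* π(θ(⟨ξ|η⟩)) υ(φ θ*)* V`. Therefore `α(B)` and
`β(B)` form a C*-base (`isCStarBase_ind`) and `E ⊗_π 𝔎` is a C*-bimodule (`isCStarBaseBimod_ind`).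
As `π` is faithful, `ξ ↦ κ_ξ V` is isometric, whence `α(E)` consists exactly of these operators.
Thus a morphism `E ⊗_π 𝔎 → F ⊗_π 𝔎` induces an adjointable operator `E → F` through its action on
`α(E)`, which commutes with the left actions because the morphism intertwines the representations
`ρ_β` (`exists_eq_indMap`); this proves that the functor is full.

**The isomorphisms `τ`.** The vectors `|R⟩₁ (η ⊗ ζ)` with `R = κ_ξ V` and `(ξ ⊗ η) ⊗ ζ` have the
same Gram matrix, which defines the unitary `τ`. It maps `|R⟩₂ (ξ ⊗ ζ)` with `R = κ_η υ(θ)* V` to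
`(ξ ⊗ η) ⊗ υ(θ)* ζ`, and with this second formula the factorizations correspond to each other,
where for `β` the approximation theorem is applied to elementary tensors (`indBeta_itp`).
Naturality and the coherence diagrams are checked on vectors of the two forms
(`IsAdmissibleRep.tau_associativity`).
-/


open scoped InnerProduct
open Filter Topology

noncomputable section

/-! ### Closed linear spans -/

section ClosedSpan

variable {V W : Type*} [NormedAddCommGroup V] [NormedSpace ℂ V] [NormedAddCommGroup W]
  [NormedSpace ℂ W]

/-- The closed linear span of a set. -/
abbrev closedSpan (s : Set V) : Submodule ℂ V := (Submodule.span ℂ s).topologicalClosure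

lemma isClosed_closedSpan (s : Set V) : IsClosed (closedSpan s : Set V) :=
  Submodule.isClosed_topologicalClosure _

lemma mem_closedSpan {s : Set V} {x : V} (h : x ∈ s) : x ∈ closedSpan s :=
  subset_closure (Submodule.subset_span h)

lemma closedSpan_le {s : Set V} {M : Submodule ℂ V} (hM : IsClosed (M : Set V)) (h : s ⊆ M) :
    closedSpan s ≤ M :=
  Submodule.topologicalClosure_minimal _ (Submodule.span_le.2 h) hM

lemma closedSpan_le_closedSpan {s t : Set V} (h : ∀ x ∈ s, x ∈ closedSpan t) :
    closedSpan s ≤ closedSpan t :=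
  closedSpan_le (isClosed_closedSpan t) h

lemma closedSpan_mono {s t : Set V} (h : s ⊆ t) : closedSpan s ≤ closedSpan t :=
  closedSpan_le_closedSpan fun _ hx => mem_closedSpan (h hx)

lemma closedSpan_induction {s : Set V} {p : V → Prop} (mem : ∀ x ∈ s, p x) (zero : p 0)
    (add : ∀ x y, p x → p y → p (x + y)) (smul : ∀ (c : ℂ) x, p x → p (c • x))
    (closed : IsClosed {x | p x}) {x : V} (hx : x ∈ closedSpan s) : p x := by
  let M : Submodule ℂ V :=
    { carrier := {x | p x}
      add_mem' := fun {a b} ha hb => add a b ha hb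
      zero_mem' := zero
      smul_mem' := fun c x h => smul c x h }
  exact closedSpan_le (M := M) closed mem hx

lemma mem_of_mem_closedSpan {σ : ℂ →+* ℂ} (f : V →SL[σ] W) {s : Set V} {M : Submodule ℂ W}
    (hM : IsClosed (M : Set W)) (h : ∀ x ∈ s, f x ∈ M) {x : V} (hx : x ∈ closedSpan s) :
    f x ∈ M :=
  closedSpan_induction (p := fun x => f x ∈ M) h (by simp)
    (fun x y hx hy => by rw [map_add]; exact M.add_mem hx hy)
    (fun c x hx => by rw [map_smulₛₗ]; exact M.smul_mem _ hx) (hM.preimage f.continuous) hx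

lemma dense_of_forall_mem {s : Set V} (h : ∀ x, x ∈ closedSpan s) :
    Dense (Submodule.span ℂ s : Set V) := h

lemma clm_ext_of_total {ι : Type*} {v : ι → V} (hv : Dense (Submodule.span ℂ (Set.range v) : Set V))
    {S T : V →L[ℂ] W} (h : ∀ i, S (v i) = T (v i)) : S = T :=
  ContinuousLinearMap.ext_on hv (by rintro _ ⟨i, rfl⟩; exact h i)

end ClosedSpan

/-! ### Approximate units -/

/-- The filter `l` is a self-adjoint approximate unit of norm at most `1` for the subset `J`. -/
structure IsApproxUnitOf {A : Type*} [NonUnitalCStarAlgebra A] (l : Filter A) (J : Set A) :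
    Prop where
  neBot : l.NeBot
  mem : ∀ᶠ u in l, u ∈ J
  norm_le : ∀ᶠ u in l, ‖u‖ ≤ 1
  star_eq : ∀ᶠ u in l, star u = u
  tendsto_mul : ∀ a ∈ J, Tendsto (fun u => a * u) l (𝓝 a)

lemma exists_isApproxUnitOf {A : Type*} [NonUnitalCStarAlgebra A]
    (J : NonUnitalStarSubalgebra ℂ A) (hJ : IsClosed (J : Set A)) :
    ∃ l : Filter A, IsApproxUnitOf l (J : Set A) := by
  let : NonUnitalCStarAlgebra J :=
    NonUnitalStarSubalgebra.nonUnitalCStarAlgebra (h_closed := hJ) J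
  let := CStarAlgebra.spectralOrder J
  have := CStarAlgebra.spectralOrderedRing J
  have hi := CStarAlgebra.increasingApproximateUnit J
  have hu := hi.toIsApproximateUnit
  have hne := hu.neBot
  refine ⟨(CStarAlgebra.approximateUnit J).map (fun x : J => (x : A)), hne.map _, ?_, ?_, ?_, ?_⟩
  · exact eventually_map.2 (Eventually.of_forall fun x => x.2)
  · exact eventually_map.2 (hi.eventually_norm.mono fun x hx => hx)
  · exact eventually_map.2 (hi.eventually_star_eq.mono fun x hx => congrArg Subtype.val hx)
  · intro a ha
    exact tendsto_map'_iff.2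
      ((continuous_subtype_val.tendsto _).comp (hu.tendsto_mul_left (⟨a, ha⟩ : J)))

namespace IsApproxUnitOf

variable {A : Type*} [NonUnitalCStarAlgebra A] {l : Filter A} {J : Set A}

/-- If `c = ⟨x|x⟩` lies in `J` and `f u` stands for `x u`, then `x u` converges to `x`. -/
lemma tendsto_of_norm_sq (hl : IsApproxUnitOf l J) {X : Type*} [NormedAddCommGroup X] {c : A}
    (hc : c ∈ J) (f : A → X) (x : X)
    (hf : ∀ u, ‖f u - x‖ ^ 2 ≤ ‖star u * (c * u) - star u * c - c * u + c‖) :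
    Tendsto f l (𝓝 x) := by
  rw [tendsto_iff_norm_sub_tendsto_zero]
  have h1 : Tendsto (fun u => 2 * ‖c * u - c‖) l (𝓝 0) := by
    have := (tendsto_iff_norm_sub_tendsto_zero.1 (hl.tendsto_mul c hc)).const_mul 2
    simpa using this
  have h2 : Tendsto (fun u => √(2 * ‖c * u - c‖)) l (𝓝 0) := by
    have := (Real.continuous_sqrt.tendsto 0).comp h1
    rwa [Real.sqrt_zero] at this
  refine squeeze_zero' (Eventually.of_forall fun _ => norm_nonneg _) ?_ h2
  filter_upwards [hl.norm_le, hl.star_eq] with u hu hs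
  refine Real.le_sqrt_of_sq_le ((hf u).trans ?_)
  have e : star u * (c * u) - star u * c - c * u + c = star u * (c * u - c) - (c * u - c) := by
    rw [mul_sub]; abel
  rw [e]
  calc _ ≤ ‖star u * (c * u - c)‖ + ‖c * u - c‖ := norm_sub_le _ _
    _ ≤ 1 * ‖c * u - c‖ + ‖c * u - c‖ := by
      gcongr
      exact (norm_mul_le _ _).trans (by rw [hs]; gcongr)
    _ = _ := by ring

end IsApproxUnitOf

section OperatorApproxUnit

variable {𝔥 H : Type*} [NormedAddCommGroup 𝔥] [InnerProductSpace ℂ 𝔥] [CompleteSpace 𝔥]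
  [NormedAddCommGroup H] [InnerProductSpace ℂ H] [CompleteSpace H]

lemma exists_isApproxUnitOf_operators {M : Submodule ℂ (𝔥 →L[ℂ] 𝔥)}
    (hM : IsClosed (M : Set (𝔥 →L[ℂ] 𝔥))) (hmul : ∀ a ∈ M, ∀ b ∈ M, a ∘L b ∈ M)
    (hadj : ∀ a ∈ M, a† ∈ M) : ∃ l : Filter (𝔥 →L[ℂ] 𝔥), IsApproxUnitOf l (M : Set (𝔥 →L[ℂ] 𝔥)) :=
  exists_isApproxUnitOf
    { M with
      mul_mem' := fun {a b} ha hb => hmul a ha b hb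
      star_mem' := fun {a} ha => hadj a ha } hM

lemma norm_sq_eq_norm_adjoint_comp (x : 𝔥 →L[ℂ] H) : ‖x‖ ^ 2 = ‖x† ∘L x‖ := by
  rw [ContinuousLinearMap.norm_adjoint_comp_self, sq]

lemma IsApproxUnitOf.tendsto_comp {l : Filter (𝔥 →L[ℂ] 𝔥)} {M : Set (𝔥 →L[ℂ] 𝔥)}
    (hl : IsApproxUnitOf l M) (x : 𝔥 →L[ℂ] H) (hx : x† ∘L x ∈ M) :
    Tendsto (fun u => x ∘L u) l (𝓝 x) := by
  refine hl.tendsto_of_norm_sq hx _ _ fun u => le_of_eq ?_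
  rw [norm_sq_eq_norm_adjoint_comp]
  congr 1
  simp only [map_sub, ContinuousLinearMap.adjoint_comp, ContinuousLinearMap.star_eq_adjoint]
  ext ζ
  simp
  abel

lemma IsApproxUnitOf.tendsto_comp' {l : Filter (𝔥 →L[ℂ] 𝔥)} {M : Set (𝔥 →L[ℂ] 𝔥)}
    (hl : IsApproxUnitOf l M) (x : H →L[ℂ] 𝔥) (hx : x ∘L x† ∈ M) :
    Tendsto (fun u => u ∘L x) l (𝓝 x) := by
  have h := hl.tendsto_comp (x†) (by rwa [ContinuousLinearMap.adjoint_adjoint])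
  have h2 := ((ContinuousLinearMap.adjoint (𝕜 := ℂ) (E := 𝔥) (F := H)).continuous.tendsto _).comp h
  rw [ContinuousLinearMap.adjoint_adjoint] at h2
  refine h2.congr' ?_
  filter_upwards [hl.star_eq] with u hu
  rw [ContinuousLinearMap.star_eq_adjoint] at hu
  simp [ContinuousLinearMap.adjoint_comp, hu]

/-- An operator `x` with `x* x` in a C*-algebra `M` belongs to the closure of `x M`. -/
lemma mem_closedSpan_comp {M : Submodule ℂ (𝔥 →L[ℂ] 𝔥)}
    (hM : IsClosed (M : Set (𝔥 →L[ℂ] 𝔥))) (hmul : ∀ a ∈ M, ∀ b ∈ M, a ∘L b ∈ M)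
    (hadj : ∀ a ∈ M, a† ∈ M) (x : 𝔥 →L[ℂ] H) (hx : x† ∘L x ∈ M) :
    x ∈ closedSpan {y : 𝔥 →L[ℂ] H | ∃ a ∈ M, y = x ∘L a} := by
  obtain ⟨l, hl⟩ := exists_isApproxUnitOf_operators hM hmul hadj
  have := hl.neBot
  exact (isClosed_closedSpan _).mem_of_tendsto (hl.tendsto_comp x hx)
    (hl.mem.mono fun u hu => mem_closedSpan ⟨u, hu, rfl⟩)

end OperatorApproxUnit

/-! ### Operators determined by their values on total families -/

/-- A sesquilinear form that induces the norm, such as the inner product of a Hilbert space or of a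
Hilbert C*-module. -/
structure IsNormForm {H A : Type*} [NormedAddCommGroup H] [NormedSpace ℂ H]
    [NormedAddCommGroup A] [NormedSpace ℂ A] [StarAddMonoid A]
    (s : H →ₗ⋆[ℂ] H →ₗ[ℂ] A) : Prop where
  star_eq : ∀ x y, star (s x y) = s y x
  norm_le : ∀ x y, ‖s x y‖ ≤ ‖x‖ * ‖y‖
  norm_sq : ∀ x, ‖x‖ ^ 2 = ‖s x x‖

lemma isNormForm_inner (H : Type*) [NormedAddCommGroup H] [InnerProductSpace ℂ H] :
    IsNormForm (innerₛₗ ℂ : H →ₗ⋆[ℂ] H →ₗ[ℂ] ℂ) where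
  star_eq x y := by simp
  norm_le x y := by simpa using norm_inner_le_norm x y
  norm_sq x := by simp

lemma CStarBimod.isNormForm {B : Type u} [NonUnitalCStarAlgebra B] [PartialOrder B]
    [StarOrderedRing B] (E : CStarBimod B) : IsNormForm E.inner :=
  ⟨E.star_inner, E.norm_inner_le, E.norm_sq⟩

/-- A log-convex sequence that grows at most like `r ^ n` satisfies `a 1 ≤ r * a 0`. -/
lemma le_mul_of_logConvex {a : ℕ → ℝ} (h0 : ∀ n, 0 ≤ a n)
    (h : ∀ n, a (n + 1) ^ 2 ≤ a n * a (n + 2)) {D r : ℝ} (hr : 0 ≤ r)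
    (hg : ∀ n, a n ≤ D * r ^ n) : a 1 ≤ r * a 0 := by
  -- If `q = a 1 / a 0 > r`, log-convexity forces `a n ≥ q ^ n * a 0`, which outgrows `D * r ^ n`.
  by_contra! hlt
  have ha0 : 0 < a 0 := by
    refine (h0 0).lt_of_ne fun e => ?_
    have h1 := h 0
    rw [← e] at h1 hlt
    simp only [zero_add, zero_mul, mul_zero] at h1 hlt
    nlinarith
  set q := a 1 / a 0 with hq
  have hqr : r < q := by rwa [hq, lt_div_iff₀ ha0]
  have hq0 : 0 < q := hr.trans_lt hqr
  have step : ∀ n, 0 < a n ∧ q * a n ≤ a (n + 1) := by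
    intro n
    induction n with
    | zero => exact ⟨ha0, by rw [hq, div_mul_cancel₀ _ ha0.ne']⟩
    | succ n ih =>
      have h1 : 0 < a (n + 1) := (mul_pos hq0 ih.1).trans_le ih.2
      refine ⟨h1, ?_⟩
      have h2 := h n
      have h3 : a n * (q * a (n + 1)) ≤ a n * a (n + 2) := by
        calc a n * (q * a (n + 1)) = (q * a n) * a (n + 1) := by ring
          _ ≤ a (n + 1) * a (n + 1) := by gcongr; exact ih.2
          _ = a (n + 1) ^ 2 := by ring
          _ ≤ _ := h2
      exact le_of_mul_le_mul_left h3 ih.1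
  have hpow : ∀ n, q ^ n * a 0 ≤ a n := by
    intro n
    induction n with
    | zero => simp
    | succ n ih =>
      calc q ^ (n + 1) * a 0 = q * (q ^ n * a 0) := by ring
        _ ≤ q * a n := by gcongr
        _ ≤ _ := (step n).2
  rcases hr.eq_or_lt with rfl | hr
  · have h1 := (hpow 1).trans (hg 1)
    simp only [pow_one, mul_zero] at h1
    nlinarith
  · have ht := tendsto_pow_atTop_atTop_of_one_lt ((one_lt_div hr).2 hqr)
    obtain ⟨n, hn⟩ := (ht.eventually_gt_atTop (D / a 0)).exists
    have h1 := (hpow n).trans (hg n)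
    rw [div_pow, div_lt_div_iff₀ ha0 (by positivity)] at hn
    linarith

section Families

variable {A H H' : Type*} [NormedAddCommGroup A] [NormedSpace ℂ A] [StarAddMonoid A]
  [NormedAddCommGroup H] [NormedSpace ℂ H] [NormedAddCommGroup H'] [NormedSpace ℂ H']
  {s : H →ₗ⋆[ℂ] H →ₗ[ℂ] A} {s' : H' →ₗ⋆[ℂ] H' →ₗ[ℂ] A} {ι ι' : Type*}

lemma denseRange_linearCombination {v : ι → H}
    (hv : Dense (Submodule.span ℂ (Set.range v) : Set H)) :
    DenseRange (Finsupp.linearCombination ℂ v) := by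
  rwa [DenseRange, ← LinearMap.coe_range, Finsupp.range_linearCombination]

omit [StarAddMonoid A] in
lemma linearCombination_form_eq {v : ι → H} {v' : ι' → H'} {t : ι → ι'} {t' : ι' → ι}
    (hadj : ∀ i j, s' (v' (t i)) (v' j) = s (v i) (v (t' j))) (x : ι →₀ ℂ) (y : ι' →₀ ℂ) :
    s' (Finsupp.linearCombination ℂ v' (Finsupp.mapDomain t x)) (Finsupp.linearCombination ℂ v' y) =
      s (Finsupp.linearCombination ℂ v x)
        (Finsupp.linearCombination ℂ v (Finsupp.mapDomain t' y)) := by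
  induction x using Finsupp.induction_linear with
  | zero => simp
  | add x x' hx hx' => simp only [Finsupp.mapDomain_add, map_add, LinearMap.add_apply, hx, hx']
  | single i c =>
    induction y using Finsupp.induction_linear with
    | zero => simp
    | add y y' hy hy' => simp only [Finsupp.mapDomain_add, map_add, hy, hy']
    | single j d => simp [Finsupp.mapDomain_single, hadj]

/-- If `t` and `t'` act on the indices of total families like an operator and its adjoint, and
the powers of `t' t` grow at most exponentially with rate `r`, then there is a bounded operator of
norm at most `√r` that acts like `t`.

The point is that no inequality between Gram matrices has to be known. For a linear combination `x`
of members of the family and the formally self-adjoint `P = t' t`, the Cauchy–Schwarz inequality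
makes `n ↦ ‖P ^ n x‖` log-convex, so that a growth bound on single members, with any constant,
already gives `‖P x‖ ≤ r ‖x‖`, and then `‖t x‖ ^ 2 = ⟨x, P x⟩ ≤ r ‖x‖ ^ 2`. -/
theorem exists_clm_of_adjoint [CompleteSpace H'] (hs : IsNormForm s) (hs' : IsNormForm s')
    {v : ι → H} (hv : Dense (Submodule.span ℂ (Set.range v) : Set H)) (v' : ι' → H') (t : ι → ι')
    (t' : ι' → ι) (hadj : ∀ i j, s' (v' (t i)) (v' j) = s (v i) (v (t' j))) {r : ℝ} (hr : 0 ≤ r)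
    (hgrow : ∀ i, ∃ D, ∀ n : ℕ, ‖v ((fun i => t' (t i))^[n] i)‖ ≤ D * r ^ n) :
    ∃ R : H →L[ℂ] H', (∀ i, R (v i) = v' (t i)) ∧ ‖R‖ ≤ √r := by
  set f := Finsupp.linearCombination ℂ v with hf
  set f' := Finsupp.linearCombination ℂ v' with hf'
  let P : (ι →₀ ℂ) → (ι →₀ ℂ) := fun x => Finsupp.mapDomain t' (Finsupp.mapDomain t x)
  have had : ∀ x y, s' (f' (Finsupp.mapDomain t x)) (f' y) = s (f x) (f (Finsupp.mapDomain t' y)) :=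
    linearCombination_form_eq hadj
  have hsym : ∀ x y, s (f (P x)) (f y) = s (f x) (f (P y)) := fun x y => by
    rw [← had, ← hs.star_eq, ← had, hs'.star_eq]
  have hP : ∀ (n : ℕ) x, P^[n] x = Finsupp.mapDomain ((fun i => t' (t i))^[n]) x := by
    intro n
    induction n with
    | zero => intro x; simp
    | succ n ih =>
      intro x
      rw [Function.iterate_succ_apply, ih, Function.iterate_succ]
      simp only [P, ← Finsupp.mapDomain_comp]
      rfl
  have hgr : ∀ x, ∃ D, ∀ n : ℕ, ‖f (P^[n] x)‖ ≤ D * r ^ n := by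
    intro x
    simp only [hP]
    induction x using Finsupp.induction_linear with
    | zero => exact ⟨0, by simp⟩
    | add x y hx hy =>
      obtain ⟨D, hD⟩ := hx
      obtain ⟨D', hD'⟩ := hy
      refine ⟨D + D', fun n => ?_⟩
      rw [Finsupp.mapDomain_add, map_add, add_mul]
      exact (norm_add_le _ _).trans (add_le_add (hD n) (hD' n))
    | single i c =>
      obtain ⟨D, hD⟩ := hgrow i
      refine ⟨‖c‖ * D, fun n => ?_⟩
      rw [Finsupp.mapDomain_single, hf, Finsupp.linearCombination_single, norm_smul, mul_assoc]
      exact mul_le_mul_of_nonneg_left (hD n) (norm_nonneg _)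
  have hA : ∀ x, ‖f (P x)‖ ≤ r * ‖f x‖ := by
    intro x
    obtain ⟨D, hD⟩ := hgr x
    refine le_mul_of_logConvex (a := fun n => ‖f (P^[n] x)‖) (fun _ => norm_nonneg _)
      (fun n => ?_) hr hD
    simp only [Function.iterate_succ_apply']
    rw [hs.norm_sq, hsym]
    exact hs.norm_le _ _
  have hT : ∀ x, ‖f' (Finsupp.mapDomain t x)‖ ≤ √r * ‖f x‖ := by
    intro x
    refine abs_le_of_sq_le_sq' ?_ (by positivity) |>.2
    rw [mul_pow, Real.sq_sqrt hr, hs'.norm_sq, had]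
    calc _ ≤ ‖f x‖ * ‖f (P x)‖ := hs.norm_le _ _
      _ ≤ ‖f x‖ * (r * ‖f x‖) := by gcongr; exact hA x
      _ = _ := by ring
  have hd := denseRange_linearCombination hv
  let g : (ι →₀ ℂ) →ₗ[ℂ] H' := f' ∘ₗ Finsupp.lmapDomain ℂ ℂ t
  have hg : ∀ x, ‖g x‖ ≤ √r * ‖f x‖ := hT
  refine ⟨g.extendOfNorm f, fun i => ?_,
    LinearMap.opNorm_extendOfNorm_le hd (Real.sqrt_nonneg _) hg⟩
  have := LinearMap.extendOfNorm_eq hd ⟨_, hg⟩ (Finsupp.single i 1)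
  simpa [g, f, f', Finsupp.mapDomain_single] using this

lemma continuous_of_isNormForm (hs : IsNormForm s) : Continuous fun p : H × H => s p.1 p.2 := by
  let t := LinearMap.mkContinuous₂ s 1 fun x y => by simpa using hs.norm_le x y
  exact (t.continuous.comp continuous_fst).clm_apply continuous_snd

/-- Families with equal Gram matrices are related by an isometry. -/
theorem exists_linearIsometry_of_gram [CompleteSpace H'] (hs : IsNormForm s) (hs' : IsNormForm s')
    {v : ι → H} (hv : Dense (Submodule.span ℂ (Set.range v) : Set H)) (v' : ι → H')
    (h : ∀ i j, s' (v' i) (v' j) = s (v i) (v j)) :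
    ∃ U : H →ₗᵢ[ℂ] H', (∀ i, U (v i) = v' i) ∧ ∀ x y, s' (U x) (U y) = s x y := by
  set f := Finsupp.linearCombination ℂ v with hf
  set g := Finsupp.linearCombination ℂ v' with hg
  have hd : DenseRange f := denseRange_linearCombination hv
  have hform : ∀ x y, s' (g x) (g y) = s (f x) (f y) := fun x y => by
    simpa using linearCombination_form_eq (t := id) (t' := id) h x y
  have hle : ∀ x, ‖g x‖ ≤ 1 * ‖f x‖ := fun x => by
    rw [one_mul]
    refine abs_le_of_sq_le_sq' ?_ (norm_nonneg _) |>.2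
    rw [hs.norm_sq, hs'.norm_sq, hform]
  let R := g.extendOfNorm f
  have hR : ∀ x, R (f x) = g x := LinearMap.extendOfNorm_eq hd ⟨_, hle⟩
  have hRform : ∀ x y, s' (R x) (R y) = s x y := by
    intro x y
    have c1 := continuous_of_isNormForm hs'
    have c2 := continuous_of_isNormForm hs
    refine hd.induction_on x (isClosed_eq (c1.comp (by fun_prop : Continuous fun x => (R x, R y)))
      (c2.comp (by fun_prop : Continuous fun x => (x, y)))) fun x => ?_
    refine hd.induction_on y (isClosed_eq
      (c1.comp (by fun_prop : Continuous fun y => (R (f x), R y)))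
      (c2.comp (by fun_prop : Continuous fun y => (f x, y)))) fun y => ?_
    rw [hR, hR, hform]
  refine ⟨⟨R.toLinearMap, fun x => ?_⟩, fun i => ?_, hRform⟩
  · have h1 : ‖R x‖ ^ 2 = ‖x‖ ^ 2 := by rw [hs.norm_sq, hs'.norm_sq, hRform]
    exact (sq_eq_sq₀ (norm_nonneg _) (norm_nonneg _)).1 h1
  · have := hR (Finsupp.single i 1)
    simpa [f, g] using this

/-- Total families with equal Gram matrices are related by a unitary. -/
theorem exists_linearIsometryEquiv_of_gram [CompleteSpace H] [CompleteSpace H'] (hs : IsNormForm s)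
    (hs' : IsNormForm s') {v : ι → H} (hv : Dense (Submodule.span ℂ (Set.range v) : Set H))
    {v' : ι → H'} (hv' : Dense (Submodule.span ℂ (Set.range v') : Set H'))
    (h : ∀ i j, s' (v' i) (v' j) = s (v i) (v j)) :
    ∃ U : H ≃ₗᵢ[ℂ] H', (∀ i, U (v i) = v' i) ∧ ∀ x y, s' (U x) (U y) = s x y := by
  obtain ⟨U, hU, hform⟩ := exists_linearIsometry_of_gram hs hs' hv v' h
  have hsurj : Function.Surjective U := by
    have hc : IsClosed ((LinearMap.range U.toLinearMap : Submodule ℂ H') : Set H') := by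
      rw [LinearMap.coe_range]
      exact U.isometry.isClosedEmbedding.isClosed_range
    intro y
    have : y ∈ LinearMap.range U.toLinearMap :=
      closedSpan_le hc (by rintro _ ⟨i, rfl⟩; exact ⟨v i, hU i⟩) (hv' y)
    exact this
  exact ⟨LinearIsometryEquiv.ofSurjective U hsurj, hU, hform⟩

end Families

section HilbertFamilies

variable {H H' : Type*} [NormedAddCommGroup H] [InnerProductSpace ℂ H] [CompleteSpace H]
  [NormedAddCommGroup H'] [InnerProductSpace ℂ H'] [CompleteSpace H'] {ι ι' : Type*}

lemma adjoint_apply_eq_of_total {v : ι → H}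
    (hv : Dense (Submodule.span ℂ (Set.range v) : Set H)) {R : H →L[ℂ] H'} {y : H'} {x : H}
    (h : ∀ i, ⟪R (v i), y⟫_ℂ = ⟪v i, x⟫_ℂ) : (R†) y = x := by
  refine ext_inner_left ℂ fun z => ?_
  rw [ContinuousLinearMap.adjoint_inner_right]
  refine closedSpan_induction (p := fun z => ⟪R z, y⟫_ℂ = ⟪z, x⟫_ℂ)
    (by rintro _ ⟨i, rfl⟩; exact h i) (by simp)
    (fun x y hx hy => by simp only [map_add, inner_add_left, hx, hy])
    (fun c x hx => by simp only [map_smul, inner_smul_left, hx])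
    (isClosed_eq (by fun_prop) (by fun_prop)) (hv z)

lemma adjoint_eq_of_total {v : ι → H} (hv : Dense (Submodule.span ℂ (Set.range v) : Set H))
    {w : ι' → H'} (hw : Dense (Submodule.span ℂ (Set.range w) : Set H')) {R : H →L[ℂ] H'}
    {S : H' →L[ℂ] H} (h : ∀ i j, ⟪R (v i), w j⟫_ℂ = ⟪v i, S (w j)⟫_ℂ) : R† = S :=
  clm_ext_of_total hw fun j => adjoint_apply_eq_of_total hv fun i => h i j

lemma LinearIsometryEquiv.adjoint_toCLM (U : H ≃ₗᵢ[ℂ] H') :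
    (U.toContinuousLinearEquiv : H →L[ℂ] H')† = (U.symm.toContinuousLinearEquiv : H' →L[ℂ] H) := by
  refine ContinuousLinearMap.ext fun y => ext_inner_left ℂ fun x => ?_
  rw [ContinuousLinearMap.adjoint_inner_right]
  change ⟪U x, y⟫_ℂ = ⟪x, U.symm y⟫_ℂ
  rw [← U.inner_map_map x (U.symm y), U.apply_symm_apply]

end HilbertFamilies

/-! ### C*-factorizations and their representations -/

/-- A continuous linear map on a submodule `M` maps `M` into a closed submodule as soon as it does
so on a subset `S` of `M` whose closed linear span contains `M`. -/
lemma mem_of_subtype_closedSpan {V W : Type*} [NormedAddCommGroup V] [NormedSpace ℂ V]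
    [NormedAddCommGroup W] [NormedSpace ℂ W] {M : Submodule ℂ V} (f : M →L[ℂ] W) {S : Set V}
    (hM : ∀ x ∈ M, x ∈ closedSpan S) {Z : Submodule ℂ W} (hZ : IsClosed (Z : Set W))
    (hS : ∀ x ∈ S, ∃ h : x ∈ M, f ⟨x, h⟩ ∈ Z) (x : M) : f x ∈ Z := by
  let N : Submodule ℂ M := Z.comap f.toLinearMap
  have hN : IsClosed (N : Set M) := hZ.preimage f.continuous
  have h1 : Submodule.span ℂ S ≤ N.map M.subtype :=
    Submodule.span_le.2 fun y hy => by
      obtain ⟨h, h'⟩ := hS y hy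
      exact ⟨⟨y, h⟩, h', rfl⟩
  have h2 : (x : V) ∈ closure ((fun y : M => (y : V)) '' (N : Set M)) :=
    closure_mono (fun y hy => h1 hy) (hM x x.2)
  have h3 : x ∈ closure (N : Set M) := closure_subtype.2 h2
  rw [hN.closure_eq] at h3
  exact h3

section Fact

variable {𝔥 : Type w} [NormedAddCommGroup 𝔥] [InnerProductSpace ℂ 𝔥] [CompleteSpace 𝔥]
  {M N : Submodule ℂ (𝔥 →L[ℂ] 𝔥)} {H : Type w} [NormedAddCommGroup H] [InnerProductSpace ℂ H]
  [CompleteSpace H] {F : Submodule ℂ (𝔥 →L[ℂ] H)}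

lemma IsCStarBase.symm (hb : IsCStarBase M N) : IsCStarBase N M :=
  ⟨hb.right, hb.left, fun a ha b hb' => (hb.commute b hb' a ha).symm⟩

lemma IsCStarFact.adjoint_comp_mem (hF : IsCStarFact M F) {ξ η : 𝔥 →L[ℂ] H} (h : ξ ∈ F)
    (h' : η ∈ F) : ξ† ∘L η ∈ M := by
  rw [← hF.adjoint_mul]
  exact mem_closedSpan ⟨ξ, h, η, h', rfl⟩

lemma IsCStarFact.comp_mem (hF : IsCStarFact M F) {ξ : 𝔥 →L[ℂ] H} (h : ξ ∈ F)
    {a : 𝔥 →L[ℂ] 𝔥} (ha : a ∈ M) : ξ ∘L a ∈ F := by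
  have : ξ ∘L a ∈ closedSpan {ξ : 𝔥 →L[ℂ] H | ∃ η ∈ F, ∃ a ∈ M, ξ = η ∘L a} :=
    mem_closedSpan ⟨ξ, h, a, ha, rfl⟩
  rwa [closedSpan, hF.mul_alg] at this

lemma IsCStarFact.total (hF : IsCStarFact M F) :
    Dense (Submodule.span ℂ (Set.range fun p : F × 𝔥 => p.1.1 p.2) : Set H) := by
  convert hF.dense using 4
  ext x
  constructor
  · rintro ⟨p, rfl⟩
    exact ⟨p.1, p.1.2, p.2, rfl⟩
  · rintro ⟨ξ, h, ζ, rfl⟩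
    exact ⟨(⟨ξ, h⟩, ζ), rfl⟩

/-- The condition `[F M] = F` follows from `F* F ⊆ M` and `F M ⊆ F`. -/
lemma isCStarFact_of_comp_mem (hM : IsNondegCStarAlg M) (hc : IsClosed (F : Set (𝔥 →L[ℂ] H)))
    (h1 : (Submodule.span ℂ {a : 𝔥 →L[ℂ] 𝔥 | ∃ ξ ∈ F, ∃ η ∈ F,
      a = ξ† ∘L η}).topologicalClosure = M) (h2 : ∀ ξ ∈ F, ∀ a ∈ M, ξ ∘L a ∈ F)
    (h3 : Dense (Submodule.span ℂ {x : H | ∃ ξ ∈ F, ∃ ζ, x = ξ ζ} : Set H)) :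
    IsCStarFact M F where
  isClosed := hc
  adjoint_mul := h1
  dense := h3
  mul_alg := by
    refine le_antisymm (closedSpan_le hc ?_) fun ξ hξ => ?_
    · rintro _ ⟨η, hη, a, ha, rfl⟩
      exact h2 η hη a ha
    · have hx : ξ† ∘L ξ ∈ M := by
        rw [← h1]
        exact mem_closedSpan ⟨ξ, hξ, ξ, hξ, rfl⟩
      refine closedSpan_mono ?_
        (mem_closedSpan_comp hM.isClosed hM.mul_mem hM.adjoint_mem ξ hx)
      rintro _ ⟨a, ha, rfl⟩
      exact ⟨ξ, hξ, a, ha, rfl⟩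

lemma IsRho.unique (hF : IsCStarFact M F) {b : 𝔥 →L[ℂ] 𝔥} {R R' : H →L[ℂ] H} (h : IsRho F b R)
    (h' : IsRho F b R') : R = R' :=
  clm_ext_of_total hF.total fun p => by rw [h p.1 p.1.2, h' p.1 p.1.2]

/-- The operator `ξ ζ ↦ ξ b ζ` is bounded. On the index pairs `(ξ, ζ)` its formal adjoint is given
by `b*`, because `b*` commutes with the operators `ξ* η`. -/
lemma exists_isRho (hb : IsCStarBase M N) (hF : IsCStarFact M F) (b : N) :
    ∃ R : H →L[ℂ] H, IsRho F b.1 R ∧ ‖R‖ ≤ ‖b‖ := by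
  have hb' : b.1† ∈ N := hb.right.adjoint_mem _ b.2
  obtain ⟨R, hR, hn⟩ := exists_clm_of_adjoint (isNormForm_inner H) (isNormForm_inner H) hF.total
    (fun p : F × 𝔥 => p.1.1 p.2) (fun p => (p.1, b.1 p.2)) (fun p => (p.1, (b.1†) p.2))
    (fun p q => by
      have := congrArg (fun T : 𝔥 →L[ℂ] 𝔥 => T q.2)
        (hb.commute _ (hF.adjoint_comp_mem p.1.2 q.1.2) _ hb')
      simp only [ContinuousLinearMap.comp_apply] at this
      simp only [innerₛₗ_apply_apply]
      rw [← ContinuousLinearMap.adjoint_inner_right, ← ContinuousLinearMap.adjoint_inner_right,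
        ← ContinuousLinearMap.adjoint_inner_right, ← this])
    (sq_nonneg ‖b‖) (fun p => ⟨‖p.1‖ * ‖p.2‖, fun n => by
      have key : ∀ n : ℕ, (fun p : F × 𝔥 => (p.1, (b.1†) (b.1 p.2)))^[n] p =
          (p.1, ((b.1† ∘L b.1)^n) p.2) := by
        intro n
        induction n with
        | zero => simp
        | succ n ih => rw [Function.iterate_succ_apply', ih, pow_succ']; rfl
      refine (congrArg (fun q : F × 𝔥 => ‖q.1.1 q.2‖) (key n)).le.trans ?_
      calc ‖p.1.1 (((b.1† ∘L b.1)^n) p.2)‖ ≤ ‖p.1.1‖ * (‖(b.1† ∘L b.1)^n‖ * ‖p.2‖) :=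
            (p.1.1.le_opNorm _).trans (by gcongr; exact ContinuousLinearMap.le_opNorm _ _)
        _ ≤ ‖p.1.1‖ * (‖(b.1† ∘L b.1)‖^n * ‖p.2‖) := by
            gcongr
            rcases n with _ | n
            · rw [pow_zero, pow_zero]; exact ContinuousLinearMap.norm_id_le
            · exact norm_pow_le' _ (Nat.succ_pos n)
        _ = _ := by
            rw [← norm_sq_eq_norm_adjoint_comp]
            simp only [Submodule.coe_norm]
            ring⟩)
  refine ⟨R, fun ξ hξ ζ => hR (⟨ξ, hξ⟩, ζ), ?_⟩
  rwa [Real.sqrt_sq (norm_nonneg _)] at hn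

/-- The representation `ρ_F` of `N` on `H` associated with a C*-factorization `F` of `H`. -/
def rho (hb : IsCStarBase M N) (hF : IsCStarFact M F) : N →L[ℂ] (H →L[ℂ] H) :=
  LinearMap.mkContinuous
    { toFun := fun b => (exists_isRho hb hF b).choose
      map_add' := fun b c => IsRho.unique hF (exists_isRho hb hF (b + c)).choose_spec.1
        fun ξ hξ ζ => by
          rw [add_apply, (exists_isRho hb hF b).choose_spec.1 ξ hξ,
            (exists_isRho hb hF c).choose_spec.1 ξ hξ, Submodule.coe_add, add_apply, map_add]
      map_smul' := fun z b => IsRho.unique hF (exists_isRho hb hF (z • b)).choose_spec.1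
        fun ξ hξ ζ => by
          rw [RingHom.id_apply, smul_apply, (exists_isRho hb hF b).choose_spec.1 ξ hξ,
            Submodule.coe_smul, smul_apply, map_smul] } 1
    fun b => by simpa using (exists_isRho hb hF b).choose_spec.2

lemma isRho_rho (hb : IsCStarBase M N) (hF : IsCStarFact M F) (b : N) :
    IsRho F b.1 (rho hb hF b) :=
  (exists_isRho hb hF b).choose_spec.1

lemma rho_apply (hb : IsCStarBase M N) (hF : IsCStarFact M F) (b : N) {ξ : 𝔥 →L[ℂ] H} (hξ : ξ ∈ F)
    (ζ : 𝔥) : rho hb hF b (ξ ζ) = ξ (b.1 ζ) :=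
  isRho_rho hb hF b ξ hξ ζ

lemma rhoStable_iff (hb : IsCStarBase M N) (hF : IsCStarFact M F) {G : Submodule ℂ (𝔥 →L[ℂ] H)} :
    RhoStable N F G ↔
      closedSpan {η : 𝔥 →L[ℂ] H | ∃ b : N, ∃ η' ∈ G, η = rho hb hF b ∘L η'} = G := by
  have : {η : 𝔥 →L[ℂ] H | ∃ b ∈ N, ∃ R, IsRho F b R ∧ ∃ η' ∈ G, η = R ∘L η'} =
      {η : 𝔥 →L[ℂ] H | ∃ b : N, ∃ η' ∈ G, η = rho hb hF b ∘L η'} := by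
    ext η
    constructor
    · rintro ⟨b, hb', R, hR, η', hη', rfl⟩
      exact ⟨⟨b, hb'⟩, η', hη', by rw [hR.unique hF (isRho_rho hb hF ⟨b, hb'⟩)]⟩
    · rintro ⟨b, η', hη', rfl⟩
      exact ⟨b, b.2, _, isRho_rho hb hF b, η', hη', rfl⟩
  rw [RhoStable, this]

/-- If operators `k i : Y → H` are such that the `(k i)* (k j)` map a C*-factorization `F` of `Y`
onto a total subset of `F`, and if the ranges of the `k i` are total in `H`, then the `k i F` span a
C*-factorization of `H`. -/
theorem isCStarFact_push (hM : IsNondegCStarAlg M) (hF : IsCStarFact M F) {H' : Type w}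
    [NormedAddCommGroup H'] [InnerProductSpace ℂ H'] [CompleteSpace H'] {κ : Type*}
    (k : κ → H →L[ℂ] H') (h1 : ∀ i j, ∀ η ∈ F, ((k i)† ∘L k j) ∘L η ∈ F)
    (h2 : ∀ η ∈ F, η ∈ closedSpan {η : 𝔥 →L[ℂ] H | ∃ i j, ∃ η' ∈ F, η = ((k i)† ∘L k j) ∘L η'})
    (h3 : ∀ x, x ∈ closedSpan {x : H' | ∃ i y, x = k i y}) :
    IsCStarFact M (closedSpan {ω : 𝔥 →L[ℂ] H' | ∃ i, ∃ η ∈ F, ω = k i ∘L η}) := by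
  set G := closedSpan {ω : 𝔥 →L[ℂ] H' | ∃ i, ∃ η ∈ F, ω = k i ∘L η} with hG
  have mem : ∀ i, ∀ η ∈ F, k i ∘L η ∈ G := fun i η hη => mem_closedSpan ⟨i, η, hη, rfl⟩
  refine isCStarFact_of_comp_mem hM (isClosed_closedSpan _) (le_antisymm ?_ ?_) ?_ ?_
  · refine closedSpan_le hM.isClosed ?_
    rintro _ ⟨ω, hω, ω', hω', rfl⟩
    refine closedSpan_induction (p := fun ω => ω† ∘L ω' ∈ M) ?_ (by simp)
      (fun x y hx hy => by
        rw [map_add, ContinuousLinearMap.add_comp]; exact M.add_mem hx hy)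
      (fun c x hx => by
        rw [map_smulₛₗ, ContinuousLinearMap.smul_comp]; exact M.smul_mem _ hx)
      (hM.isClosed.preimage (by fun_prop)) hω
    rintro _ ⟨i, η, hη, rfl⟩
    refine closedSpan_induction (p := fun ω' => (k i ∘L η)† ∘L ω' ∈ M) ?_ (by simp)
      (fun x y hx hy => by
        rw [ContinuousLinearMap.comp_add]; exact M.add_mem hx hy)
      (fun c x hx => by
        rw [ContinuousLinearMap.comp_smul]; exact M.smul_mem _ hx)
      (hM.isClosed.preimage (by fun_prop)) hω'
    rintro _ ⟨j, η', hη', rfl⟩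
    have := hF.adjoint_comp_mem hη (h1 i j η' hη')
    rwa [ContinuousLinearMap.adjoint_comp]
  · rw [← hF.adjoint_mul]
    refine closedSpan_le_closedSpan ?_
    rintro _ ⟨ξ, hξ, η, hη, rfl⟩
    refine closedSpan_induction
      (p := fun η => ξ† ∘L η ∈ closedSpan {a : 𝔥 →L[ℂ] 𝔥 | ∃ ξ ∈ G, ∃ η ∈ G, a = ξ† ∘L η}) ?_
      (by simp) (fun x y hx hy => by
        rw [ContinuousLinearMap.comp_add]; exact Submodule.add_mem _ hx hy)
      (fun c x hx => by
        rw [ContinuousLinearMap.comp_smul]; exact Submodule.smul_mem _ _ hx)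
      ((isClosed_closedSpan _).preimage (by fun_prop)) (h2 η hη)
    rintro _ ⟨i, j, η', hη', rfl⟩
    refine mem_closedSpan ⟨k i ∘L ξ, mem i ξ hξ, k j ∘L η', mem j η' hη', ?_⟩
    rw [ContinuousLinearMap.adjoint_comp]
    rfl
  · intro ω hω a ha
    refine closedSpan_induction (p := fun ω => ω ∘L a ∈ G) ?_ (by simp)
      (fun x y hx hy => by
        rw [ContinuousLinearMap.add_comp]; exact Submodule.add_mem _ hx hy)
      (fun c x hx => by
        rw [ContinuousLinearMap.smul_comp]; exact Submodule.smul_mem _ _ hx)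
      ((isClosed_closedSpan _).preimage (by fun_prop)) hω
    rintro _ ⟨i, η, hη, rfl⟩
    exact mem i _ (hF.comp_mem hη ha)
  · intro x
    refine closedSpan_le_closedSpan ?_ (h3 x)
    rintro _ ⟨i, y, rfl⟩
    refine mem_of_mem_closedSpan (k i) (isClosed_closedSpan _) ?_ (hF.dense y)
    rintro _ ⟨ξ, hξ, ζ, rfl⟩
    exact mem_closedSpan ⟨_, mem i ξ hξ, ζ, rfl⟩

/-- The C*-algebra `M` is a C*-factorization of the underlying Hilbert space. -/
lemma IsNondegCStarAlg.isCStarFact (hM : IsNondegCStarAlg M) : IsCStarFact M M := by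
  refine isCStarFact_of_comp_mem hM hM.isClosed (le_antisymm (closedSpan_le hM.isClosed ?_) ?_)
    hM.mul_mem hM.nondeg
  · rintro _ ⟨a, ha, b, hb, rfl⟩
    exact hM.mul_mem _ (hM.adjoint_mem a ha) _ hb
  · intro a ha
    have := mem_closedSpan_comp hM.isClosed hM.mul_mem hM.adjoint_mem a
      (hM.mul_mem _ (hM.adjoint_mem a ha) _ ha)
    refine closedSpan_mono ?_ this
    rintro _ ⟨b, hb, rfl⟩
    exact ⟨a†, hM.adjoint_mem a ha, b, hb, by rw [ContinuousLinearMap.adjoint_adjoint]⟩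

end Fact

namespace CStarBaseBimod

variable {𝔥 : Type w} [NormedAddCommGroup 𝔥] [InnerProductSpace ℂ 𝔥] [CompleteSpace 𝔥]
  {𝔟 : CStarBase 𝔥}

/-- The representation `ρ_α` of `𝔅†` on a C*-bimodule with first factorization `α`. -/
def rhoA (X : CStarBaseBimod 𝔟) : 𝔟.alg' →L[ℂ] (X →L[ℂ] X) := rho 𝔟.isBase X.isBimod.alpha_fact

/-- The representation `ρ_β` of `𝔅` on a C*-bimodule with second factorization `β`. -/
def rhoB (X : CStarBaseBimod 𝔟) : 𝔟.alg →L[ℂ] (X →L[ℂ] X) :=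
  rho 𝔟.isBase.symm X.isBimod.beta_fact

variable (X Y : CStarBaseBimod 𝔟)

lemma rhoA_apply (b : 𝔟.alg') (ξ : X.alpha) (ζ : 𝔥) : X.rhoA b (ξ.1 ζ) = ξ.1 (b.1 ζ) :=
  rho_apply _ _ b ξ.2 ζ

lemma rhoB_apply (b : 𝔟.alg) (η : X.beta) (ζ : 𝔥) : X.rhoB b (η.1 ζ) = η.1 (b.1 ζ) :=
  rho_apply _ _ b η.2 ζ

lemma closedSpan_rhoA :
    closedSpan {η : 𝔥 →L[ℂ] X | ∃ b : 𝔟.alg', ∃ η' ∈ X.beta, η = X.rhoA b ∘L η'} = X.beta :=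
  (rhoStable_iff 𝔟.isBase X.isBimod.alpha_fact).1 X.isBimod.beta_stable

lemma closedSpan_rhoB :
    closedSpan {η : 𝔥 →L[ℂ] X | ∃ b : 𝔟.alg, ∃ η' ∈ X.alpha, η = X.rhoB b ∘L η'} = X.alpha :=
  (rhoStable_iff 𝔟.isBase.symm X.isBimod.beta_fact).1 X.isBimod.alpha_stable

lemma rhoA_comp_mem (b : 𝔟.alg') {η : 𝔥 →L[ℂ] X} (h : η ∈ X.beta) : X.rhoA b ∘L η ∈ X.beta := by
  rw [← closedSpan_rhoA]
  exact mem_closedSpan ⟨b, η, h, rfl⟩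

lemma rhoB_comp_mem (b : 𝔟.alg) {η : 𝔥 →L[ℂ] X} (h : η ∈ X.alpha) : X.rhoB b ∘L η ∈ X.alpha := by
  rw [← closedSpan_rhoB]
  exact mem_closedSpan ⟨b, η, h, rfl⟩

lemma total_alpha :
    Dense (Submodule.span ℂ (Set.range fun p : X.alpha × 𝔥 => p.1.1 p.2) : Set X) :=
  X.isBimod.alpha_fact.total

lemma total_beta :
    Dense (Submodule.span ℂ (Set.range fun p : X.beta × 𝔥 => p.1.1 p.2) : Set X) :=
  X.isBimod.beta_fact.total

/-- The representations `ρ_α` and `ρ_β` commute, because `ρ_α` leaves `β` invariant and `ρ_β` acts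
on `β 𝔥` by right multiplication. -/
lemma rhoA_comp_rhoB (b : 𝔟.alg') (c : 𝔟.alg) (x : X) :
    X.rhoA b (X.rhoB c x) = X.rhoB c (X.rhoA b x) := by
  refine congrArg (fun T : X →L[ℂ] X => T x) (clm_ext_of_total X.total_beta
    (S := X.rhoA b ∘L X.rhoB c) (T := X.rhoB c ∘L X.rhoA b) fun p => ?_)
  have h := X.rhoB_apply c ⟨_, X.rhoA_comp_mem b p.1.2⟩ p.2
  simp only [ContinuousLinearMap.comp_apply] at h ⊢
  rw [h, rhoB_apply]

/-! ### Creation operators on relative tensor products -/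

/-- The canonical map from the algebraic tensor product to the relative tensor product. -/
def relOf : X.alpha ⊗[ℂ] (𝔥 ⊗[ℂ] Y.beta) →ₗ[ℂ] RelTensor X Y where
  toFun x := SepCompl.of (isPreInner_rel X Y) x
  map_add' x y := map_add (SepCompl.of (isPreInner_rel X Y)) x y
  map_smul' c x := map_smul (SepCompl.of (isPreInner_rel X Y)) c x

lemma denseRange_relOf : DenseRange (relOf X Y) := SepCompl.denseRange_of (isPreInner_rel X Y)

lemma relTmul_eq (ξ : X.alpha) (ζ : 𝔥) (η : Y.beta) :
    (relTmul ξ ζ η : RelTensor X Y) = relOf X Y (ξ ⊗ₜ (ζ ⊗ₜ η)) := rfl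

lemma total_relTmul : Dense (Submodule.span ℂ (Set.range fun p : X.alpha × 𝔥 × Y.beta =>
    (relTmul p.1 p.2.1 p.2.2 : RelTensor X Y)) : Set (RelTensor X Y)) := by
  refine (denseRange_relOf X Y).mono ?_
  rintro _ ⟨x, rfl⟩
  induction x with
  | zero => rw [map_zero]; exact Submodule.zero_mem _
  | add w w' h h' => rw [map_add]; exact Submodule.add_mem _ h h'
  | tmul ξ w =>
    induction w with
    | zero => rw [TensorProduct.tmul_zero, map_zero]; exact Submodule.zero_mem _
    | add w w' h h' => rw [TensorProduct.tmul_add, map_add]; exact Submodule.add_mem _ h h'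
    | tmul ζ η => exact Submodule.subset_span ⟨(ξ, ζ, η), rfl⟩

variable {X Y}

lemma inner_relTmul (ξ ξ' : X.alpha) (ζ ζ' : 𝔥) (η η' : Y.beta) :
    ⟪(relTmul ξ ζ η : RelTensor X Y), relTmul ξ' ζ' η'⟫_ℂ =
      ⟪ζ, (ξ.1† ∘L ξ'.1) ((η.1† ∘L η'.1) ζ')⟫_ℂ := by
  rw [← relForm_tmul]
  exact SepCompl.form_of _ _ _

lemma commute_adjoint_apply (ξ ξ' : X.alpha) (η η' : Y.beta) (ζ : 𝔥) :
    (ξ.1†) (ξ'.1 ((η.1†) (η'.1 ζ))) = (η.1†) (η'.1 ((ξ.1†) (ξ'.1 ζ))) :=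
  congrArg (fun T : 𝔥 →L[ℂ] 𝔥 => T ζ) (commute_adjoint X Y ξ.2 ξ'.2 η.2 η'.2).eq

lemma inner_relTmul_left (ξ ξ' : X.alpha) (ζ ζ' : 𝔥) (η η' : Y.beta) :
    ⟪(relTmul ξ ζ η : RelTensor X Y), relTmul ξ' ζ' η'⟫_ℂ =
      ⟪η.1 ζ, η'.1 ((ξ.1†) (ξ'.1 ζ'))⟫_ℂ := by
  rw [inner_relTmul, ← ContinuousLinearMap.adjoint_inner_right]
  simp only [ContinuousLinearMap.comp_apply]
  rw [commute_adjoint_apply]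

lemma inner_relTmul_right (ξ ξ' : X.alpha) (ζ ζ' : 𝔥) (η η' : Y.beta) :
    ⟪(relTmul ξ ζ η : RelTensor X Y), relTmul ξ' ζ' η'⟫_ℂ =
      ⟪ξ.1 ζ, ξ'.1 ((η.1†) (η'.1 ζ'))⟫_ℂ := by
  rw [inner_relTmul, ← ContinuousLinearMap.adjoint_inner_right]
  rfl

lemma norm_iterate_adjoint_comp_le {H H' : Type*} [NormedAddCommGroup H] [InnerProductSpace ℂ H]
    [CompleteSpace H] [NormedAddCommGroup H'] [InnerProductSpace ℂ H'] [CompleteSpace H']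
    (T : H →L[ℂ] H') (n : ℕ) (x : H) : ‖(fun x => (T†) (T x))^[n] x‖ ≤ (‖T‖ ^ 2) ^ n * ‖x‖ := by
  induction n with
  | zero => simp
  | succ n ih =>
    rw [Function.iterate_succ_apply']
    calc ‖(T† ∘L T) ((fun x => (T†) (T x))^[n] x)‖
        ≤ ‖T† ∘L T‖ * ‖(fun x => (T†) (T x))^[n] x‖ := ContinuousLinearMap.le_opNorm _ _
      _ ≤ ‖T‖ ^ 2 * ((‖T‖ ^ 2) ^ n * ‖x‖) := by
          rw [norm_sq_eq_norm_adjoint_comp]; rw [norm_sq_eq_norm_adjoint_comp] at ih; gcongr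
      _ = _ := by ring

variable (X Y) in
/-- The operator `|ξ⟩₁` is bounded: on index pairs `|ξ⟩₁* |ξ⟩₁` acts as `(η, ζ) ↦ (η, ξ* ξ ζ)`. -/
lemma exists_isKet₁ (ξ : X.alpha) :
    ∃ T : Y →L[ℂ] RelTensor X Y, IsKet₁ ξ T ∧ ‖T‖ ≤ ‖ξ‖ := by
  obtain ⟨R, hR, hn⟩ := exists_clm_of_adjoint (isNormForm_inner Y)
    (isNormForm_inner (RelTensor X Y)) Y.total_beta
    (fun p : X.alpha × 𝔥 × Y.beta => (relTmul p.1 p.2.1 p.2.2 : RelTensor X Y))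
    (fun p => (ξ, p.2, p.1)) (fun p => (p.2.2, (ξ.1†) (p.1.1 p.2.1)))
    (fun p q => inner_relTmul_left _ _ _ _ _ _) (sq_nonneg ‖ξ‖)
    (fun p => ⟨‖p.1‖ * ‖p.2‖, fun n => by
      have key : ∀ n : ℕ, (fun p : Y.beta × 𝔥 => (p.1, (ξ.1†) (ξ.1 p.2)))^[n] p =
          (p.1, (fun x => (ξ.1†) (ξ.1 x))^[n] p.2) := by
        intro n
        induction n with
        | zero => simp
        | succ n ih => rw [Function.iterate_succ_apply', ih, Function.iterate_succ_apply']
      refine (congrArg (fun q : Y.beta × 𝔥 => ‖q.1.1 q.2‖) (key n)).le.trans ?_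
      calc _ ≤ ‖p.1‖ * ((‖ξ‖ ^ 2) ^ n * ‖p.2‖) := (p.1.1.le_opNorm _).trans
            (mul_le_mul_of_nonneg_left (norm_iterate_adjoint_comp_le ξ.1 n p.2) (norm_nonneg _))
        _ = _ := by ring⟩)
  refine ⟨R, fun ζ η => hR (η, ζ), ?_⟩
  exact hn.trans_eq (Real.sqrt_sq (norm_nonneg _))

variable (X Y) in
/-- The operator `|η⟩₂` is bounded: on index pairs `|η⟩₂* |η⟩₂` acts as `(ξ, ζ) ↦ (ξ, η* η ζ)`. -/
lemma exists_isKet₂ (η : Y.beta) :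
    ∃ T : X →L[ℂ] RelTensor X Y, IsKet₂ η T ∧ ‖T‖ ≤ ‖η‖ := by
  obtain ⟨R, hR, hn⟩ := exists_clm_of_adjoint (isNormForm_inner X)
    (isNormForm_inner (RelTensor X Y)) X.total_alpha
    (fun p : X.alpha × 𝔥 × Y.beta => (relTmul p.1 p.2.1 p.2.2 : RelTensor X Y))
    (fun p => (p.1, p.2, η)) (fun p => (p.1, (η.1†) (p.2.2.1 p.2.1)))
    (fun p q => inner_relTmul_right _ _ _ _ _ _) (sq_nonneg ‖η‖)
    (fun p => ⟨‖p.1‖ * ‖p.2‖, fun n => by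
      have key : ∀ n : ℕ, (fun p : X.alpha × 𝔥 => (p.1, (η.1†) (η.1 p.2)))^[n] p =
          (p.1, (fun x => (η.1†) (η.1 x))^[n] p.2) := by
        intro n
        induction n with
        | zero => simp
        | succ n ih => rw [Function.iterate_succ_apply', ih, Function.iterate_succ_apply']
      refine (congrArg (fun q : X.alpha × 𝔥 => ‖q.1.1 q.2‖) (key n)).le.trans ?_
      calc _ ≤ ‖p.1‖ * ((‖η‖ ^ 2) ^ n * ‖p.2‖) := (p.1.1.le_opNorm _).trans
            (mul_le_mul_of_nonneg_left (norm_iterate_adjoint_comp_le η.1 n p.2) (norm_nonneg _))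
        _ = _ := by ring⟩)
  refine ⟨R, fun ζ ξ => hR (ξ, ζ), ?_⟩
  exact hn.trans_eq (Real.sqrt_sq (norm_nonneg _))

lemma IsKet₁.unique {ξ : X.alpha} {T T' : Y →L[ℂ] RelTensor X Y} (h : IsKet₁ ξ T)
    (h' : IsKet₁ ξ T') : T = T' :=
  clm_ext_of_total Y.total_beta fun p => by rw [h, h']

lemma IsKet₂.unique {η : Y.beta} {T T' : X →L[ℂ] RelTensor X Y} (h : IsKet₂ η T)
    (h' : IsKet₂ η T') : T = T' :=
  clm_ext_of_total X.total_alpha fun p => by rw [h, h']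

lemma relTmul_add_left (ξ ξ' : X.alpha) (ζ : 𝔥) (η : Y.beta) :
    (relTmul (ξ + ξ') ζ η : RelTensor X Y) = relTmul ξ ζ η + relTmul ξ' ζ η := by
  simp only [relTmul_eq, TensorProduct.add_tmul, map_add]

lemma relTmul_smul_left (c : ℂ) (ξ : X.alpha) (ζ : 𝔥) (η : Y.beta) :
    (relTmul (c • ξ) ζ η : RelTensor X Y) = c • relTmul ξ ζ η := by
  rw [relTmul_eq, relTmul_eq, ← TensorProduct.smul_tmul', map_smul]

lemma relTmul_add_right (ξ : X.alpha) (ζ : 𝔥) (η η' : Y.beta) :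
    (relTmul ξ ζ (η + η') : RelTensor X Y) = relTmul ξ ζ η + relTmul ξ ζ η' := by
  simp only [relTmul_eq, TensorProduct.tmul_add, TensorProduct.tmul_add, map_add]

lemma relTmul_smul_right (c : ℂ) (ξ : X.alpha) (ζ : 𝔥) (η : Y.beta) :
    (relTmul ξ ζ (c • η) : RelTensor X Y) = c • relTmul ξ ζ η := by
  simp only [relTmul_eq, TensorProduct.tmul_smul, TensorProduct.tmul_smul, map_smul]

variable (X Y)

/-- The operators `|ξ⟩₁`, as a function of `ξ ∈ α`. -/
def ket₁ : X.alpha →L[ℂ] (Y →L[ℂ] RelTensor X Y) :=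
  LinearMap.mkContinuous
    { toFun := fun ξ => (exists_isKet₁ X Y ξ).choose
      map_add' := fun ξ ξ' => (exists_isKet₁ X Y (ξ + ξ')).choose_spec.1.unique fun ζ η => by
        rw [add_apply, (exists_isKet₁ X Y ξ).choose_spec.1,
          (exists_isKet₁ X Y ξ').choose_spec.1, relTmul_add_left]
      map_smul' := fun c ξ => (exists_isKet₁ X Y (c • ξ)).choose_spec.1.unique fun ζ η => by
        rw [RingHom.id_apply, smul_apply, (exists_isKet₁ X Y ξ).choose_spec.1,
          relTmul_smul_left] } 1
    fun ξ => by simpa using (exists_isKet₁ X Y ξ).choose_spec.2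

/-- The operators `|η⟩₂`, as a function of `η ∈ δ`. -/
def ket₂ : Y.beta →L[ℂ] (X →L[ℂ] RelTensor X Y) :=
  LinearMap.mkContinuous
    { toFun := fun η => (exists_isKet₂ X Y η).choose
      map_add' := fun η η' => (exists_isKet₂ X Y (η + η')).choose_spec.1.unique fun ζ ξ => by
        rw [add_apply, (exists_isKet₂ X Y η).choose_spec.1,
          (exists_isKet₂ X Y η').choose_spec.1, relTmul_add_right]
      map_smul' := fun c η => (exists_isKet₂ X Y (c • η)).choose_spec.1.unique fun ζ ξ => by
        rw [RingHom.id_apply, smul_apply, (exists_isKet₂ X Y η).choose_spec.1,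
          relTmul_smul_right] } 1
    fun η => by simpa using (exists_isKet₂ X Y η).choose_spec.2

lemma isKet₁_ket₁ (ξ : X.alpha) : IsKet₁ ξ (ket₁ X Y ξ) := (exists_isKet₁ X Y ξ).choose_spec.1

lemma isKet₂_ket₂ (η : Y.beta) : IsKet₂ η (ket₂ X Y η) := (exists_isKet₂ X Y η).choose_spec.1

lemma ket₁_apply (ξ : X.alpha) (ζ : 𝔥) (η : Y.beta) : ket₁ X Y ξ (η.1 ζ) = relTmul ξ ζ η :=
  isKet₁_ket₁ X Y ξ ζ η

lemma ket₂_apply (ξ : X.alpha) (ζ : 𝔥) (η : Y.beta) : ket₂ X Y η (ξ.1 ζ) = relTmul ξ ζ η :=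
  isKet₂_ket₂ X Y η ζ ξ

lemma total_ket₁ : Dense (Submodule.span ℂ (Set.range fun p : X.alpha × Y => ket₁ X Y p.1 p.2) :
    Set (RelTensor X Y)) := by
  refine (total_relTmul X Y).mono (Submodule.span_mono ?_)
  rintro _ ⟨p, rfl⟩
  exact ⟨(p.1, p.2.2.1 p.2.1), ket₁_apply _ _ _ _ _⟩

lemma total_ket₂ : Dense (Submodule.span ℂ (Set.range fun p : Y.beta × X => ket₂ X Y p.1 p.2) :
    Set (RelTensor X Y)) := by
  refine (total_relTmul X Y).mono (Submodule.span_mono ?_)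
  rintro _ ⟨p, rfl⟩
  exact ⟨(p.2.2, p.1.1 p.2.1), ket₂_apply _ _ _ _ _⟩

/-- The element `ξ* ξ'` of `𝔅` for `ξ, ξ' ∈ α`. -/
def ipA (ξ ξ' : X.alpha) : 𝔟.alg := ⟨ξ.1† ∘L ξ'.1, alpha_adjoint_mem X ξ.2 ξ'.2⟩

/-- The element `η* η'` of `𝔅†` for `η, η' ∈ β`. -/
def ipB (η η' : Y.beta) : 𝔟.alg' := ⟨η.1† ∘L η'.1, beta_adjoint_mem Y η.2 η'.2⟩

lemma ket₁_adjoint_comp (ξ ξ' : X.alpha) :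
    (ket₁ X Y ξ)† ∘L ket₁ X Y ξ' = Y.rhoB (X.ipA ξ ξ') := by
  refine clm_ext_of_total Y.total_beta fun q => ?_
  rw [ContinuousLinearMap.comp_apply]
  refine adjoint_apply_eq_of_total Y.total_beta fun p => ?_
  rw [rhoB_apply, ket₁_apply, ket₁_apply, inner_relTmul_left]
  rfl

lemma ket₂_adjoint_comp (η η' : Y.beta) :
    (ket₂ X Y η)† ∘L ket₂ X Y η' = X.rhoA (Y.ipB η η') := by
  refine clm_ext_of_total X.total_alpha fun q => ?_
  rw [ContinuousLinearMap.comp_apply]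
  refine adjoint_apply_eq_of_total X.total_alpha fun p => ?_
  rw [rhoA_apply, ket₂_apply, ket₂_apply, inner_relTmul_right]
  rfl

lemma inner_ket₁ (ξ ξ' : X.alpha) (y y' : Y) :
    ⟪ket₁ X Y ξ y, ket₁ X Y ξ' y'⟫_ℂ = ⟪y, Y.rhoB (X.ipA ξ ξ') y'⟫_ℂ := by
  rw [← ket₁_adjoint_comp, ← ContinuousLinearMap.adjoint_inner_right]
  rfl

lemma inner_ket₂ (η η' : Y.beta) (x x' : X) :
    ⟪ket₂ X Y η x, ket₂ X Y η' x'⟫_ℂ = ⟪x, X.rhoA (Y.ipB η η') x'⟫_ℂ := by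
  rw [← ket₂_adjoint_comp, ← ContinuousLinearMap.adjoint_inner_right]
  rfl

/-! ### The relative tensor product is well defined -/

lemma relAlpha_eq : relAlpha X Y = closedSpan {ω : 𝔥 →L[ℂ] RelTensor X Y |
    ∃ ξ : X.alpha, ∃ η ∈ Y.alpha, ω = ket₁ X Y ξ ∘L η} := by
  rw [relAlpha]
  congr 2
  ext ω
  constructor
  · rintro ⟨ξ, T, hT, η, hη, rfl⟩
    exact ⟨ξ, η, hη, by rw [hT.unique (isKet₁_ket₁ X Y ξ)]⟩
  · rintro ⟨ξ, η, hη, rfl⟩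
    exact ⟨ξ, _, isKet₁_ket₁ X Y ξ, η, hη, rfl⟩

lemma relBeta_eq : relBeta X Y = closedSpan {ω : 𝔥 →L[ℂ] RelTensor X Y |
    ∃ η : Y.beta, ∃ ξ ∈ X.beta, ω = ket₂ X Y η ∘L ξ} := by
  rw [relBeta]
  congr 2
  ext ω
  constructor
  · rintro ⟨η, T, hT, ξ, hξ, rfl⟩
    exact ⟨η, ξ, hξ, by rw [hT.unique (isKet₂_ket₂ X Y η)]⟩
  · rintro ⟨η, ξ, hξ, rfl⟩
    exact ⟨η, _, isKet₂_ket₂ X Y η, ξ, hξ, rfl⟩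

lemma ket₁_comp_mem (ξ : X.alpha) {η : 𝔥 →L[ℂ] Y} (hη : η ∈ Y.alpha) :
    ket₁ X Y ξ ∘L η ∈ relAlpha X Y := by
  rw [relAlpha_eq]; exact mem_closedSpan ⟨ξ, η, hη, rfl⟩

lemma ket₂_comp_mem (η : Y.beta) {ξ : 𝔥 →L[ℂ] X} (hξ : ξ ∈ X.beta) :
    ket₂ X Y η ∘L ξ ∈ relBeta X Y := by
  rw [relBeta_eq]; exact mem_closedSpan ⟨η, ξ, hξ, rfl⟩

/-- `isCStarFact_push` applies to the operators `|ξ⟩₁`, because `|ξ⟩₁* |ξ'⟩₁ = ρ_δ(ξ* ξ')` and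
`[ρ_δ(𝔅) γ] = γ`. -/
lemma isCStarFact_relAlpha : IsCStarFact 𝔟.alg (relAlpha X Y) := by
  rw [relAlpha_eq]
  refine isCStarFact_push 𝔟.isBase.left Y.isBimod.alpha_fact (ket₁ X Y)
    (fun i j η hη => ?_) (fun η hη => ?_) fun x => ?_
  · rw [ket₁_adjoint_comp]
    exact Y.rhoB_comp_mem _ hη
  · rw [← closedSpan_rhoB] at hη
    refine closedSpan_le_closedSpan ?_ hη
    rintro _ ⟨b, η', hη', rfl⟩
    refine mem_of_subtype_closedSpan
      (((ContinuousLinearMap.compL ℂ 𝔥 Y Y).flip η') ∘L Y.rhoB)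
      (S := {a : 𝔥 →L[ℂ] 𝔥 | ∃ ξ ∈ X.alpha, ∃ η ∈ X.alpha, a = ξ† ∘L η}) (fun a ha => ?_)
      (isClosed_closedSpan _) ?_ b
    · rw [closedSpan, X.isBimod.alpha_fact.adjoint_mul]; exact ha
    · rintro _ ⟨ξ, hξ, ξ', hξ', rfl⟩
      refine ⟨alpha_adjoint_mem X hξ hξ', mem_closedSpan ⟨⟨ξ, hξ⟩, ⟨ξ', hξ'⟩, η', hη', ?_⟩⟩
      rw [ket₁_adjoint_comp]
      rfl
  · refine closedSpan_mono ?_ (total_ket₁ X Y x)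
    rintro _ ⟨p, rfl⟩
    exact ⟨p.1, p.2, rfl⟩

/-- `isCStarFact_push` applies to the operators `|η⟩₂`, because `|η⟩₂* |η'⟩₂ = ρ_α(η* η')` and
`[ρ_α(𝔅†) β] = β`. -/
lemma isCStarFact_relBeta : IsCStarFact 𝔟.alg' (relBeta X Y) := by
  rw [relBeta_eq]
  refine isCStarFact_push 𝔟.isBase.right X.isBimod.beta_fact (ket₂ X Y)
    (fun i j η hη => ?_) (fun η hη => ?_) fun x => ?_
  · rw [ket₂_adjoint_comp]
    exact X.rhoA_comp_mem _ hη
  · rw [← closedSpan_rhoA] at hη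
    refine closedSpan_le_closedSpan ?_ hη
    rintro _ ⟨b, η', hη', rfl⟩
    refine mem_of_subtype_closedSpan
      (((ContinuousLinearMap.compL ℂ 𝔥 X X).flip η') ∘L X.rhoA)
      (S := {a : 𝔥 →L[ℂ] 𝔥 | ∃ ξ ∈ Y.beta, ∃ η ∈ Y.beta, a = ξ† ∘L η}) (fun a ha => ?_)
      (isClosed_closedSpan _) ?_ b
    · rw [closedSpan, Y.isBimod.beta_fact.adjoint_mul]; exact ha
    · rintro _ ⟨ξ, hξ, ξ', hξ', rfl⟩
      refine ⟨beta_adjoint_mem Y hξ hξ', mem_closedSpan ⟨⟨ξ, hξ⟩, ⟨ξ', hξ'⟩, η', hη', ?_⟩⟩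
      rw [ket₂_adjoint_comp]
      rfl
  · refine closedSpan_mono ?_ (total_ket₂ X Y x)
    rintro _ ⟨p, rfl⟩
    exact ⟨p.1, p.2, rfl⟩

/-- The representation `ρ_{α ▷ γ}` is `id ⊗ ρ_γ`. -/
lemma rho_relAlpha_ket₂ (b : 𝔟.alg') (η : Y.beta) :
    rho 𝔟.isBase (isCStarFact_relAlpha X Y) b ∘L ket₂ X Y η =
      ket₂ X Y ⟨Y.rhoA b ∘L η.1, Y.rhoA_comp_mem b η.2⟩ := by
  have h1 : ∀ ξ : X.alpha, rho 𝔟.isBase (isCStarFact_relAlpha X Y) b ∘L ket₁ X Y ξ =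
      ket₁ X Y ξ ∘L Y.rhoA b := fun ξ => clm_ext_of_total Y.total_alpha fun p => by
    have := rho_apply 𝔟.isBase (isCStarFact_relAlpha X Y) b (ket₁_comp_mem X Y ξ p.1.2) p.2
    simp only [ContinuousLinearMap.comp_apply] at this ⊢
    rw [this, rhoA_apply]
  refine clm_ext_of_total X.total_alpha fun p => ?_
  have := congrArg (fun T : Y →L[ℂ] RelTensor X Y => T (η.1 p.2)) (h1 p.1)
  simp only [ContinuousLinearMap.comp_apply] at this ⊢
  rw [ket₂_apply, ket₂_apply, ← ket₁_apply, this, ← ket₁_apply]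
  rfl

/-- The representation `ρ_{β ◁ δ}` is `ρ_β ⊗ id`. -/
lemma rho_relBeta_ket₁ (b : 𝔟.alg) (ξ : X.alpha) :
    rho 𝔟.isBase.symm (isCStarFact_relBeta X Y) b ∘L ket₁ X Y ξ =
      ket₁ X Y ⟨X.rhoB b ∘L ξ.1, X.rhoB_comp_mem b ξ.2⟩ := by
  have h1 : ∀ η : Y.beta, rho 𝔟.isBase.symm (isCStarFact_relBeta X Y) b ∘L ket₂ X Y η =
      ket₂ X Y η ∘L X.rhoB b := fun η => clm_ext_of_total X.total_beta fun p => by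
    have := rho_apply 𝔟.isBase.symm (isCStarFact_relBeta X Y) b (ket₂_comp_mem X Y η p.1.2) p.2
    simp only [ContinuousLinearMap.comp_apply] at this ⊢
    rw [this, rhoB_apply]
  refine clm_ext_of_total Y.total_beta fun p => ?_
  have := congrArg (fun T : X →L[ℂ] RelTensor X Y => T (ξ.1 p.2)) (h1 p.1)
  simp only [ContinuousLinearMap.comp_apply] at this ⊢
  rw [ket₁_apply, ket₁_apply, ← ket₂_apply, this, ← ket₂_apply]
  rfl

/-- The operators `ρ_{α ▷ γ}(b) |η⟩₂ = |ρ_γ(b) η⟩₂` with `η ∈ δ` reproduce all `|η⟩₂` with `η ∈ δ`,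
because `[ρ_γ(𝔅†) δ] = δ`. -/
lemma rhoStable_relBeta : RhoStable 𝔟.alg' (relAlpha X Y) (relBeta X Y) := by
  rw [rhoStable_iff 𝔟.isBase (isCStarFact_relAlpha X Y)]
  refine le_antisymm (closedSpan_le (isCStarFact_relBeta X Y).isClosed ?_) ?_
  · rintro _ ⟨b, ω, hω, rfl⟩
    rw [relBeta_eq] at hω
    refine mem_of_mem_closedSpan (ContinuousLinearMap.compL ℂ 𝔥 (RelTensor X Y) (RelTensor X Y)
      (rho 𝔟.isBase (isCStarFact_relAlpha X Y) b)) (isCStarFact_relBeta X Y).isClosed ?_ hω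
    rintro _ ⟨η, ξ, hξ, rfl⟩
    rw [ContinuousLinearMap.compL_apply, ← ContinuousLinearMap.comp_assoc, rho_relAlpha_ket₂]
    exact ket₂_comp_mem X Y _ hξ
  · refine (relBeta_eq X Y).le.trans (closedSpan_le_closedSpan ?_)
    rintro _ ⟨η, ξ, hξ, rfl⟩
    refine mem_of_subtype_closedSpan
      (((ContinuousLinearMap.compL ℂ 𝔥 X (RelTensor X Y)).flip ξ) ∘L ket₂ X Y)
      (S := {η : 𝔥 →L[ℂ] Y | ∃ b : 𝔟.alg', ∃ η' ∈ Y.beta, η = Y.rhoA b ∘L η'})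
      (fun η hη => by rw [closedSpan_rhoA]; exact hη) (isClosed_closedSpan _) ?_ η
    rintro _ ⟨b, η', hη', rfl⟩
    refine ⟨Y.rhoA_comp_mem b hη', mem_closedSpan ⟨b, ket₂ X Y ⟨η', hη'⟩ ∘L ξ,
      ket₂_comp_mem X Y _ hξ, ?_⟩⟩
    rw [← ContinuousLinearMap.comp_assoc, rho_relAlpha_ket₂]
    rfl

/-- The operators `ρ_{β ◁ δ}(b) |ξ⟩₁ = |ρ_β(b) ξ⟩₁` with `ξ ∈ α` reproduce all `|ξ⟩₁` with `ξ ∈ α`,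
because `[ρ_β(𝔅) α] = α`. -/
lemma rhoStable_relAlpha : RhoStable 𝔟.alg (relBeta X Y) (relAlpha X Y) := by
  rw [rhoStable_iff 𝔟.isBase.symm (isCStarFact_relBeta X Y)]
  refine le_antisymm (closedSpan_le (isCStarFact_relAlpha X Y).isClosed ?_) ?_
  · rintro _ ⟨b, ω, hω, rfl⟩
    rw [relAlpha_eq] at hω
    refine mem_of_mem_closedSpan (ContinuousLinearMap.compL ℂ 𝔥 (RelTensor X Y) (RelTensor X Y)
      (rho 𝔟.isBase.symm (isCStarFact_relBeta X Y) b)) (isCStarFact_relAlpha X Y).isClosed ?_ hω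
    rintro _ ⟨ξ, η, hη, rfl⟩
    rw [ContinuousLinearMap.compL_apply, ← ContinuousLinearMap.comp_assoc, rho_relBeta_ket₁]
    exact ket₁_comp_mem X Y _ hη
  · refine (relAlpha_eq X Y).le.trans (closedSpan_le_closedSpan ?_)
    rintro _ ⟨ξ, η, hη, rfl⟩
    refine mem_of_subtype_closedSpan
      (((ContinuousLinearMap.compL ℂ 𝔥 Y (RelTensor X Y)).flip η) ∘L ket₁ X Y)
      (S := {ξ : 𝔥 →L[ℂ] X | ∃ b : 𝔟.alg, ∃ ξ' ∈ X.alpha, ξ = X.rhoB b ∘L ξ'})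
      (fun ξ hξ => by rw [closedSpan_rhoB]; exact hξ) (isClosed_closedSpan _) ?_ ξ
    rintro _ ⟨b, ξ', hξ', rfl⟩
    refine ⟨X.rhoB_comp_mem b hξ', mem_closedSpan ⟨b, ket₁ X Y ⟨ξ', hξ'⟩ ∘L η,
      ket₁_comp_mem X Y _ hη, ?_⟩⟩
    rw [← ContinuousLinearMap.comp_assoc, rho_relBeta_ket₁]
    rfl

/-- The unit: both associated representations are the inclusions of the algebras of the base. -/
lemma isCStarBaseBimod_unit (𝔟 : CStarBase 𝔥) : IsCStarBaseBimod 𝔟 𝔥 𝔟.alg' 𝔟.alg where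
  alpha_fact := 𝔟.isBase.left.isCStarFact
  beta_fact := 𝔟.isBase.right.isCStarFact
  beta_stable := by
    rw [RhoStable]
    have h := 𝔟.isBase.right.isCStarFact
    refine le_antisymm (closedSpan_le h.isClosed ?_) (h.mul_alg.symm.le.trans (closedSpan_mono ?_))
    · rintro _ ⟨b, hb, R, hR, η, hη, rfl⟩
      rw [hR.unique 𝔟.isBase.left.isCStarFact fun ξ hξ ζ =>
        congrArg (fun T : 𝔥 →L[ℂ] 𝔥 => T ζ) (𝔟.isBase.commute ξ hξ b hb).symm]
      exact 𝔟.isBase.right.mul_mem _ hb _ hη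
    · rintro _ ⟨b, hb, a, ha, rfl⟩
      exact ⟨b, hb, b, fun ξ hξ ζ =>
        congrArg (fun T : 𝔥 →L[ℂ] 𝔥 => T ζ) (𝔟.isBase.commute ξ hξ b hb).symm, a, ha, rfl⟩
  alpha_stable := by
    rw [RhoStable]
    have h := 𝔟.isBase.left.isCStarFact
    refine le_antisymm (closedSpan_le h.isClosed ?_) (h.mul_alg.symm.le.trans (closedSpan_mono ?_))
    · rintro _ ⟨b, hb, R, hR, η, hη, rfl⟩
      rw [hR.unique 𝔟.isBase.right.isCStarFact fun ξ hξ ζ =>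
        congrArg (fun T : 𝔥 →L[ℂ] 𝔥 => T ζ) (𝔟.isBase.commute b hb ξ hξ)]
      exact 𝔟.isBase.left.mul_mem _ hb _ hη
    · rintro _ ⟨b, hb, a, ha, rfl⟩
      exact ⟨b, hb, b, fun ξ hξ ζ =>
        congrArg (fun T : 𝔥 →L[ℂ] 𝔥 => T ζ) (𝔟.isBase.commute b hb ξ hξ), a, ha, rfl⟩

theorem relWellDefined (𝔟 : CStarBase 𝔥) : RelWellDefined 𝔟 where
  exists_ket₁ X Y ξ := ⟨_, isKet₁_ket₁ X Y ξ⟩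
  exists_ket₂ X Y η := ⟨_, isKet₂_ket₂ X Y η⟩
  isBimod_tensor X Y := ⟨isCStarFact_relAlpha X Y, isCStarFact_relBeta X Y, rhoStable_relBeta X Y,
    rhoStable_relAlpha X Y⟩
  isBimod_unit := isCStarBaseBimod_unit 𝔟

end CStarBaseBimod

/-! ### The monoidal category of C*-bimodules over a C*-base -/

/-- The vectors `k i (v j)` are total if the `v j` are total and the ranges of the `k i` are. -/
lemma total_comp {V W κ ι : Type*} [NormedAddCommGroup V] [NormedSpace ℂ V] [NormedAddCommGroup W]
    [NormedSpace ℂ W] {k : κ → V →L[ℂ] W} {v : ι → V}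
    (hk : Dense (Submodule.span ℂ (Set.range fun p : κ × V => k p.1 p.2) : Set W))
    (hv : Dense (Submodule.span ℂ (Set.range v) : Set V)) :
    Dense (Submodule.span ℂ (Set.range fun p : κ × ι => k p.1 (v p.2)) : Set W) := by
  refine dense_of_forall_mem fun x => closedSpan_le_closedSpan ?_ (hk x)
  rintro _ ⟨p, rfl⟩
  refine mem_of_mem_closedSpan (k p.1) (isClosed_closedSpan _) ?_ (hv p.2)
  rintro _ ⟨j, rfl⟩
  exact mem_closedSpan ⟨(p.1, j), rfl⟩

namespace CStarBaseBimod

variable {𝔥 : Type w} [NormedAddCommGroup 𝔥] [InnerProductSpace ℂ 𝔥] [CompleteSpace 𝔥]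
  {𝔟 : CStarBase 𝔥}

/-- The relative tensor product of C*-bimodules as a C*-bimodule. -/
abbrev tens (X Y : CStarBaseBimod 𝔟) : CStarBaseBimod 𝔟 := (relWellDefined 𝔟).tensor X Y

/-- The unit C*-bimodule. -/
abbrev uni (𝔟 : CStarBase 𝔥) : CStarBaseBimod 𝔟 := (relWellDefined 𝔟).unit

section Kets

variable (X Y : CStarBaseBimod 𝔟)

/-- The operators `|ξ⟩₁` with values in the C*-bimodule `tens X Y`. -/
def k₁ : X.alpha →L[ℂ] (Y →L[ℂ] tens X Y) := ket₁ X Y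

/-- The operators `|η⟩₂` with values in the C*-bimodule `tens X Y`. -/
def k₂ : Y.beta →L[ℂ] (X →L[ℂ] tens X Y) := ket₂ X Y

variable {X Y} in
lemma relTmul_eq_k₁ (ξ : X.alpha) (ζ : 𝔥) (η : Y.beta) :
    (relTmul ξ ζ η : RelTensor X Y) = k₁ X Y ξ (η.1 ζ) := (ket₁_apply X Y ξ ζ η).symm

variable {X Y} in
lemma relTmul_eq_k₂ (ξ : X.alpha) (ζ : 𝔥) (η : Y.beta) :
    (relTmul ξ ζ η : RelTensor X Y) = k₂ X Y η (ξ.1 ζ) := (ket₂_apply X Y ξ ζ η).symm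

lemma k₁_apply_beta (ξ : X.alpha) (η : Y.beta) (ζ : 𝔥) :
    k₁ X Y ξ (η.1 ζ) = k₂ X Y η (ξ.1 ζ) :=
  (ket₁_apply X Y ξ ζ η).trans (ket₂_apply X Y ξ ζ η).symm

lemma inner_k₁ (ξ ξ' : X.alpha) (y y' : Y) :
    ⟪k₁ X Y ξ y, k₁ X Y ξ' y'⟫_ℂ = ⟪y, Y.rhoB (X.ipA ξ ξ') y'⟫_ℂ := inner_ket₁ X Y ξ ξ' y y'

lemma inner_k₂ (η η' : Y.beta) (x x' : X) :
    ⟪k₂ X Y η x, k₂ X Y η' x'⟫_ℂ = ⟪x, X.rhoA (Y.ipB η η') x'⟫_ℂ := inner_ket₂ X Y η η' x x'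

lemma total_k₁ : Dense (Submodule.span ℂ (Set.range fun p : X.alpha × Y => k₁ X Y p.1 p.2) :
    Set (tens X Y)) := total_ket₁ X Y

lemma total_k₂ : Dense (Submodule.span ℂ (Set.range fun p : Y.beta × X => k₂ X Y p.1 p.2) :
    Set (tens X Y)) := total_ket₂ X Y

lemma tens_alpha : (tens X Y).alpha = closedSpan {ω : 𝔥 →L[ℂ] tens X Y |
    ∃ ξ : X.alpha, ∃ η ∈ Y.alpha, ω = k₁ X Y ξ ∘L η} := relAlpha_eq X Y

lemma tens_beta : (tens X Y).beta = closedSpan {ω : 𝔥 →L[ℂ] tens X Y |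
    ∃ η : Y.beta, ∃ ξ ∈ X.beta, ω = k₂ X Y η ∘L ξ} := relBeta_eq X Y

variable {X Y}

/-- The element `|ξ⟩₁ η` of `α ▷ γ`. -/
def kA (ξ : X.alpha) (η : Y.alpha) : (tens X Y).alpha :=
  ⟨k₁ X Y ξ ∘L η.1, ket₁_comp_mem X Y ξ η.2⟩

/-- The element `|η⟩₂ ξ` of `β ◁ δ`. -/
def kB (η : Y.beta) (ξ : X.beta) : (tens X Y).beta :=
  ⟨k₂ X Y η ∘L ξ.1, ket₂_comp_mem X Y η ξ.2⟩

lemma isKet₁_iff {ξ : X.alpha} {T : Y →L[ℂ] tens X Y} : IsKet₁ ξ T ↔ T = k₁ X Y ξ :=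
  ⟨fun h => IsKet₁.unique h (isKet₁_ket₁ X Y ξ), fun h => h ▸ isKet₁_ket₁ X Y ξ⟩

lemma isKet₂_iff {η : Y.beta} {T : X →L[ℂ] tens X Y} : IsKet₂ η T ↔ T = k₂ X Y η :=
  ⟨fun h => IsKet₂.unique h (isKet₂_ket₂ X Y η), fun h => h ▸ isKet₂_ket₂ X Y η⟩

lemma rhoA_k₁ (b : 𝔟.alg') (ξ : X.alpha) (y : Y) :
    (tens X Y).rhoA b (k₁ X Y ξ y) = k₁ X Y ξ (Y.rhoA b y) := by
  refine congrArg (fun T : Y →L[ℂ] tens X Y => T y) (clm_ext_of_total Y.total_alpha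
    (S := (tens X Y).rhoA b ∘L k₁ X Y ξ) (T := k₁ X Y ξ ∘L Y.rhoA b) fun p => ?_)
  have := rhoA_apply (tens X Y) b (kA ξ p.1) p.2
  simp only [ContinuousLinearMap.comp_apply, rhoA_apply]
  exact this

lemma rhoB_k₂ (b : 𝔟.alg) (η : Y.beta) (x : X) :
    (tens X Y).rhoB b (k₂ X Y η x) = k₂ X Y η (X.rhoB b x) := by
  refine congrArg (fun T : X →L[ℂ] tens X Y => T x) (clm_ext_of_total X.total_beta
    (S := (tens X Y).rhoB b ∘L k₂ X Y η) (T := k₂ X Y η ∘L X.rhoB b) fun p => ?_)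
  have := rhoB_apply (tens X Y) b (kB η p.1) p.2
  simp only [ContinuousLinearMap.comp_apply, rhoB_apply]
  exact this

lemma norm_relTmul_le (ξ : X.alpha) (ζ : 𝔥) (η : Y.beta) :
    ‖(relTmul ξ ζ η : RelTensor X Y)‖ ≤ ‖ξ‖ * ‖ζ‖ * ‖η‖ := by
  obtain ⟨T, hT, hn⟩ := exists_isKet₁ X Y ξ
  rw [← hT ζ η]
  calc _ ≤ ‖T‖ * (‖η.1‖ * ‖ζ‖) := (T.le_opNorm _).trans (by gcongr; exact η.1.le_opNorm _)
    _ ≤ ‖ξ‖ * (‖η‖ * ‖ζ‖) := mul_le_mul_of_nonneg_right hn (by positivity)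
    _ = _ := by ring

end Kets

/-! ### Tensor products of morphisms -/

section TensorHom

variable {X X' Y Y' Z : CStarBaseBimod 𝔟}

/-- The adjoint of a morphism. -/
def Hom.adj (T : X ⟶ Y) : Y ⟶ X where
  toCLM := (op T)†
  map_alpha := T.adjoint_alpha
  adjoint_alpha ξ h := by rw [ContinuousLinearMap.adjoint_adjoint]; exact T.map_alpha ξ h
  map_beta := T.adjoint_beta
  adjoint_beta ξ h := by rw [ContinuousLinearMap.adjoint_adjoint]; exact T.map_beta ξ h

/-- The action of a morphism on the first factorization. -/
def pushA (T : X ⟶ Y) (ξ : X.alpha) : Y.alpha := ⟨op T ∘L ξ.1, T.map_alpha ξ.1 ξ.2⟩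

/-- The action of a morphism on the second factorization. -/
def pushB (T : X ⟶ Y) (ξ : X.beta) : Y.beta := ⟨op T ∘L ξ.1, T.map_beta ξ.1 ξ.2⟩

omit [CompleteSpace 𝔥] in
lemma norm_iterate_comp_le {H H' : Type*} [NormedAddCommGroup H] [InnerProductSpace ℂ H]
    [CompleteSpace H] [NormedAddCommGroup H'] [InnerProductSpace ℂ H'] [CompleteSpace H']
    (T : H →L[ℂ] H') (n : ℕ) (x : 𝔥 →L[ℂ] H) :
    ‖(fun x => T† ∘L (T ∘L x))^[n] x‖ ≤ (‖T‖ ^ 2) ^ n * ‖x‖ := by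
  induction n with
  | zero => simp
  | succ n ih =>
    rw [Function.iterate_succ_apply']
    calc ‖T† ∘L (T ∘L ((fun x => T† ∘L (T ∘L x))^[n] x))‖
        ≤ ‖T†‖ * (‖T‖ * ‖(fun x => T† ∘L (T ∘L x))^[n] x‖) :=
          (ContinuousLinearMap.opNorm_comp_le _ _).trans
            (by gcongr; exact ContinuousLinearMap.opNorm_comp_le _ _)
      _ ≤ ‖T‖ * (‖T‖ * ((‖T‖ ^ 2) ^ n * ‖x‖)) := by
          rw [LinearIsometryEquiv.norm_map]; gcongr
      _ = _ := by ring

/-- The operator `S ⊗ T` is bounded. On index triples its formal adjoint is given by the action of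
`S*` and `T*`, and the powers of `S* S` and `T* T` grow at most exponentially. -/
lemma exists_tensorMap (S : X ⟶ X') (T : Y ⟶ Y') :
    ∃ R : RelTensor X Y →L[ℂ] RelTensor X' Y', ∀ ξ ζ η,
      R (relTmul ξ ζ η) = relTmul (pushA S ξ) ζ (pushB T η) := by
  obtain ⟨R, hR, -⟩ := exists_clm_of_adjoint (isNormForm_inner (RelTensor X Y))
    (isNormForm_inner (RelTensor X' Y')) (total_relTmul X Y)
    (fun p : X'.alpha × 𝔥 × Y'.beta => (relTmul p.1 p.2.1 p.2.2 : RelTensor X' Y'))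
    (fun p => (pushA S p.1, p.2.1, pushB T p.2.2))
    (fun p => (pushA (Hom.adj S) p.1, p.2.1, pushB (Hom.adj T) p.2.2))
    (fun p q => by
      refine (inner_relTmul _ _ _ _ _ _).trans ((inner_relTmul _ _ _ _ _ _).trans ?_).symm
      simp only [pushA, pushB, ContinuousLinearMap.adjoint_comp]
      rfl) (r := ‖op S‖ ^ 2 * ‖op T‖ ^ 2) (by positivity)
    (fun p => ⟨‖p.1‖ * ‖p.2.1‖ * ‖p.2.2‖, fun n => by
      have key : ∀ n : ℕ, (fun p : X.alpha × 𝔥 × Y.beta => (pushA (Hom.adj S) (pushA S p.1), p.2.1,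
          pushB (Hom.adj T) (pushB T p.2.2)))^[n] p =
          ((fun ξ => pushA (Hom.adj S) (pushA S ξ))^[n] p.1, p.2.1,
            (fun η => pushB (Hom.adj T) (pushB T η))^[n] p.2.2) := by
        intro n
        induction n with
        | zero => simp
        | succ n ih =>
          rw [Function.iterate_succ_apply', ih, Function.iterate_succ_apply',
            Function.iterate_succ_apply']
      have h1 : ∀ n : ℕ, ((fun ξ => pushA (Hom.adj S) (pushA S ξ))^[n] p.1).1 =
          (fun x => (op S)† ∘L (op S ∘L x))^[n] p.1.1 := by
        intro n
        induction n with
        | zero => simp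
        | succ n ih => rw [Function.iterate_succ_apply', Function.iterate_succ_apply', ← ih]; rfl
      have h2 : ∀ n : ℕ, ((fun η => pushB (Hom.adj T) (pushB T η))^[n] p.2.2).1 =
          (fun x => (op T)† ∘L (op T ∘L x))^[n] p.2.2.1 := by
        intro n
        induction n with
        | zero => simp
        | succ n ih => rw [Function.iterate_succ_apply', Function.iterate_succ_apply', ← ih]; rfl
      refine (congrArg (fun q : X.alpha × 𝔥 × Y.beta =>
        ‖(relTmul q.1 q.2.1 q.2.2 : RelTensor X Y)‖) (key n)).le.trans ?_
      refine (norm_relTmul_le _ _ _).trans ?_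
      have b1 := norm_iterate_comp_le (op S) n p.1.1
      have b2 := norm_iterate_comp_le (op T) n p.2.2.1
      rw [← h1] at b1
      rw [← h2] at b2
      refine (mul_le_mul (mul_le_mul_of_nonneg_right b1 (norm_nonneg p.2.1)) b2 (norm_nonneg _)
        (by positivity)).trans_eq ?_
      simp only [Submodule.coe_norm]
      ring⟩)
  exact ⟨R, fun ξ ζ η => hR (ξ, ζ, η)⟩

/-- The operator `S ⊗ T` on relative tensor products. -/
def tensorMap (S : X ⟶ X') (T : Y ⟶ Y') : tens X Y →L[ℂ] tens X' Y' :=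
  (exists_tensorMap S T).choose

lemma tensorMap_relTmul (S : X ⟶ X') (T : Y ⟶ Y') (ξ : X.alpha) (ζ : 𝔥) (η : Y.beta) :
    tensorMap S T (relTmul ξ ζ η : RelTensor X Y) =
      (relTmul (pushA S ξ) ζ (pushB T η) : RelTensor X' Y') :=
  (exists_tensorMap S T).choose_spec ξ ζ η

lemma tensorMap_k₁ (S : X ⟶ X') (T : Y ⟶ Y') (ξ : X.alpha) (y : Y) :
    tensorMap S T (k₁ X Y ξ y) = k₁ X' Y' (pushA S ξ) (op T y) := by
  refine congrArg (fun R : Y →L[ℂ] tens X' Y' => R y) (clm_ext_of_total Y.total_beta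
    (S := tensorMap S T ∘L k₁ X Y ξ) (T := k₁ X' Y' (pushA S ξ) ∘L op T) fun p => ?_)
  rw [ContinuousLinearMap.comp_apply, ← relTmul_eq_k₁, tensorMap_relTmul, relTmul_eq_k₁]
  rfl

lemma tensorMap_k₂ (S : X ⟶ X') (T : Y ⟶ Y') (η : Y.beta) (x : X) :
    tensorMap S T (k₂ X Y η x) = k₂ X' Y' (pushB T η) (op S x) := by
  refine congrArg (fun R : X →L[ℂ] tens X' Y' => R x) (clm_ext_of_total X.total_alpha
    (S := tensorMap S T ∘L k₂ X Y η) (T := k₂ X' Y' (pushB T η) ∘L op S) fun p => ?_)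
  rw [ContinuousLinearMap.comp_apply, ← relTmul_eq_k₂, tensorMap_relTmul, relTmul_eq_k₂]
  rfl

lemma adjoint_tensorMap (S : X ⟶ X') (T : Y ⟶ Y') :
    (tensorMap S T)† = tensorMap (Hom.adj S) (Hom.adj T) := by
  refine adjoint_eq_of_total (H := tens X Y) (H' := tens X' Y') (total_relTmul X Y)
    (total_relTmul X' Y') fun p q => ?_
  rw [tensorMap_relTmul, tensorMap_relTmul]
  refine (inner_relTmul _ _ _ _ _ _).trans ((inner_relTmul _ _ _ _ _ _).trans ?_).symm
  simp only [pushA, pushB, ContinuousLinearMap.adjoint_comp]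
  rfl

lemma tensorMap_comp_mem_alpha (S : X ⟶ X') (T : Y ⟶ Y') {ω : 𝔥 →L[ℂ] tens X Y}
    (h : ω ∈ (tens X Y).alpha) : tensorMap S T ∘L ω ∈ (tens X' Y').alpha := by
  rw [tens_alpha] at h
  refine mem_of_mem_closedSpan (ContinuousLinearMap.compL ℂ 𝔥 _ _ (tensorMap S T))
    (tens X' Y').isBimod.alpha_fact.isClosed ?_ h
  rintro _ ⟨ξ, η, hη, rfl⟩
  have : tensorMap S T ∘L (k₁ X Y ξ ∘L η) = (kA (pushA S ξ) (pushA T ⟨η, hη⟩)).1 :=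
    ContinuousLinearMap.ext fun ζ => tensorMap_k₁ S T ξ (η ζ)
  rw [ContinuousLinearMap.compL_apply, this]
  exact (kA (pushA S ξ) (pushA T ⟨η, hη⟩)).2

lemma tensorMap_comp_mem_beta (S : X ⟶ X') (T : Y ⟶ Y') {ω : 𝔥 →L[ℂ] tens X Y}
    (h : ω ∈ (tens X Y).beta) : tensorMap S T ∘L ω ∈ (tens X' Y').beta := by
  rw [tens_beta] at h
  refine mem_of_mem_closedSpan (ContinuousLinearMap.compL ℂ 𝔥 _ _ (tensorMap S T))
    (tens X' Y').isBimod.beta_fact.isClosed ?_ h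
  rintro _ ⟨η, ξ, hξ, rfl⟩
  have : tensorMap S T ∘L (k₂ X Y η ∘L ξ) = (kB (pushB T η) (pushB S ⟨ξ, hξ⟩)).1 :=
    ContinuousLinearMap.ext fun ζ => tensorMap_k₂ S T η (ξ ζ)
  rw [ContinuousLinearMap.compL_apply, this]
  exact (kB (pushB T η) (pushB S ⟨ξ, hξ⟩)).2

/-- The tensor product of morphisms. -/
def tmap (S : X ⟶ X') (T : Y ⟶ Y') : tens X Y ⟶ tens X' Y' where
  toCLM := tensorMap S T
  map_alpha _ h := tensorMap_comp_mem_alpha S T h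
  adjoint_alpha ω h := by
    rw [adjoint_tensorMap]; exact tensorMap_comp_mem_alpha (Hom.adj S) (Hom.adj T) h
  map_beta _ h := tensorMap_comp_mem_beta S T h
  adjoint_beta ω h := by
    rw [adjoint_tensorMap]; exact tensorMap_comp_mem_beta (Hom.adj S) (Hom.adj T) h

lemma tmap_k₁ (S : X ⟶ X') (T : Y ⟶ Y') (ξ : X.alpha) (y : Y) :
    op (tmap S T) (k₁ X Y ξ y) = k₁ X' Y' (pushA S ξ) (op T y) := tensorMap_k₁ S T ξ y

lemma tmap_k₂ (S : X ⟶ X') (T : Y ⟶ Y') (η : Y.beta) (x : X) :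
    op (tmap S T) (k₂ X Y η x) = k₂ X' Y' (pushB T η) (op S x) := tensorMap_k₂ S T η x

lemma op_comp (S : X ⟶ Y) (T : Y ⟶ Z) (x : X) : op (S ≫ T) x = op T (op S x) := rfl

lemma pushB_id (ξ : X.beta) : pushB (𝟙 X) ξ = ξ := rfl

lemma pushA_id (ξ : X.alpha) : pushA (𝟙 X) ξ = ξ := rfl

lemma hom_ext {S T : X ⟶ Y} (h : op S = op T) : S = T := Hom.ext h

lemma hom_ext_of_total {ι : Type*} {v : ι → X}
    (hv : Dense (Submodule.span ℂ (Set.range v) : Set X)) {S T : X ⟶ Y}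
    (h : ∀ i, op S (v i) = op T (v i)) : S = T :=
  hom_ext (clm_ext_of_total hv h)

end TensorHom

/-! ### Unitary isomorphisms -/

section Unitary

variable {X Y Z W : CStarBaseBimod 𝔟}

omit [CompleteSpace 𝔥] in
/-- Operator spaces with generators that correspond under a unitary correspond under it. -/
lemma unitary_comp_mem {H H' : Type*} [NormedAddCommGroup H] [InnerProductSpace ℂ H]
    [NormedAddCommGroup H'] [InnerProductSpace ℂ H'] (U : H ≃ₗᵢ[ℂ] H')
    {S : Set (𝔥 →L[ℂ] H)} {F : Submodule ℂ (𝔥 →L[ℂ] H)} {F' : Submodule ℂ (𝔥 →L[ℂ] H')}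
    (hF : F = closedSpan S) (hF' : F' = closedSpan
      ((fun ω => (U.toContinuousLinearEquiv : H →L[ℂ] H') ∘L ω) '' S)) :
    (∀ ω ∈ F, (U.toContinuousLinearEquiv : H →L[ℂ] H') ∘L ω ∈ F') ∧
      ∀ ω ∈ F', (U.symm.toContinuousLinearEquiv : H' →L[ℂ] H) ∘L ω ∈ F := by
  subst hF hF'
  refine ⟨fun ω hω => ?_, fun ω hω => ?_⟩
  · exact mem_of_mem_closedSpan (ContinuousLinearMap.compL ℂ 𝔥 H H'
      (U.toContinuousLinearEquiv : H →L[ℂ] H')) (isClosed_closedSpan _)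
      (fun x hx => mem_closedSpan (Set.mem_image_of_mem _ hx)) hω
  · refine mem_of_mem_closedSpan (ContinuousLinearMap.compL ℂ 𝔥 H' H
      (U.symm.toContinuousLinearEquiv : H' →L[ℂ] H)) (isClosed_closedSpan _) ?_ hω
    rintro _ ⟨x, hx, rfl⟩
    refine mem_closedSpan ?_
    convert hx
    ext ζ
    exact U.symm_apply_apply _

/-- A unitary that maps generators of the factorizations to generators is an isomorphism. -/
def isoOfUnitary (U : X ≃ₗᵢ[ℂ] Y) {S T : Set (𝔥 →L[ℂ] X)} (hS : X.alpha = closedSpan S)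
    (hS' : Y.alpha = closedSpan ((fun ω => (U.toContinuousLinearEquiv : X →L[ℂ] Y) ∘L ω) '' S))
    (hT : X.beta = closedSpan T)
    (hT' : Y.beta = closedSpan ((fun ω => (U.toContinuousLinearEquiv : X →L[ℂ] Y) ∘L ω) '' T)) :
    X ≅ Y where
  hom :=
    { toCLM := U.toContinuousLinearEquiv
      map_alpha := (unitary_comp_mem U hS hS').1
      adjoint_alpha := by rw [U.adjoint_toCLM]; exact (unitary_comp_mem U hS hS').2
      map_beta := (unitary_comp_mem U hT hT').1
      adjoint_beta := by rw [U.adjoint_toCLM]; exact (unitary_comp_mem U hT hT').2 }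
  inv :=
    { toCLM := U.symm.toContinuousLinearEquiv
      map_alpha := (unitary_comp_mem U hS hS').2
      adjoint_alpha := by
        rw [U.symm.adjoint_toCLM, LinearIsometryEquiv.symm_symm]
        exact (unitary_comp_mem U hS hS').1
      map_beta := (unitary_comp_mem U hT hT').2
      adjoint_beta := by
        rw [U.symm.adjoint_toCLM, LinearIsometryEquiv.symm_symm]
        exact (unitary_comp_mem U hT hT').1 }
  hom_inv_id := Hom.ext (ContinuousLinearMap.ext fun x => U.symm_apply_apply x)
  inv_hom_id := Hom.ext (ContinuousLinearMap.ext fun x => U.apply_symm_apply x)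

variable (X Y Z)

lemma total_k₂_k₁ : Dense (Submodule.span ℂ (Set.range fun p : Z.beta × X.alpha × Y =>
    k₂ (tens X Y) Z p.1 (k₁ X Y p.2.1 p.2.2)) : Set (tens (tens X Y) Z)) :=
  total_comp (k := fun ϑ : Z.beta => k₂ (tens X Y) Z ϑ)
    (v := fun q : X.alpha × Y => k₁ X Y q.1 q.2) (total_k₂ (tens X Y) Z) (total_k₁ X Y)

lemma total_k₁_k₂ : Dense (Submodule.span ℂ (Set.range fun p : Z.beta × X.alpha × Y =>
    k₁ X (tens Y Z) p.2.1 (k₂ Y Z p.1 p.2.2)) : Set (tens X (tens Y Z))) := by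
  convert total_comp (k := fun ξ : X.alpha => k₁ X (tens Y Z) ξ)
    (v := fun q : Z.beta × Y => k₂ Y Z q.1 q.2) (total_k₁ X (tens Y Z)) (total_k₂ Y Z) using 3
  ext x
  constructor
  · rintro ⟨p, rfl⟩
    exact ⟨(p.2.1, p.1, p.2.2), rfl⟩
  · rintro ⟨p, rfl⟩
    exact ⟨(p.2.1, p.1, p.2.2), rfl⟩

/-- Both families have the Gram matrix `⟨y, ρ_δ(ξ* ξ') ρ_γ(ϑ* ϑ') y'⟩`, up to the order of the two
commuting factors. -/
lemma exists_assoc : ∃ U : tens (tens X Y) Z ≃ₗᵢ[ℂ] tens X (tens Y Z),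
    ∀ p : Z.beta × X.alpha × Y, U (k₂ (tens X Y) Z p.1 (k₁ X Y p.2.1 p.2.2)) =
      k₁ X (tens Y Z) p.2.1 (k₂ Y Z p.1 p.2.2) := by
  obtain ⟨U, hU, -⟩ := exists_linearIsometryEquiv_of_gram (isNormForm_inner (tens (tens X Y) Z))
    (isNormForm_inner (tens X (tens Y Z))) (total_k₂_k₁ X Y Z) (total_k₁_k₂ X Y Z) fun p q => by
      simp only [innerₛₗ_apply_apply]
      rw [inner_k₂, inner_k₁, rhoA_k₁, inner_k₁, rhoB_k₂, inner_k₂, rhoA_comp_rhoB]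
  exact ⟨U, hU⟩

/-- The unitary underlying the associator. -/
def assocU : tens (tens X Y) Z ≃ₗᵢ[ℂ] tens X (tens Y Z) := (exists_assoc X Y Z).choose

variable {X Y Z}

lemma assocU_k₂_k₁ (ϑ : Z.beta) (ξ : X.alpha) (y : Y) :
    assocU X Y Z (k₂ (tens X Y) Z ϑ (k₁ X Y ξ y)) = k₁ X (tens Y Z) ξ (k₂ Y Z ϑ y) :=
  (exists_assoc X Y Z).choose_spec (ϑ, ξ, y)

lemma assocU_k₂_k₂ (ϑ : Z.beta) (η : Y.beta) (x : X) :
    assocU X Y Z (k₂ (tens X Y) Z ϑ (k₂ X Y η x)) = k₂ X (tens Y Z) (kB ϑ η) x := by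
  refine congrArg (fun R : X →L[ℂ] tens X (tens Y Z) => R x) (clm_ext_of_total X.total_alpha
    (S := ((assocU X Y Z).toContinuousLinearEquiv : tens (tens X Y) Z →L[ℂ] tens X (tens Y Z)) ∘L
      k₂ (tens X Y) Z ϑ ∘L k₂ X Y η) (T := k₂ X (tens Y Z) (kB ϑ η)) fun p => ?_)
  change assocU X Y Z (k₂ (tens X Y) Z ϑ (k₂ X Y η (p.1.1 p.2))) = _
  rw [← k₁_apply_beta, assocU_k₂_k₁, ← k₁_apply_beta]
  rfl

lemma assocU_k₁_kA (ξ : X.alpha) (η : Y.alpha) (z : Z) :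
    assocU X Y Z (k₁ (tens X Y) Z (kA ξ η) z) = k₁ X (tens Y Z) ξ (k₁ Y Z η z) := by
  refine congrArg (fun R : Z →L[ℂ] tens X (tens Y Z) => R z) (clm_ext_of_total Z.total_beta
    (S := ((assocU X Y Z).toContinuousLinearEquiv : tens (tens X Y) Z →L[ℂ] tens X (tens Y Z)) ∘L
      k₁ (tens X Y) Z (kA ξ η)) (T := k₁ X (tens Y Z) ξ ∘L k₁ Y Z η) fun p => ?_)
  change assocU X Y Z (k₁ (tens X Y) Z (kA ξ η) (p.1.1 p.2)) = k₁ X _ ξ (k₁ Y Z η (p.1.1 p.2))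
  rw [k₁_apply_beta, k₁_apply_beta]
  exact assocU_k₂_k₁ p.1 ξ (η.1 p.2)

variable (X Y Z)

/-- Generators of the first factorization of a threefold tensor product. -/
lemma tens_tens_alpha : (tens (tens X Y) Z).alpha = closedSpan {ω : 𝔥 →L[ℂ] tens (tens X Y) Z |
    ∃ (ξ : X.alpha) (η : Y.alpha) (κ : Z.alpha), ω = k₁ (tens X Y) Z (kA ξ η) ∘L κ.1} := by
  rw [tens_alpha]
  refine le_antisymm (closedSpan_le_closedSpan ?_) (closedSpan_mono ?_)
  · rintro _ ⟨ω, κ, hκ, rfl⟩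
    refine mem_of_subtype_closedSpan
      (((ContinuousLinearMap.compL ℂ 𝔥 Z (tens (tens X Y) Z)).flip κ) ∘L k₁ (tens X Y) Z)
      (S := {ω : 𝔥 →L[ℂ] tens X Y | ∃ ξ : X.alpha, ∃ η ∈ Y.alpha, ω = k₁ X Y ξ ∘L η})
      (fun ω hω => by rwa [tens_alpha] at hω) (isClosed_closedSpan _) ?_ ω
    rintro _ ⟨ξ, η, hη, rfl⟩
    exact ⟨(kA ξ ⟨η, hη⟩).2, mem_closedSpan ⟨ξ, ⟨η, hη⟩, ⟨κ, hκ⟩, rfl⟩⟩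
  · rintro _ ⟨ξ, η, κ, rfl⟩
    exact ⟨kA ξ η, κ.1, κ.2, rfl⟩

lemma tens_tens_alpha' : (tens X (tens Y Z)).alpha = closedSpan {ω : 𝔥 →L[ℂ] tens X (tens Y Z) |
    ∃ (ξ : X.alpha) (η : Y.alpha) (κ : Z.alpha),
      ω = k₁ X (tens Y Z) ξ ∘L (k₁ Y Z η ∘L κ.1)} := by
  rw [tens_alpha]
  refine le_antisymm (closedSpan_le_closedSpan ?_) (closedSpan_mono ?_)
  · rintro _ ⟨ξ, ω, hω, rfl⟩
    rw [tens_alpha] at hω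
    refine mem_of_mem_closedSpan (ContinuousLinearMap.compL ℂ 𝔥 _ _ (k₁ X (tens Y Z) ξ))
      (isClosed_closedSpan _) ?_ hω
    rintro _ ⟨η, κ, hκ, rfl⟩
    exact mem_closedSpan ⟨ξ, η, ⟨κ, hκ⟩, rfl⟩
  · rintro _ ⟨ξ, η, κ, rfl⟩
    exact ⟨ξ, _, (kA η κ).2, rfl⟩

lemma tens_tens_beta : (tens (tens X Y) Z).beta = closedSpan {ω : 𝔥 →L[ℂ] tens (tens X Y) Z |
    ∃ (ϑ : Z.beta) (η : Y.beta) (ξ : X.beta),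
      ω = k₂ (tens X Y) Z ϑ ∘L (k₂ X Y η ∘L ξ.1)} := by
  rw [tens_beta]
  refine le_antisymm (closedSpan_le_closedSpan ?_) (closedSpan_mono ?_)
  · rintro _ ⟨ϑ, ω, hω, rfl⟩
    rw [tens_beta] at hω
    refine mem_of_mem_closedSpan (ContinuousLinearMap.compL ℂ 𝔥 _ _ (k₂ (tens X Y) Z ϑ))
      (isClosed_closedSpan _) ?_ hω
    rintro _ ⟨η, ξ, hξ, rfl⟩
    exact mem_closedSpan ⟨ϑ, η, ⟨ξ, hξ⟩, rfl⟩
  · rintro _ ⟨ϑ, η, ξ, rfl⟩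
    exact ⟨ϑ, _, (kB η ξ).2, rfl⟩

lemma tens_tens_beta' : (tens X (tens Y Z)).beta = closedSpan {ω : 𝔥 →L[ℂ] tens X (tens Y Z) |
    ∃ (ϑ : Z.beta) (η : Y.beta) (ξ : X.beta), ω = k₂ X (tens Y Z) (kB ϑ η) ∘L ξ.1} := by
  rw [tens_beta]
  refine le_antisymm (closedSpan_le_closedSpan ?_) (closedSpan_mono ?_)
  · rintro _ ⟨ω, ξ, hξ, rfl⟩
    refine mem_of_subtype_closedSpan
      (((ContinuousLinearMap.compL ℂ 𝔥 X (tens X (tens Y Z))).flip ξ) ∘L k₂ X (tens Y Z))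
      (S := {ω : 𝔥 →L[ℂ] tens Y Z | ∃ ϑ : Z.beta, ∃ η ∈ Y.beta, ω = k₂ Y Z ϑ ∘L η})
      (fun ω hω => by rwa [tens_beta] at hω) (isClosed_closedSpan _) ?_ ω
    rintro _ ⟨ϑ, η, hη, rfl⟩
    exact ⟨(kB ϑ ⟨η, hη⟩).2, mem_closedSpan ⟨ϑ, ⟨η, hη⟩, ⟨ξ, hξ⟩, rfl⟩⟩
  · rintro _ ⟨ϑ, η, ξ, rfl⟩
    exact ⟨kB ϑ η, ξ.1, ξ.2, rfl⟩

/-- The associator `a`, which satisfies `a |ϑ⟩₂ |ξ⟩₁ = |ξ⟩₁ |ϑ⟩₂`. -/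
def assocIso : tens (tens X Y) Z ≅ tens X (tens Y Z) :=
  isoOfUnitary (assocU X Y Z) (tens_tens_alpha X Y Z)
    (by
      rw [tens_tens_alpha']
      congr 2
      ext ω
      constructor
      · rintro ⟨ξ, η, κ, rfl⟩
        exact ⟨_, ⟨ξ, η, κ, rfl⟩, ContinuousLinearMap.ext fun ζ => assocU_k₁_kA ξ η (κ.1 ζ)⟩
      · rintro ⟨_, ⟨ξ, η, κ, rfl⟩, rfl⟩
        exact ⟨ξ, η, κ, ContinuousLinearMap.ext fun ζ => assocU_k₁_kA ξ η (κ.1 ζ)⟩)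
    (tens_tens_beta X Y Z)
    (by
      rw [tens_tens_beta']
      congr 2
      ext ω
      constructor
      · rintro ⟨ϑ, η, ξ, rfl⟩
        exact ⟨_, ⟨ϑ, η, ξ, rfl⟩, ContinuousLinearMap.ext fun ζ => assocU_k₂_k₂ ϑ η (ξ.1 ζ)⟩
      · rintro ⟨_, ⟨ϑ, η, ξ, rfl⟩, rfl⟩
        exact ⟨ϑ, η, ξ, ContinuousLinearMap.ext fun ζ => assocU_k₂_k₂ ϑ η (ξ.1 ζ)⟩)

variable {X Y Z}

lemma assoc_k₂_k₁ (ϑ : Z.beta) (ξ : X.alpha) (y : Y) :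
    op (assocIso X Y Z).hom (k₂ (tens X Y) Z ϑ (k₁ X Y ξ y)) = k₁ X (tens Y Z) ξ (k₂ Y Z ϑ y) :=
  assocU_k₂_k₁ ϑ ξ y

lemma assoc_k₂_k₂ (ϑ : Z.beta) (η : Y.beta) (x : X) :
    op (assocIso X Y Z).hom (k₂ (tens X Y) Z ϑ (k₂ X Y η x)) = k₂ X (tens Y Z) (kB ϑ η) x :=
  assocU_k₂_k₂ ϑ η x

/-! ### Unit isomorphisms -/

variable (X)

lemma uni_rhoA (b : 𝔟.alg') : (uni 𝔟).rhoA b = b.1 :=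
  IsRho.unique (uni 𝔟).isBimod.alpha_fact (isRho_rho 𝔟.isBase (uni 𝔟).isBimod.alpha_fact b)
    fun ξ hξ ζ => congrArg (fun T : 𝔥 →L[ℂ] 𝔥 => T ζ) (𝔟.isBase.commute ξ hξ b b.2).symm

lemma uni_rhoB (b : 𝔟.alg) : (uni 𝔟).rhoB b = b.1 :=
  IsRho.unique (uni 𝔟).isBimod.beta_fact (isRho_rho 𝔟.isBase.symm (uni 𝔟).isBimod.beta_fact b)
    fun ξ hξ ζ => congrArg (fun T : 𝔥 →L[ℂ] 𝔥 => T ζ) (𝔟.isBase.commute b b.2 ξ hξ)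

lemma exists_leftU : ∃ U : tens (uni 𝔟) X ≃ₗᵢ[ℂ] X,
    ∀ p : X.beta × 𝔥, U (k₂ (uni 𝔟) X p.1 p.2) = p.1.1 p.2 := by
  obtain ⟨U, hU, -⟩ := exists_linearIsometryEquiv_of_gram (isNormForm_inner (tens (uni 𝔟) X))
    (isNormForm_inner X) (total_k₂ (uni 𝔟) X) X.total_beta fun p q => by
      simp only [innerₛₗ_apply_apply]
      rw [inner_k₂, uni_rhoA, ← ContinuousLinearMap.adjoint_inner_right]
      rfl
  exact ⟨U, hU⟩

lemma exists_rightU : ∃ U : tens X (uni 𝔟) ≃ₗᵢ[ℂ] X,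
    ∀ p : X.alpha × 𝔥, U (k₁ X (uni 𝔟) p.1 p.2) = p.1.1 p.2 := by
  obtain ⟨U, hU, -⟩ := exists_linearIsometryEquiv_of_gram (isNormForm_inner (tens X (uni 𝔟)))
    (isNormForm_inner X) (total_k₁ X (uni 𝔟)) X.total_alpha fun p q => by
      simp only [innerₛₗ_apply_apply]
      rw [inner_k₁, uni_rhoB, ← ContinuousLinearMap.adjoint_inner_right]
      rfl
  exact ⟨U, hU⟩

/-- The unitary underlying the left unit isomorphism. -/
def leftU : tens (uni 𝔟) X ≃ₗᵢ[ℂ] X := (exists_leftU X).choose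

/-- The unitary underlying the right unit isomorphism. -/
def rightU : tens X (uni 𝔟) ≃ₗᵢ[ℂ] X := (exists_rightU X).choose

lemma leftU_k₂ (ξ : X.beta) (ζ : uni 𝔟) : leftU X (k₂ (uni 𝔟) X ξ ζ) = ξ.1 ζ :=
  (exists_leftU X).choose_spec (ξ, ζ)

lemma rightU_k₁ (ξ : X.alpha) (ζ : uni 𝔟) : rightU X (k₁ X (uni 𝔟) ξ ζ) = ξ.1 ζ :=
  (exists_rightU X).choose_spec (ξ, ζ)

lemma leftU_k₁ (b : (uni 𝔟).alpha) (x : X) : leftU X (k₁ (uni 𝔟) X b x) = X.rhoB b x := by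
  refine congrArg (fun R : X →L[ℂ] X => R x) (clm_ext_of_total X.total_beta
    (S := ((leftU X).toContinuousLinearEquiv : tens (uni 𝔟) X →L[ℂ] X) ∘L
      k₁ (uni 𝔟) X b) (T := X.rhoB b) fun p => ?_)
  change leftU X (k₁ (uni 𝔟) X b (p.1.1 p.2)) = _
  rw [k₁_apply_beta, leftU_k₂]
  exact (rhoB_apply X b p.1 p.2).symm

lemma rightU_k₂ (b : (uni 𝔟).beta) (x : X) : rightU X (k₂ X (uni 𝔟) b x) = X.rhoA b x := by
  refine congrArg (fun R : X →L[ℂ] X => R x) (clm_ext_of_total X.total_alpha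
    (S := ((rightU X).toContinuousLinearEquiv : tens X (uni 𝔟) →L[ℂ] X) ∘L
      k₂ X (uni 𝔟) b) (T := X.rhoA b) fun p => ?_)
  change rightU X (k₂ X (uni 𝔟) b (p.1.1 p.2)) = _
  refine (congrArg (rightU X) (k₁_apply_beta X (uni 𝔟) p.1 b p.2)).symm.trans ?_
  exact (rightU_k₁ X p.1 _).trans (rhoA_apply X b p.1 p.2).symm

/-- The left unit isomorphism. -/
def leftIso : tens (uni 𝔟) X ≅ X :=
  isoOfUnitary (leftU X) (tens_alpha (uni 𝔟) X)
    (by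
      conv_lhs => rw [← closedSpan_rhoB]
      congr 2
      ext ω
      constructor
      · rintro ⟨b, η, hη, rfl⟩
        exact ⟨_, ⟨b, η, hη, rfl⟩, ContinuousLinearMap.ext fun ζ => leftU_k₁ X b (η ζ)⟩
      · rintro ⟨_, ⟨b, η, hη, rfl⟩, rfl⟩
        exact ⟨b, η, hη, ContinuousLinearMap.ext fun ζ => leftU_k₁ X b (η ζ)⟩)
    (tens_beta (uni 𝔟) X)
    (by
      conv_lhs => rw [← X.isBimod.beta_fact.mul_alg]
      congr 2
      ext ω
      constructor
      · rintro ⟨η, hη, b, hb, rfl⟩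
        exact ⟨_, ⟨⟨η, hη⟩, b, hb, rfl⟩, ContinuousLinearMap.ext fun ζ => leftU_k₂ X ⟨η, hη⟩ (b ζ)⟩
      · rintro ⟨_, ⟨η, b, hb, rfl⟩, rfl⟩
        exact ⟨η.1, η.2, b, hb, ContinuousLinearMap.ext fun ζ => leftU_k₂ X η (b ζ)⟩)

/-- The right unit isomorphism. -/
def rightIso : tens X (uni 𝔟) ≅ X :=
  isoOfUnitary (rightU X) (tens_alpha X (uni 𝔟))
    (by
      conv_lhs => rw [← X.isBimod.alpha_fact.mul_alg]
      congr 2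
      ext ω
      constructor
      · rintro ⟨η, hη, b, hb, rfl⟩
        exact ⟨_, ⟨⟨η, hη⟩, b, hb, rfl⟩, ContinuousLinearMap.ext fun ζ => rightU_k₁ X ⟨η, hη⟩ (b ζ)⟩
      · rintro ⟨_, ⟨η, b, hb, rfl⟩, rfl⟩
        exact ⟨η.1, η.2, b, hb, ContinuousLinearMap.ext fun ζ => rightU_k₁ X η (b ζ)⟩)
    (tens_beta X (uni 𝔟))
    (by
      conv_lhs => rw [← closedSpan_rhoA]
      congr 2
      ext ω
      constructor
      · rintro ⟨b, η, hη, rfl⟩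
        exact ⟨_, ⟨b, η, hη, rfl⟩, ContinuousLinearMap.ext fun ζ => rightU_k₂ X b (η ζ)⟩
      · rintro ⟨_, ⟨b, η, hη, rfl⟩, rfl⟩
        exact ⟨b, η, hη, ContinuousLinearMap.ext fun ζ => rightU_k₂ X b (η ζ)⟩)

variable {X}

lemma left_k₂ (ξ : X.beta) (ζ : uni 𝔟) : op (leftIso X).hom (k₂ (uni 𝔟) X ξ ζ) = ξ.1 ζ :=
  leftU_k₂ X ξ ζ

lemma right_k₁ (ξ : X.alpha) (ζ : uni 𝔟) : op (rightIso X).hom (k₁ X (uni 𝔟) ξ ζ) = ξ.1 ζ :=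
  rightU_k₁ X ξ ζ

lemma left_k₁ (b : (uni 𝔟).alpha) (x : X) : op (leftIso X).hom (k₁ (uni 𝔟) X b x) = X.rhoB b x :=
  leftU_k₁ X b x

end Unitary

/-! ### Coherence -/

/-- The monoidal structure given by the relative tensor product. -/
def relMonoidalData (𝔟 : CStarBase 𝔥) : MonoidalData (CStarBaseBimod 𝔟) tens (uni 𝔟) where
  tensorHom := tmap
  associator := assocIso
  leftUnitor := leftIso
  rightUnitor := rightIso
  id_tensorHom_id X Y := hom_ext_of_total (total_k₁ X Y) fun p => by
    rw [tmap_k₁]; rfl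
  tensorHom_comp_tensorHom {X₁ Y₁ Z₁ X₂ Y₂ Z₂} f₁ f₂ g₁ g₂ :=
    hom_ext_of_total (total_k₁ X₁ X₂) fun p => by
      rw [op_comp, tmap_k₁, tmap_k₁, tmap_k₁]; rfl
  associator_naturality {X₁ X₂ X₃ Y₁ Y₂ Y₃} f₁ f₂ f₃ :=
    hom_ext_of_total (total_k₂_k₁ X₁ X₂ X₃) fun p => by
      rw [op_comp, op_comp, tmap_k₂, tmap_k₁, assoc_k₂_k₁, assoc_k₂_k₁, tmap_k₁, tmap_k₂]
  leftUnitor_naturality {X Y} f := hom_ext_of_total (total_k₂ (uni 𝔟) X) fun p => by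
    rw [op_comp, op_comp, tmap_k₂, left_k₂, left_k₂]; rfl
  rightUnitor_naturality {X Y} f := hom_ext_of_total (total_k₁ X (uni 𝔟)) fun p => by
    rw [op_comp, op_comp, tmap_k₁, right_k₁, right_k₁]; rfl
  pentagon W X Y Z :=
    hom_ext_of_total (total_comp (k := fun ϑ : Z.beta => k₂ (tens (tens W X) Y) Z ϑ)
      (v := fun q : Y.beta × W.alpha × X => k₂ (tens W X) Y q.1 (k₁ W X q.2.1 q.2.2))
      (total_k₂ (tens (tens W X) Y) Z) (total_k₂_k₁ W X Y)) fun p => by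
      simp only [op_comp]
      rw [tmap_k₂, assoc_k₂_k₁, assoc_k₂_k₁, tmap_k₁, pushB_id, pushA_id, assoc_k₂_k₂,
        assoc_k₂_k₂, assoc_k₂_k₁]
  triangle X Y := hom_ext_of_total (total_k₂_k₁ X (uni 𝔟) Y) fun p => by
    rw [op_comp, assoc_k₂_k₁, tmap_k₁, left_k₂, tmap_k₂, right_k₁, pushA_id]
    exact k₁_apply_beta X Y p.2.1 p.1 p.2.2

lemma isRelStructure_relMonoidalData (𝔟 : CStarBase 𝔥) :
    IsRelStructure (relWellDefined 𝔟) (relMonoidalData 𝔟) where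
  tensorHom S T ξ ζ η := tensorMap_relTmul S T ξ ζ η
  associator ξ ϑ ξ₁ ϑ₂ ϑ₂' ξ₁' h₁ h₂ h₃ h₄ ω := by
    rw [isKet₁_iff.1 h₁, isKet₂_iff.1 h₂, isKet₂_iff.1 h₃, isKet₁_iff.1 h₄]
    exact assoc_k₂_k₁ ϑ ξ ω
  leftUnitor {X} b ζ ξ :=
    (congrArg (op (leftIso X).hom) (relTmul_eq_k₂ (X := uni 𝔟) b ζ ξ)).trans (left_k₂ ξ _)
  rightUnitor {X} η ζ b :=
    (congrArg (op (rightIso X).hom) (relTmul_eq_k₁ (Y := uni 𝔟) η ζ b)).trans (right_k₁ η _)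

end CStarBaseBimod

namespace CStarBimod

variable {B : Type u} [NonUnitalCStarAlgebra B] [PartialOrder B] [StarOrderedRing B]

/-! ### Elementary properties of right C*-bimodules -/

section Basic

variable (E F : CStarBimod B)

/-- The action `(b, ξ) ↦ b ξ` as a continuous bilinear map. -/
def lmulL : B →L[ℂ] E →L[ℂ] E :=
  LinearMap.mkContinuous₂ E.lmul 1 fun b ξ => by simpa using E.norm_lmul_le b ξ

/-- The action `(b, ξ) ↦ ξ b` as a continuous bilinear map. -/
def rmulL : B →L[ℂ] E →L[ℂ] E :=
  LinearMap.mkContinuous₂ E.rmul 1 fun b ξ => by simpa using E.norm_rmul_le b ξ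

/-- The inner product as a continuous sesquilinear map. -/
def innerL : E →L⋆[ℂ] E →L[ℂ] B :=
  LinearMap.mkContinuous₂ E.inner 1 fun ξ η => by simpa using E.norm_inner_le ξ η

lemma innerL_apply (ξ η : E) : E.innerL ξ η = E.inner ξ η := rfl

lemma continuous_inner_left (η : E) : Continuous fun ξ => E.inner ξ η :=
  (continuous_of_isNormForm E.isNormForm).comp (Continuous.prodMk_left η)

variable {E F}

lemma inner_rmul_left (b : B) (ξ η : E) : E.inner (E.rmul b ξ) η = star b * E.inner ξ η :=
  E.isPreInner.left_mul ξ η b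

lemma inner_lmul_right (b : B) (ξ η : E) :
    E.inner ξ (E.lmul b η) = E.inner (E.lmul (star b) ξ) η := by
  rw [E.inner_lmul, star_star]

/-- Vectors are determined by their inner products with a total set. -/
lemma ext_inner_of_total {ι : Type*} {v : ι → E}
    (hv : Dense (Submodule.span ℂ (Set.range v) : Set E)) {x y : E}
    (h : ∀ i, E.inner (v i) x = E.inner (v i) y) : x = y := by
  have h1 : ∀ z, E.inner z x = E.inner z y := fun z =>
    closedSpan_induction (p := fun z => E.inner z x = E.inner z y)
      (by rintro _ ⟨i, rfl⟩; exact h i) (by simp)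
      (fun x y hx hy => by simp only [map_add, LinearMap.add_apply, hx, hy])
      (fun c x hx => by simp only [map_smulₛₗ, LinearMap.smul_apply, hx])
      (isClosed_eq (E.continuous_inner_left x) (E.continuous_inner_left y)) (hv z)
  have h2 : ‖x - y‖ ^ 2 = 0 := by rw [E.norm_sq, map_sub, h1, sub_self, norm_zero]
  exact sub_eq_zero.1 (norm_eq_zero.1 (pow_eq_zero_iff two_ne_zero |>.1 h2))

lemma dense_span_range_id : Dense (Submodule.span ℂ (Set.range fun x : E => x) : Set E) :=
  dense_of_forall_mem fun x => mem_closedSpan ⟨x, rfl⟩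

lemma ext_inner {x y : E} (h : ∀ z, E.inner z x = E.inner z y) : x = y :=
  ext_inner_of_total dense_span_range_id h

lemma lmul_rmul (b c : B) (ξ : E) : E.lmul b (E.rmul c ξ) = E.rmul c (E.lmul b ξ) :=
  ext_inner fun z => by
    rw [inner_lmul_right, E.inner_rmul, E.inner_rmul, inner_lmul_right]

lemma total_lmul :
    Dense (Submodule.span ℂ (Set.range fun p : B × E => E.lmul p.1 p.2) : Set E) := by
  convert E.lmul_dense using 4
  ext x
  exact ⟨fun ⟨p, hp⟩ => ⟨p.1, p.2, hp.symm⟩, fun ⟨b, ξ, h⟩ => ⟨(b, ξ), h.symm⟩⟩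

/-- A filter that is an approximate unit for all of `B` acts as one from the right. -/
lemma tendsto_rmul {l : Filter B} {J : Set B} (hl : IsApproxUnitOf l J) {ξ : E}
    (hξ : E.inner ξ ξ ∈ J) : Tendsto (fun u => E.rmul u ξ) l (𝓝 ξ) := by
  refine hl.tendsto_of_norm_sq hξ _ _ fun u => le_of_eq ?_
  rw [E.norm_sq]
  congr 1
  simp only [map_sub, LinearMap.sub_apply, E.inner_rmul, inner_rmul_left, mul_assoc]
  abel

lemma exists_isApproxUnitOf_univ (B : Type u) [NonUnitalCStarAlgebra B] :
    ∃ l : Filter B, IsApproxUnitOf l (Set.univ : Set B) := by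
  simpa using exists_isApproxUnitOf (⊤ : NonUnitalStarSubalgebra ℂ B) (by simp)

lemma total_rmul :
    Dense (Submodule.span ℂ (Set.range fun p : E × B => E.rmul p.2 p.1) : Set E) := by
  obtain ⟨l, hl⟩ := exists_isApproxUnitOf_univ B
  have := hl.neBot
  refine dense_of_forall_mem fun x => (isClosed_closedSpan _).mem_of_tendsto
    (tendsto_rmul hl (Set.mem_univ (E.inner x x))) (Eventually.of_forall fun u => ?_)
  exact mem_closedSpan ⟨(x, u), rfl⟩

lemma op_rmul (T : E ⟶ F) (b : B) (ξ : E) : op T (E.rmul b ξ) = F.rmul b (op T ξ) := by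
  obtain ⟨S, hS⟩ := T.adjointable
  refine ext_inner fun z => ?_
  have h : ∀ x, F.inner z (op T x) = E.inner (S z) x := fun x => by
    rw [← F.star_inner, ← E.star_inner]; exact congrArg star (hS x z)
  rw [h, F.inner_rmul, h, E.inner_rmul]

lemma op_lmul (T : E ⟶ F) (b : B) (ξ : E) : op T (E.lmul b ξ) = F.lmul b (op T ξ) :=
  T.map_lmul b ξ

/-- The adjoint of a morphism. -/
def Hom.adj (T : E ⟶ F) : F ⟶ E where
  toCLM := T.adjointable.choose
  adjointable := ⟨T.toCLM, fun ξ η => by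
    rw [← E.star_inner, ← T.adjointable.choose_spec, F.star_inner]⟩
  map_lmul b ξ := ext_inner fun z => by
    rw [← T.adjointable.choose_spec, inner_lmul_right, inner_lmul_right,
      ← T.adjointable.choose_spec, T.map_lmul]

lemma inner_op (T : E ⟶ F) (ξ : E) (η : F) :
    F.inner (op T ξ) η = E.inner ξ (op (Hom.adj T) η) :=
  T.adjointable.choose_spec ξ η

lemma op_comp {G : CStarBimod B} (S : E ⟶ F) (T : F ⟶ G) (x : E) :
    op (S ≫ T) x = op T (op S x) := rfl

lemma op_id (x : E) : op (𝟙 E) x = x := rfl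

lemma hom_ext_of_total {ι : Type*} {v : ι → E}
    (hv : Dense (Submodule.span ℂ (Set.range v) : Set E)) {S T : E ⟶ F}
    (h : ∀ i, op S (v i) = op T (v i)) : S = T :=
  Hom.ext' (clm_ext_of_total hv h)

/-- A surjective isometry that preserves inner products and left multiplication is an
isomorphism. -/
def isoOfUnitary (U : E ≃ₗᵢ[ℂ] F) (hU : ∀ x y, F.inner (U x) (U y) = E.inner x y)
    (hl : ∀ b x, U (E.lmul b x) = F.lmul b (U x)) : E ≅ F where
  hom :=
    { toCLM := U.toContinuousLinearEquiv
      adjointable := ⟨U.symm.toContinuousLinearEquiv, fun ξ η => by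
        conv_lhs => rw [← U.apply_symm_apply η]
        exact hU _ _⟩
      map_lmul := hl }
  inv :=
    { toCLM := U.symm.toContinuousLinearEquiv
      adjointable := ⟨U.toContinuousLinearEquiv, fun ξ η => by
        conv_rhs => rw [← U.apply_symm_apply ξ]
        exact (hU _ _).symm⟩
      map_lmul := fun b ξ => by
        refine U.injective ?_
        change U (U.symm _) = U (E.lmul b (U.symm ξ))
        rw [hl, U.apply_symm_apply, U.apply_symm_apply] }
  hom_inv_id := Hom.ext' (ContinuousLinearMap.ext fun x => U.symm_apply_apply x)
  inv_hom_id := Hom.ext' (ContinuousLinearMap.ext fun x => U.apply_symm_apply x)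

end Basic

/-! ### The internal tensor product -/

section Tensor

variable (E F G : CStarBimod B)

/-- The map `(ξ, η) ↦ ξ ⊗ η` as a continuous bilinear map. -/
def tmulL : E →L[ℂ] F →L[ℂ] itp E F :=
  LinearMap.mkContinuous₂ (LinearMap.mk₂ ℂ (fun ξ η => (tmul ξ η : itp E F))
    (fun ξ ξ' η => (congrArg _ (TensorProduct.add_tmul ξ ξ' η)).trans
      (map_add (SepCompl.of (isPreInner_itp E F)) _ _))
    (fun c ξ η => (congrArg _ (TensorProduct.smul_tmul' c ξ η).symm).trans
      (map_smul (SepCompl.of (isPreInner_itp E F)) _ _))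
    (fun ξ η η' => (congrArg _ (TensorProduct.tmul_add ξ η η')).trans
      (map_add (SepCompl.of (isPreInner_itp E F)) _ _))
    (fun c ξ η => (congrArg _ (TensorProduct.tmul_smul c ξ η)).trans
      (map_smul (SepCompl.of (isPreInner_itp E F)) _ _))) 1
    fun ξ η => by rw [one_mul]; exact norm_itpTmul_le E F ξ η

variable {E F G}

lemma inner_tmul (ξ ξ' : E) (η η' : F) : (itp E F).inner (tmul ξ η) (tmul ξ' η') =
    F.inner η (F.lmul (E.inner ξ ξ') η') :=
  (SepCompl.form_of (isPreInner_itp E F) _ _).trans (itpForm_tmul E F ξ ξ' η η')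

lemma lmul_tmul (b : B) (ξ : E) (η : F) :
    (itp E F).lmul b (tmul ξ η) = tmul (E.lmul b ξ) η :=
  (itpLmul_of E F b (ξ ⊗ₜ η)).trans rfl

lemma rmul_tmul (b : B) (ξ : E) (η : F) :
    (itp E F).rmul b (tmul ξ η) = tmul ξ (F.rmul b η) :=
  (itpRmul_of E F b (ξ ⊗ₜ η)).trans rfl

variable (E F) in
lemma total_tmul : Dense (Submodule.span ℂ (Set.range fun p : E × F => (tmul p.1 p.2 : itp E F)) :
    Set (itp E F)) := by
  refine dense_of_forall_mem fun x => SepCompl.induction_span (isPreInner_itp E F)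
    (closedSpan (Set.range fun p : E × F => (tmul p.1 p.2 : itp E F)))
    (isClosed_closedSpan _) (fun ξ η => ?_) x
  exact mem_closedSpan (V := itp E F) ⟨(ξ, η), rfl⟩

/-- Elementary tensors of elements of total families are total. -/
lemma total_tmul_of {ι κ : Type*} {v : ι → E} {w : κ → F}
    (hv : Dense (Submodule.span ℂ (Set.range v) : Set E))
    (hw : Dense (Submodule.span ℂ (Set.range w) : Set F)) :
    Dense (Submodule.span ℂ (Set.range fun p : ι × κ => (tmul (v p.1) (w p.2) : itp E F)) :
      Set (itp E F)) := by
  refine dense_of_forall_mem fun x => closedSpan_le_closedSpan ?_ (total_tmul E F x)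
  rintro _ ⟨p, rfl⟩
  refine mem_of_mem_closedSpan (tmulL E F p.1) (isClosed_closedSpan _) ?_ (hw p.2)
  rintro _ ⟨j, rfl⟩
  refine mem_of_mem_closedSpan ((tmulL E F).flip (w j)) (isClosed_closedSpan _) ?_ (hv p.1)
  rintro _ ⟨i, rfl⟩
  exact mem_closedSpan ⟨(i, j), rfl⟩

lemma norm_tmul_le (ξ : E) (η : F) : ‖(tmul ξ η : itp E F)‖ ≤ ‖ξ‖ * ‖η‖ :=
  norm_itpTmul_le E F ξ η

/-- The internal tensor product is balanced. -/
lemma tmul_rmul (b : B) (ξ : E) (η : F) :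
    (tmul (E.rmul b ξ) η : itp E F) = tmul ξ (F.lmul b η) :=
  ext_inner_of_total (total_tmul E F) fun p => by
    rw [inner_tmul, inner_tmul, E.inner_rmul, F.lmul_mul]

section TensorHom

variable {E' F' : CStarBimod B}

lemma norm_iterate_adj_comp_le (T : E ⟶ F) (n : ℕ) (x : E) :
    ‖(fun x => op (Hom.adj T) (op T x))^[n] x‖ ≤ (‖op (Hom.adj T)‖ * ‖op T‖) ^ n * ‖x‖ := by
  induction n with
  | zero => simp
  | succ n ih =>
    rw [Function.iterate_succ_apply']
    calc _ ≤ ‖op (Hom.adj T)‖ * (‖op T‖ * ‖(fun x => op (Hom.adj T) (op T x))^[n] x‖) :=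
          (ContinuousLinearMap.le_opNorm _ _).trans
            (by gcongr; exact ContinuousLinearMap.le_opNorm _ _)
      _ ≤ ‖op (Hom.adj T)‖ * (‖op T‖ * ((‖op (Hom.adj T)‖ * ‖op T‖) ^ n * ‖x‖)) := by gcongr
      _ = _ := by ring

/-- The operator `S ⊗ T` is bounded. On pairs of vectors its formal adjoint is given by the action
of `S*` and `T*`, and the powers of `S* S` and `T* T` grow at most exponentially. -/
lemma exists_tensorMap (S : E ⟶ E') (T : F ⟶ F') :
    ∃ R : itp E F →L[ℂ] itp E' F', ∀ p : E × F,
      R (tmul p.1 p.2) = tmul (op S p.1) (op T p.2) := by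
  obtain ⟨R, hR, -⟩ := exists_clm_of_adjoint (itp E F).isNormForm (itp E' F').isNormForm
    (total_tmul E F) (fun p : E' × F' => (tmul p.1 p.2 : itp E' F'))
    (fun p => (op S p.1, op T p.2)) (fun p => (op (Hom.adj S) p.1, op (Hom.adj T) p.2))
    (fun p q => by rw [inner_tmul, inner_tmul, inner_op, inner_op, op_lmul])
    (r := (‖op (Hom.adj S)‖ * ‖op S‖) * (‖op (Hom.adj T)‖ * ‖op T‖)) (by positivity)
    (fun p => ⟨‖p.1‖ * ‖p.2‖, fun n => by
      have e : (fun q : E × F => (op (Hom.adj S) (op S q.1), op (Hom.adj T) (op T q.2)))^[n] p =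
          ((fun x => op (Hom.adj S) (op S x))^[n] p.1,
            (fun x => op (Hom.adj T) (op T x))^[n] p.2) :=
        congrFun (Prod.map_iterate (fun x => op (Hom.adj S) (op S x))
          (fun x => op (Hom.adj T) (op T x)) n) p
      rw [e]
      calc _ ≤ _ := norm_tmul_le _ _
        _ ≤ ((‖op (Hom.adj S)‖ * ‖op S‖) ^ n * ‖p.1‖) *
            ((‖op (Hom.adj T)‖ * ‖op T‖) ^ n * ‖p.2‖) := by
          gcongr <;> exact norm_iterate_adj_comp_le _ _ _
        _ = _ := by rw [mul_pow]; ring⟩)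
  exact ⟨R, hR⟩

/-- The operator `S ⊗ T`. -/
def tensorMap (S : E ⟶ E') (T : F ⟶ F') : itp E F →L[ℂ] itp E' F' :=
  (exists_tensorMap S T).choose

lemma tensorMap_tmul (S : E ⟶ E') (T : F ⟶ F') (ξ : E) (η : F) :
    tensorMap S T (tmul ξ η) = tmul (op S ξ) (op T η) :=
  (exists_tensorMap S T).choose_spec (ξ, η)

lemma inner_tensorMap (S : E ⟶ E') (T : F ⟶ F') (x : itp E F) (y : itp E' F') :
    (itp E' F').inner (tensorMap S T x) y =
      (itp E F).inner x (tensorMap (Hom.adj S) (Hom.adj T) y) := by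
  have h : ∀ p : E × F, (itp E' F').inner (tensorMap S T (tmul p.1 p.2)) y =
      (itp E F).inner (tmul p.1 p.2) (tensorMap (Hom.adj S) (Hom.adj T) y) := fun p => by
    refine congrArg (fun R : itp E' F' →L[ℂ] B => R y) (clm_ext_of_total (total_tmul E' F')
      (S := (itp E' F').innerL (tensorMap S T (tmul p.1 p.2)))
      (T := (itp E F).innerL (tmul p.1 p.2) ∘L tensorMap (Hom.adj S) (Hom.adj T)) fun q => ?_)
    change (itp E' F').inner _ _ = (itp E F).inner _ (tensorMap _ _ _)
    rw [tensorMap_tmul, tensorMap_tmul, inner_tmul, inner_tmul, inner_op, inner_op, op_lmul]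
  refine closedSpan_induction (p := fun x => (itp E' F').inner (tensorMap S T x) y =
      (itp E F).inner x (tensorMap (Hom.adj S) (Hom.adj T) y))
    (by rintro _ ⟨p, rfl⟩; exact h p) (by simp)
    (fun x y hx hy => by simp only [map_add, LinearMap.add_apply, hx, hy])
    (fun c x hx => by simp only [map_smul, map_smulₛₗ, LinearMap.smul_apply, hx])
    (isClosed_eq (((itp E' F').continuous_inner_left y).comp (tensorMap S T).continuous)
      ((itp E F).continuous_inner_left _)) (total_tmul E F x)

/-- The tensor product of morphisms. -/
def tmap (S : E ⟶ E') (T : F ⟶ F') : itp E F ⟶ itp E' F' where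
  toCLM := tensorMap S T
  adjointable := ⟨tensorMap (Hom.adj S) (Hom.adj T), inner_tensorMap S T⟩
  map_lmul b x := by
    refine congrArg (fun R : itp E F →L[ℂ] itp E' F' => R x) (clm_ext_of_total (total_tmul E F)
      (S := tensorMap S T ∘L (itp E F).lmulL b) (T := (itp E' F').lmulL b ∘L tensorMap S T)
      fun p => ?_)
    change tensorMap S T ((itp E F).lmul b _) = (itp E' F').lmul b (tensorMap S T _)
    rw [lmul_tmul, tensorMap_tmul, tensorMap_tmul, lmul_tmul, op_lmul]

lemma tmap_tmul (S : E ⟶ E') (T : F ⟶ F') (ξ : E) (η : F) :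
    op (tmap S T) (tmul ξ η) = tmul (op S ξ) (op T η) := tensorMap_tmul S T ξ η

end TensorHom

/-! ### Coherence isomorphisms for the internal tensor product -/

/-- Total families with equal Gram matrices that are compatible with the left action define an
isomorphism. -/
lemma exists_iso_of_gram {ι : Type*} {v : ι → E} {v' : ι → F}
    (hv : Dense (Submodule.span ℂ (Set.range v) : Set E))
    (hv' : Dense (Submodule.span ℂ (Set.range v') : Set F))
    (h : ∀ i j, F.inner (v' i) (v' j) = E.inner (v i) (v j)) (s : B → ι → ι)
    (hs : ∀ b i, E.lmul b (v i) = v (s b i)) (hs' : ∀ b i, F.lmul b (v' i) = v' (s b i)) :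
    ∃ U : E ≅ F, ∀ i, op U.hom (v i) = v' i := by
  obtain ⟨U, hU, hform⟩ := exists_linearIsometryEquiv_of_gram E.isNormForm F.isNormForm hv hv' h
  refine ⟨isoOfUnitary U hform fun b x => ?_, hU⟩
  refine congrArg (fun R : E →L[ℂ] F => R x) (clm_ext_of_total hv
    (S := (U.toContinuousLinearEquiv : E →L[ℂ] F) ∘L E.lmulL b)
    (T := F.lmulL b ∘L (U.toContinuousLinearEquiv : E →L[ℂ] F)) fun i => ?_)
  change U (E.lmul b (v i)) = F.lmul b (U (v i))
  rw [hs, hU, hU, hs']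

variable (E F G)

lemma total_tmul_tmul : Dense (Submodule.span ℂ (Set.range fun p : (E × F) × G =>
    (tmul (tmul p.1.1 p.1.2 : itp E F) p.2 : itp (itp E F) G)) : Set (itp (itp E F) G)) :=
  total_tmul_of (v := fun q : E × F => (tmul q.1 q.2 : itp E F)) (w := fun x : G => x)
    (total_tmul E F) dense_span_range_id

lemma total_tmul_tmul' : Dense (Submodule.span ℂ (Set.range fun p : (E × F) × G =>
    (tmul p.1.1 (tmul p.1.2 p.2 : itp F G) : itp E (itp F G))) : Set (itp E (itp F G))) := by
  convert total_tmul_of (v := fun x : E => x) (w := fun q : F × G => (tmul q.1 q.2 : itp F G))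
    dense_span_range_id (total_tmul F G) using 3
  ext x
  constructor
  · rintro ⟨p, rfl⟩
    exact ⟨(p.1.1, p.1.2, p.2), rfl⟩
  · rintro ⟨p, rfl⟩
    exact ⟨((p.1, p.2.1), p.2.2), rfl⟩

lemma exists_assoc : ∃ U : itp (itp E F) G ≅ itp E (itp F G), ∀ p : (E × F) × G,
    op U.hom (tmul (tmul p.1.1 p.1.2 : itp E F) p.2) = tmul p.1.1 (tmul p.1.2 p.2 : itp F G) :=
  exists_iso_of_gram (total_tmul_tmul E F G) (total_tmul_tmul' E F G)
    (fun p q => by rw [inner_tmul, inner_tmul, lmul_tmul, inner_tmul, inner_tmul])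
    (fun b p => ((E.lmul b p.1.1, p.1.2), p.2)) (fun b p => by rw [lmul_tmul, lmul_tmul])
    fun b p => by rw [lmul_tmul]

/-- The elementary tensor `b ⊗ ξ` of elements of `B` and `E`. -/
def unitTmul {E : CStarBimod B} (b : B) (ξ : E) : itp (unit B) E := tmul (E := unit B) b ξ

/-- The elementary tensor `ξ ⊗ b` of elements of `E` and `B`. -/
def tmulUnit {E : CStarBimod B} (ξ : E) (b : B) : itp E (unit B) := tmul (F := unit B) ξ b

lemma total_unitTmul : Dense (Submodule.span ℂ (Set.range fun p : B × E =>
    (unitTmul p.1 p.2 : itp (unit B) E)) : Set (itp (unit B) E)) := total_tmul (unit B) E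

lemma total_tmulUnit : Dense (Submodule.span ℂ (Set.range fun p : E × B =>
    (tmulUnit p.1 p.2 : itp E (unit B))) : Set (itp E (unit B))) := total_tmul E (unit B)

variable {E}

lemma inner_unitTmul (b c : B) (ξ η : E) :
    (itp (unit B) E).inner (unitTmul b ξ) (unitTmul c η) = E.inner ξ (E.lmul (star b * c) η) :=
  inner_tmul (E := unit B) b c ξ η

lemma inner_tmulUnit (b c : B) (ξ η : E) :
    (itp E (unit B)).inner (tmulUnit ξ b) (tmulUnit η c) = star b * (E.inner ξ η * c) :=
  inner_tmul (F := unit B) ξ η b c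

lemma lmul_unitTmul (a b : B) (ξ : E) :
    (itp (unit B) E).lmul a (unitTmul b ξ) = unitTmul (a * b) ξ := lmul_tmul (E := unit B) a b ξ

lemma lmul_tmulUnit (a b : B) (ξ : E) :
    (itp E (unit B)).lmul a (tmulUnit ξ b) = tmulUnit (E.lmul a ξ) b :=
  lmul_tmul (F := unit B) a ξ b

lemma tmap_unitTmul (T : E ⟶ F) (b : B) (ξ : E) :
    op (tmap (𝟙 (unit B)) T) (unitTmul b ξ) = unitTmul b (op T ξ) :=
  tmap_tmul (𝟙 (unit B)) T b ξ

lemma tmap_tmulUnit (T : E ⟶ F) (b : B) (ξ : E) :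
    op (tmap T (𝟙 (unit B))) (tmulUnit ξ b) = tmulUnit (op T ξ) b :=
  tmap_tmul T (𝟙 (unit B)) ξ b

variable (E)

lemma exists_left : ∃ U : itp (unit B) E ≅ E, ∀ p : B × E,
    op U.hom (unitTmul p.1 p.2) = E.lmul p.1 p.2 :=
  exists_iso_of_gram (total_unitTmul E) total_lmul
    (fun p q => by rw [inner_unitTmul, E.inner_lmul, E.lmul_mul])
    (fun b p => (b * p.1, p.2)) (fun b p => lmul_unitTmul b p.1 p.2)
    fun b p => (E.lmul_mul b p.1 p.2).symm

lemma exists_right : ∃ U : itp E (unit B) ≅ E, ∀ p : E × B,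
    op U.hom (tmulUnit p.1 p.2) = E.rmul p.2 p.1 :=
  exists_iso_of_gram (total_tmulUnit E) total_rmul
    (fun p q => by rw [inner_tmulUnit, E.inner_rmul, inner_rmul_left, mul_assoc])
    (fun b p => (E.lmul b p.1, p.2)) (fun b p => lmul_tmulUnit b p.2 p.1)
    fun b p => lmul_rmul _ _ _

/-- The associator `(ξ ⊗ η) ⊗ ζ ↦ ξ ⊗ (η ⊗ ζ)`. -/
def assocIso : itp (itp E F) G ≅ itp E (itp F G) := (exists_assoc E F G).choose

/-- The left unit isomorphism `b ⊗ ξ ↦ b ξ`. -/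
def leftIso : itp (unit B) E ≅ E := (exists_left E).choose

/-- The right unit isomorphism `ξ ⊗ b ↦ ξ b`. -/
def rightIso : itp E (unit B) ≅ E := (exists_right E).choose

variable {E F G}

lemma assoc_tmul (ξ : E) (η : F) (ζ : G) :
    op (assocIso E F G).hom (tmul (tmul ξ η : itp E F) ζ) = tmul ξ (tmul η ζ : itp F G) :=
  (exists_assoc E F G).choose_spec ((ξ, η), ζ)

lemma left_tmul (b : B) (ξ : E) : op (leftIso E).hom (unitTmul b ξ) = E.lmul b ξ :=
  (exists_left E).choose_spec (b, ξ)

lemma right_tmul (ξ : E) (b : B) : op (rightIso E).hom (tmulUnit ξ b) = E.rmul b ξ :=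
  (exists_right E).choose_spec (ξ, b)

variable (B) in
/-- The monoidal structure given by the internal tensor product. -/
def itpMonoidalData : MonoidalData (CStarBimod B) itp (unit B) where
  tensorHom := tmap
  associator := assocIso
  leftUnitor := leftIso
  rightUnitor := rightIso
  id_tensorHom_id E F := hom_ext_of_total (total_tmul E F) fun p => by rw [tmap_tmul]; rfl
  tensorHom_comp_tensorHom {E₁ F₁ G₁ E₂ F₂ G₂} f₁ f₂ g₁ g₂ :=
    hom_ext_of_total (total_tmul E₁ E₂) fun p => by
      rw [op_comp, tmap_tmul, tmap_tmul, tmap_tmul]; rfl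
  associator_naturality {E₁ E₂ E₃ F₁ F₂ F₃} f₁ f₂ f₃ :=
    hom_ext_of_total (total_tmul_tmul E₁ E₂ E₃) fun p => by
      rw [op_comp, op_comp, tmap_tmul, tmap_tmul, assoc_tmul, assoc_tmul, tmap_tmul, tmap_tmul]
  leftUnitor_naturality {E F} f := hom_ext_of_total (total_unitTmul E) fun p => by
    rw [op_comp, op_comp, tmap_unitTmul, left_tmul, left_tmul, op_lmul]
  rightUnitor_naturality {E F} f := hom_ext_of_total (total_tmulUnit E) fun p => by
    rw [op_comp, op_comp, tmap_tmulUnit, right_tmul, right_tmul, op_rmul]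
  pentagon W X Y Z :=
    hom_ext_of_total (total_tmul_of (w := fun x : Z => x) (total_tmul_tmul W X Y)
      dense_span_range_id) fun p => by
      simp only [op_comp]
      rw [tmap_tmul, assoc_tmul, op_id, assoc_tmul, tmap_tmul, assoc_tmul, op_id, assoc_tmul,
        assoc_tmul]
  triangle X Y := hom_ext_of_total (total_tmul_tmul X (unit B) Y) fun p => by
    rw [op_comp, assoc_tmul, tmap_tmul, tmap_tmul]
    exact (congrArg (tmulL X Y p.1.1) (@left_tmul B _ _ _ Y p.1.2 p.2)).trans
      ((@tmul_rmul B _ _ _ X Y p.1.2 p.1.1 p.2).symm.trans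
      (congrArg (fun x => tmulL X Y x p.2) (@right_tmul B _ _ _ X p.1.1 p.1.2).symm))

lemma isItpStructure_itpMonoidalData : IsItpStructure (itpMonoidalData B) where
  tensorHom := tmap_tmul
  associator := assoc_tmul
  leftUnitor := left_tmul
  rightUnitor := right_tmul

end Tensor

end CStarBimod

/-! ### The inverse semigroup of partial automorphisms -/

namespace PAut

variable {B : Type u} [NonUnitalCStarAlgebra B]

lemma ext_maps {θ θ' : PAut B} (h : ∀ a c, θ.Maps a c ↔ θ'.Maps a c) : θ = θ' :=
  le_antisymm (fun a c => (h a c).1) fun a c => (h a c).2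

instance : Monoid (PAut B) where
  mul_assoc _ _ _ := ext_maps fun _ _ =>
    ⟨fun ⟨m, h, n, h', h''⟩ => ⟨n, ⟨m, h, h'⟩, h''⟩, fun ⟨n, ⟨m, h, h'⟩, h''⟩ => ⟨m, h, n, h', h''⟩⟩
  one_mul θ := ext_maps fun a c =>
    ⟨by rintro ⟨m, h, h'⟩; obtain rfl : m = c := h'; exact h, fun h => ⟨c, h, rfl⟩⟩
  mul_one θ := ext_maps fun a c =>
    ⟨by rintro ⟨m, h, h'⟩; obtain rfl : a = m := h; exact h', fun h => ⟨a, rfl, h⟩⟩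

instance : StarMul (PAut B) where
  star_involutive _ := rfl
  star_mul _ _ := ext_maps fun _ _ =>
    ⟨fun ⟨m, h, h'⟩ => ⟨m, h', h⟩, fun ⟨m, h, h'⟩ => ⟨m, h', h⟩⟩

lemma mul_le_mul {θ θ' φ φ' : PAut B} (h : θ ≤ θ') (h' : φ ≤ φ') : θ * φ ≤ θ' * φ' :=
  fun a c ⟨m, k, k'⟩ => ⟨m, h' a m k, h m c k'⟩

lemma star_le_star {θ θ' : PAut B} (h : θ ≤ θ') : star θ ≤ star θ' := fun a c k => h c a k

lemma star_mul_self_le_one (θ : PAut B) : star θ * θ ≤ 1 := fun _ _ ⟨_, h, h'⟩ =>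
  θ.left_unique h h'

lemma mul_star_self_le_one (θ : PAut B) : θ * star θ ≤ 1 := star_mul_self_le_one (star θ)

lemma mul_star_mul_self (θ : PAut B) : θ * star θ * θ = θ := ext_maps fun a c =>
  ⟨fun ⟨_, h, _, h', h''⟩ => by
    obtain rfl := θ.left_unique h h'
    exact h'', fun h => ⟨c, h, a, h, h⟩⟩

lemma eq_one_of_one_le {θ : PAut B} (h : 1 ≤ θ) : θ = 1 := ext_maps fun a c =>
  ⟨fun k => θ.right_unique (h a a rfl) k, h a c⟩

lemma mul_left_le {θ φ ψ : PAut B} (h : θ ≤ 1) (h' : φ ≤ ψ) : θ * φ ≤ ψ := by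
  simpa using mul_le_mul h h'

lemma mul_right_le {θ φ ψ : PAut B} (h : θ ≤ 1) (h' : φ ≤ ψ) : φ * θ ≤ ψ := by
  simpa using mul_le_mul h' h

/-- If `φ ≤ σ`, then `φ` is the restriction of `σ` by an idempotent. -/
lemma eq_mul_of_le {φ σ : PAut B} (h : φ ≤ σ) : φ = φ * star φ * σ := ext_maps fun a c =>
  ⟨fun k => ⟨c, h a c k, a, k, k⟩, fun ⟨n, hn, m, hm, hm'⟩ => by
    have e : a = m := σ.left_unique hn (h m n hm)
    exact e ▸ hm'⟩

variable {θ : PAut B} {a b c d x y : B}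

lemma Maps.mul (h : θ.Maps a c) (h' : θ.Maps b d) : θ.Maps (a * b) (c * d) :=
  mul_mem (S := NonUnitalStarSubalgebra ℂ (B × B)) h h'

lemma Maps.star (h : θ.Maps a c) : θ.Maps (star a) (star c) := θ.graph.star_mem' h

lemma maps_zero (θ : PAut B) : θ.Maps 0 0 := zero_mem θ.graph

lemma Maps.mem_img (h : θ.Maps a c) : c ∈ θ.img := ⟨a, h⟩

lemma mul_mem_dom (b : B) (h : a ∈ θ.dom) : b * a ∈ θ.dom := θ.mul_dom b h.choose_spec

lemma mem_dom_mul (b : B) (h : a ∈ θ.dom) : a * b ∈ θ.dom := θ.dom_mul b h.choose_spec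

lemma star_mem_dom (h : a ∈ θ.dom) : Star.star a ∈ θ.dom := θ.domAlg.star_mem' h

lemma mul_mem_img (b : B) (h : a ∈ θ.img) : b * a ∈ θ.img := mul_mem_dom (θ := Star.star θ) b h

lemma mem_img_mul (b : B) (h : a ∈ θ.img) : a * b ∈ θ.img := mem_dom_mul (θ := Star.star θ) b h

lemma star_mem_img (h : a ∈ θ.img) : Star.star a ∈ θ.img := star_mem_dom (θ := Star.star θ) h

/-- The domain of a partial automorphism as a closed linear subspace. -/
def domSub (θ : PAut B) : Submodule ℂ B := { θ.domAlg with smul_mem' := θ.domAlg.smul_mem' }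

lemma eq_of_mul_eq (hx : x ∈ θ.img) (hy : y ∈ θ.img) (h : ∀ c ∈ θ.img, x * c = y * c) : x = y := by
  have h1 : x - y ∈ (Star.star θ).domSub := Submodule.sub_mem _ hx hy
  have h2 : (x - y) * Star.star (x - y) = 0 := by
    rw [sub_mul, sub_eq_zero]
    exact h _ (star_mem_img h1)
  exact sub_eq_zero.1 ((CStarRing.mul_star_self_eq_zero_iff _).1 h2)

lemma exists_approxUnit_dom (θ : PAut B) : ∃ l : Filter B, IsApproxUnitOf l θ.dom :=
  exists_isApproxUnitOf θ.domAlg θ.isClosed_dom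

lemma maps_toHom (a : θ.domAlg) : θ.Maps a (θ.toHom a) := a.2.choose_spec

lemma norm_toHom (a : θ.domAlg) : ‖θ.toHom a‖ = ‖(a : B)‖ :=
  θ.isometry_toHom.norm_map_of_map_zero (map_zero _) a

end PAut

namespace CStarBimod

variable {B : Type u} [NonUnitalCStarAlgebra B] [PartialOrder B] [StarOrderedRing B]

/-! ### Homogeneous elements -/

section Homog

variable {E F : CStarBimod B} {θ φ ψ : PAut B} {ξ η : E} {b c : B}

lemma inner_mem_dom_of_mem_closure (h : ξ ∈ closure (Submodule.span ℂ
    {ζ : E | ∃ η, ∃ b ∈ θ.dom, ζ = E.rmul b η} : Set E)) (η : E) : E.inner η ξ ∈ θ.dom := by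
  refine mem_of_mem_closedSpan (E.innerL η) (M := θ.domSub) θ.isClosed_dom ?_ h
  rintro _ ⟨ζ, b, hb, rfl⟩
  rw [innerL_apply, E.inner_rmul]
  exact PAut.mul_mem_dom _ hb

/-- The condition `ξ ∈ E Dom(θ)` means that `⟨ξ|ξ⟩` lies in `Dom(θ)`. -/
lemma mem_homog_iff : ξ ∈ E.homog θ ↔
    E.inner ξ ξ ∈ θ.dom ∧ ∀ b c, θ.Maps b c → E.rmul b ξ = E.lmul c ξ := by
  refine ⟨fun h => ⟨inner_mem_dom_of_mem_closure h.1 ξ, h.2⟩, fun h => ⟨?_, h.2⟩⟩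
  obtain ⟨l, hl⟩ := θ.exists_approxUnit_dom
  have := hl.neBot
  exact (isClosed_closedSpan _).mem_of_tendsto (tendsto_rmul hl h.1)
    (hl.mem.mono fun u hu => mem_closedSpan ⟨ξ, u, hu, rfl⟩)

lemma inner_mem_dom (h : ξ ∈ E.homog θ) (η : E) : E.inner η ξ ∈ θ.dom :=
  inner_mem_dom_of_mem_closure h.1 η

lemma inner_mem_dom' (h : ξ ∈ E.homog θ) (η : E) : E.inner ξ η ∈ θ.dom := by
  rw [← E.star_inner]; exact PAut.star_mem_dom (inner_mem_dom h η)

lemma rmul_eq_lmul (h : ξ ∈ E.homog θ) (h' : θ.Maps b c) : E.rmul b ξ = E.lmul c ξ := h.2 b c h'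

variable (E θ) in
/-- The homogeneous subspace of degree `θ`. -/
def homogSub : Submodule ℂ E where
  carrier := E.homog θ
  zero_mem' := ⟨Submodule.zero_mem (closedSpan _), fun b c _ => by simp⟩
  add_mem' h h' := ⟨Submodule.add_mem (closedSpan _) h.1 h'.1, fun b c k => by
    rw [map_add, map_add, h.2 b c k, h'.2 b c k]⟩
  smul_mem' z ξ h := ⟨Submodule.smul_mem (closedSpan _) z h.1, fun b c k => by
    rw [map_smul, map_smul, h.2 b c k]⟩

variable (E θ) in
lemma isClosed_homog : IsClosed (E.homog θ) := by
  have : E.homog θ = closure (Submodule.span ℂ {ζ : E | ∃ η, ∃ b ∈ θ.dom, ζ = E.rmul b η} : Set E) ∩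
      ⋂ b, ⋂ c, ⋂ (_ : θ.Maps b c), {ξ | E.rmulL b ξ = E.lmulL c ξ} := by
    ext ξ
    simp only [Set.mem_inter_iff, Set.mem_iInter]
    rfl
  rw [this]
  exact isClosed_closure.inter (isClosed_iInter fun b => isClosed_iInter fun c =>
    isClosed_iInter fun _ => isClosed_eq (E.rmulL b).continuous (E.lmulL c).continuous)

/-- If `θ ≤ φ`, then `E_θ ⊆ E_φ`. -/
lemma homog_mono (h : θ ≤ φ) : E.homog θ ⊆ E.homog φ := by
  intro ξ hξ
  refine mem_homog_iff.2 ⟨(inner_mem_dom hξ ξ).imp fun c => h _ c, fun b c k => ?_⟩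
  obtain ⟨l, hl⟩ := θ.exists_approxUnit_dom
  have := hl.neBot
  -- `ξ b` and `c ξ` are both limits of `ξ (b u)`, where `u` is an approximate unit of the domain
  have t1 : Tendsto (fun u => E.rmul u (E.rmul b ξ)) l (𝓝 (E.rmul b ξ)) :=
    tendsto_rmul hl (by rw [E.inner_rmul]; exact PAut.mem_dom_mul _ (inner_mem_dom hξ _))
  have t2 : Tendsto (fun u => E.lmul c (E.rmul u ξ)) l (𝓝 (E.lmul c ξ)) :=
    ((E.lmulL c).continuous.tendsto ξ).comp (tendsto_rmul hl (inner_mem_dom hξ ξ))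
  refine tendsto_nhds_unique t1 (t2.congr' ?_)
  filter_upwards [hl.mem] with u hu
  obtain ⟨d, hd⟩ := hu
  obtain ⟨e, he⟩ := PAut.mul_mem_dom (θ := θ) b ⟨d, hd⟩
  have h2 : e = c * d := φ.right_unique (h _ _ he) (k.mul (h _ _ hd))
  rw [rmul_eq_lmul hξ hd, ← E.lmul_mul, ← h2, ← rmul_eq_lmul hξ he, E.rmul_mul]

lemma mem_closedSpan_img (h : ξ ∈ E.homog θ) :
    ξ ∈ closedSpan {ζ : E | ∃ c ∈ θ.img, ζ = E.lmul c ξ} := by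
  obtain ⟨l, hl⟩ := θ.exists_approxUnit_dom
  have := hl.neBot
  refine (isClosed_closedSpan _).mem_of_tendsto (tendsto_rmul hl (inner_mem_dom h ξ))
    (hl.mem.mono fun u hu => mem_closedSpan ?_)
  obtain ⟨d, hd⟩ := hu
  exact ⟨d, hd.mem_img, rmul_eq_lmul h hd⟩

/-- The relation `θ(⟨η|bξ⟩) = θ(⟨η|ξ⟩) b` for a `θ`-homogeneous `ξ`. -/
lemma maps_inner_lmul (hξ : ξ ∈ E.homog θ) (h : θ.Maps (E.inner η ξ) c) (b : B) :
    θ.Maps (E.inner η (E.lmul b ξ)) (c * b) := by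
  have key : ∀ d ∈ θ.img, θ.Maps (E.inner η (E.lmul d ξ)) (c * d) := by
    rintro d ⟨e, he⟩
    rw [← rmul_eq_lmul hξ he, E.inner_rmul]
    exact h.mul he
  obtain ⟨n, hn⟩ : E.inner η (E.lmul b ξ) ∈ θ.dom := by
    rw [inner_lmul_right]; exact inner_mem_dom hξ _
  have : n = c * b := PAut.eq_of_mul_eq hn.mem_img (PAut.mem_img_mul b h.mem_img) fun d hd => by
    obtain ⟨e, he⟩ := hd
    have h1 := hn.mul he
    rw [← E.inner_rmul, ← lmul_rmul, rmul_eq_lmul hξ he, ← E.lmul_mul] at h1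
    rw [mul_assoc]
    exact θ.right_unique h1 (key _ (PAut.mul_mem_img b he.mem_img))
  exact this ▸ hn

/-- The operator `η ↦ θ(⟨ξ|η⟩)` for a `θ`-homogeneous `ξ`, which is the adjoint of `|ξ]`. -/
def innerTw (hξ : ξ ∈ E.homog θ) : E →L[ℂ] B :=
  LinearMap.mkContinuous
    { toFun := fun η => θ.toHom ⟨E.inner ξ η, inner_mem_dom' hξ η⟩
      map_add' := fun η η' => by
        rw [← map_add]; congr 1; exact Subtype.ext (map_add _ _ _)
      map_smul' := fun z η => by
        rw [RingHom.id_apply, ← map_smul]; congr 1; exact Subtype.ext (map_smul _ _ _) } ‖ξ‖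
    fun η => (PAut.norm_toHom _).trans_le (E.norm_inner_le ξ η)

lemma maps_innerTw (hξ : ξ ∈ E.homog θ) (η : E) : θ.Maps (E.inner ξ η) (innerTw hξ η) :=
  PAut.maps_toHom ⟨E.inner ξ η, inner_mem_dom' hξ η⟩

lemma eq_innerTw (hξ : ξ ∈ E.homog θ) (h : θ.Maps (E.inner ξ η) c) : c = innerTw hξ η :=
  θ.right_unique h (maps_innerTw hξ η)

lemma innerTw_lmul (hξ : ξ ∈ E.homog θ) (b : B) (η : E) :
    innerTw hξ (E.lmul b η) = b * innerTw hξ η := by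
  refine (eq_innerTw hξ ?_).symm
  have h := maps_inner_lmul (η := η) hξ (c := star (innerTw hξ η))
    (by rw [← E.star_inner]; exact (maps_innerTw hξ η).star) (star b)
  have h' := h.star
  rwa [E.star_inner, E.inner_lmul, star_star, star_mul, star_star, star_star] at h'

/-- Morphisms preserve degrees. -/
lemma op_mem_homog (T : E ⟶ F) (h : ξ ∈ E.homog θ) : op T ξ ∈ F.homog θ := by
  refine mem_homog_iff.2 ⟨?_, fun b c k => ?_⟩
  · rw [inner_op]
    exact inner_mem_dom' h _
  · rw [← op_rmul, ← op_lmul, rmul_eq_lmul h k]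

lemma tmul_mem_homog {η : F} (hξ : ξ ∈ E.homog θ) (hη : η ∈ F.homog φ) :
    (tmul ξ η : itp E F) ∈ (itp E F).homog (θ * φ) := by
  refine mem_homog_iff.2 ⟨?_, ?_⟩
  · obtain ⟨c, hc⟩ := inner_mem_dom hη η
    obtain ⟨d, hd⟩ := PAut.mul_mem_dom c (inner_mem_dom hξ ξ)
    rw [inner_tmul]
    exact ⟨d, c * E.inner ξ ξ, maps_inner_lmul hη hc _, hd⟩
  · rintro b d ⟨m, h, h'⟩
    rw [rmul_tmul, lmul_tmul, rmul_eq_lmul hη h, ← tmul_rmul, rmul_eq_lmul hξ h']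

/-- Homogeneous elements of `B` of degree `θ`. -/
abbrev hB (θ : PAut B) : Set B := (unit B).homog θ

lemma hB_mono (h : θ ≤ φ) : hB θ ⊆ hB φ := homog_mono (B := B) (E := unit B) h

lemma isClosed_hB (θ : PAut B) : IsClosed (hB θ) := isClosed_homog (unit B) θ

/-- The homogeneous elements of `B` of degree `θ` as a linear subspace. -/
def hBSub (θ : PAut B) : Submodule ℂ B := homogSub (unit B) θ

lemma mem_hB_iff : c ∈ hB θ ↔ star c * c ∈ θ.dom ∧ ∀ a b, θ.Maps a b → c * a = b * c :=
  mem_homog_iff (E := unit B)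

lemma lmul_mem_homog (hb : b ∈ hB θ) (hξ : ξ ∈ E.homog φ) : E.lmul b ξ ∈ E.homog (θ * φ) := by
  rw [← left_tmul]
  exact op_mem_homog (leftIso E).hom (tmul_mem_homog (E := unit B) hb hξ)

lemma rmul_mem_homog (hξ : ξ ∈ E.homog θ) (hb : b ∈ hB φ) : E.rmul b ξ ∈ E.homog (θ * φ) := by
  rw [← right_tmul]
  exact op_mem_homog (rightIso E).hom (tmul_mem_homog (F := unit B) hξ hb)

/-- The inner product `⟨ξ|η⟩` of elements of degrees `θ` and `φ` has degree `θ* φ`. -/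
lemma inner_mem_homog (hξ : ξ ∈ E.homog θ) (hη : η ∈ E.homog φ) :
    E.inner ξ η ∈ hB (star θ * φ) := by
  refine mem_hB_iff.2 ⟨?_, ?_⟩
  · have h1 : innerTw hη ξ ∈ θ.img := by
      refine mem_of_mem_closedSpan (innerTw hη) (M := (star θ).domSub) θ.isClosed_img ?_
        (mem_closedSpan_img hξ)
      rintro _ ⟨c, hc, rfl⟩
      rw [innerTw_lmul]
      exact PAut.mem_img_mul _ hc
    have h2 := (maps_innerTw hη ξ)
    obtain ⟨d, hd⟩ := PAut.mem_img_mul (star (innerTw hη ξ)) h1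
    refine ⟨d, _, ?_, hd⟩
    have h3 := h2.mul h2.star
    rwa [E.star_inner] at h3 ⊢
  · rintro a b ⟨m, h, h'⟩
    have h'' : θ.Maps b m := h'
    rw [← E.inner_rmul, rmul_eq_lmul hη h, inner_lmul_right, ← rmul_eq_lmul hξ h''.star,
      inner_rmul_left, star_star]

lemma mul_mem_hB (hb : b ∈ hB θ) (hc : c ∈ hB φ) : b * c ∈ hB (θ * φ) :=
  lmul_mem_homog (E := unit B) hb hc

lemma mem_dom_of_mem_hB (h : c ∈ hB θ) : c ∈ θ.dom := by
  have h1 := (h : c ∈ (unit B).homog θ).1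
  refine closedSpan_le (M := θ.domSub) θ.isClosed_dom ?_ h1
  rintro _ ⟨a, b, hb, rfl⟩
  exact PAut.mul_mem_dom (B := B) a hb

lemma mem_img_of_mem_hB (h : c ∈ hB θ) : c ∈ θ.img := by
  have h1 : c ∈ closedSpan {ζ : B | ∃ d ∈ θ.img, ζ = d * c} := mem_closedSpan_img (E := unit B) h
  refine closedSpan_le (M := (star θ).domSub) θ.isClosed_img ?_ h1
  rintro _ ⟨d, hd, rfl⟩
  exact PAut.mem_img_mul c hd

lemma star_mem_hB (h : c ∈ hB θ) : star c ∈ hB (star θ) := by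
  refine mem_hB_iff.2 ⟨PAut.mul_mem_img _ (PAut.star_mem_img (mem_img_of_mem_hB h)), ?_⟩
  intro a b k
  have k' : θ.Maps b a := k
  have := congrArg star ((mem_hB_iff.1 h).2 _ _ k'.star)
  simpa using this.symm

lemma star_mul_self_comm (h : c ∈ hB θ) (hb : b ∈ θ.dom) : star c * c * b = b * (star c * c) := by
  obtain ⟨d, hd⟩ := hb
  rw [mul_assoc, (mem_hB_iff.1 h).2 _ _ hd, ← mul_assoc,
    (mem_hB_iff.1 (star_mem_hB h)).2 d b hd, mul_assoc]

/-- Homogeneous elements of `B` are normal: `c* c` commutes with the domain and `c c*` with the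
image of the degree, both of which contain `c`, so that `p p = p q = q q` for `p = c* c` and
`q = c c*`. -/
lemma normal_of_mem_hB (h : c ∈ hB θ) : star c * c = c * star c := by
  have hd := mem_dom_of_mem_hB h
  have hi := mem_img_of_mem_hB h
  have h1 := star_mul_self_comm h hd
  have h2 := star_mul_self_comm (star_mem_hB h) (b := c) hi
  rw [star_star] at h2
  set p := star c * c with hp
  set q := c * star c with hq
  have hpq : star c * c * (star c * c) = star c * c * (c * star c) := by
    rw [mul_assoc, ← mul_assoc c, ← hq, h2, ← mul_assoc]
  have hqp : c * star c * (c * star c) = star c * c * (c * star c) := by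
    have : c * star c * (c * star c) = c * (star c * c) * star c := by simp only [mul_assoc]
    rw [this, ← hp, ← h1]; simp only [mul_assoc]
  have hps : star p = p := by simp [hp]
  have hqs : star q = q := by simp [hq]
  have hpq2 : q * p = p * p := by
    rw [← hp, ← hq] at hpq
    have := congrArg star hpq
    rw [star_mul p p, star_mul p q, hps, hqs] at this
    exact this.symm
  have h3 : star (p - q) * (p - q) = 0 := by
    rw [star_sub, hps, hqs, sub_mul, mul_sub, mul_sub, hpq2]
    rw [← hp, ← hq] at hpq hqp
    rw [hqp, ← hpq]; abel
  exact sub_eq_zero.1 ((CStarRing.star_mul_self_eq_zero_iff _).1 h3)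

/-- A partial automorphism fixes the elements of `B` that are homogeneous of its degree. -/
lemma maps_self_of_mem_hB (h : c ∈ hB θ) : θ.Maps c c := by
  have hn := normal_of_mem_hB h
  obtain ⟨d, hd⟩ := mem_dom_of_mem_hB h
  set p := star c * c with hp
  have hps : star p = p := by simp [hp]
  have hr := (mem_hB_iff.1 h).2
  have hr' := (mem_hB_iff.1 (star_mem_hB h)).2
  -- `θ` fixes `c* c`
  have key : ∀ {φ : PAut B} {x : B}, c ∈ hB φ → φ.Maps p x → x * p = p * p := by
    intro φ x hc hx
    have h1 := (mem_hB_iff.1 hc).2 _ _ hx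
    have h2 : c * p = p * c := (star_mul_self_comm hc (mem_dom_of_mem_hB hc)).symm
    conv_lhs => rw [hn, ← mul_assoc, ← h1, h2, mul_assoc, ← hn]
  have key' : ∀ {φ : PAut B} {x : B}, star c ∈ hB φ → φ.Maps p x → x * p = p * p := by
    intro φ x hc hx
    have h1 := (mem_hB_iff.1 hc).2 _ _ hx
    have h2 : star c * p = p * star c := by
      have := (star_mul_self_comm hc (mem_dom_of_mem_hB hc)).symm
      rwa [star_star, ← hn] at this
    conv_lhs => rw [hp, ← mul_assoc, ← h1, h2, mul_assoc]
  have hm : θ.Maps p (star d * d) := hd.star.mul hd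
  obtain ⟨e, he⟩ : p ∈ θ.img := PAut.mul_mem_img _ (mem_img_of_mem_hB h)
  set x := star d * d with hx
  have hxs : star x = x := by simp [hx]
  have e1 : x * p = p * p := key h hm
  have e2 : e * p = p * p := key' (star_mem_hB h) (he : (star θ).Maps p e)
  have e3 : p * x = x * x := θ.right_unique ((he.mul hm)) (e2 ▸ hm.mul hm)
  have e4 : x * p = x * x := by
    have := congrArg star e3
    rwa [star_mul p x, star_mul x x, hps, hxs] at this
  have hxp : x = p := by
    have : star (x - p) * (x - p) = 0 := by
      rw [star_sub, hps, hxs, sub_mul, mul_sub, mul_sub, e3, ← e4, e1]; abel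
    exact sub_eq_zero.1 ((CStarRing.star_mul_self_eq_zero_iff _).1 this)
  -- `d = θ(c)` satisfies `d* d = d* c = c* d = c* c`, hence `(d - c)* (d - c) = 0`
  have e5 : star d * c = p := by
    rw [hn]
    exact (hr _ _ hd.star).symm
  have e6 : star c * d = p := by
    have := congrArg star e5
    rwa [star_mul, star_star, hps] at this
  have hdc : d = c := by
    have : star (d - c) * (d - c) = 0 := by
      rw [star_sub, sub_mul, mul_sub, mul_sub, e5, e6, ← hx, hxp, ← hp]; abel
    exact sub_eq_zero.1 ((CStarRing.star_mul_self_eq_zero_iff _).1 this)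
  exact hdc ▸ hd

/-- Partial automorphisms conjugate degrees. -/
lemma conj_mem_hB (hc : c ∈ hB ψ) (h : θ.Maps c b) : b ∈ hB (θ * ψ * star θ) := by
  refine mem_hB_iff.2 ⟨?_, ?_⟩
  · have h1 := maps_self_of_mem_hB hc
    exact ⟨_, _, h.star.mul h, _, h1.star.mul h1, h.star.mul h⟩
  · rintro a d ⟨m, hm, n, hn, hd⟩
    have hm' : θ.Maps m a := hm
    have h1 := h.mul hm'
    rw [(mem_hB_iff.1 hc).2 _ _ hn] at h1
    exact θ.right_unique h1 (hd.mul h)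

/-- The element `θ(⟨ξ|η⟩)` has degree `φ θ*`: by `inner_mem_homog` and `conj_mem_hB`, its degree is
`θ (θ* φ) θ*`, which lies below `φ θ*`. -/
lemma maps_inner_mem_homog (hξ : ξ ∈ E.homog θ) (hη : η ∈ E.homog φ)
    (h : θ.Maps (E.inner ξ η) c) : c ∈ hB (φ * star θ) := by
  refine hB_mono ?_ (conj_mem_hB (inner_mem_homog hξ hη) h)
  rw [← mul_assoc, mul_assoc (θ * star θ)]
  exact PAut.mul_left_le (PAut.mul_star_self_le_one θ) le_rfl

/-- The homogeneous elements of an idempotent degree form a C*-algebra, which has an approximate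
unit. -/
lemma exists_approxUnit_hB (ψ : PAut B) (h : ψ * ψ = ψ) (h' : star ψ = ψ) :
    ∃ l : Filter B, IsApproxUnitOf l (hB ψ) :=
  exists_isApproxUnitOf
    { hBSub ψ with
      mul_mem' := fun {a b} ha hb => by
        have := mul_mem_hB (b := a) (c := b) ha hb
        rwa [h] at this
      star_mem' := fun {a} ha => by
        have := star_mem_hB (c := a) ha
        rwa [h'] at this } (isClosed_hB ψ)

lemma exists_approxUnit_source (θ : PAut B) : ∃ l : Filter B, IsApproxUnitOf l (hB (star θ * θ)) :=
  exists_approxUnit_hB _ (by rw [mul_assoc, ← mul_assoc θ, PAut.mul_star_mul_self]) (by simp)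

/-- Homogeneous elements belong to `[ξ Z]`, where `Z` is the centre of `B`. -/
lemma mem_closedSpan_rmul_center (h : ξ ∈ E.homog θ) :
    ξ ∈ closedSpan {ζ : E | ∃ c ∈ hB (1 : PAut B), ζ = E.rmul c ξ} := by
  obtain ⟨l, hl⟩ := exists_approxUnit_source θ
  have := hl.neBot
  exact (isClosed_closedSpan _).mem_of_tendsto (tendsto_rmul hl (inner_mem_homog h h))
    (hl.mem.mono fun u hu => mem_closedSpan
      ⟨u, hB_mono θ.star_mul_self_le_one hu, rfl⟩)

/-- Homogeneous elements belong to `[Z ξ]`, where `Z` is the centre of `B`. -/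
lemma mem_closedSpan_lmul_center (h : ξ ∈ E.homog θ) :
    ξ ∈ closedSpan {ζ : E | ∃ c ∈ hB (1 : PAut B), ζ = E.lmul c ξ} := by
  obtain ⟨l, hl⟩ := exists_approxUnit_source θ
  have := hl.neBot
  refine (isClosed_closedSpan _).mem_of_tendsto (tendsto_rmul hl (inner_mem_homog h h))
    (hl.mem.mono fun u hu => mem_closedSpan ?_)
  obtain ⟨c, a, ha, hc⟩ := mem_dom_of_mem_hB hu
  refine ⟨a, hB_mono ?_ (conj_mem_hB hu ha), rmul_eq_lmul h ha⟩
  rw [← mul_assoc, PAut.mul_star_mul_self]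
  exact θ.mul_star_self_le_one

end Homog

end CStarBimod

namespace CStarBimod

variable {B : Type u} [NonUnitalCStarAlgebra B] [PartialOrder B] [StarOrderedRing B]

/-! ### Admissible right C*-bimodules -/

omit [PartialOrder B] [StarOrderedRing B] in
lemma eq_of_forall_mul_eq {a c : B} (h : ∀ b, a * b = c * b) : a = c := by
  have : (a - c) * star (a - c) = 0 := by rw [sub_mul, h, sub_self]
  exact sub_eq_zero.1 ((CStarRing.mul_star_self_eq_zero_iff _).1 this)

lemma star_mem_hB_one {c : B} (h : c ∈ hB (1 : PAut B)) : star c ∈ hB (1 : PAut B) := by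
  simpa using star_mem_hB h

/-- The isometry `c ↦ |c⟩`. -/
def ketI : B →ₗᵢ[ℂ] (unit B →L[ℂ] unit B) where
  toFun c := ket (E := unit B) c
  map_add' c d := ContinuousLinearMap.ext fun b => add_mul (R := B) c d b
  map_smul' z c := ContinuousLinearMap.ext fun b => smul_mul_assoc (β := B) z c b
  norm_map' c := (ContinuousLinearMap.isometry_mul ℂ B).norm_map_of_map_zero (map_zero _) c

/-- The isometry `c ↦ |c]`. -/
def ketI' : B →ₗᵢ[ℂ] (unit B →L[ℂ] unit B) where
  toFun c := ket' (E := unit B) c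
  map_add' c d := ContinuousLinearMap.ext fun b => mul_add (R := B) b c d
  map_smul' z c := ContinuousLinearMap.ext fun b => mul_smul_comm (β := B) z b c
  norm_map' c := (ContinuousLinearMap.isometry_mul_flip ℂ B).norm_map_of_map_zero (map_zero _) c

omit [PartialOrder B] [StarOrderedRing B] in
/-- The components of the families `|B⟩` and `|B]` are images of closed subspaces `M` of `B` under
an isometry `κ`, and vanish unless a condition `q` on the degree holds. Hence such a component is the
closed linear span of `P ⊆ κ(S) ∪ {0}` if and only if `S` is linearly dense in `M` whenever `q`
holds. -/
lemma closure_eq_iff {W : Type*} [NormedAddCommGroup W] [NormedSpace ℂ W] (κ : B →ₗᵢ[ℂ] W)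
    {P : Set W} {S : Set B} {q : Prop} (h1 : ∀ R ∈ P, R = 0 ∨ (q ∧ ∃ c ∈ S, R = κ c))
    (h2 : q → ∀ c ∈ S, κ c ∈ P) {M : Submodule ℂ B} (hM : IsClosed (M : Set B)) (hS : S ⊆ M) :
    (closure (Submodule.span ℂ P : Set W) = {T | T = 0 ∨ (q ∧ ∃ ξ ∈ M, T = κ ξ)}) ↔
      (q → ∀ c ∈ M, c ∈ closedSpan S) := by
  have hmap : ∀ N : Submodule ℂ B, IsClosed (N : Set B) →
      IsClosed ((N.map κ.toLinearMap : Submodule ℂ W) : Set W) := fun N hN =>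
    κ.isometry.isClosedEmbedding.isClosedMap _ hN
  have hle : ∀ N : Submodule ℂ B, IsClosed (N : Set B) → S ⊆ N →
      closedSpan P ≤ N.map κ.toLinearMap := fun N hN hSN => closedSpan_le (hmap N hN) fun R hR => by
    rcases h1 R hR with rfl | ⟨-, c, hc, rfl⟩
    · exact Submodule.zero_mem _
    · exact ⟨c, hSN hc, rfl⟩
  constructor
  · intro h hq c hc
    have h3 : κ c ∈ closedSpan P := by
      change κ c ∈ closure (Submodule.span ℂ P : Set W)
      rw [h]
      exact Or.inr ⟨hq, c, hc, rfl⟩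
    obtain ⟨d, hd, he⟩ := hle _ (isClosed_closedSpan S) (fun _ hx => mem_closedSpan hx) h3
    exact κ.injective he ▸ hd
  · intro h
    refine Set.Subset.antisymm (fun R hR => ?_) ?_
    · by_cases hq : q
      · obtain ⟨d, hd, rfl⟩ := hle M hM hS hR
        exact Or.inr ⟨hq, d, hd, rfl⟩
      · refine Or.inl ?_
        have : closedSpan P ≤ ⊥ := closedSpan_le isClosed_singleton fun R hR => by
          rcases h1 R hR with rfl | ⟨hq', -⟩
          · exact Submodule.zero_mem _
          · exact absurd hq' hq
        exact this hR
    · rintro R (rfl | ⟨hq, c, hc, rfl⟩)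
      · exact Submodule.zero_mem (closedSpan P)
      · exact mem_of_mem_closedSpan κ.toContinuousLinearMap (isClosed_closedSpan P)
          (fun x hx => mem_closedSpan (h2 hq x hx)) (h hq c hc)

variable (E : CStarBimod B)

/-- The inner products `⟨ξ|η⟩` of degree below `ρ`. -/
def innerSet (ρ : PAut B) : Set B := {c | ∃ r s, ∃ ξ ∈ E.homog r, ∃ η ∈ E.homog s,
  star r * s ≤ ρ ∧ c = E.inner ξ η}

/-- The elements `|ξ]* η` of degree below `σ*`. -/
def innerSet' (σ : PAut B) : Set B := {c | ∃ σ₁ σ₂, ∃ ξ ∈ E.homog σ₁, ∃ η ∈ E.homog (star σ₂),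
  σ₁ * σ₂ ≤ σ ∧ σ₁.Maps (E.inner ξ η) c}

lemma innerSet_subset (ρ : PAut B) : E.innerSet ρ ⊆ hB ρ := by
  rintro _ ⟨r, s, ξ, hξ, η, hη, hle, rfl⟩
  exact hB_mono hle (inner_mem_homog hξ hη)

lemma innerSet'_subset (σ : PAut B) : E.innerSet' σ ⊆ hB (star σ) := by
  rintro c ⟨σ₁, σ₂, ξ, hξ, η, hη, hle, h⟩
  have := PAut.star_le_star hle
  rw [star_mul] at this
  exact hB_mono this (maps_inner_mem_homog hξ hη h)

variable {E}

lemma eq_zero_of_isHomogAdjoint_zero {σ : PAut B} {S : E →L[ℂ] unit B}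
    (h : IsHomogAdjoint σ (0 : unit B →L[ℂ] E) S) : S = 0 :=
  ContinuousLinearMap.ext fun η => by
    have h1 : σ.Maps ((unit B).inner (S η) (S η)) (E.inner η 0) := h (S η) η
    rw [map_zero] at h1
    exact (CStarRing.star_mul_self_eq_zero_iff (E := B) (S η)).1 (σ.left_unique h1 σ.maps_zero)

/-- The adjoint of `|ξ⟩` is `η ↦ ⟨ξ|η⟩`. -/
lemma isHomogAdjoint_ket_iff {ξ : E} {S : E →L[ℂ] unit B} :
    IsHomogAdjoint 1 (ket ξ) S ↔ S = E.innerL ξ := by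
  have key : ∀ η (b : B), E.inner η (ket ξ b) = star (E.inner ξ η) * b := fun η b => by
    rw [E.star_inner]; exact E.inner_rmul η ξ b
  constructor
  · refine fun h => ContinuousLinearMap.ext fun η =>
      star_injective (R := B) (eq_of_forall_mul_eq fun b => ?_)
    have h1 : (unit B).inner (S η) b = E.inner η (ket ξ b) := h b η
    exact h1.trans (key η b)
  · rintro rfl b η
    exact (key η b).symm

/-- The adjoint of `|ξ]` is `η ↦ σ(⟨ξ|η⟩)`, where `σ` is the degree of `ξ`. -/
lemma isHomogAdjoint_ket'_iff {σ : PAut B} {ξ : E} (hξ : ξ ∈ E.homog σ) {S : E →L[ℂ] unit B} :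
    IsHomogAdjoint (star σ) (ket' ξ) S ↔ S = innerTw hξ := by
  have key : ∀ η (b : B), σ.Maps (E.inner η (ket' ξ b)) (star (innerTw hξ η) * b) := fun η b => by
    refine maps_inner_lmul hξ ?_ b
    rw [← E.star_inner]
    exact (maps_innerTw hξ η).star
  constructor
  · refine fun h => ContinuousLinearMap.ext fun η =>
      star_injective (R := B) (eq_of_forall_mul_eq fun b => ?_)
    have h1 : σ.Maps (E.inner η (ket' ξ b)) ((unit B).inner (S η) b) := h b η
    exact σ.right_unique h1 (key η b)
  · rintro rfl b η
    exact key η b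

lemma innerL_comp_ket (ξ η : E) : E.innerL ξ ∘L ket η = ketI (E.inner ξ η) :=
  ContinuousLinearMap.ext fun b => E.inner_rmul ξ η (b : B)

lemma innerTw_comp_ket' {σ : PAut B} {ξ : E} (hξ : ξ ∈ E.homog σ) (η : E) :
    (innerTw hξ : E →L[ℂ] unit B) ∘L ket' η = ketI' (innerTw hξ η) :=
  ContinuousLinearMap.ext fun b => innerTw_lmul hξ (b : B) η

/-- The condition `[|E⟩* |E⟩] = |B⟩` in terms of elements of `B`. -/
lemma ket_mul_iff : E.ketFam.adj.mul E.ketFam = (unit B).ketFam ↔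
    ∀ ρ, ∀ c ∈ hB ρ, c ∈ closedSpan (E.innerSet ρ) := by
  have key := fun ρ σ => closure_eq_iff (ketI (B := B)) (P := {R : unit B →L[ℂ] unit B |
      ∃ ρ' σ' ρ₁ σ₁, ∃ T' ∈ E.ketFam.adj ρ' σ', ∃ T ∈ E.ketFam ρ₁ σ₁,
        ρ' * ρ₁ ≤ ρ ∧ σ' * σ₁ ≤ σ ∧ R = T' ∘L T}) (q := σ = 1) (S := E.innerSet ρ)
      (M := hBSub ρ) (fun R => by
        rintro ⟨ρ', σ', ρ₁, σ₁, T', ⟨T₁, hT₁, hadj⟩, T, hT, hρ, hσ, rfl⟩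
        rcases hT with rfl | ⟨rfl, η, hη, rfl⟩
        · exact Or.inl (ContinuousLinearMap.comp_zero _)
        rcases hT₁ with rfl | ⟨hσ', ξ, hξ, rfl⟩
        · rw [eq_zero_of_isHomogAdjoint_zero hadj]
          exact Or.inl (ContinuousLinearMap.zero_comp _)
        rw [hσ', isHomogAdjoint_ket_iff] at hadj
        subst hadj
        have e : σ' = 1 := by rw [← star_star σ', hσ']; simp
        refine Or.inr ⟨PAut.eq_one_of_one_le (by simpa [e] using hσ), E.inner ξ η, ?_,
          innerL_comp_ket ξ η⟩
        exact ⟨star ρ', ρ₁, ξ, hξ, η, hη, by rwa [star_star], rfl⟩)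
      (by
        rintro rfl c ⟨r, s, ξ, hξ, η, hη, hle, rfl⟩
        refine ⟨star r, 1, s, 1, E.innerL ξ, ⟨ket ξ, Or.inr ⟨by simp, ξ, by simpa using hξ, rfl⟩,
          ?_⟩, ket η, Or.inr ⟨rfl, η, hη, rfl⟩, hle, by simp, (innerL_comp_ket ξ η).symm⟩
        rw [star_one]
        exact isHomogAdjoint_ket_iff.2 rfl)
      (isClosed_hB ρ) (E.innerSet_subset ρ)
  constructor
  · intro h ρ
    exact (key ρ 1).1 (congrFun (congrFun h ρ) 1) rfl
  · intro h
    funext ρ σ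
    exact (key ρ σ).2 fun _ => h ρ

/-- The condition `[|E]* |E]] = |B]` in terms of elements of `B`. -/
lemma ket'_mul_iff : E.ketFam'.adj.mul E.ketFam' = (unit B).ketFam' ↔
    ∀ σ, ∀ c ∈ hB (star σ), c ∈ closedSpan (E.innerSet' σ) := by
  have key := fun ρ σ => closure_eq_iff (ketI' (B := B)) (P := {R : unit B →L[ℂ] unit B |
      ∃ ρ' σ' ρ₁ σ₁, ∃ T' ∈ E.ketFam'.adj ρ' σ', ∃ T ∈ E.ketFam' ρ₁ σ₁,
        ρ' * ρ₁ ≤ ρ ∧ σ' * σ₁ ≤ σ ∧ R = T' ∘L T}) (q := ρ = 1) (S := E.innerSet' σ)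
      (M := hBSub (star σ)) (fun R => by
        rintro ⟨ρ', σ', ρ₁, σ₁, T', ⟨T₁, hT₁, hadj⟩, T, hT, hρ, hσ, rfl⟩
        rcases hT with rfl | ⟨rfl, η, hη, rfl⟩
        · exact Or.inl (ContinuousLinearMap.comp_zero _)
        rcases hT₁ with rfl | ⟨hρ', ξ, hξ, rfl⟩
        · rw [eq_zero_of_isHomogAdjoint_zero hadj]
          exact Or.inl (ContinuousLinearMap.zero_comp _)
        rw [star_star] at hξ
        rw [isHomogAdjoint_ket'_iff hξ] at hadj
        subst hadj
        have e : ρ' = 1 := by rw [← star_star ρ', hρ']; simp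
        refine Or.inr ⟨PAut.eq_one_of_one_le (by simpa [e] using hρ), innerTw hξ η, ?_,
          innerTw_comp_ket' hξ η⟩
        exact ⟨σ', σ₁, ξ, hξ, η, hη, hσ, maps_innerTw hξ η⟩)
      (by
        rintro rfl c ⟨r, s, ξ, hξ, η, hη, hle, hc⟩
        rw [eq_innerTw hξ hc]
        refine ⟨1, r, 1, s, innerTw hξ, ⟨ket' ξ, Or.inr ⟨by simp, ξ, by simpa using hξ, rfl⟩,
          (isHomogAdjoint_ket'_iff hξ).2 rfl⟩, ket' η, Or.inr ⟨rfl, η, hη, rfl⟩, by simp, hle,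
          (innerTw_comp_ket' hξ η).symm⟩)
      (isClosed_hB (star σ)) (E.innerSet'_subset σ)
  constructor
  · intro h σ
    exact (key 1 σ).1 (congrFun (congrFun h 1) σ) rfl
  · intro h
    funext ρ σ
    exact (key ρ σ).2 fun _ => h σ

variable {Θ : InvSemigroup B}

lemma IsAdmissible.mem_innerSet (h : E.IsAdmissible Θ) {ρ : PAut B} {c : B} (hc : c ∈ hB ρ) :
    c ∈ closedSpan (E.innerSet ρ) := ket_mul_iff.1 h.ket_mul ρ c hc

lemma IsAdmissible.mem_innerSet' (h : E.IsAdmissible Θ) {σ : PAut B} {c : B}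
    (hc : c ∈ hB (star σ)) : c ∈ closedSpan (E.innerSet' σ) := ket'_mul_iff.1 h.ket'_mul σ c hc

/-- The pairs `(θ, ξ)` with `θ ∈ Θ` and `ξ ∈ E_θ`. -/
abbrev HomogElt (Θ : InvSemigroup B) (E : CStarBimod B) : Type u :=
  {p : PAut B × E // p.1 ∈ Θ.carrier ∧ p.2 ∈ E.homog p.1}

lemma mem_homogSpan {S : Set (PAut B)} {x : E} :
    x ∈ E.homogSpan S ↔ x ∈ closedSpan {ξ : E | ∃ θ ∈ S, ξ ∈ E.homog θ} := by
  have : (⋃ θ ∈ S, E.homog θ) = {ξ : E | ∃ θ ∈ S, ξ ∈ E.homog θ} := by ext; simp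
  rw [homogSpan, this]; rfl

lemma isDecomposableOver_iff : E.IsDecomposableOver Θ ↔
    Dense (Submodule.span ℂ (Set.range fun p : HomogElt Θ E => p.1.2) : Set E) := by
  have : (Set.range fun p : HomogElt Θ E => p.1.2) = {ξ : E | ∃ θ ∈ Θ.carrier, ξ ∈ E.homog θ} := by
    ext ξ
    constructor
    · rintro ⟨p, rfl⟩
      exact ⟨p.1.1, p.2⟩
    · rintro ⟨θ, hθ, h⟩
      exact ⟨⟨(θ, ξ), hθ, h⟩, rfl⟩
  rw [this, IsDecomposableOver, Set.eq_univ_iff_forall]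
  exact forall_congr' fun x => mem_homogSpan

/-- The products are obtained from homogeneous elements of degree `1`, which form the centre of `B`
and reproduce all homogeneous elements. -/
lemma isAdmissible_unit (hB' : (unit B).IsDecomposable) (hs : (unit B).IsSupported Θ) :
    (unit B).IsAdmissible Θ where
  decomposable := by
    refine Set.eq_univ_iff_forall.2 fun x => mem_homogSpan.2 ?_
    have hx : x ∈ (unit B).homogSpan Set.univ := by rw [hB']; trivial
    refine closedSpan_le_closedSpan ?_ (mem_homogSpan.1 hx)
    rintro ξ ⟨θ, -, hξ⟩
    rw [hs θ] at hξ
    refine closedSpan_mono ?_ (mem_homogSpan.1 hξ)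
    rintro η ⟨φ, hφ, hη⟩
    exact ⟨φ, hφ.1, hη⟩
  ket_mul := ket_mul_iff.2 fun ρ c hc => by
    refine closedSpan_mono ?_ (mem_closedSpan_lmul_center (E := unit B) hc)
    rintro _ ⟨b, hb, rfl⟩
    refine ⟨1, ρ, @star B _ b, star_mem_hB_one (B := B) hb, c, hc, by simp, ?_⟩
    exact congrArg (fun x : B => x * c) (star_star (R := B) b).symm
  ket'_mul := ket'_mul_iff.2 fun σ c hc => by
    refine closedSpan_mono ?_ (mem_closedSpan_lmul_center (E := unit B) hc)
    rintro _ ⟨b, hb, rfl⟩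
    refine ⟨1, σ, @star B _ b, star_mem_hB_one (B := B) hb, c, hc, by simp, ?_⟩
    exact congrArg (fun x : B => x * c) (star_star (R := B) b)

variable {F : CStarBimod B}

lemma total_homog_tmul (hE : E.IsDecomposableOver Θ) (hF : F.IsDecomposableOver Θ) :
    Dense (Submodule.span ℂ (Set.range fun p : HomogElt Θ E × HomogElt Θ F =>
      (tmul p.1.1.2 p.2.1.2 : itp E F)) : Set (itp E F)) :=
  total_tmul_of (v := fun p : HomogElt Θ E => p.1.2) (w := fun p : HomogElt Θ F => p.1.2)
    (isDecomposableOver_iff.1 hE) (isDecomposableOver_iff.1 hF)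

/-- Admissibility passes to internal tensor products, because
`⟨ξ ⊗ η|ξ' ⊗ η'⟩ = ⟨η|⟨ξ|ξ'⟩η'⟩` and `|ξ ⊗ η]* (ξ' ⊗ η') = |ξ]* (ξ' (|η]* η'))`, and because the
central elements that reproduce `η'` and `ξ'` are approximated by values of the inner expressions
`⟨ξ|ξ'⟩` and `|η]* η'`, respectively. -/
lemma isAdmissible_itp (hE : E.IsAdmissible Θ) (hF : F.IsAdmissible Θ) :
    (itp E F).IsAdmissible Θ where
  decomposable := by
    rw [isDecomposableOver_iff]
    refine (total_homog_tmul hE.decomposable hF.decomposable).mono (Submodule.span_mono ?_)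
    rintro _ ⟨p, rfl⟩
    exact ⟨⟨(p.1.1.1 * p.2.1.1, _), Θ.mul_mem p.1.2.1 p.2.2.1,
      tmul_mem_homog p.1.2.2 p.2.2.2⟩, rfl⟩
  ket_mul := ket_mul_iff.2 fun ρ c hc => by
    refine closedSpan_le_closedSpan ?_ (hF.mem_innerSet hc)
    rintro _ ⟨r, s, η, hη, η', hη', hle, rfl⟩
    refine mem_of_mem_closedSpan (F.innerL η) (isClosed_closedSpan _) ?_
      (mem_closedSpan_lmul_center hη')
    rintro _ ⟨b, hb, rfl⟩
    refine mem_of_mem_closedSpan ((F.innerL η) ∘L F.lmulL.flip η') (isClosed_closedSpan _) ?_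
      (hE.mem_innerSet hb)
    rintro _ ⟨s', t', ξ, hξ, ξ', hξ', hle', rfl⟩
    refine mem_closedSpan ⟨s' * r, t' * s, _, tmul_mem_homog hξ hη, _, tmul_mem_homog hξ' hη', ?_,
      (inner_tmul ξ ξ' η η').symm⟩
    have := PAut.mul_le_mul (PAut.mul_right_le hle' (le_refl (star r))) (le_refl s)
    refine le_trans (le_of_eq ?_) (this.trans hle)
    simp only [star_mul, mul_assoc]
  ket'_mul := ket'_mul_iff.2 fun σ c hc => by
    refine closedSpan_le_closedSpan ?_ (hE.mem_innerSet' hc)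
    rintro _ ⟨a, s, ξ, hξ, ξ', hξ', hle, hm⟩
    rw [eq_innerTw hξ hm]
    refine mem_of_mem_closedSpan (innerTw hξ) (isClosed_closedSpan _) ?_
      (mem_closedSpan_rmul_center hξ')
    rintro _ ⟨b, hb, rfl⟩
    refine mem_of_mem_closedSpan (innerTw hξ ∘L E.rmulL.flip ξ') (isClosed_closedSpan _) ?_
      (hF.mem_innerSet' (σ := 1) (by simpa using hb))
    rintro n ⟨d, e, η, hη, η', hη', hle', hn⟩
    refine mem_closedSpan ⟨a * d, e * s, _, tmul_mem_homog hξ hη, tmul ξ' η', ?_, ?_, ?_⟩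
    · rw [star_mul]
      exact tmul_mem_homog hξ' hη'
    · have := PAut.mul_le_mul (PAut.mul_right_le hle' (le_refl a)) (le_refl s)
      refine le_trans (le_of_eq ?_) (this.trans hle)
      simp only [mul_assoc]
    · refine ⟨E.inner ξ ξ' * n, ?_, ?_⟩
      · rw [inner_tmul, eq_innerTw hη hn, ← innerTw_lmul]
        exact maps_innerTw hη _
      · rw [← E.inner_rmul]
        exact maps_innerTw hξ _

end CStarBimod

/-! ### Induced Hilbert spaces -/

section OperatorSpan

variable {H₁ H₂ H₃ : Type*} [NormedAddCommGroup H₁] [InnerProductSpace ℂ H₁] [CompleteSpace H₁]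
  [NormedAddCommGroup H₂] [InnerProductSpace ℂ H₂] [CompleteSpace H₂]
  [NormedAddCommGroup H₃] [InnerProductSpace ℂ H₃] [CompleteSpace H₃]

omit [CompleteSpace H₁] [CompleteSpace H₂] [CompleteSpace H₃] in
lemma comp_mem_of_mem_closedSpan {s : Set (H₂ →L[ℂ] H₃)} {t : Set (H₁ →L[ℂ] H₂)}
    {M : Submodule ℂ (H₁ →L[ℂ] H₃)} (hM : IsClosed (M : Set (H₁ →L[ℂ] H₃)))
    (h : ∀ x ∈ s, ∀ y ∈ t, x ∘L y ∈ M) {a : H₂ →L[ℂ] H₃} {b : H₁ →L[ℂ] H₂}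
    (ha : a ∈ closedSpan s) (hb : b ∈ closedSpan t) : a ∘L b ∈ M := by
  refine mem_of_mem_closedSpan (ContinuousLinearMap.compL ℂ H₁ H₂ H₃ a) hM (fun y hy => ?_) hb
  exact mem_of_mem_closedSpan ((ContinuousLinearMap.compL ℂ H₁ H₂ H₃).flip y) hM
    (fun x hx => h x hx y hy) ha

lemma adjoint_mem_of_mem_closedSpan {s : Set (H₁ →L[ℂ] H₂)} {M : Submodule ℂ (H₂ →L[ℂ] H₁)}
    (hM : IsClosed (M : Set (H₂ →L[ℂ] H₁))) (h : ∀ x ∈ s, x† ∈ M) {a : H₁ →L[ℂ] H₂}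
    (ha : a ∈ closedSpan s) : a† ∈ M :=
  mem_of_mem_closedSpan (ContinuousLinearMap.adjoint (𝕜 := ℂ) (E := H₁) (F := H₂)
    ).toContinuousLinearEquiv.toContinuousLinearMap hM h ha

lemma ext_inner_of_total {ι : Type*} {v : ι → H₁}
    (hv : Dense (Submodule.span ℂ (Set.range v) : Set H₁)) {x y : H₁}
    (h : ∀ i, ⟪v i, x⟫_ℂ = ⟪v i, y⟫_ℂ) : x = y := by
  have := adjoint_apply_eq_of_total (R := .id ℂ H₁) hv h
  rw [ContinuousLinearMap.adjoint_id] at this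
  exact this

end OperatorSpan

section Ind

variable {B : Type u} [NonUnitalCStarAlgebra B] [PartialOrder B] [StarOrderedRing B]
  {K : Type v} [NormedAddCommGroup K] [InnerProductSpace ℂ K] [CompleteSpace K]
  (π : B →⋆ₙₐ[ℂ] (K →L[ℂ] K)) (E F : CStarBimod B)

open CStarBimod

/-- The canonical map from the algebraic tensor product to `E ⊗_π 𝔎`. -/
def indOf : E ⊗[ℂ] K →ₗ[ℂ] IndSpace π E where
  toFun x := SepCompl.of (isPreInner_ind π E) x
  map_add' x y := map_add (SepCompl.of (isPreInner_ind π E)) x y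
  map_smul' c x := map_smul (SepCompl.of (isPreInner_ind π E)) c x

lemma denseRange_indOf : DenseRange (indOf π E) := SepCompl.denseRange_of (isPreInner_ind π E)

variable {E F}

lemma indTmul_eq (ξ : E) (ζ : K) : indTmul π ξ ζ = indOf π E (ξ ⊗ₜ ζ) := rfl

lemma inner_indTmul (ξ ξ' : E) (ζ ζ' : K) :
    ⟪indTmul π ξ ζ, indTmul π ξ' ζ'⟫_ℂ = ⟪ζ, π (E.inner ξ ξ') ζ'⟫_ℂ := by
  refine (SepCompl.form_of (isPreInner_ind π E) _ _).trans ?_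
  simp [indForm]

omit [PartialOrder B] [StarOrderedRing B] in
lemma inner_rep_left (b : B) (ζ ζ' : K) : ⟪π b ζ, ζ'⟫_ℂ = ⟪ζ, π (star b) ζ'⟫_ℂ := by
  rw [map_star, ContinuousLinearMap.star_eq_adjoint, ContinuousLinearMap.adjoint_inner_right]

omit [PartialOrder B] [StarOrderedRing B] in
lemma norm_rep_le (b : B) : ‖π b‖ ≤ ‖b‖ := NonUnitalStarAlgHom.norm_apply_le π b

lemma norm_indTmul_le (ξ : E) (ζ : K) : ‖indTmul π ξ ζ‖ ≤ ‖ξ‖ * ‖ζ‖ := by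
  refine abs_le_of_sq_le_sq' ?_ (by positivity) |>.2
  rw [(isNormForm_inner _).norm_sq, innerₛₗ_apply_apply, inner_indTmul]
  calc _ ≤ ‖ζ‖ * ‖π (E.inner ξ ξ) ζ‖ := norm_inner_le_norm _ _
    _ ≤ ‖ζ‖ * (‖E.inner ξ ξ‖ * ‖ζ‖) := by
      gcongr
      exact (ContinuousLinearMap.le_opNorm _ _).trans (by gcongr; exact norm_rep_le π _)
    _ = (‖ξ‖ * ‖ζ‖) ^ 2 := by rw [← E.norm_sq]; ring

variable (E) in
/-- The operators `ζ ↦ ξ ⊗ ζ`, as a function of `ξ ∈ E`. -/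
def indKet : E →L[ℂ] (K →L[ℂ] IndSpace π E) :=
  LinearMap.mkContinuous₂ (LinearMap.mk₂ ℂ (fun ξ ζ => indTmul π ξ ζ)
    (fun ξ ξ' ζ => by simp only [indTmul_eq, TensorProduct.add_tmul, map_add])
    (fun c ξ ζ => by rw [indTmul_eq, indTmul_eq, ← TensorProduct.smul_tmul', map_smul])
    (fun ξ ζ ζ' => by simp only [indTmul_eq, TensorProduct.tmul_add, map_add])
    (fun c ξ ζ => by rw [indTmul_eq, indTmul_eq, TensorProduct.tmul_smul, map_smul])) 1
    fun ξ ζ => by rw [one_mul]; exact norm_indTmul_le π ξ ζ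

lemma indKet_apply (ξ : E) (ζ : K) : indKet π E ξ ζ = indTmul π ξ ζ := rfl

variable (E) in
lemma total_indTmul : Dense (Submodule.span ℂ (Set.range fun p : E × K => indTmul π p.1 p.2) :
    Set (IndSpace π E)) := by
  refine (denseRange_indOf π E).mono ?_
  rintro _ ⟨x, rfl⟩
  induction x with
  | zero => rw [map_zero]; exact Submodule.zero_mem _
  | add w w' h h' => rw [map_add]; exact Submodule.add_mem _ h h'
  | tmul ξ ζ => exact Submodule.subset_span ⟨(ξ, ζ), rfl⟩

lemma total_indTmul_of {ι : Type*} {v : ι → E}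
    (hv : Dense (Submodule.span ℂ (Set.range v) : Set E)) :
    Dense (Submodule.span ℂ (Set.range fun p : ι × K => indTmul π (v p.1) p.2) :
      Set (IndSpace π E)) := by
  refine dense_of_forall_mem fun x => closedSpan_le_closedSpan ?_ (total_indTmul π E x)
  rintro _ ⟨p, rfl⟩
  refine mem_of_mem_closedSpan ((indKet π E).flip p.2) (isClosed_closedSpan _) ?_ (hv p.1)
  rintro _ ⟨i, rfl⟩
  exact mem_closedSpan ⟨(i, p.2), rfl⟩

lemma indTmul_rmul (b : B) (ξ : E) (ζ : K) : indTmul π (E.rmul b ξ) ζ = indTmul π ξ (π b ζ) :=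
  ext_inner_of_total (total_indTmul π E) fun p => by
    rw [inner_indTmul, inner_indTmul, E.inner_rmul, map_mul]; rfl

lemma indKet_adjoint_comp (ξ η : E) : (indKet π E ξ)† ∘L indKet π E η = π (E.inner ξ η) := by
  refine ContinuousLinearMap.ext fun ζ => ext_inner_left ℂ fun ζ' => ?_
  rw [ContinuousLinearMap.comp_apply, ContinuousLinearMap.adjoint_inner_right, indKet_apply,
    indKet_apply, inner_indTmul]

lemma norm_indKet (hπ : Function.Injective π) (ξ : E) : ‖indKet π E ξ‖ = ‖ξ‖ := by
  refine (sq_eq_sq₀ (norm_nonneg _) (norm_nonneg _)).1 ?_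
  rw [norm_sq_eq_norm_adjoint_comp, indKet_adjoint_comp, NonUnitalStarAlgHom.norm_map π hπ,
    E.norm_sq]

/-! ### Approximation of homogeneous elements by elements with degree in `Θ` -/

variable {Θ : InvSemigroup B}

/-- The closed linear span of the rank-one operators `|ξ⟩⟨η|`, where `ξ` and `η` belong to given
sets of homogeneous elements and their degrees `θ` and `φ` satisfy `θ φ* ≤ 1`. -/
def rankOneAlg (Θ : InvSemigroup B) (S : PAut B → Set E) :
    Submodule ℂ (IndSpace π E →L[ℂ] IndSpace π E) :=
  closedSpan {R | ∃ θ ∈ Θ.carrier, ∃ φ ∈ Θ.carrier, ∃ ξ ∈ S θ, ∃ η ∈ S φ, θ * star φ ≤ 1 ∧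
    R = indKet π E ξ ∘L (indKet π E η)†}

lemma mem_closedSpan_of_mem_hB (hs : (unit B).IsSupported Θ) {τ : PAut B} {b : B}
    (hb : b ∈ hB τ) :
    b ∈ closedSpan {c : B | ∃ ψ, (ψ ∈ Θ.carrier ∧ ψ ≤ τ) ∧ c ∈ hB ψ} :=
  (mem_homogSpan (E := unit B)).1 ((Set.ext_iff.1 (hs τ) b).1 hb)

lemma indKet_comp_rep (b : B) (ξ : E) : indKet π E ξ ∘L π b = indKet π E (E.rmul b ξ) :=
  ContinuousLinearMap.ext fun ζ => (indTmul_rmul π b ξ ζ).symm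

lemma rankOneAlg_mul_mem {S : PAut B → Set E} (hS : ∀ θ ∈ Θ.carrier, S θ ⊆ E.homog θ)
    (hmul : ∀ θ ∈ Θ.carrier, ∀ φ ∈ Θ.carrier, ∀ ξ ∈ S θ, ∀ b ∈ hB φ, E.rmul b ξ ∈ S (θ * φ))
    {a b : IndSpace π E →L[ℂ] IndSpace π E} (ha : a ∈ rankOneAlg π Θ S)
    (hb : b ∈ rankOneAlg π Θ S) : a ∘L b ∈ rankOneAlg π Θ S := by
  refine comp_mem_of_mem_closedSpan (isClosed_closedSpan _) ?_ ha hb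
  rintro _ ⟨θ, hθ, φ, hφ, ξ, hξ, η, hη, hle, rfl⟩ _ ⟨θ', hθ', φ', hφ', ξ', hξ', η', hη', hle', rfl⟩
  have h1 := inner_mem_homog (hS φ hφ hη) (hS θ' hθ' hξ')
  have h2 := Θ.mul_mem (Θ.star_mem hφ) hθ'
  refine mem_closedSpan ⟨θ * (star φ * θ'), Θ.mul_mem hθ h2, φ', hφ', _, hmul θ hθ _ h2 ξ hξ _ h1,
    η', hη', ?_, ?_⟩
  · rw [← mul_assoc, mul_assoc (θ * star φ)]
    exact PAut.mul_left_le hle hle'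
  · rw [← indKet_comp_rep, ← indKet_adjoint_comp]
    rfl

lemma rankOneAlg_adjoint_mem {S : PAut B → Set E} {a : IndSpace π E →L[ℂ] IndSpace π E}
    (ha : a ∈ rankOneAlg π Θ S) : a† ∈ rankOneAlg π Θ S := by
  refine adjoint_mem_of_mem_closedSpan (isClosed_closedSpan _) ?_ ha
  rintro _ ⟨θ, hθ, φ, hφ, ξ, hξ, η, hη, hle, rfl⟩
  refine mem_closedSpan ⟨φ, hφ, θ, hθ, η, hη, ξ, hξ, ?_, ?_⟩
  · have := PAut.star_le_star hle
    rwa [star_mul, star_star, star_one] at this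
  · rw [ContinuousLinearMap.adjoint_comp, ContinuousLinearMap.adjoint_adjoint]

/-- If elements with degree in `Θ` are total, then every homogeneous element is approximated by
elements whose degree lies in `Θ` and below its own.

An approximate unit of `rankOneAlg` converges to the identity on `E`, so that `x` is approximated by
sums of elements `ξ ⟨η|x⟩` with `θ φ* ≤ 1`, where `θ` and `φ` are the degrees of `ξ` and `η`. As `B`
is `Θ`-supported, `⟨η|x⟩` is approximated by elements with degrees `ψ ≤ φ* τ` in `Θ`, and then
`θ ψ ≤ θ φ* τ ≤ τ`. -/
theorem mem_closedSpan_of_total (hπ : Function.Injective π) (hs : (unit B).IsSupported Θ)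
    {S : PAut B → Set E} (hS : ∀ θ ∈ Θ.carrier, S θ ⊆ E.homog θ)
    (hmul : ∀ θ ∈ Θ.carrier, ∀ φ ∈ Θ.carrier, ∀ ξ ∈ S θ, ∀ b ∈ hB φ, E.rmul b ξ ∈ S (θ * φ))
    (htot : ∀ x, x ∈ closedSpan {ξ : E | ∃ θ ∈ Θ.carrier, ξ ∈ S θ}) {τ : PAut B} {x : E}
    (hx : x ∈ E.homog τ) :
    x ∈ closedSpan {ξ : E | ∃ θ ∈ Θ.carrier, θ ≤ τ ∧ ξ ∈ S θ} := by
  obtain ⟨l, hl⟩ := exists_isApproxUnitOf_operators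
    (M := rankOneAlg π Θ S) (isClosed_closedSpan _)
    (fun a ha b hb => rankOneAlg_mul_mem π hS hmul ha hb)
    fun a ha => rankOneAlg_adjoint_mem π ha
  have := hl.neBot
  -- the approximate unit of the algebra acts as an approximate unit on all of `E`
  have key : ∀ y : E, Tendsto (fun u => u ∘L indKet π E y) l (𝓝 (indKet π E y)) := by
    intro y
    refine closedSpan_induction
      (p := fun y => Tendsto (fun u => u ∘L indKet π E y) l (𝓝 (indKet π E y))) ?_ ?_ ?_ ?_ ?_
      (htot y)
    · rintro ξ ⟨θ, hθ, hξ⟩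
      exact hl.tendsto_comp' _ (mem_closedSpan ⟨θ, hθ, θ, hθ, ξ, hξ, ξ, hξ,
        θ.mul_star_self_le_one, rfl⟩)
    · simp
    · intro y z hy hz
      simpa only [map_add, ContinuousLinearMap.comp_add] using hy.add hz
    · intro c y hy
      simpa only [map_smul, ContinuousLinearMap.comp_smul] using hy.const_smul c
    · refine isClosed_of_closure_subset fun y hy => ?_
      change Tendsto _ _ _
      rw [Metric.tendsto_nhds]
      intro ε hε
      obtain ⟨z, hz, hyz⟩ := Metric.mem_closure_iff.1 hy (ε / 3) (by positivity)
      filter_upwards [Metric.tendsto_nhds.1 hz (ε / 3) (by positivity), hl.norm_le] with u hu hu'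
      rw [dist_eq_norm] at hu hyz ⊢
      have e : u ∘L indKet π E y - indKet π E y = u ∘L indKet π E (y - z) +
          (u ∘L indKet π E z - indKet π E z) - indKet π E (y - z) := by
        simp only [map_sub, ContinuousLinearMap.comp_sub]; abel
      have h1 : ‖u ∘L indKet π E (y - z)‖ ≤ ‖y - z‖ := by
        refine (ContinuousLinearMap.opNorm_comp_le _ _).trans ?_
        rw [norm_indKet π hπ]
        exact mul_le_of_le_one_left (norm_nonneg _) hu'
      rw [e]
      calc _ ≤ ‖u ∘L indKet π E (y - z)‖ + ‖u ∘L indKet π E z - indKet π E z‖ +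
            ‖indKet π E (y - z)‖ := (norm_sub_le _ _).trans (by gcongr; exact norm_add_le _ _)
        _ < ε / 3 + ε / 3 + ε / 3 := by
          rw [norm_indKet π hπ]
          gcongr
          exact h1.trans_lt hyz
        _ = ε := by ring
  let κ : E →ₗᵢ[ℂ] (K →L[ℂ] IndSpace π E) := ⟨(indKet π E).toLinearMap, norm_indKet π hπ⟩
  have hmem : indKet π E x ∈ (closedSpan {ξ : E | ∃ θ ∈ Θ.carrier, θ ≤ τ ∧ ξ ∈ S θ}).map
      κ.toLinearMap := by
    have hc := κ.isometry.isClosedEmbedding.isClosedMap _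
      (isClosed_closedSpan {ξ : E | ∃ θ ∈ Θ.carrier, θ ≤ τ ∧ ξ ∈ S θ})
    refine hc.mem_of_tendsto (key x) (hl.mem.mono fun u hu => ?_)
    refine mem_of_mem_closedSpan ((ContinuousLinearMap.compL ℂ K _ _).flip (indKet π E x))
      (M := (closedSpan {ξ : E | ∃ θ ∈ Θ.carrier, θ ≤ τ ∧ ξ ∈ S θ}).map κ.toLinearMap) hc ?_ hu
    rintro _ ⟨θ, hθ, φ, hφ, ξ, hξ, η, hη, hle, rfl⟩
    refine ⟨E.rmul (E.inner η x) ξ, ?_, ?_⟩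
    · have h1 := inner_mem_homog (hS φ hφ hη) hx
      replace h1 := mem_closedSpan_of_mem_hB hs h1
      refine mem_of_mem_closedSpan (E.rmulL.flip ξ) (isClosed_closedSpan _) ?_ h1
      rintro b ⟨ψ, ⟨hψ, hψ'⟩, hb⟩
      refine mem_closedSpan ⟨θ * ψ, Θ.mul_mem hθ hψ, ?_, hmul θ hθ ψ hψ ξ hξ b hb⟩
      refine (PAut.mul_le_mul le_rfl hψ').trans ?_
      rw [← mul_assoc]
      exact PAut.mul_left_le hle le_rfl
    · change indKet π E _ = (indKet π E ξ ∘L (indKet π E η)†) ∘L indKet π E x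
      rw [ContinuousLinearMap.comp_assoc, indKet_adjoint_comp, indKet_comp_rep]
  obtain ⟨y, hy, e⟩ := hmem
  exact κ.injective e ▸ hy

/-- Decomposable bimodules are `Θ`-supported if `B` is. -/
theorem mem_closedSpan_homog_of_le (hπ : Function.Injective π) (hs : (unit B).IsSupported Θ)
    (hE : E.IsDecomposableOver Θ) {τ : PAut B} {x : E} (hx : x ∈ E.homog τ) :
    x ∈ closedSpan {ξ : E | ∃ θ ∈ Θ.carrier, θ ≤ τ ∧ ξ ∈ E.homog θ} :=
  mem_closedSpan_of_total π hπ hs (S := fun θ => E.homog θ) (fun _ _ => subset_rfl)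
    (fun _ _ _ _ _ hξ _ hb => rmul_mem_homog hξ hb)
    (fun x => mem_homogSpan.1 (Set.eq_univ_iff_forall.1 hE x)) hx

end Ind

/-! ### Covariant representations -/

section OperatorSpan

variable {H₁ H₂ H₃ : Type*} [NormedAddCommGroup H₁] [InnerProductSpace ℂ H₁]
  [NormedAddCommGroup H₂] [InnerProductSpace ℂ H₂] [CompleteSpace H₂]
  [NormedAddCommGroup H₃] [InnerProductSpace ℂ H₃] [CompleteSpace H₃]

lemma adjoint_comp_mem_of_mem_closedSpan {s : Set (H₂ →L[ℂ] H₃)} {t : Set (H₁ →L[ℂ] H₃)}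
    {M : Submodule ℂ (H₁ →L[ℂ] H₂)} (hM : IsClosed (M : Set (H₁ →L[ℂ] H₂)))
    (h : ∀ x ∈ s, ∀ y ∈ t, x† ∘L y ∈ M) {a : H₂ →L[ℂ] H₃} {b : H₁ →L[ℂ] H₃}
    (ha : a ∈ closedSpan s) (hb : b ∈ closedSpan t) : a† ∘L b ∈ M := by
  let s' : Set (H₃ →L[ℂ] H₂) := {x | ∃ y ∈ s, x = y†}
  have h1 : a† ∈ closedSpan s' :=
    adjoint_mem_of_mem_closedSpan (M := closedSpan s') (isClosed_closedSpan s')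
      (fun x hx => mem_closedSpan (s := s') ⟨x, hx, rfl⟩) ha
  refine comp_mem_of_mem_closedSpan hM ?_ h1 hb
  rintro _ ⟨x, hx, rfl⟩ y hy
  exact h x hx y hy

end OperatorSpan

section Covariant

variable {B : Type u} [NonUnitalCStarAlgebra B]
  {Θ : InvSemigroup B} {K : Type v} [NormedAddCommGroup K] [InnerProductSpace ℂ K] [CompleteSpace K]
  {π : B →⋆ₙₐ[ℂ] (K →L[ℂ] K)} {υ : Θ.carrier → (K →L[ℂ] K)}

open CStarBimod

namespace InvSemigroup

instance : Mul Θ.carrier := ⟨fun θ φ => ⟨θ.1 * φ.1, Θ.mul_mem θ.2 φ.2⟩⟩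

instance : Star Θ.carrier := ⟨fun θ => ⟨star θ.1, Θ.star_mem θ.2⟩⟩

lemma coe_mul (θ φ : Θ.carrier) : (θ * φ).1 = θ.1 * φ.1 := rfl

lemma coe_star (θ : Θ.carrier) : (star θ).1 = star θ.1 := rfl

lemma star_mul_self_idem (θ : Θ.carrier) : star θ * θ * (star θ * θ) = star θ * θ :=
  Subtype.ext (by
    simp only [coe_mul, coe_star]
    rw [mul_assoc, ← mul_assoc θ.1, PAut.mul_star_mul_self])

end InvSemigroup

open InvSemigroup

namespace IsCovariant

variable (hcov : IsCovariant Θ π υ)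
include hcov

lemma mul_eq (θ φ : Θ.carrier) : υ θ ∘L υ φ = υ (θ * φ) := hcov.map_mul θ φ

lemma star_eq (θ : Θ.carrier) : υ (star θ) = (υ θ)† :=
  ((ContinuousLinearMap.star_eq_adjoint _).symm.trans (hcov.map_star θ)).symm

lemma star_mul_eq (θ φ : Θ.carrier) : (υ θ)† ∘L (υ φ)† = (υ (φ * θ))† := by
  rw [← ContinuousLinearMap.adjoint_comp, hcov.mul_eq]

/-- The operator of an idempotent is the projection onto the image of its ideal. -/
lemma comp_rep {φ : Θ.carrier} (h : φ * φ = φ) {b : B} (hb : b ∈ φ.1.img) :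
    υ φ ∘L π b = π b := by
  refine ContinuousLinearMap.ext fun ζ => ?_
  have h1 : π b ζ ∈ Set.range (υ φ) := by
    rw [hcov.range_eq]
    exact subset_closure (Submodule.subset_span ⟨b, hb, ζ, rfl⟩)
  obtain ⟨x, hx⟩ := h1
  rw [ContinuousLinearMap.comp_apply, ← hx, ← ContinuousLinearMap.comp_apply, hcov.mul_eq, h]

omit hcov in
lemma rep_adjoint (b : B) : (π b)† = π (star b) :=
  ((StarHomClass.map_star π b).trans (ContinuousLinearMap.star_eq_adjoint _)).symm

lemma rep_comp {φ : Θ.carrier} (h : φ * φ = φ) (h' : star φ = φ) {b : B} (hb : b ∈ φ.1.img) :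
    π b ∘L υ φ = π b := by
  have h1 := congrArg ContinuousLinearMap.adjoint (hcov.comp_rep h (PAut.star_mem_img hb))
  rwa [ContinuousLinearMap.adjoint_comp, rep_adjoint, star_star, ← hcov.star_eq, h'] at h1

lemma rep_comp_source (θ : Θ.carrier) {b : B} (hb : b ∈ θ.1.dom) :
    π b ∘L υ (star θ * θ) = π b := by
  refine hcov.rep_comp (star_mul_self_idem θ) (Subtype.ext ?_) ?_
  · simp only [coe_mul, coe_star, star_mul, star_star]
  · obtain ⟨c, hc⟩ := hb
    exact ⟨b, c, hc, hc⟩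

/-- The covariance relation `υ(θ) π(b) = π(θ(b)) υ(θ)`. -/
lemma intertwine {θ : Θ.carrier} {b c : B} (h : θ.1.Maps b c) : υ θ ∘L π b = π c ∘L υ θ := by
  have h1 : (υ θ ∘L π b ∘L (υ θ)†) ∘L υ θ = π c ∘L υ θ := by
    have := hcov.conj θ b c h
    rw [ContinuousLinearMap.star_eq_adjoint] at this
    exact congrArg (fun T => T ∘L υ θ) this
  rw [← h1, ContinuousLinearMap.comp_assoc, ContinuousLinearMap.comp_assoc, ← hcov.star_eq,
    hcov.mul_eq, hcov.rep_comp_source θ ⟨c, h⟩]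

lemma intertwine' {θ : Θ.carrier} {b c : B} (h : θ.1.Maps b c) :
    π b ∘L (υ θ)† = (υ θ)† ∘L π c := by
  rw [← hcov.star_eq]
  exact (hcov.intertwine (θ := star θ) (b := c) (c := b) h).symm

lemma one_mul (h1 : 1 ∈ Θ.carrier) (θ : Θ.carrier) : υ ⟨1, h1⟩ ∘L υ θ = υ θ := by
  rw [hcov.mul_eq]; congr 1; exact Subtype.ext (_root_.one_mul θ.1)

lemma adjoint_one (h1 : 1 ∈ Θ.carrier) : (υ ⟨1, h1⟩)† = υ ⟨1, h1⟩ := by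
  rw [← hcov.star_eq]; congr 1; exact Subtype.ext (star_one _)

lemma adjoint_mul_one (h1 : 1 ∈ Θ.carrier) (θ : Θ.carrier) :
    (υ θ)† ∘L υ ⟨1, h1⟩ = (υ θ)† := by
  rw [← hcov.star_eq, hcov.mul_eq]; congr 1; exact Subtype.ext (_root_.mul_one _)

end IsCovariant

/-! ### The operators `|ξ⟩ ⊗ Id` and `|ξ] ⊗ υ(θ)*` -/

variable [PartialOrder B] [StarOrderedRing B]

variable (π) in
lemma exists_indV : ∃ V : IndSpace π (unit B) →ₗᵢ[ℂ] K,
    ∀ (b : B) (ζ : K), V (indTmul π (E := unit B) b ζ) = π b ζ := by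
  obtain ⟨V, hV, -⟩ := exists_linearIsometry_of_gram (isNormForm_inner (IndSpace π (unit B)))
    (isNormForm_inner K) (total_indTmul π (unit B)) (fun p => π (p.1 : B) p.2) fun p q => by
      rw [innerₛₗ_apply_apply, innerₛₗ_apply_apply, inner_indTmul]
      refine (inner_rep_left π (p.1 : B) _ _).trans ?_
      exact congrArg (fun T : K →L[ℂ] K => ⟪p.2, T q.2⟫_ℂ)
        (map_mul π (star (R := B) p.1) (q.1 : B)).symm
  exact ⟨V, fun b ζ => hV (b, ζ)⟩

variable (π) in
/-- The isometry `B ⊗_π 𝔎 → 𝔎`, `b ⊗ ζ ↦ π(b)ζ`. -/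
def indV : IndSpace π (unit B) →L[ℂ] K := (exists_indV π).choose.toContinuousLinearMap

lemma indV_indTmul (b : B) (ζ : K) : indV π (indTmul π (E := unit B) b ζ) = π b ζ :=
  (exists_indV π).choose_spec b ζ

lemma indV_adjoint_comp : (indV π)† ∘L indV π = .id ℂ _ := by
  refine ContinuousLinearMap.ext fun x => ext_inner_left ℂ fun y => ?_
  rw [ContinuousLinearMap.comp_apply, ContinuousLinearMap.adjoint_inner_right]
  exact LinearIsometry.inner_map_map _ y x

lemma norm_indV_le : ‖indV π‖ ≤ 1 := LinearIsometry.norm_toContinuousLinearMap_le _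

variable (π) in
/-- The operators `ζ ↦ b ⊗ ζ` from `𝔎` to `B ⊗_π 𝔎`. -/
def unitKet : B →L[ℂ] (K →L[ℂ] IndSpace π (unit B)) := indKet π (unit B)

lemma indV_comp_unitKet (b : B) : indV π ∘L unitKet π b = π b :=
  ContinuousLinearMap.ext fun ζ => indV_indTmul b ζ

lemma unitKet_eq (b : B) : unitKet π b = (indV π)† ∘L π b := by
  rw [← indV_comp_unitKet, ← ContinuousLinearMap.comp_assoc, indV_adjoint_comp]
  rfl

lemma indV_comp_adjoint_comp_rep (b : B) : indV π ∘L (indV π)† ∘L π b = π b := by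
  rw [← unitKet_eq, indV_comp_unitKet]

lemma clm_ext_unit {H : Type*} [NormedAddCommGroup H] [NormedSpace ℂ H]
    {S T : IndSpace π (unit B) →L[ℂ] H} (h : ∀ b, S ∘L unitKet π b = T ∘L unitKet π b) : S = T :=
  clm_ext_of_total (total_indTmul π (unit B)) fun p =>
    congrArg (fun T : K →L[ℂ] H => T p.2) (h p.1)

section Kets

variable {E F : CStarBimod B} {ξ η : E}

lemma indKet_ext {H : Type*} [NormedAddCommGroup H] [InnerProductSpace ℂ H] [CompleteSpace H]
    {S T : H →L[ℂ] IndSpace π E} (h : ∀ η, (indKet π E η)† ∘L S = (indKet π E η)† ∘L T) :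
    S = T := by
  refine ContinuousLinearMap.ext fun x => _root_.ext_inner_of_total (total_indTmul π E) fun p => ?_
  rw [← indKet_apply, ← ContinuousLinearMap.adjoint_inner_right,
    ← ContinuousLinearMap.adjoint_inner_right]
  exact congrArg (fun T : H →L[ℂ] K => ⟪p.2, T x⟫_ℂ) (h p.1)

lemma clm_ext_ind {H : Type*} [NormedAddCommGroup H] [NormedSpace ℂ H]
    {S T : IndSpace π E →L[ℂ] H} {ι : Type*} {v : ι → E}
    (hv : Dense (Submodule.span ℂ (Set.range v) : Set E))
    (h : ∀ i, S ∘L indKet π E (v i) = T ∘L indKet π E (v i)) : S = T :=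
  clm_ext_of_total (total_indTmul_of π hv) fun p =>
    congrArg (fun T : K →L[ℂ] H => T p.2) (h p.1)

variable (hcov : IsCovariant Θ π υ)
include hcov

/-- For a `θ`-homogeneous `ξ`, one has `b ξ ⊗ υ(θ)* ζ = ξ ⊗ υ(θ)* π(b) ζ`, so that the operator
`|ξ] ⊗ υ(θ)*` maps `b ⊗ ζ` to `ξ ⊗ υ(θ)* π(b) ζ`. -/
lemma indKet_lmul_comp {θ : Θ.carrier} (hξ : ξ ∈ E.homog θ.1) (b : B) :
    indKet π E (E.lmul b ξ) ∘L (υ θ)† = indKet π E ξ ∘L (υ θ)† ∘L π b := by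
  refine indKet_ext fun η => ?_
  obtain ⟨c, hc⟩ := inner_mem_dom hξ η
  rw [← ContinuousLinearMap.comp_assoc, ← ContinuousLinearMap.comp_assoc, indKet_adjoint_comp,
    indKet_adjoint_comp, hcov.intertwine' (maps_inner_lmul hξ hc b),
    ← ContinuousLinearMap.comp_assoc, hcov.intertwine' hc, map_mul]
  rfl

lemma indKet_comp_source {θ : Θ.carrier} (hξ : ∀ η, E.inner η ξ ∈ θ.1.dom) :
    indKet π E ξ ∘L υ (star θ * θ) = indKet π E ξ := by
  refine indKet_ext fun η => ?_
  rw [← ContinuousLinearMap.comp_assoc, indKet_adjoint_comp,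
    hcov.rep_comp_source θ (hξ η)]

lemma indKet_comp_one (h1 : 1 ∈ Θ.carrier) (ξ : E) :
    indKet π E ξ ∘L υ ⟨1, h1⟩ = indKet π E ξ := by
  refine indKet_ext fun η => ?_
  rw [← ContinuousLinearMap.comp_assoc, indKet_adjoint_comp,
    hcov.rep_comp (φ := ⟨1, h1⟩) (Subtype.ext (mul_one _)) (Subtype.ext (star_one _)) ⟨_, rfl⟩]

/-- The operator `|ξ] ⊗ υ(θ)*` does not change if the degree `θ` of `ξ` is replaced by a larger
one. -/
lemma indKet_comp_adjoint_of_le {φ σ : Θ.carrier} (h : φ.1 ≤ σ.1) (hξ : ξ ∈ E.homog φ.1) :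
    indKet π E ξ ∘L (υ φ)† = indKet π E ξ ∘L (υ σ)† := by
  have e : star φ = star φ * φ * star σ := Subtype.ext <| by
    have := PAut.eq_mul_of_le (PAut.star_le_star h)
    rwa [star_star] at this
  rw [← hcov.star_eq φ, e, ← hcov.mul_eq, ← ContinuousLinearMap.comp_assoc,
    indKet_comp_source hcov (inner_mem_dom hξ), hcov.star_eq]

/-- The range of the isometry `B ⊗_π 𝔎 → 𝔎` is the range of the projection `υ(Id)`. -/
lemma indV_comp_adjoint (h1 : 1 ∈ Θ.carrier) : indV π ∘L (indV π)† = υ ⟨1, h1⟩ := by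
  have e1 : υ ⟨1, h1⟩ ∘L indV π = indV π := clm_ext_unit fun b => by
    rw [ContinuousLinearMap.comp_assoc, indV_comp_unitKet,
      hcov.comp_rep (φ := ⟨1, h1⟩) (Subtype.ext (mul_one _)) ⟨_, rfl⟩]
  have e2 : (indV π)† ∘L υ ⟨1, h1⟩ = (indV π)† := by
    rw [← hcov.adjoint_one h1, ← ContinuousLinearMap.adjoint_comp, e1]
  rw [← e2]
  refine ContinuousLinearMap.ext fun x => ?_
  have hx : υ ⟨1, h1⟩ x ∈ closedSpan {y : K | ∃ c ∈ (1 : PAut B).img, ∃ x, y = π c x} := by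
    have : υ ⟨1, h1⟩ x ∈ Set.range (υ ⟨1, h1⟩) := ⟨x, rfl⟩
    rwa [hcov.range_eq] at this
  refine closedSpan_induction (p := fun y => indV π (((indV π)†) y) = y) ?_ (by simp)
    (fun x y hx hy => by simp only [map_add, hx, hy]) (fun c x hx => by simp only [map_smul, hx])
    (isClosed_eq (by fun_prop) continuous_id) hx
  rintro _ ⟨c, -, x, rfl⟩
  exact congrArg (fun T : K →L[ℂ] K => T x) (indV_comp_adjoint_comp_rep (π := π) c)

lemma indKet_comp_indV_comp_adjoint (h1 : 1 ∈ Θ.carrier) (ξ : E) :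
    (indKet π E ξ ∘L indV π) ∘L (indV π)† = indKet π E ξ := by
  rw [ContinuousLinearMap.comp_assoc, indV_comp_adjoint hcov h1, indKet_comp_one hcov]

lemma indKet_comp_adjoint_comp_indV (h1 : 1 ∈ Θ.carrier) {θ : Θ.carrier}
    (hξ : ∀ η, E.inner η ξ ∈ θ.1.dom) :
    (indKet π E ξ ∘L (υ θ)† ∘L indV π) ∘L (indV π)† ∘L υ θ = indKet π E ξ := by
  have : (indKet π E ξ ∘L (υ θ)† ∘L indV π) ∘L (indV π)† ∘L υ θ =
    indKet π E ξ ∘L (υ θ)† ∘L (indV π ∘L (indV π)†) ∘L υ θ := rfl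
  rw [this, indV_comp_adjoint hcov h1, hcov.one_mul, ← hcov.star_eq, hcov.mul_eq,
    indKet_comp_source hcov hξ]

omit hcov in
variable (π E) in
/-- The operators `|ξ⟩ ⊗ Id : b ⊗ ζ ↦ ξ b ⊗ ζ`, as a function of `ξ ∈ E`. -/
def indA : E →L[ℂ] (IndSpace π (unit B) →L[ℂ] IndSpace π E) :=
  (ContinuousLinearMap.compL ℂ _ _ _).flip (indV π) ∘L indKet π E

omit hcov in
variable (π υ E) in
/-- The operators `|ξ] ⊗ υ(θ)* : b ⊗ ζ ↦ b ξ ⊗ υ(θ)* ζ`, as a function of `ξ`. The formula is valid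
for `θ`-homogeneous `ξ`. -/
def indB (θ : Θ.carrier) : E →L[ℂ] (IndSpace π (unit B) →L[ℂ] IndSpace π E) :=
  (ContinuousLinearMap.compL ℂ _ _ _).flip ((υ θ)† ∘L indV π) ∘L indKet π E

omit hcov in
lemma indA_eq (ξ : E) : indA π E ξ = indKet π E ξ ∘L indV π := rfl

omit hcov in
lemma indB_eq (θ : Θ.carrier) (ξ : E) : indB π υ E θ ξ = indKet π E ξ ∘L (υ θ)† ∘L indV π := rfl

omit hcov in
lemma indA_comp_unitKet (ξ : E) (b : B) :
    indA π E ξ ∘L unitKet π b = indKet π E (E.rmul b ξ) := by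
  rw [indA_eq, ContinuousLinearMap.comp_assoc, indV_comp_unitKet, indKet_comp_rep]

lemma indB_comp_unitKet {θ : Θ.carrier} (hξ : ξ ∈ E.homog θ.1) (b : B) :
    indB π υ E θ ξ ∘L unitKet π b = indKet π E (E.lmul b ξ) ∘L (υ θ)† := by
  rw [indKet_lmul_comp hcov hξ, indB_eq, ContinuousLinearMap.comp_assoc,
    ContinuousLinearMap.comp_assoc, indV_comp_unitKet]

lemma norm_indA (h1 : 1 ∈ Θ.carrier) (hπ : Function.Injective π) (ξ : E) :
    ‖indA π E ξ‖ = ‖ξ‖ := by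
  refine le_antisymm ?_ ?_
  · rw [indA_eq, ← norm_indKet π hπ ξ]
    exact (ContinuousLinearMap.opNorm_comp_le _ _).trans
      (mul_le_of_le_one_right (norm_nonneg _) norm_indV_le)
  · rw [← norm_indKet π hπ ξ, ← indKet_comp_indV_comp_adjoint hcov h1]
    refine (ContinuousLinearMap.opNorm_comp_le _ _).trans
      (mul_le_of_le_one_right (norm_nonneg _) ?_)
    rw [LinearIsometryEquiv.norm_map]
    exact norm_indV_le

/-! ### The spaces `α(E)` and `β(E)` -/

omit hcov in
lemma isIndMap_ket_iff {R : IndSpace π (unit B) →L[ℂ] IndSpace π E} :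
    IsIndMap π (ket ξ) (.id ℂ K) R ↔ R = indA π E ξ := by
  constructor
  · intro h
    refine clm_ext_unit fun b => ContinuousLinearMap.ext fun ζ => ?_
    rw [indA_comp_unitKet]
    exact h b ζ
  · rintro rfl b ζ
    exact congrArg (fun T : K →L[ℂ] _ => T ζ) (indA_comp_unitKet ξ b)

lemma isIndMap_ket_one_iff (h1 : 1 ∈ Θ.carrier) {R : IndSpace π (unit B) →L[ℂ] IndSpace π E} :
    IsIndMap π (ket ξ) (υ ⟨1, h1⟩) R ↔ R = indA π E ξ := by
  rw [← isIndMap_ket_iff]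
  refine forall_congr' fun b => forall_congr' fun ζ => ?_
  have := congrArg (fun T : K →L[ℂ] _ => T ζ) (indKet_comp_one hcov h1 (ket ξ b))
  exact Eq.congr_right this

lemma isIndMap_ket'_iff {θ : Θ.carrier} (hξ : ξ ∈ E.homog θ.1)
    {R : IndSpace π (unit B) →L[ℂ] IndSpace π E} :
    IsIndMap π (ket' ξ) ((υ θ)†) R ↔ R = indB π υ E θ ξ := by
  constructor
  · intro h
    refine clm_ext_unit fun b => ContinuousLinearMap.ext fun ζ => ?_
    rw [indB_comp_unitKet hcov hξ]
    exact h b ζ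
  · rintro rfl b ζ
    exact congrArg (fun T : K →L[ℂ] _ => T ζ) (indB_comp_unitKet hcov hξ b)

omit hcov in
lemma eq_zero_of_isIndMap_zero {V : K →L[ℂ] K} {R : IndSpace π (unit B) →L[ℂ] IndSpace π E}
    (h : IsIndMap π 0 V R) : R = 0 :=
  clm_ext_unit fun b => ContinuousLinearMap.ext fun ζ =>
    (h b ζ).trans (congrArg (fun T : K →L[ℂ] _ => T (V ζ)) (map_zero (indKet π E)))

lemma indBeta_eq (h1 : 1 ∈ Θ.carrier) : indBeta π E υ = closedSpan
    {R | ∃ θ : Θ.carrier, ∃ ξ ∈ E.homog θ.1, R = indB π υ E θ ξ} := by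
  refine le_antisymm (closedSpan_le (isClosed_closedSpan _) ?_) (closedSpan_mono ?_)
  · rintro R ⟨ρ, σ, T, rfl | ⟨-, ξ, hξ, rfl⟩, hR⟩
    · rw [eq_zero_of_isIndMap_zero hR]; exact Submodule.zero_mem _
    · have e : υ σ = (υ (star σ))† := by rw [← hcov.star_eq]; rfl
      rw [e] at hR
      have hR' := (isIndMap_ket'_iff hcov (θ := star σ) hξ).1 hR
      exact mem_closedSpan ⟨star σ, ξ, hξ, hR'⟩
  · rintro R ⟨θ, ξ, hξ, rfl⟩
    refine ⟨⟨1, h1⟩, star θ, ket' ξ, Or.inr ⟨rfl, ξ, hξ, rfl⟩, ?_⟩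
    rw [hcov.star_eq]
    exact (isIndMap_ket'_iff hcov hξ).2 rfl

lemma indB_mem (h1 : 1 ∈ Θ.carrier) (θ : Θ.carrier) (hξ : ξ ∈ E.homog θ.1) :
    indB π υ E θ ξ ∈ indBeta π E υ := by
  rw [indBeta_eq hcov h1]
  exact mem_closedSpan ⟨θ, ξ, hξ, rfl⟩

lemma indA_mem (h1 : 1 ∈ Θ.carrier) (hE : E.IsDecomposableOver Θ) (ξ : E) :
    indA π E ξ ∈ indAlpha π E υ := by
  have hξ : ξ ∈ closedSpan (Set.range fun p : HomogElt Θ E => p.1.2) :=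
    isDecomposableOver_iff.1 hE ξ
  refine mem_of_mem_closedSpan (indA π E) (Submodule.isClosed_topologicalClosure _) ?_ hξ
  rintro _ ⟨p, rfl⟩
  exact mem_closedSpan ⟨⟨p.1.1, p.2.1⟩, ⟨1, h1⟩, ket p.1.2, Or.inr ⟨rfl, _, p.2.2, rfl⟩,
    (isIndMap_ket_one_iff hcov h1).2 rfl⟩

/-- The space `α(E)` consists of the operators `|ξ⟩ ⊗ Id` only: they form a closed subspace, because
`ξ ↦ |ξ⟩ ⊗ Id` is isometric. -/
lemma mem_indAlpha_iff (h1 : 1 ∈ Θ.carrier) (hπ : Function.Injective π)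
    (hE : E.IsDecomposableOver Θ) {R : IndSpace π (unit B) →L[ℂ] IndSpace π E} :
    R ∈ indAlpha π E υ ↔ ∃ ξ, R = indA π E ξ := by
  refine ⟨fun hR => ?_, fun ⟨ξ, h⟩ => h ▸ indA_mem hcov h1 hE ξ⟩
  let κ : E →ₗᵢ[ℂ] (IndSpace π (unit B) →L[ℂ] IndSpace π E) :=
    ⟨(indA π E).toLinearMap, norm_indA hcov h1 hπ⟩
  have hc : IsClosed (Set.range κ.toLinearMap) := κ.isometry.isClosedEmbedding.isClosed_range
  have : R ∈ LinearMap.range κ.toLinearMap := by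
    refine closedSpan_le (by rwa [LinearMap.coe_range]) ?_ hR
    rintro R ⟨ρ, σ, T, rfl | ⟨h, ξ, hξ, rfl⟩, hR⟩
    · rw [eq_zero_of_isIndMap_zero hR]; exact Submodule.zero_mem _
    · obtain rfl : σ = ⟨1, h1⟩ := Subtype.ext h
      exact ⟨ξ, ((isIndMap_ket_one_iff hcov h1).1 hR).symm⟩
  obtain ⟨ξ, rfl⟩ := this
  exact ⟨ξ, rfl⟩

end Kets

end Covariant

section Covariant

variable {B : Type u} [NonUnitalCStarAlgebra B] [PartialOrder B] [StarOrderedRing B]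
  {Θ : InvSemigroup B} {K : Type v} [NormedAddCommGroup K] [InnerProductSpace ℂ K] [CompleteSpace K]
  {π : B →⋆ₙₐ[ℂ] (K →L[ℂ] K)} {υ : Θ.carrier → (K →L[ℂ] K)}

open CStarBimod InvSemigroup

variable {E F : CStarBimod B} {ξ η : E}

/-! ### Products of the operators `|ξ⟩ ⊗ Id` and `|ξ] ⊗ υ(θ)*` -/

variable (π) in
/-- The operators `b ⊗ ζ ↦ c b ⊗ ζ` on `B ⊗_π 𝔎`. -/
def unitA : B →L[ℂ] (IndSpace π (unit B) →L[ℂ] IndSpace π (unit B)) := indA π (unit B)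

variable (π υ) in
/-- The operators `b ⊗ ζ ↦ b c ⊗ υ(θ)* ζ` on `B ⊗_π 𝔎`. -/
def unitB (θ : Θ.carrier) : B →L[ℂ] (IndSpace π (unit B) →L[ℂ] IndSpace π (unit B)) :=
  indB π υ (unit B) θ

lemma unitA_eq (b : B) : unitA π b = (indV π)† ∘L π b ∘L indV π :=
  congrArg (fun T => T ∘L indV π) (unitKet_eq b)

lemma unitB_eq (θ : Θ.carrier) (c : B) :
    unitB π υ θ c = (indV π)† ∘L π c ∘L (υ θ)† ∘L indV π :=
  congrArg (fun T => T ∘L (υ θ)† ∘L indV π) (unitKet_eq c)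

lemma indA_adjoint_comp (ξ η : E) : (indA π E ξ)† ∘L indA π E η = unitA π (E.inner ξ η) := by
  rw [unitA_eq, ← indKet_adjoint_comp, indA_eq, indA_eq, ContinuousLinearMap.adjoint_comp]
  rfl

lemma comp_indV_comp_unitA {H : Type*} [NormedAddCommGroup H] [NormedSpace ℂ H] (T : K →L[ℂ] H)
    (b : B) : (T ∘L indV π) ∘L unitA π b = T ∘L π b ∘L indV π := by
  have : (T ∘L indV π) ∘L unitA π b = T ∘L (indV π ∘L unitKet π b) ∘L indV π := rfl
  rw [this, indV_comp_unitKet]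

lemma comp_indV_comp_unitB {H : Type*} [NormedAddCommGroup H] [NormedSpace ℂ H] (T : K →L[ℂ] H)
    (θ : Θ.carrier) (c : B) :
    (T ∘L indV π) ∘L unitB π υ θ c = T ∘L π c ∘L (υ θ)† ∘L indV π := by
  have : (T ∘L indV π) ∘L unitB π υ θ c = T ∘L (indV π ∘L unitKet π c) ∘L (υ θ)† ∘L indV π := rfl
  rw [this, indV_comp_unitKet]

lemma indA_comp_unitA (ξ : E) (b : B) : indA π E ξ ∘L unitA π b = indA π E (E.rmul b ξ) := by
  rw [indA_eq, comp_indV_comp_unitA, ← ContinuousLinearMap.comp_assoc, indKet_comp_rep]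
  rfl

lemma indA_comp_unitB (ξ : E) (θ : Θ.carrier) (c : B) :
    indA π E ξ ∘L unitB π υ θ c = indB π υ E θ (E.rmul c ξ) := by
  rw [indA_eq, comp_indV_comp_unitB, ← ContinuousLinearMap.comp_assoc, indKet_comp_rep]
  rfl

variable (hcov : IsCovariant Θ π υ)
include hcov

lemma indB_comp_unitA {θ : Θ.carrier} (hξ : ξ ∈ E.homog θ.1) (b : B) :
    indB π υ E θ ξ ∘L unitA π b = indB π υ E θ (E.lmul b ξ) := by
  have h := comp_indV_comp_unitA (π := π) (indKet π E ξ ∘L (υ θ)†) b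
  have h' := congrArg (fun T => T ∘L indV π) (indKet_lmul_comp hcov hξ b)
  exact h.trans h'.symm

lemma indB_comp_unitB {θ φ : Θ.carrier} (hξ : ξ ∈ E.homog θ.1) (c : B) :
    indB π υ E θ ξ ∘L unitB π υ φ c = indB π υ E (φ * θ) (E.lmul c ξ) := by
  have h := comp_indV_comp_unitB (π := π) (υ := υ) (indKet π E ξ ∘L (υ θ)†) φ c
  have h' := congrArg (fun T => T ∘L (υ φ)† ∘L indV π) (indKet_lmul_comp hcov hξ c)
  rw [indB_eq (φ * θ), ← hcov.star_mul_eq]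
  exact h.trans h'.symm

/-- One has `(|ξ] ⊗ υ(θ)*)* (|η] ⊗ υ(φ)*) = |c] ⊗ υ(φ θ*)*` for `c = θ(⟨ξ|η⟩)`. -/
lemma indB_adjoint_comp {θ φ : Θ.carrier} {c : B} (h : θ.1.Maps (E.inner ξ η) c) :
    (indB π υ E θ ξ)† ∘L indB π υ E φ η = unitB π υ (φ * star θ) c := by
  rw [unitB_eq, indB_eq, ContinuousLinearMap.adjoint_comp, ContinuousLinearMap.adjoint_comp,
    ContinuousLinearMap.adjoint_adjoint, ← hcov.star_mul_eq, hcov.star_eq,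
    ContinuousLinearMap.adjoint_adjoint]
  have e : ((indV π)† ∘L υ θ) ∘L (indKet π E ξ)† ∘L indB π υ E φ η =
      (indV π)† ∘L (υ θ ∘L ((indKet π E ξ)† ∘L indKet π E η)) ∘L (υ φ)† ∘L indV π := rfl
  refine Eq.trans ?_ (e.trans ?_)
  · rfl
  · rw [indKet_adjoint_comp, hcov.intertwine h]
    rfl

lemma unitB_adjoint {θ : Θ.carrier} {c : B} (hc : c ∈ hB θ.1) :
    (unitB π υ θ c)† = unitB π υ (star θ) (star c) := by
  rw [unitB_eq, unitB_eq, ContinuousLinearMap.adjoint_comp, ContinuousLinearMap.adjoint_comp,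
    ContinuousLinearMap.adjoint_comp, ContinuousLinearMap.adjoint_adjoint,
    ContinuousLinearMap.adjoint_adjoint, IsCovariant.rep_adjoint, hcov.star_eq,
    ContinuousLinearMap.adjoint_adjoint]
  have h := hcov.intertwine (θ := θ) (maps_self_of_mem_hB hc).star
  have e : (((indV π)† ∘L υ θ) ∘L π (star c)) ∘L indV π =
    (indV π)† ∘L (υ θ ∘L π (star c)) ∘L indV π := rfl
  exact e.trans (by rw [h]; rfl)

lemma indB_of_le {φ σ : Θ.carrier} (h : φ.1 ≤ σ.1) (hξ : ξ ∈ E.homog φ.1) :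
    indB π υ E φ ξ = indB π υ E σ ξ :=
  congrArg (fun T => T ∘L indV π) (indKet_comp_adjoint_of_le hcov h hξ)

/-! ### The C*-base -/

variable (h1 : 1 ∈ Θ.carrier) (hπ : Function.Injective π)
include h1

lemma unitB_mem {θ : Θ.carrier} {c : B} (hc : c ∈ hB θ.1) :
    unitB π υ θ c ∈ indBeta π (unit B) υ := indB_mem (E := unit B) hcov h1 θ hc

lemma dense_indAlpha (hE : E.IsDecomposableOver Θ) : Dense (Submodule.span ℂ
    {x : IndSpace π E | ∃ R ∈ indAlpha π E υ, ∃ y, x = R y} : Set (IndSpace π E)) := by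
  refine (total_indTmul_of π (isDecomposableOver_iff.1 hE)).mono (Submodule.span_mono ?_)
  rintro _ ⟨⟨p, ζ⟩, rfl⟩
  refine ⟨indA π E p.1.2, indA_mem hcov h1 hE _, ((indV π)†) ζ, ?_⟩
  exact congrArg (fun T : K →L[ℂ] _ => T ζ) (indKet_comp_indV_comp_adjoint hcov h1 p.1.2).symm

lemma dense_indBeta (hE : E.IsDecomposableOver Θ) : Dense (Submodule.span ℂ
    {x : IndSpace π E | ∃ R ∈ indBeta π E υ, ∃ y, x = R y} : Set (IndSpace π E)) := by
  refine (total_indTmul_of π (isDecomposableOver_iff.1 hE)).mono (Submodule.span_mono ?_)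
  rintro _ ⟨⟨p, ζ⟩, rfl⟩
  refine ⟨indB π υ E ⟨p.1.1, p.2.1⟩ p.1.2, indB_mem hcov h1 _ p.2.2,
    ((indV π)†) (υ ⟨p.1.1, p.2.1⟩ ζ), ?_⟩
  exact congrArg (fun T : K →L[ℂ] _ => T ζ)
    (indKet_comp_adjoint_comp_indV hcov h1 (θ := ⟨p.1.1, p.2.1⟩)
      (inner_mem_dom p.2.2)).symm

lemma isNondegCStarAlg_indBeta (hd : (unit B).IsDecomposableOver Θ) :
    IsNondegCStarAlg (indBeta π (unit B) υ) where
  isClosed := Submodule.isClosed_topologicalClosure _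
  mul_mem a ha b hb := by
    rw [indBeta_eq hcov h1] at ha hb
    refine comp_mem_of_mem_closedSpan (Submodule.isClosed_topologicalClosure _) ?_ ha hb
    rintro _ ⟨θ, ξ, hξ, rfl⟩ _ ⟨φ, η, hη, rfl⟩
    exact (indB_comp_unitB (E := unit B) hcov hξ η).symm ▸
      indB_mem hcov h1 (φ * θ) (lmul_mem_homog (E := unit B) hη hξ)
  adjoint_mem a ha := by
    rw [indBeta_eq hcov h1] at ha
    refine adjoint_mem_of_mem_closedSpan (Submodule.isClosed_topologicalClosure _) ?_ ha
    rintro _ ⟨θ, ξ, hξ, rfl⟩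
    exact (unitB_adjoint hcov (θ := θ) (c := ξ) hξ).symm ▸
      unitB_mem hcov h1 (θ := star θ) (star_mem_hB (B := B) (c := ξ) hξ)
  nondeg := dense_indBeta hcov h1 hd

include hπ in
lemma mem_indAlpha_unit_iff (hd : (unit B).IsDecomposableOver Θ)
    {R : IndSpace π (unit B) →L[ℂ] IndSpace π (unit B)} :
    R ∈ indAlpha π (unit B) υ ↔ ∃ b : B, R = unitA π b :=
  mem_indAlpha_iff hcov h1 hπ hd

include hπ in
/-- The algebra `α(B)` consists of left multiplications on the first factor of `B ⊗_π 𝔎`, and `β(B)`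
is spanned by right multiplications on it combined with operators on `𝔎`; hence they commute. -/
theorem isCStarBase_ind (hd : (unit B).IsDecomposableOver Θ) :
    IsCStarBase (indAlpha π (unit B) υ) (indBeta π (unit B) υ) where
  left :=
    { isClosed := Submodule.isClosed_topologicalClosure _
      mul_mem := fun a ha b hb => by
        rw [mem_indAlpha_unit_iff hcov h1 hπ hd] at ha hb ⊢
        obtain ⟨c, rfl⟩ := ha
        obtain ⟨d, rfl⟩ := hb
        exact ⟨c * d, indA_comp_unitA (E := unit B) c d⟩
      adjoint_mem := fun a ha => by
        rw [mem_indAlpha_unit_iff hcov h1 hπ hd] at ha ⊢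
        obtain ⟨c, rfl⟩ := ha
        refine ⟨star c, ?_⟩
        rw [unitA_eq, unitA_eq, ContinuousLinearMap.adjoint_comp, ContinuousLinearMap.adjoint_comp,
          ContinuousLinearMap.adjoint_adjoint, IsCovariant.rep_adjoint]
        rfl
      nondeg := dense_indAlpha hcov h1 hd }
  right := isNondegCStarAlg_indBeta hcov h1 hd
  commute a ha b hb := by
    obtain ⟨c, rfl⟩ := (mem_indAlpha_unit_iff hcov h1 hπ hd).1 ha
    rw [indBeta_eq hcov h1] at hb
    refine closedSpan_induction (p := fun b => unitA π c ∘L b = b ∘L unitA π c) ?_ (by simp)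
      (fun x y hx hy => by simp only [ContinuousLinearMap.comp_add, ContinuousLinearMap.add_comp,
        hx, hy])
      (fun z x hx => by simp only [ContinuousLinearMap.comp_smul, ContinuousLinearMap.smul_comp,
        hx])
      (isClosed_eq (by fun_prop) (by fun_prop)) hb
    rintro _ ⟨θ, ξ, hξ, rfl⟩
    exact (indA_comp_unitB (E := unit B) c θ ξ).trans
      (indB_comp_unitA (E := unit B) hcov hξ c).symm

/-! ### The C*-bimodules -/

include hπ in
/-- The space `α(E)` satisfies `[α(E)* α(E)] = α(B)`, because `E` is full. -/
theorem isCStarFact_indAlpha (hd : (unit B).IsDecomposableOver Θ) (hE : E.IsDecomposableOver Θ) :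
    IsCStarFact (indAlpha π (unit B) υ) (indAlpha π E υ) := by
  refine isCStarFact_of_comp_mem (isCStarBase_ind hcov h1 hπ hd).left
    (Submodule.isClosed_topologicalClosure _) (le_antisymm (closedSpan_le
      (Submodule.isClosed_topologicalClosure _) ?_) ?_) ?_ (dense_indAlpha hcov h1 hE)
  · rintro _ ⟨R, hR, S, hS, rfl⟩
    obtain ⟨ξ, rfl⟩ := (mem_indAlpha_iff hcov h1 hπ hE).1 hR
    obtain ⟨η, rfl⟩ := (mem_indAlpha_iff hcov h1 hπ hE).1 hS
    rw [indA_adjoint_comp]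
    exact indA_mem (E := unit B) hcov h1 hd _
  · intro R hR
    obtain ⟨b, rfl⟩ := (mem_indAlpha_unit_iff hcov h1 hπ hd).1 hR
    refine mem_of_mem_closedSpan (unitA π) (Submodule.isClosed_topologicalClosure _) ?_ (E.full b)
    rintro _ ⟨ξ, η, rfl⟩
    exact mem_closedSpan ⟨_, indA_mem hcov h1 hE ξ, _, indA_mem hcov h1 hE η,
      (indA_adjoint_comp ξ η).symm⟩
  · intro R hR S hS
    obtain ⟨ξ, rfl⟩ := (mem_indAlpha_iff hcov h1 hπ hE).1 hR
    obtain ⟨b, rfl⟩ := (mem_indAlpha_unit_iff hcov h1 hπ hd).1 hS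
    rw [indA_comp_unitA]
    exact indA_mem hcov h1 hE _

omit hcov h1 in
/-- The element `θ(⟨ξ|η⟩)` is also the adjoint of `φ(⟨η|ξ⟩)` if `η` has degree `φ`. -/
lemma maps_inner_symm {θ φ : PAut B} {c : B} (hξ : ξ ∈ E.homog θ) (hη : η ∈ E.homog φ)
    (h : θ.Maps (E.inner ξ η) c) : φ.Maps (E.inner η ξ) (star c) := by
  obtain ⟨m, hm, hm'⟩ := maps_self_of_mem_hB (maps_inner_mem_homog hξ hη h)
  have e : m = E.inner ξ η := θ.left_unique hm h
  rw [← E.star_inner, ← e]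
  exact hm'.star

section AdjointSpan

variable {H H' : Type*} [NormedAddCommGroup H] [InnerProductSpace ℂ H] [CompleteSpace H]
  [NormedAddCommGroup H'] [InnerProductSpace ℂ H'] [CompleteSpace H']
  {F : Submodule ℂ (H →L[ℂ] H')} {R S : H →L[ℂ] H'} {T : H →L[ℂ] H}

omit hcov h1

/-- The closed linear span `[F* F]` for a space `F` of operators. -/
def adjointSpan (F : Submodule ℂ (H →L[ℂ] H')) : Submodule ℂ (H →L[ℂ] H) :=
  closedSpan {a | ∃ ξ ∈ F, ∃ η ∈ F, a = ξ† ∘L η}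

lemma isClosed_adjointSpan : IsClosed (adjointSpan F : Set (H →L[ℂ] H)) := isClosed_closedSpan _

lemma adjoint_comp_mem_adjointSpan (hR : R ∈ F) (hS : S ∈ F) : R† ∘L S ∈ adjointSpan F :=
  mem_closedSpan ⟨R, hR, S, hS, rfl⟩

lemma adjoint_mem_adjointSpan (hT : T ∈ adjointSpan F) : T† ∈ adjointSpan F := by
  refine adjoint_mem_of_mem_closedSpan isClosed_adjointSpan ?_ hT
  rintro _ ⟨R, hR, S, hS, rfl⟩
  rw [ContinuousLinearMap.adjoint_comp, ContinuousLinearMap.adjoint_adjoint]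
  exact adjoint_comp_mem_adjointSpan hS hR

lemma adjoint_mem_adjointSpan_iff : T† ∈ adjointSpan F ↔ T ∈ adjointSpan F :=
  ⟨fun h => by simpa using adjoint_mem_adjointSpan h, adjoint_mem_adjointSpan⟩

end AdjointSpan

lemma unitB_innerTw_mem {θ : Θ.carrier} {ψ φ : Θ.carrier} (hξ : ξ ∈ E.homog ψ.1)
    (hη : η ∈ E.homog φ.1) (hle : φ.1 * star ψ.1 ≤ θ.1) :
    unitB π υ θ (innerTw hξ η) ∈ adjointSpan (indBeta π E υ) := by
  have e : unitB π υ (φ * star ψ) (innerTw hξ η) = unitB π υ θ (innerTw hξ η) :=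
    indB_of_le (E := unit B) hcov hle (maps_inner_mem_homog (B := B) hξ hη (maps_innerTw hξ η))
  rw [← e, ← indB_adjoint_comp hcov (maps_innerTw hξ η)]
  exact adjoint_comp_mem_adjointSpan (indB_mem hcov h1 ψ hξ) (indB_mem hcov h1 φ hη)

omit h1 in
lemma unitB_innerTw_adjoint {θ : Θ.carrier} {ψ φ : PAut B} (hξ : ξ ∈ E.homog ψ)
    (hη : η ∈ E.homog φ) (hle : φ * star ψ ≤ θ.1) :
    (unitB π υ θ (innerTw hξ η))† = unitB π υ (star θ) (innerTw hη ξ) := by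
  have h := maps_innerTw hξ η
  rw [unitB_adjoint hcov (hB_mono hle (maps_inner_mem_homog hξ hη h)),
    eq_innerTw hη (maps_inner_symm hξ hη h)]

/-- The products `R* S` with `R, S ∈ β(E)` span the operators `|c] ⊗ υ(θ)*` if `c` is one of the
inner products that describe admissibility. -/
lemma unitB_mem_adjointSpan (hs : (unit B).IsSupported Θ) (hE : E.IsDecomposableOver Θ)
    (hπ : Function.Injective π) {θ : Θ.carrier} {c : B} (hc : c ∈ E.innerSet' (star θ.1)) :
    unitB π υ θ c ∈ adjointSpan (indBeta π E υ) := by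
  obtain ⟨σ₁, σ₂, ξ, hξ, η, hη, hle, hc⟩ := hc
  rw [eq_innerTw hξ hc]
  have hle' : ∀ {ψ φ : PAut B}, ψ ≤ σ₁ → φ ≤ star σ₂ → φ * star ψ ≤ θ.1 := fun hψ hφ => by
    have h2 := PAut.star_le_star ((PAut.mul_le_mul hψ (PAut.star_le_star hφ)).trans
      ((star_star σ₂).symm ▸ hle))
    rwa [star_mul, star_star, star_star] at h2
  -- it suffices to consider elements `η` and `ξ` whose degrees belong to `Θ`
  refine mem_of_mem_closedSpan (unitB π υ θ ∘L innerTw hξ) isClosed_adjointSpan ?_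
    (mem_closedSpan_homog_of_le π hπ hs hE hη)
  rintro η ⟨φ, hφ, hφ', hη⟩
  rw [ContinuousLinearMap.comp_apply, ← adjoint_mem_adjointSpan_iff,
    unitB_innerTw_adjoint hcov hξ hη (hle' le_rfl hφ')]
  refine mem_of_mem_closedSpan (unitB π υ (star θ) ∘L innerTw hη) isClosed_adjointSpan ?_
    (mem_closedSpan_homog_of_le π hπ hs hE hξ)
  rintro ξ ⟨ψ, hψ, hψ', hξ⟩
  rw [ContinuousLinearMap.comp_apply, ← unitB_innerTw_adjoint hcov hξ hη (hle' hψ' hφ'),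
    adjoint_mem_adjointSpan_iff]
  exact unitB_innerTw_mem hcov h1 (ψ := ⟨ψ, hψ⟩) (φ := ⟨φ, hφ⟩) hξ hη (hle' hψ' hφ')

include hπ in
/-- The inclusion `β(B) ⊆ [β(E)* β(E)]` is where the condition `[|E]* |E]] = |B]` enters. -/
theorem isCStarFact_indBeta (hΘ : Θ.IsAdmissible) (hd : (unit B).IsDecomposableOver Θ)
    (hE : E.IsAdmissible Θ) : IsCStarFact (indBeta π (unit B) υ) (indBeta π E υ) := by
  refine isCStarFact_of_comp_mem (isCStarBase_ind hcov h1 hπ hd).right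
    (Submodule.isClosed_topologicalClosure _) (le_antisymm (closedSpan_le
      (Submodule.isClosed_topologicalClosure _) ?_) ?_) ?_ (dense_indBeta hcov h1 hE.decomposable)
  · rintro _ ⟨R, hR, S, hS, rfl⟩
    rw [indBeta_eq hcov h1] at hR hS
    refine adjoint_comp_mem_of_mem_closedSpan (Submodule.isClosed_topologicalClosure _) ?_ hR hS
    rintro _ ⟨θ, ξ, hξ, rfl⟩ _ ⟨φ, η, hη, rfl⟩
    rw [indB_adjoint_comp hcov (maps_innerTw hξ η)]
    exact unitB_mem hcov h1 (maps_inner_mem_homog hξ hη (maps_innerTw hξ η))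
  · rw [indBeta_eq hcov h1]
    refine closedSpan_le (isClosed_closedSpan _) ?_
    rintro _ ⟨θ, c, hc, rfl⟩
    exact mem_of_mem_closedSpan (unitB π υ θ) isClosed_adjointSpan
      (fun d hd => unitB_mem_adjointSpan hcov h1 hΘ.supported hE.decomposable hπ hd)
      (hE.mem_innerSet' (c := c) (σ := star θ.1) hc)
  · intro R hR S hS
    rw [indBeta_eq hcov h1] at hR hS
    refine comp_mem_of_mem_closedSpan (Submodule.isClosed_topologicalClosure _) ?_ hR hS
    rintro _ ⟨θ, ξ, hξ, rfl⟩ _ ⟨φ, η, hη, rfl⟩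
    exact (indB_comp_unitB hcov hξ η).symm ▸ indB_mem hcov h1 (φ * θ) (lmul_mem_homog hη hξ)

/-- An operator that acts on `β(E)` by right multiplication with an element of `α(B)` is the left
action of an element of `B`. -/
lemma comp_indKet_of_isRho_beta (hE : E.IsDecomposableOver Θ) {b : B}
    {R : IndSpace π E →L[ℂ] IndSpace π E} (hR : IsRho (indBeta π E υ) (unitA π b) R) (ξ : E) :
    R ∘L indKet π E ξ = indKet π E (E.lmul b ξ) := by
  have e : ((ContinuousLinearMap.compL ℂ _ _ _ R) ∘L indKet π E) = indKet π E ∘L E.lmulL b := by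
    refine clm_ext_of_total (isDecomposableOver_iff.1 hE) ?_
    rintro ⟨⟨θ, ξ⟩, hθ, hξ⟩
    change R ∘L indKet π E ξ = indKet π E (E.lmul b ξ)
    have h2 : R ∘L indB π υ E ⟨θ, hθ⟩ ξ = indB π υ E ⟨θ, hθ⟩ ξ ∘L unitA π b :=
      ContinuousLinearMap.ext (hR _ (indB_mem hcov h1 ⟨θ, hθ⟩ hξ))
    rw [indB_comp_unitA hcov (θ := ⟨θ, hθ⟩) hξ b, indB_eq, indB_eq] at h2
    rw [← indKet_comp_adjoint_comp_indV hcov h1 (θ := ⟨θ, hθ⟩) (inner_mem_dom hξ),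
      ← indKet_comp_adjoint_comp_indV hcov h1 (θ := ⟨θ, hθ⟩) (ξ := E.lmul b ξ)
        fun η => inner_lmul_right b η ξ ▸ inner_mem_dom hξ _, ← h2]
    rfl
  exact congrArg (fun T : E →L[ℂ] _ => T ξ) e

/-- An operator that acts on `α(E)` by right multiplication with `|c] ⊗ υ(σ)*`. -/
lemma comp_indKet_of_isRho_alpha (hE : E.IsDecomposableOver Θ) {σ : Θ.carrier} {c : B}
    {R : IndSpace π E →L[ℂ] IndSpace π E} (hR : IsRho (indAlpha π E υ) (unitB π υ σ c) R) (ξ : E) :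
    R ∘L indKet π E ξ = indKet π E (E.rmul c ξ) ∘L (υ σ)† := by
  have h2 : R ∘L indA π E ξ = indB π υ E σ (E.rmul c ξ) := by
    rw [← indA_comp_unitB]
    exact ContinuousLinearMap.ext fun x => hR _ (indA_mem hcov h1 hE ξ) x
  rw [← indKet_comp_indV_comp_adjoint hcov h1 ξ, ← indA_eq, ← ContinuousLinearMap.comp_assoc, h2,
    ← hcov.adjoint_mul_one h1, ← indV_comp_adjoint hcov h1]
  rfl

lemma rho_comp_indA (hE : E.IsDecomposableOver Θ) {b : B}
    {R : IndSpace π E →L[ℂ] IndSpace π E} (hR : IsRho (indBeta π E υ) (unitA π b) R) (ξ : E) :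
    R ∘L indA π E ξ = indA π E (E.lmul b ξ) :=
  congrArg (fun T => T ∘L indV π) (comp_indKet_of_isRho_beta hcov h1 hE hR ξ)

lemma rho_comp_indB (hE : E.IsDecomposableOver Θ) {σ θ : Θ.carrier} {c : B}
    {R : IndSpace π E →L[ℂ] IndSpace π E} (hR : IsRho (indAlpha π E υ) (unitB π υ σ c) R) (ξ : E) :
    R ∘L indB π υ E θ ξ = indB π υ E (θ * σ) (E.rmul c ξ) := by
  have h := congrArg (fun T => T ∘L (υ θ)† ∘L indV π) (comp_indKet_of_isRho_alpha hcov h1 hE hR ξ)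
  rw [indB_eq (θ * σ), ← hcov.star_mul_eq]
  exact h

section Stable

variable (hb : IsCStarBase (indAlpha π (unit B) υ) (indBeta π (unit B) υ))
  (hα : IsCStarFact (indAlpha π (unit B) υ) (indAlpha π E υ))
  (hβ : IsCStarFact (indBeta π (unit B) υ) (indBeta π E υ)) (hE : E.IsDecomposableOver Θ)
include hE

lemma rho_unitB_comp_indB {θ σ : Θ.carrier} {c : B} (hc : c ∈ hB σ.1) (ξ : E) :
    rho hb hα ⟨unitB π υ σ c, unitB_mem hcov h1 hc⟩ ∘L indB π υ E θ ξ =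
      indB π υ E (θ * σ) (E.rmul c ξ) :=
  rho_comp_indB hcov h1 hE (isRho_rho hb hα _) ξ

lemma rho_comp_mem_indBeta (b : indBeta π (unit B) υ) {θ : Θ.carrier} (hξ : ξ ∈ E.homog θ.1) :
    rho hb hα b ∘L indB π υ E θ ξ ∈ indBeta π E υ := by
  let f : indBeta π (unit B) υ →L[ℂ] (IndSpace π (unit B) →L[ℂ] IndSpace π E) :=
    (ContinuousLinearMap.compL ℂ _ _ _).flip (indB π υ E θ ξ) ∘L rho hb hα
  have hc : IsClosed (indBeta π E υ : Set (IndSpace π (unit B) →L[ℂ] IndSpace π E)) :=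
    Submodule.isClosed_topologicalClosure _
  refine mem_of_subtype_closedSpan f (fun x hx => (indBeta_eq (E := unit B) hcov h1).le hx) hc ?_ b
  rintro _ ⟨σ, c, hc, rfl⟩
  refine ⟨unitB_mem hcov h1 hc, ?_⟩
  have := indB_mem hcov h1 (θ * σ) (rmul_mem_homog hξ hc)
  rw [← rho_unitB_comp_indB hcov h1 hb hα hE hc] at this
  exact this

lemma indB_mem_rho {θ : Θ.carrier} (hξ : ξ ∈ E.homog θ.1) : indB π υ E θ ξ ∈ closedSpan
    {η | ∃ b : indBeta π (unit B) υ, ∃ η' ∈ indBeta π E υ, η = rho hb hα b ∘L η'} := by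
  refine mem_of_mem_closedSpan (indB π υ E θ) (isClosed_closedSpan _) ?_
    (mem_closedSpan_rmul_center hξ)
  rintro _ ⟨c, hc, rfl⟩
  have h := rho_unitB_comp_indB hcov h1 hb hα hE (θ := θ) (σ := ⟨1, h1⟩) hc ξ
  have e : θ * ⟨1, h1⟩ = θ := Subtype.ext (mul_one θ.1)
  rw [e] at h
  exact mem_closedSpan ⟨_, _, indB_mem hcov h1 θ hξ, h.symm⟩

include hb hα in
/-- The operators `ρ_{α(E)}(|c] ⊗ υ(σ)*)` map `|ξ] ⊗ υ(θ)*` to `|ξ c] ⊗ υ(θ σ)*`. -/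
theorem rhoStable_indBeta : RhoStable (indBeta π (unit B) υ) (indAlpha π E υ) (indBeta π E υ) := by
  refine (rhoStable_iff hb hα).2 (le_antisymm
    (closedSpan_le (Submodule.isClosed_topologicalClosure _) ?_) ?_)
  · rintro _ ⟨b, S, hS, rfl⟩
    rw [indBeta_eq hcov h1] at hS
    refine mem_of_mem_closedSpan (ContinuousLinearMap.compL ℂ _ _ _ (rho hb hα b))
      (Submodule.isClosed_topologicalClosure _) ?_ hS
    rintro _ ⟨θ, ξ, hξ, rfl⟩
    exact rho_comp_mem_indBeta hcov h1 hb hα hE b hξ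
  · refine (indBeta_eq hcov h1).trans_le (closedSpan_le (isClosed_closedSpan _) ?_)
    rintro _ ⟨θ, ξ, hξ, rfl⟩
    exact indB_mem_rho hcov h1 hb hα hE hξ

lemma rho_unitA_comp_indA (hd : (unit B).IsDecomposableOver Θ) (b : B) (ξ : E) :
    rho hb.symm hβ ⟨unitA π b, indA_mem (E := unit B) hcov h1 hd b⟩ ∘L indA π E ξ =
      indA π E (E.lmul b ξ) :=
  rho_comp_indA hcov h1 hE (isRho_rho hb.symm hβ _) ξ

include hb hβ hπ in
/-- The operators `ρ_{β(E)}(|b⟩ ⊗ Id)` map `|ξ⟩ ⊗ Id` to `|b ξ⟩ ⊗ Id`. -/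
theorem rhoStable_indAlpha (hd : (unit B).IsDecomposableOver Θ) :
    RhoStable (indAlpha π (unit B) υ) (indBeta π E υ) (indAlpha π E υ) := by
  refine (rhoStable_iff hb.symm hβ).2 (le_antisymm
    (closedSpan_le (Submodule.isClosed_topologicalClosure _) ?_) ?_)
  · rintro _ ⟨⟨b, hb'⟩, S, hS, rfl⟩
    obtain ⟨c, rfl⟩ := (mem_indAlpha_unit_iff hcov h1 hπ hd).1 hb'
    obtain ⟨ξ, rfl⟩ := (mem_indAlpha_iff hcov h1 hπ hE).1 hS
    rw [rho_unitA_comp_indA hcov h1 hb hβ hE hd]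
    exact indA_mem hcov h1 hE _
  · intro S hS
    obtain ⟨ξ, rfl⟩ := (mem_indAlpha_iff hcov h1 hπ hE).1 hS
    refine mem_of_mem_closedSpan (indA π E) (isClosed_closedSpan _) ?_ (E.lmul_dense ξ)
    rintro _ ⟨c, η, rfl⟩
    exact mem_closedSpan ⟨_, _, indA_mem hcov h1 hE η,
      (rho_unitA_comp_indA hcov h1 hb hβ hE hd c η).symm⟩

end Stable

omit h1 in
include hπ in
/-- The Hilbert space `E ⊗_π 𝔎` with the spaces `β(E)` and `α(E)` is a C*-bimodule. -/
theorem isCStarBaseBimod_ind (hΘ : Θ.IsAdmissible)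
    (hb : IsCStarBase (indAlpha π (unit B) υ) (indBeta π (unit B) υ))
    (hd : (unit B).IsDecomposableOver Θ) (hE : E.IsAdmissible Θ) :
    IsCStarBaseBimod (indBase π υ hb) (IndSpace π E) (indBeta π E υ) (indAlpha π E υ) where
  alpha_fact := isCStarFact_indAlpha hcov hΘ.one_mem hπ hd hE.decomposable
  beta_fact := isCStarFact_indBeta hcov hΘ.one_mem hπ hΘ hd hE
  beta_stable := rhoStable_indBeta hcov hΘ.one_mem hb
    (isCStarFact_indAlpha hcov hΘ.one_mem hπ hd hE.decomposable) hE.decomposable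
  alpha_stable := rhoStable_indAlpha hcov hΘ.one_mem hπ hb
    (isCStarFact_indBeta hcov hΘ.one_mem hπ hΘ hd hE) hE.decomposable hd

end Covariant

/-! ### The functor from admissible bimodules to C*-bimodules -/

section IndFunctor

variable {B : Type u} [NonUnitalCStarAlgebra B] [PartialOrder B] [StarOrderedRing B]
  {Θ : InvSemigroup B} {K : Type v} [NormedAddCommGroup K] [InnerProductSpace ℂ K] [CompleteSpace K]
  {π : B →⋆ₙₐ[ℂ] (K →L[ℂ] K)} {υ : Θ.carrier → (K →L[ℂ] K)}

open CStarBimod InvSemigroup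

variable {E F G : CStarBimod B}

lemma indKet_injective (hπ : Function.Injective π) : Function.Injective (indKet π E) :=
  fun ξ η h => by
    rw [← sub_eq_zero, ← norm_eq_zero, ← norm_indKet π hπ, map_sub, h, sub_self, norm_zero]

variable (π) in
/-- The operator `T ⊗ Id` is bounded: on pairs `(ξ, ζ)` its formal adjoint is given by `T*`. -/
lemma exists_indMap (T : E ⟶ F) : ∃ R : IndSpace π E →L[ℂ] IndSpace π F,
    ∀ p : E × K, R (indTmul π p.1 p.2) = indTmul π (CStarBimod.op T p.1) p.2 := by
  obtain ⟨R, hR, -⟩ := exists_clm_of_adjoint (isNormForm_inner (IndSpace π E))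
    (isNormForm_inner (IndSpace π F)) (total_indTmul π E)
    (fun p : F × K => indTmul π p.1 p.2) (fun p => (CStarBimod.op T p.1, p.2))
    (fun p => (CStarBimod.op (CStarBimod.Hom.adj T) p.1, p.2))
    (fun p q => by
      rw [innerₛₗ_apply_apply, innerₛₗ_apply_apply, inner_indTmul, inner_indTmul, inner_op])
    (r := ‖CStarBimod.op (CStarBimod.Hom.adj T)‖ * ‖CStarBimod.op T‖) (by positivity)
    (fun p => ⟨‖p.1‖ * ‖p.2‖, fun n => by
      have key : ∀ n : ℕ, (fun p : E × K =>
          (CStarBimod.op (CStarBimod.Hom.adj T) (CStarBimod.op T p.1), p.2))^[n] p =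
          ((fun x => CStarBimod.op (CStarBimod.Hom.adj T) (CStarBimod.op T x))^[n] p.1, p.2) := by
        intro n
        induction n with
        | zero => rfl
        | succ n ih => rw [Function.iterate_succ_apply', ih, Function.iterate_succ_apply']
      refine (congrArg (fun q : E × K => ‖indTmul π q.1 q.2‖) (key n)).le.trans ?_
      refine (norm_indTmul_le π _ _).trans ?_
      refine (mul_le_mul_of_nonneg_right (norm_iterate_adj_comp_le T n p.1)
        (norm_nonneg p.2)).trans_eq ?_
      ring⟩)
  exact ⟨R, hR⟩

variable (π) in
/-- The operator `T ⊗ Id : E ⊗_π 𝔎 → F ⊗_π 𝔎`. -/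
def indMap (T : E ⟶ F) : IndSpace π E →L[ℂ] IndSpace π F := (exists_indMap π T).choose

lemma indMap_indTmul (T : E ⟶ F) (ξ : E) (ζ : K) :
    indMap π T (indTmul π ξ ζ) = indTmul π (CStarBimod.op T ξ) ζ :=
  (exists_indMap π T).choose_spec (ξ, ζ)

lemma indMap_comp_indKet (T : E ⟶ F) (ξ : E) :
    indMap π T ∘L indKet π E ξ = indKet π F (CStarBimod.op T ξ) :=
  ContinuousLinearMap.ext fun ζ => indMap_indTmul T ξ ζ

lemma adjoint_indMap (T : E ⟶ F) : (indMap π T)† = indMap π (CStarBimod.Hom.adj T) :=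
  adjoint_eq_of_total (total_indTmul π E) (total_indTmul π F) fun p q => by
    rw [indMap_indTmul, indMap_indTmul, inner_indTmul, inner_indTmul, inner_op]

lemma indMap_comp_indA (T : E ⟶ F) (ξ : E) :
    indMap π T ∘L indA π E ξ = indA π F (CStarBimod.op T ξ) :=
  congrArg (fun S => S ∘L indV π) (indMap_comp_indKet T ξ)

lemma indMap_comp_indB (T : E ⟶ F) (θ : Θ.carrier) (ξ : E) :
    indMap π T ∘L indB π υ E θ ξ = indB π υ F θ (CStarBimod.op T ξ) :=
  congrArg (fun S => S ∘L (υ θ)† ∘L indV π) (indMap_comp_indKet T ξ)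

section Membership

variable (hcov : IsCovariant Θ π υ) (h1 : 1 ∈ Θ.carrier) (hπ : Function.Injective π)
include hcov h1

include hπ in
lemma indMap_comp_mem_indAlpha (hE : E.IsDecomposableOver Θ) (hF : F.IsDecomposableOver Θ)
    (T : E ⟶ F) {R : IndSpace π (unit B) →L[ℂ] IndSpace π E} (hR : R ∈ indAlpha π E υ) :
    indMap π T ∘L R ∈ indAlpha π F υ := by
  obtain ⟨ξ, rfl⟩ := (mem_indAlpha_iff hcov h1 hπ hE).1 hR
  rw [indMap_comp_indA]
  exact indA_mem hcov h1 hF _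

lemma indMap_comp_mem_indBeta (T : E ⟶ F) {R : IndSpace π (unit B) →L[ℂ] IndSpace π E}
    (hR : R ∈ indBeta π E υ) : indMap π T ∘L R ∈ indBeta π F υ := by
  rw [indBeta_eq hcov h1] at hR
  refine mem_of_mem_closedSpan (ContinuousLinearMap.compL ℂ _ _ _ (indMap π T))
    (Submodule.isClosed_topologicalClosure _) ?_ hR
  rintro _ ⟨θ, ξ, hξ, rfl⟩
  rw [ContinuousLinearMap.compL_apply, indMap_comp_indB]
  exact indB_mem hcov h1 θ (op_mem_homog T hξ)

include hπ in
lemma indA_injective : Function.Injective (indA π E) := fun ξ η h => by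
  rw [← sub_eq_zero, ← norm_eq_zero, ← norm_indA hcov h1 hπ, map_sub, h, sub_self, norm_zero]

include hπ in
lemma unitA_injective : Function.Injective (unitA π) := indA_injective (E := unit B) hcov h1 hπ

include hπ in
/-- An operator that maps `α(E)` to `α(F)` defines an operator from `E` to `F`. -/
lemma exists_clm_of_comp_indA {R : IndSpace π E →L[ℂ] IndSpace π F}
    (h : ∀ ξ, ∃ η, R ∘L indA π E ξ = indA π F η) :
    ∃ T : E →L[ℂ] F, ∀ ξ, R ∘L indA π E ξ = indA π F (T ξ) := by
  choose t ht using h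
  refine ⟨LinearMap.mkContinuous ⟨⟨t, fun ξ η => ?_⟩, fun c ξ => ?_⟩ ‖R‖ fun ξ => ?_, ht⟩
  · refine indA_injective hcov h1 hπ ?_
    rw [map_add, ← ht, ← ht, ← ht, map_add, ContinuousLinearMap.comp_add]
  · refine indA_injective hcov h1 hπ ?_
    rw [RingHom.id_apply, map_smul, ← ht, ← ht, map_smul, ContinuousLinearMap.comp_smul]
  · change ‖t ξ‖ ≤ _
    rw [← norm_indA hcov h1 hπ (t ξ), ← ht, ← norm_indA hcov h1 hπ ξ]
    exact ContinuousLinearMap.opNorm_comp_le _ _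

lemma comp_indKet_of_comp_indA {R : IndSpace π E →L[ℂ] IndSpace π F} {ξ : E} {η : F}
    (h : R ∘L indA π E ξ = indA π F η) : R ∘L indKet π E ξ = indKet π F η := by
  rw [← indKet_comp_indV_comp_adjoint hcov h1 ξ, ← indKet_comp_indV_comp_adjoint hcov h1 η,
    ← indA_eq, ← indA_eq, ← h]
  rfl

include hπ in
lemma inner_eq_of_comp_indA {R : IndSpace π E →L[ℂ] IndSpace π F} {T : E →L[ℂ] F} {S : F →L[ℂ] E}
    (hT : ∀ ξ, R ∘L indA π E ξ = indA π F (T ξ)) (hS : ∀ η, R† ∘L indA π F η = indA π E (S η))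
    (ξ : E) (η : F) : F.inner (T ξ) η = E.inner ξ (S η) := by
  refine unitA_injective hcov h1 hπ ?_
  rw [← indA_adjoint_comp, ← indA_adjoint_comp, ← hT, ← hS, ContinuousLinearMap.adjoint_comp]
  rfl

end Membership

section Functor

variable {hb : IsCStarBase (indAlpha π (unit B) υ) (indBeta π (unit B) υ)}
  {hE' : IsCStarBaseBimod (indBase π υ hb) (IndSpace π E) (indBeta π E υ) (indAlpha π E υ)}
  {hF' : IsCStarBaseBimod (indBase π υ hb) (IndSpace π F) (indBeta π F υ) (indAlpha π F υ)}
  (hcov : IsCovariant Θ π υ) (h1 : 1 ∈ Θ.carrier) (hπ : Function.Injective π)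
  (hE : E.IsDecomposableOver Θ) (hF : F.IsDecomposableOver Θ)

/-- The morphism `T ⊗ Id` of C*-bimodules. -/
def indHom (T : E ⟶ F) :
    indBimod π υ (indBase π υ hb) E hE' ⟶ indBimod π υ (indBase π υ hb) F hF' :=
  CStarBaseBimod.Hom.mk (X := indBimod π υ (indBase π υ hb) E hE')
    (Y := indBimod π υ (indBase π υ hb) F hF') (indMap π T)
    (fun _ h => indMap_comp_mem_indAlpha hcov h1 hπ hE hF T h)
    (fun ω h => by
      have := indMap_comp_mem_indAlpha hcov h1 hπ hF hE (CStarBimod.Hom.adj T) h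
      rw [← adjoint_indMap] at this
      exact this)
    (fun _ h => indMap_comp_mem_indBeta hcov h1 T h)
    (fun ω h => by
      have := indMap_comp_mem_indBeta hcov h1 (CStarBimod.Hom.adj T) h
      rw [← adjoint_indMap] at this
      exact this)

/-- The representations `ρ_β` are natural. -/
lemma op_rhoB {𝔥 : Type w} [NormedAddCommGroup 𝔥] [InnerProductSpace ℂ 𝔥] [CompleteSpace 𝔥]
    {𝔟 : CStarBase 𝔥} {X Y : CStarBaseBimod 𝔟} (T : X ⟶ Y) (b : 𝔟.alg) :
    CStarBaseBimod.op T ∘L X.rhoB b = Y.rhoB b ∘L CStarBaseBimod.op T := by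
  refine clm_ext_of_total X.total_beta fun p => ?_
  rw [ContinuousLinearMap.comp_apply, ContinuousLinearMap.comp_apply, CStarBaseBimod.rhoB_apply]
  exact (CStarBaseBimod.rhoB_apply Y b (CStarBaseBimod.pushB T p.1) p.2).symm

/-- The element `|b⟩ ⊗ Id` of `α(B)`. -/
def baseA (hcov : IsCovariant Θ π υ) (h1 : 1 ∈ Θ.carrier) (hd : (unit B).IsDecomposableOver Θ)
    (b : B) : (indBase π υ hb).alg := ⟨unitA π b, indA_mem (E := unit B) hcov h1 hd b⟩

include hE in
/-- The representation `ρ_β` of `α(B)` on `E ⊗_π 𝔎` is given by the left action. -/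
lemma rhoB_comp_indKet (hd : (unit B).IsDecomposableOver Θ) (b : B) (ξ : E) :
    (CStarBaseBimod.rhoB (indBimod π υ (indBase π υ hb) E hE') (baseA hcov h1 hd b) :
      IndSpace π E →L[ℂ] IndSpace π E) ∘L indKet π E ξ = indKet π E (E.lmul b ξ) :=
  comp_indKet_of_isRho_beta hcov h1 hE
    (isRho_rho hb.symm hE'.beta_fact (baseA (hb := hb) hcov h1 hd b)) ξ

include hcov h1 hπ hE hF in
/-- Every morphism of C*-bimodules from `E ⊗_π 𝔎` to `F ⊗_π 𝔎` comes from a morphism of right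
C*-bimodules: the condition on `α` yields the operator, and the condition on `β` its compatibility
with the left actions. -/
lemma exists_eq_indMap (hd : (unit B).IsDecomposableOver Θ)
    (R : indBimod π υ (indBase π υ hb) E hE' ⟶ indBimod π υ (indBase π υ hb) F hF') :
    ∃ T : E ⟶ F, indMap π T = CStarBaseBimod.op R := by
  obtain ⟨T, hT⟩ := exists_clm_of_comp_indA hcov h1 hπ (R := CStarBaseBimod.op R) fun ξ =>
    (mem_indAlpha_iff hcov h1 hπ hF).1 (R.map_alpha _ (indA_mem hcov h1 hE ξ))
  obtain ⟨S, hS⟩ := exists_clm_of_comp_indA hcov h1 hπ (R := (CStarBaseBimod.op R)†) fun η =>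
    (mem_indAlpha_iff hcov h1 hπ hE).1 (R.adjoint_alpha _ (indA_mem hcov h1 hF η))
  have hκ : ∀ ξ, CStarBaseBimod.op R ∘L indKet π E ξ = indKet π F (T ξ) := fun ξ =>
    comp_indKet_of_comp_indA hcov h1 (hT ξ)
  have hl : ∀ b ξ, T (E.lmul b ξ) = F.lmul b (T ξ) := fun b ξ => by
    have h2 := congrArg (fun S : IndSpace π E →L[ℂ] IndSpace π F => S ∘L indKet π E ξ)
      (op_rhoB R (baseA hcov h1 hd b))
    refine indKet_injective hπ ((hκ _).symm.trans ?_)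
    rw [← rhoB_comp_indKet (hE' := hE') hcov h1 hE hd]
    refine h2.trans ?_
    rw [← rhoB_comp_indKet (hE' := hF') hcov h1 hF hd, ← hκ]
    rfl
  refine ⟨⟨T, ⟨S, inner_eq_of_comp_indA hcov h1 hπ hT hS⟩, hl⟩, ?_⟩
  refine clm_ext_ind dense_span_range_id fun ξ => ?_
  rw [indMap_comp_indKet]
  exact (hκ ξ).symm

include hπ in
lemma indMap_injective : Function.Injective (indMap π : (E ⟶ F) → _) := fun S T h => by
  refine CStarBimod.Hom.ext' (ContinuousLinearMap.ext fun ξ => indKet_injective hπ ?_)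
  rw [← indMap_comp_indKet, ← indMap_comp_indKet, h]

lemma indMap_id : indMap π (𝟙 E) = .id ℂ _ := clm_ext_ind dense_span_range_id fun ξ =>
  indMap_comp_indKet (𝟙 E) ξ

lemma indMap_comp (S : E ⟶ F) (T : F ⟶ G) : indMap π (S ≫ T) = indMap π T ∘L indMap π S :=
  clm_ext_ind dense_span_range_id fun ξ => by
    rw [indMap_comp_indKet, ContinuousLinearMap.comp_assoc, indMap_comp_indKet, indMap_comp_indKet]
    rfl

end Functor

end IndFunctor

/-! ### Compatibility of the functor with the tensor products -/

section Tau

variable {B : Type u} [NonUnitalCStarAlgebra B] [PartialOrder B] [StarOrderedRing B]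
  {Θ : InvSemigroup B} {K : Type v} [NormedAddCommGroup K] [InnerProductSpace ℂ K] [CompleteSpace K]
  {π : B →⋆ₙₐ[ℂ] (K →L[ℂ] K)} {υ : Θ.carrier → (K →L[ℂ] K)}

open CStarBimod InvSemigroup CStarBaseBimod

variable {E F G : CStarBimod B}
  {hb : IsCStarBase (indAlpha π (unit B) υ) (indBeta π (unit B) υ)}

/-- The C*-bimodule `E ⊗_π 𝔎`. -/
abbrev indObj (hE' : IsCStarBaseBimod (indBase π υ hb) (IndSpace π E) (indBeta π E υ)
    (indAlpha π E υ)) : CStarBaseBimod (indBase π υ hb) := indBimod π υ (indBase π υ hb) E hE'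

variable
  {hE' : IsCStarBaseBimod (indBase π υ hb) (IndSpace π E) (indBeta π E υ) (indAlpha π E υ)}
  {hF' : IsCStarBaseBimod (indBase π υ hb) (IndSpace π F) (indBeta π F υ) (indAlpha π F υ)}
  {hEF' : IsCStarBaseBimod (indBase π υ hb) (IndSpace π (itp E F)) (indBeta π (itp E F) υ)
    (indAlpha π (itp E F) υ)}
  (hcov : IsCovariant Θ π υ) (h1 : 1 ∈ Θ.carrier) (hπ : Function.Injective π)
  (hd : (unit B).IsDecomposableOver Θ)
  (hE : E.IsDecomposableOver Θ) (hF : F.IsDecomposableOver Θ)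

/-- The element `|ξ⟩ ⊗ Id` of `α(E)`. -/
def elA (hE' : IsCStarBaseBimod (indBase π υ hb) (IndSpace π E) (indBeta π E υ) (indAlpha π E υ))
    (hcov : IsCovariant Θ π υ) (h1 : 1 ∈ Θ.carrier) (hE : E.IsDecomposableOver Θ)
    (ξ : E) : (indObj hE').alpha := ⟨indA π E ξ, indA_mem hcov h1 hE ξ⟩

/-- The element `|ξ] ⊗ υ(θ)*` of `β(E)`. -/
def elB (hE' : IsCStarBaseBimod (indBase π υ hb) (IndSpace π E) (indBeta π E υ) (indAlpha π E υ))
    (hcov : IsCovariant Θ π υ) (h1 : 1 ∈ Θ.carrier) (θ : Θ.carrier) {ξ : E}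
    (hξ : ξ ∈ E.homog θ.1) : (indObj hE').beta := ⟨indB π υ E θ ξ, indB_mem hcov h1 θ hξ⟩

/-- An elementary tensor as a vector of the C*-bimodule. -/
def elT (hE' : IsCStarBaseBimod (indBase π υ hb) (IndSpace π E) (indBeta π E υ) (indAlpha π E υ))
    (ξ : E) (ζ : K) : indObj hE' := indTmul π ξ ζ

include hπ in
lemma exists_eq_elA (ω : (indObj hE').alpha) : ∃ ξ, ω = elA hE' hcov h1 hE ξ := by
  obtain ⟨ξ, h⟩ := (mem_indAlpha_iff hcov h1 hπ hE).1 ω.2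
  exact ⟨ξ, Subtype.ext h⟩

lemma ipA_elA (ξ ξ' : E) : (indObj hE').ipA (elA hE' hcov h1 hE ξ) (elA hE' hcov h1 hE ξ') =
    baseA hcov h1 hd (E.inner ξ ξ') := Subtype.ext (indA_adjoint_comp ξ ξ')

include hE in
lemma rhoB_elT (b : B) (ξ : E) (ζ : K) :
    (indObj hE').rhoB (baseA hcov h1 hd b) (elT hE' ξ ζ) = elT hE' (E.lmul b ξ) ζ :=
  congrArg (fun T : K →L[ℂ] IndSpace π E => T ζ) (rhoB_comp_indKet (hE' := hE') hcov h1 hE hd b ξ)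

lemma inner_elT (ξ ξ' : E) (ζ ζ' : K) :
    ⟪elT hE' ξ ζ, elT hE' ξ' ζ'⟫_ℂ = ⟪ζ, π (E.inner ξ ξ') ζ'⟫_ℂ := inner_indTmul π ξ ξ' ζ ζ'

include hπ in
lemma total_k₁_elA : Dense (Submodule.span ℂ (Set.range fun p : E × F × K =>
    k₁ (indObj hE') (indObj hF') (elA hE' hcov h1 hE p.1) (elT hF' p.2.1 p.2.2)) :
      Set (tens (indObj hE') (indObj hF'))) := by
  refine total_comp (k := fun ξ : E => k₁ (indObj hE') (indObj hF') (elA hE' hcov h1 hE ξ))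
    (v := fun q : F × K => elT hF' q.1 q.2) ?_ (total_indTmul π F)
  refine (total_k₁ (indObj hE') (indObj hF')).mono (Submodule.span_mono ?_)
  rintro _ ⟨⟨ω, y⟩, rfl⟩
  obtain ⟨ξ, rfl⟩ := exists_eq_elA hcov h1 hπ hE ω
  exact ⟨(ξ, y), rfl⟩

lemma total_elT_tmul : Dense (Submodule.span ℂ (Set.range fun p : E × F × K =>
    elT hEF' (tmul p.1 p.2.1 : itp E F) p.2.2) : Set (indObj hEF')) := by
  refine (total_indTmul_of π (total_tmul E F)).mono (Submodule.span_mono ?_)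
  rintro _ ⟨⟨⟨ξ, η⟩, ζ⟩, rfl⟩
  exact ⟨(ξ, η, ζ), rfl⟩

include hπ hd hF in
/-- Both families have the Gram matrix `⟨ζ|π(⟨η|⟨ξ|ξ'⟩η'⟩)ζ'⟩`. -/
lemma exists_tau : ∃ U : tens (indObj hE') (indObj hF') ≃ₗᵢ[ℂ] indObj hEF',
    ∀ p : E × F × K, U (k₁ (indObj hE') (indObj hF') (elA hE' hcov h1 hE p.1)
      (elT hF' p.2.1 p.2.2)) = elT hEF' (tmul p.1 p.2.1 : itp E F) p.2.2 := by
  obtain ⟨U, hU, -⟩ := exists_linearIsometryEquiv_of_gram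
    (isNormForm_inner (tens (indObj hE') (indObj hF'))) (isNormForm_inner (indObj hEF'))
    (total_k₁_elA hcov h1 hπ hE) total_elT_tmul fun p q => by
      rw [innerₛₗ_apply_apply, innerₛₗ_apply_apply, inner_k₁, ipA_elA hcov h1 hd hE,
        rhoB_elT hcov h1 hd hF, inner_elT, inner_elT, CStarBimod.inner_tmul]
  exact ⟨U, hU⟩

/-- The unitary `(|ξ⟩ ⊗ Id) ⊗ (η ⊗ ζ) ↦ (ξ ⊗ η) ⊗ ζ`. -/
def tauU (hE' : IsCStarBaseBimod (indBase π υ hb) (IndSpace π E) (indBeta π E υ) (indAlpha π E υ))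
    (hF' : IsCStarBaseBimod (indBase π υ hb) (IndSpace π F) (indBeta π F υ) (indAlpha π F υ))
    (hEF' : IsCStarBaseBimod (indBase π υ hb) (IndSpace π (itp E F)) (indBeta π (itp E F) υ)
      (indAlpha π (itp E F) υ)) :
    tens (indObj hE') (indObj hF') ≃ₗᵢ[ℂ] indObj hEF' :=
  (exists_tau (hE' := hE') (hF' := hF') (hEF' := hEF') hcov h1 hπ hd hE hF).choose

/-- The unitary `tauU` as an operator. -/
def tauL (hE' : IsCStarBaseBimod (indBase π υ hb) (IndSpace π E) (indBeta π E υ) (indAlpha π E υ))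
    (hF' : IsCStarBaseBimod (indBase π υ hb) (IndSpace π F) (indBeta π F υ) (indAlpha π F υ))
    (hEF' : IsCStarBaseBimod (indBase π υ hb) (IndSpace π (itp E F)) (indBeta π (itp E F) υ)
      (indAlpha π (itp E F) υ)) :
    tens (indObj hE') (indObj hF') →L[ℂ] IndSpace π (itp E F) :=
  ((tauU hcov h1 hπ hd hE hF hE' hF' hEF').toContinuousLinearEquiv :
    tens (indObj hE') (indObj hF') →L[ℂ] indObj hEF')

/-- The operator `|R⟩₁` on `F ⊗_π 𝔎`, where `R = |ξ⟩ ⊗ Id`. -/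
def kE (hE' : IsCStarBaseBimod (indBase π υ hb) (IndSpace π E) (indBeta π E υ) (indAlpha π E υ))
    (hF' : IsCStarBaseBimod (indBase π υ hb) (IndSpace π F) (indBeta π F υ) (indAlpha π F υ))
    (ξ : E) : IndSpace π F →L[ℂ] tens (indObj hE') (indObj hF') :=
  k₁ (indObj hE') (indObj hF') (elA hE' hcov h1 hE ξ)

/-- The operator `|R⟩₂` on `E ⊗_π 𝔎`, where `R = |η] ⊗ υ(σ)*`. -/
def kF (hE' : IsCStarBaseBimod (indBase π υ hb) (IndSpace π E) (indBeta π E υ) (indAlpha π E υ))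
    (hF' : IsCStarBaseBimod (indBase π υ hb) (IndSpace π F) (indBeta π F υ) (indAlpha π F υ))
    (σ : Θ.carrier) {η : F} (hη : η ∈ F.homog σ.1) :
    IndSpace π E →L[ℂ] tens (indObj hE') (indObj hF') :=
  k₂ (indObj hE') (indObj hF') (elB hF' hcov h1 σ hη)

lemma kF_comp_indA (σ : Θ.carrier) {η : F} (hη : η ∈ F.homog σ.1) (ξ : E) :
    kF hcov h1 hE' hF' σ hη ∘L indA π E ξ = kE hcov h1 hE hE' hF' ξ ∘L indB π υ F σ η :=
  ContinuousLinearMap.ext fun x => (k₁_apply_beta (indObj hE') (indObj hF')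
    (elA hE' hcov h1 hE ξ) (elB hF' hcov h1 σ hη) x).symm

lemma tauL_comp_kE_comp_indKet (ξ : E) (η : F) :
    (tauL hcov h1 hπ hd hE hF hE' hF' hEF' ∘L kE hcov h1 hE hE' hF' ξ) ∘L indKet π F η =
      indKet π (itp E F) (tmul ξ η) :=
  ContinuousLinearMap.ext fun ζ =>
    (exists_tau (hE' := hE') (hF' := hF') (hEF' := hEF') hcov h1 hπ hd hE hF).choose_spec (ξ, η, ζ)

lemma tauL_comp_kE_comp_indA (ξ : E) (η : F) :
    (tauL hcov h1 hπ hd hE hF hE' hF' hEF' ∘L kE hcov h1 hE hE' hF' ξ) ∘L indA π F η =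
      indA π (itp E F) (tmul ξ η) :=
  congrArg (fun T => T ∘L indV π) (tauL_comp_kE_comp_indKet hcov h1 hπ hd hE hF ξ η)

lemma tauL_comp_kF_comp_indA (ξ : E) (σ : Θ.carrier) {η : F} (hη : η ∈ F.homog σ.1) :
    (tauL hcov h1 hπ hd hE hF hE' hF' hEF' ∘L kF hcov h1 hE' hF' σ hη) ∘L indA π E ξ =
      indB π υ (itp E F) σ (tmul ξ η) := by
  rw [ContinuousLinearMap.comp_assoc, kF_comp_indA hcov h1 hE]
  exact congrArg (fun T => T ∘L (υ σ)† ∘L indV π)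
    (tauL_comp_kE_comp_indKet hcov h1 hπ hd hE hF ξ η)

/-- The unitary `τ` maps `|R⟩₂ (ξ ⊗ ζ)`, where `R = |η] ⊗ υ(σ)*`, to `(ξ ⊗ η) ⊗ υ(σ)* ζ`. -/
lemma tauL_comp_kF_comp_indKet (ξ : E) (σ : Θ.carrier) {η : F} (hη : η ∈ F.homog σ.1) :
    (tauL hcov h1 hπ hd hE hF hE' hF' hEF' ∘L kF hcov h1 hE' hF' σ hη) ∘L indKet π E ξ =
      indKet π (itp E F) (tmul ξ η) ∘L (υ σ)† := by
  rw [← indKet_comp_indV_comp_adjoint hcov h1 ξ, ← indA_eq, ← ContinuousLinearMap.comp_assoc,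
    tauL_comp_kF_comp_indA, ← hcov.adjoint_mul_one h1, ← indV_comp_adjoint hcov h1]
  rfl

lemma tauL_comp_kF_comp_indB (θ σ : Θ.carrier) (ξ : E) {η : F} (hη : η ∈ F.homog σ.1) :
    (tauL hcov h1 hπ hd hE hF hE' hF' hEF' ∘L kF hcov h1 hE' hF' σ hη) ∘L indB π υ E θ ξ =
      indB π υ (itp E F) (θ * σ) (tmul ξ η) := by
  have h := congrArg (fun T => T ∘L (υ θ)† ∘L indV π)
    (tauL_comp_kF_comp_indKet (hE' := hE') (hF' := hF') (hEF' := hEF') hcov h1 hπ hd hE hF ξ σ hη)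
  rw [indB_eq (θ * σ), ← hcov.star_mul_eq]
  exact h

/-! ### The factorizations of the tensor product -/

include hπ hF in
lemma tens_indObj_alpha : (tens (indObj hE') (indObj hF')).alpha = closedSpan
    {ω | ∃ (ξ : E) (η : F), ω = kE hcov h1 hE hE' hF' ξ ∘L indA π F η} := by
  rw [tens_alpha]
  congr 1
  ext ω
  constructor
  · rintro ⟨R, S, hS, rfl⟩
    obtain ⟨ξ, rfl⟩ := exists_eq_elA hcov h1 hπ hE R
    obtain ⟨η, rfl⟩ := (mem_indAlpha_iff hcov h1 hπ hF).1 hS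
    exact ⟨ξ, η, rfl⟩
  · rintro ⟨ξ, η, rfl⟩
    exact ⟨elA hE' hcov h1 hE ξ, _, indA_mem hcov h1 hF η, rfl⟩

include hcov h1 hπ in
lemma indAlpha_itp (hEF : (itp E F).IsDecomposableOver Θ) : indAlpha π (itp E F) υ = closedSpan
    {ω | ∃ (ξ : E) (η : F), ω = indA π (itp E F) (tmul ξ η)} := by
  refine le_antisymm (fun R hR => ?_)
    (closedSpan_le (Submodule.isClosed_topologicalClosure _) ?_)
  · obtain ⟨x, rfl⟩ := (mem_indAlpha_iff hcov h1 hπ hEF).1 hR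
    refine mem_of_mem_closedSpan (indA π (itp E F)) (isClosed_closedSpan _) ?_ (total_tmul E F x)
    rintro _ ⟨p, rfl⟩
    exact mem_closedSpan ⟨_, _, rfl⟩
  · rintro _ ⟨ξ, η, rfl⟩
    exact indA_mem hcov h1 hEF _

/-- The generators of `β(E) ◁ β(F)`: the products of the operators `|R⟩₂`, where `R = |η] ⊗ υ(σ)*`,
with the operators `|ξ] ⊗ υ(θ)*`. -/
def betaGen
    (hE' : IsCStarBaseBimod (indBase π υ hb) (IndSpace π E) (indBeta π E υ) (indAlpha π E υ))
    (hF' : IsCStarBaseBimod (indBase π υ hb) (IndSpace π F) (indBeta π F υ) (indAlpha π F υ)) :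
    Set (IndSpace π (unit B) →L[ℂ] tens (indObj hE') (indObj hF')) :=
  {ω | ∃ (θ σ : Θ.carrier) (ξ : E) (η : F) (_ : ξ ∈ E.homog θ.1) (hη : η ∈ F.homog σ.1),
    ω = kF hcov h1 hE' hF' σ hη ∘L indB π υ E θ ξ}

lemma comp_mem_closedSpan_betaGen (S : (indObj hF').beta)
    {R : IndSpace π (unit B) →L[ℂ] IndSpace π E}
    (hR : R ∈ indBeta π E υ) :
    k₂ (indObj hE') (indObj hF') S ∘L R ∈ closedSpan (betaGen hcov h1 hE' hF') := by
  refine mem_of_subtype_closedSpan (((ContinuousLinearMap.compL ℂ _ _ _).flip R) ∘L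
    k₂ (indObj hE') (indObj hF')) (S := {T | ∃ σ : Θ.carrier, ∃ η ∈ F.homog σ.1,
      T = indB π υ F σ η}) (fun T hT => (indBeta_eq hcov h1).le hT) (isClosed_closedSpan _) ?_ S
  rintro _ ⟨σ, η, hη, rfl⟩
  refine ⟨indB_mem hcov h1 σ hη, ?_⟩
  rw [indBeta_eq hcov h1] at hR
  refine mem_of_mem_closedSpan (ContinuousLinearMap.compL ℂ _ _ _ (kF hcov h1 hE' hF' σ hη))
    (isClosed_closedSpan _) ?_ hR
  rintro _ ⟨θ, ξ, hξ, rfl⟩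
  exact mem_closedSpan ⟨θ, σ, ξ, η, hξ, hη, rfl⟩

lemma tens_indObj_beta : (tens (indObj hE') (indObj hF')).beta =
    closedSpan (betaGen hcov h1 hE' hF') := by
  rw [tens_beta]
  refine le_antisymm (closedSpan_le (isClosed_closedSpan _) ?_) (closedSpan_mono ?_)
  · rintro _ ⟨S, R, hR, rfl⟩
    exact comp_mem_closedSpan_betaGen hcov h1 S hR
  · rintro _ ⟨θ, σ, ξ, η, hξ, hη, rfl⟩
    exact ⟨elB hF' hcov h1 σ hη, _, indB_mem hcov h1 θ hξ, rfl⟩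

/-- The tensors `ξ ⊗ η` with `ξ ∈ E_θ`, `η ∈ F_σ` for some `θ, σ ∈ Θ` such that `θ σ = τ`. -/
def tmulHomog (Θ : InvSemigroup B) (E F : CStarBimod B) (τ : PAut B) : Set (itp E F) :=
  {x | ∃ (θ σ : Θ.carrier) (ξ : E) (η : F), ξ ∈ E.homog θ.1 ∧ η ∈ F.homog σ.1 ∧
    θ.1 * σ.1 = τ ∧ x = tmul ξ η}

include hE hF in
/-- Homogeneous elements of `E ⊗ F` are approximated by elementary tensors of homogeneous elements
whose degrees multiply to a degree below their own. -/
lemma mem_closedSpan_tmulHomog (π : B →⋆ₙₐ[ℂ] (K →L[ℂ] K)) (hπ : Function.Injective π)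
    (hs : (unit B).IsSupported Θ) {τ : PAut B} {x : itp E F} (hx : x ∈ (itp E F).homog τ) :
    x ∈ closedSpan {y : itp E F | ∃ θ ∈ Θ.carrier, θ ≤ τ ∧ y ∈ tmulHomog Θ E F θ} := by
  refine mem_closedSpan_of_total π hπ hs ?_ ?_ (fun x => ?_) hx
  · rintro θ - _ ⟨φ, σ, ξ, η, hξ, hη, rfl, rfl⟩
    exact tmul_mem_homog hξ hη
  · rintro θ - ψ hψ _ ⟨φ, σ, ξ, η, hξ, hη, rfl, rfl⟩ b hb
    refine ⟨φ, σ * ⟨ψ, hψ⟩, ξ, F.rmul b η, hξ, rmul_mem_homog hη hb, (mul_assoc _ _ _).symm, ?_⟩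
    exact rmul_tmul b ξ η
  · refine closedSpan_mono ?_ (total_homog_tmul hE hF x)
    rintro _ ⟨⟨⟨p, hp, hp'⟩, ⟨q, hq, hq'⟩⟩, rfl⟩
    exact ⟨_, Θ.mul_mem hp hq, ⟨p.1, hp⟩, ⟨q.1, hq⟩, p.2, q.2, hp', hq', rfl, rfl⟩

include hcov h1 hπ hE hF in
lemma indBeta_itp (hs : (unit B).IsSupported Θ) : indBeta π (itp E F) υ = closedSpan
    {ω | ∃ (θ σ : Θ.carrier) (ξ : E) (η : F) (_ : ξ ∈ E.homog θ.1) (_ : η ∈ F.homog σ.1),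
      ω = indB π υ (itp E F) (θ * σ) (tmul ξ η)} := by
  refine le_antisymm ?_ (closedSpan_le (Submodule.isClosed_topologicalClosure _) ?_)
  · rw [indBeta_eq hcov h1]
    refine closedSpan_le (isClosed_closedSpan _) ?_
    rintro _ ⟨τ, x, hx, rfl⟩
    refine mem_of_mem_closedSpan (indB π υ (itp E F) τ) (isClosed_closedSpan _) ?_
      (mem_closedSpan_tmulHomog hE hF π hπ hs hx)
    rintro _ ⟨θ, hθ, hle, φ, σ, ξ, η, hξ, hη, rfl, rfl⟩
    refine mem_closedSpan ⟨φ, σ, ξ, η, hξ, hη, ?_⟩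
    exact (indB_of_le hcov (φ := φ * σ) hle (tmul_mem_homog hξ hη)).symm
  · rintro _ ⟨θ, σ, ξ, η, hξ, hη, rfl⟩
    exact indB_mem hcov h1 (θ * σ) (tmul_mem_homog hξ hη)

/-! ### The isomorphisms `τ` -/

/-- The isomorphism from the relative tensor product of `E ⊗_π 𝔎` and `F ⊗_π 𝔎` to
`(E ⊗ F) ⊗_π 𝔎`. -/
def tauIso (hs : (unit B).IsSupported Θ) (hEF : (itp E F).IsDecomposableOver Θ)
    (hE' : IsCStarBaseBimod (indBase π υ hb) (IndSpace π E) (indBeta π E υ) (indAlpha π E υ))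
    (hF' : IsCStarBaseBimod (indBase π υ hb) (IndSpace π F) (indBeta π F υ) (indAlpha π F υ))
    (hEF' : IsCStarBaseBimod (indBase π υ hb) (IndSpace π (itp E F)) (indBeta π (itp E F) υ)
      (indAlpha π (itp E F) υ)) :
    tens (indObj hE') (indObj hF') ≅ indObj hEF' :=
  isoOfUnitary (tauU hcov h1 hπ hd hE hF hE' hF' hEF') (tens_indObj_alpha hcov h1 hπ hE hF)
    (by
      refine (indAlpha_itp hcov h1 hπ hEF).trans ?_
      congr 1
      ext ω
      constructor
      · rintro ⟨ξ, η, rfl⟩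
        exact ⟨_, ⟨ξ, η, rfl⟩, tauL_comp_kE_comp_indA hcov h1 hπ hd hE hF ξ η⟩
      · rintro ⟨_, ⟨ξ, η, rfl⟩, rfl⟩
        exact ⟨ξ, η, tauL_comp_kE_comp_indA hcov h1 hπ hd hE hF ξ η⟩)
    (tens_indObj_beta hcov h1)
    (by
      refine (indBeta_itp hcov h1 hπ hE hF hs).trans ?_
      congr 1
      ext ω
      constructor
      · rintro ⟨θ, σ, ξ, η, hξ, hη, rfl⟩
        exact ⟨_, ⟨θ, σ, ξ, η, hξ, hη, rfl⟩,
          tauL_comp_kF_comp_indB hcov h1 hπ hd hE hF θ σ ξ hη⟩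
      · rintro ⟨_, ⟨θ, σ, ξ, η, hξ, hη, rfl⟩, rfl⟩
        exact ⟨θ, σ, ξ, η, hξ, hη, tauL_comp_kF_comp_indB hcov h1 hπ hd hE hF θ σ ξ hη⟩)

variable (hs : (unit B).IsSupported Θ) (hEF : (itp E F).IsDecomposableOver Θ)

lemma tauIso_k₁ (ξ : E) (η : F) (ζ : K) :
    op (tauIso hcov h1 hπ hd hE hF hs hEF hE' hF' hEF').hom
      (k₁ (indObj hE') (indObj hF') (elA hE' hcov h1 hE ξ) (elT hF' η ζ)) =
      elT hEF' (tmul ξ η : itp E F) ζ :=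
  congrArg (fun T : K →L[ℂ] IndSpace π (itp E F) => T ζ)
    (tauL_comp_kE_comp_indKet (hE' := hE') (hF' := hF') (hEF' := hEF') hcov h1 hπ hd hE hF ξ η)

lemma tauIso_k₂ (σ : Θ.carrier) (ξ : E) {η : F} (hη : η ∈ F.homog σ.1) (ζ : K) :
    op (tauIso hcov h1 hπ hd hE hF hs hEF hE' hF' hEF').hom
      (k₂ (indObj hE') (indObj hF') (elB hF' hcov h1 σ hη) (elT hE' ξ ζ)) =
      elT hEF' (tmul ξ η : itp E F) (((υ σ)†) ζ) :=
  congrArg (fun T : K →L[ℂ] IndSpace π (itp E F) => T ζ)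
    (tauL_comp_kF_comp_indKet (hE' := hE') (hF' := hF') (hEF' := hEF') hcov h1 hπ hd hE hF ξ σ hη)

end Tau

/-! ### The monoidal functor -/

/-- The vectors `|η⟩₂ x` are total if `η` runs through generators of the factorization. -/
lemma CStarBaseBimod.total_k₂_of {𝔥 : Type w} [NormedAddCommGroup 𝔥] [InnerProductSpace ℂ 𝔥]
    [CompleteSpace 𝔥] {𝔟 : CStarBase 𝔥} (X Y : CStarBaseBimod 𝔟) {S : Set (𝔥 →L[ℂ] Y)}
    (hS : Y.beta = closedSpan S) : Dense (Submodule.span ℂ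
      (Set.range fun p : {η : Y.beta // η.1 ∈ S} × X => k₂ X Y p.1.1 p.2) : Set (tens X Y)) := by
  refine dense_of_forall_mem fun x => closedSpan_le_closedSpan ?_ (total_k₂ X Y x)
  rintro _ ⟨⟨ϑ, y⟩, rfl⟩
  refine mem_of_subtype_closedSpan ((k₂ X Y).flip y) (S := S) (fun T hT => hS.le hT)
    (isClosed_closedSpan _) (fun T hT => ?_) ϑ
  exact ⟨hS.ge (mem_closedSpan hT), mem_closedSpan ⟨(⟨⟨T, _⟩, hT⟩, y), rfl⟩⟩

section Main

variable {B : Type u} [NonUnitalCStarAlgebra B] [PartialOrder B] [StarOrderedRing B]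
  {Θ : InvSemigroup B} {K : Type v} [NormedAddCommGroup K] [InnerProductSpace ℂ K] [CompleteSpace K]
  {π : B →⋆ₙₐ[ℂ] (K →L[ℂ] K)} {υ : Θ.carrier → (K →L[ℂ] K)}

open CStarBimod InvSemigroup CStarBaseBimod

/-- `(π, υ)` is a faithful covariant representation of a decomposable C*-algebra and an admissible
inverse semigroup. -/
structure IsAdmissibleRep (Θ : InvSemigroup B) (π : B →⋆ₙₐ[ℂ] (K →L[ℂ] K))
    (υ : Θ.carrier → (K →L[ℂ] K)) : Prop where
  decomposable : (unit B).IsDecomposable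
  admissible : Θ.IsAdmissible
  covariant : IsCovariant Θ π υ
  injective : Function.Injective π

namespace IsAdmissibleRep

variable (h : IsAdmissibleRep Θ π υ)

include h in
lemma admissible_unit : (unit B).IsAdmissible Θ :=
  isAdmissible_unit h.decomposable h.admissible.supported

include h in
lemma isBase : IsCStarBase (indAlpha π (unit B) υ) (indBeta π (unit B) υ) :=
  isCStarBase_ind h.covariant h.admissible.one_mem h.injective h.admissible_unit.decomposable

variable {E F G E₁ F₁ : CStarBimod B}

include h in
lemma isBimod (hE : E.IsAdmissible Θ) : IsCStarBaseBimod (indBase π υ h.isBase) (IndSpace π E)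
    (indBeta π E υ) (indAlpha π E υ) :=
  isCStarBaseBimod_ind h.covariant h.injective h.admissible h.isBase
    h.admissible_unit.decomposable hE

/-- The C*-bimodule `E ⊗_π 𝔎` of an admissible right C*-bimodule `E`. -/
abbrev obj (hE : E.IsAdmissible Θ) : CStarBaseBimod (indBase π υ h.isBase) :=
  indBimod π υ (indBase π υ h.isBase) E (h.isBimod hE)

/-- The morphism `T ⊗ Id`. -/
def map (hE : E.IsAdmissible Θ) (hF : F.IsAdmissible Θ) (T : E ⟶ F) : h.obj hE ⟶ h.obj hF :=
  indHom h.covariant h.admissible.one_mem h.injective hE.decomposable hF.decomposable T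

/-- The isomorphism `τ`. -/
def tau (hE : E.IsAdmissible Θ) (hF : F.IsAdmissible Θ) :
    tens (h.obj hE) (h.obj hF) ≅ h.obj (isAdmissible_itp hE hF) :=
  tauIso h.covariant h.admissible.one_mem h.injective h.admissible_unit.decomposable
    hE.decomposable hF.decomposable h.admissible.supported (isAdmissible_itp hE hF).decomposable
    (h.isBimod hE) (h.isBimod hF) (h.isBimod (isAdmissible_itp hE hF))

/-- The element `|ξ⟩ ⊗ Id` of `α(E)`. -/
def ketA (hE : E.IsAdmissible Θ) (ξ : E) : (h.obj hE).alpha :=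
  elA (h.isBimod hE) h.covariant h.admissible.one_mem hE.decomposable ξ

/-- The element `|ξ] ⊗ υ(θ)*` of `β(E)`. -/
def ketB (hE : E.IsAdmissible Θ) (θ : Θ.carrier) {ξ : E} (hξ : ξ ∈ E.homog θ.1) :
    (h.obj hE).beta := elB (h.isBimod hE) h.covariant h.admissible.one_mem θ hξ

/-- The elementary tensor `ξ ⊗ ζ`. -/
def vec (hE : E.IsAdmissible Θ) (ξ : E) (ζ : K) : h.obj hE := elT (h.isBimod hE) ξ ζ

variable (hE : E.IsAdmissible Θ) (hF : F.IsAdmissible Θ) (hG : G.IsAdmissible Θ)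
  (hE₁ : E₁.IsAdmissible Θ) (hF₁ : F₁.IsAdmissible Θ)

lemma map_vec (T : E ⟶ F) (ξ : E) (ζ : K) :
    op (h.map hE hF T) (h.vec hE ξ ζ) = h.vec hF (CStarBimod.op T ξ) ζ := indMap_indTmul T ξ ζ

lemma pushA_ketA (T : E ⟶ F) (ξ : E) :
    pushA (h.map hE hF T) (h.ketA hE ξ) = h.ketA hF (CStarBimod.op T ξ) :=
  Subtype.ext (indMap_comp_indA T ξ)

lemma map_id : h.map hE hE (𝟙 E) = 𝟙 (h.obj hE) := CStarBaseBimod.hom_ext indMap_id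

lemma map_comp (S : E ⟶ F) (T : F ⟶ G) :
    h.map hE hG (S ≫ T) = h.map hE hF S ≫ h.map hF hG T := CStarBaseBimod.hom_ext (indMap_comp S T)

/-- The functor is fully faithful. -/
lemma map_bijective : Function.Bijective (h.map hE hF) := by
  refine ⟨fun S T e => indMap_injective h.injective (congrArg CStarBaseBimod.Hom.toCLM e),
    fun R => ?_⟩
  obtain ⟨T, hT⟩ := exists_eq_indMap h.covariant h.admissible.one_mem h.injective hE.decomposable
    hF.decomposable h.admissible_unit.decomposable R
  exact ⟨T, CStarBaseBimod.hom_ext hT⟩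

lemma tau_k₁ (ξ : E) (η : F) (ζ : K) :
    op (h.tau hE hF).hom (k₁ (h.obj hE) (h.obj hF) (h.ketA hE ξ) (h.vec hF η ζ)) =
      h.vec (isAdmissible_itp hE hF) (CStarBimod.tmul ξ η) ζ :=
  tauIso_k₁ h.covariant h.admissible.one_mem h.injective h.admissible_unit.decomposable
    hE.decomposable hF.decomposable h.admissible.supported (isAdmissible_itp hE hF).decomposable
    ξ η ζ

lemma tau_k₂ (σ : Θ.carrier) (ξ : E) {η : F} (hη : η ∈ F.homog σ.1) (ζ : K) :
    op (h.tau hE hF).hom (k₂ (h.obj hE) (h.obj hF) (h.ketB hF σ hη) (h.vec hE ξ ζ)) =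
      h.vec (isAdmissible_itp hE hF) (CStarBimod.tmul ξ η) (((υ σ)†) ζ) :=
  tauIso_k₂ h.covariant h.admissible.one_mem h.injective h.admissible_unit.decomposable
    hE.decomposable hF.decomposable h.admissible.supported (isAdmissible_itp hE hF).decomposable
    σ ξ hη ζ

lemma total_k₁_ketA : Dense (Submodule.span ℂ (Set.range fun p : E × F × K =>
    k₁ (h.obj hE) (h.obj hF) (h.ketA hE p.1) (h.vec hF p.2.1 p.2.2)) :
      Set (tens (h.obj hE) (h.obj hF))) :=
  total_k₁_elA h.covariant h.admissible.one_mem h.injective hE.decomposable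

/-! ### Naturality and coherence of `τ` -/

lemma tau_natural (S : E ⟶ E₁) (T : F ⟶ F₁) :
    tmap (h.map hE hE₁ S) (h.map hF hF₁ T) ≫ (h.tau hE₁ hF₁).hom =
      (h.tau hE hF).hom ≫ h.map (isAdmissible_itp hE hF) (isAdmissible_itp hE₁ hF₁)
        (CStarBimod.tmap S T) :=
  CStarBaseBimod.hom_ext_of_total (h.total_k₁_ketA hE hF) fun p => by
    rw [CStarBaseBimod.op_comp, CStarBaseBimod.op_comp, tmap_k₁, pushA_ketA, map_vec, tau_k₁,
      tau_k₁, map_vec, CStarBimod.tmap_tmul]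

lemma total_k₂_k₁_ketA : Dense (Submodule.span ℂ (Set.range
    fun p : {q : Θ.carrier × G // q.2 ∈ G.homog q.1.1} × E × F × K =>
      k₂ (tens (h.obj hE) (h.obj hF)) (h.obj hG) (h.ketB hG p.1.1.1 p.1.2)
        (k₁ (h.obj hE) (h.obj hF) (h.ketA hE p.2.1) (h.vec hF p.2.2.1 p.2.2.2))) :
      Set (tens (tens (h.obj hE) (h.obj hF)) (h.obj hG))) := by
  refine total_comp (k := fun q : {q : Θ.carrier × G // q.2 ∈ G.homog q.1.1} =>
    k₂ (tens (h.obj hE) (h.obj hF)) (h.obj hG) (h.ketB hG q.1.1 q.2))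
    (v := fun q : E × F × K => k₁ (h.obj hE) (h.obj hF) (h.ketA hE q.1) (h.vec hF q.2.1 q.2.2))
    ?_ (h.total_k₁_ketA hE hF)
  refine (total_k₂_of (tens (h.obj hE) (h.obj hF)) (h.obj hG)
    (indBeta_eq (E := G) h.covariant h.admissible.one_mem)).mono (Submodule.span_mono ?_)
  rintro _ ⟨⟨⟨ϑ, σ, η, hη, e⟩, y⟩, rfl⟩
  obtain rfl : ϑ = h.ketB hG σ hη := Subtype.ext e
  exact ⟨(⟨(σ, η), hη⟩, y), rfl⟩

/-- On the vectors `|R⟩₂ |S⟩₁ (η ⊗ ζ)`, where `S = |ξ⟩ ⊗ Id` and `R = |κ] ⊗ υ(σ)*`, both composites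
take the value `(ξ ⊗ (η ⊗ κ)) ⊗ υ(σ)* ζ`. -/
lemma tau_associativity :
    tmap (h.tau hE hF).hom (𝟙 (h.obj hG)) ≫ (h.tau (isAdmissible_itp hE hF) hG).hom ≫
        h.map _ _ (CStarBimod.assocIso E F G).hom =
      (CStarBaseBimod.assocIso (h.obj hE) (h.obj hF) (h.obj hG)).hom ≫
        tmap (𝟙 (h.obj hE)) (h.tau hF hG).hom ≫ (h.tau hE (isAdmissible_itp hF hG)).hom :=
  CStarBaseBimod.hom_ext_of_total (h.total_k₂_k₁_ketA hE hF hG) fun p => by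
    simp only [CStarBaseBimod.op_comp]
    rw [tmap_k₂, pushB_id, tau_k₁, tau_k₂, map_vec, CStarBimod.assoc_tmul, assoc_k₂_k₁, tmap_k₁,
      pushA_id, tau_k₂, tau_k₁]

/-- The unit isomorphism, which is the identity: the unit over the base is `B ⊗_π 𝔎` itself. -/
def eps : uni (indBase π υ h.isBase) ≅ h.obj h.admissible_unit :=
  Iso.refl (uni (indBase π υ h.isBase))

lemma tau_left_unitality : (CStarBaseBimod.leftIso (h.obj hE)).hom =
    tmap h.eps.hom (𝟙 (h.obj hE)) ≫ (h.tau h.admissible_unit hE).hom ≫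
      h.map _ _ (CStarBimod.leftIso E).hom :=
  CStarBaseBimod.hom_ext_of_total (h.total_k₁_ketA h.admissible_unit hE) fun p => by
    refine (left_k₁ (X := h.obj hE) (h.ketA h.admissible_unit p.1) _).trans ?_
    have e1 := congrArg (op (h.map (isAdmissible_itp h.admissible_unit hE) hE
      (CStarBimod.leftIso E).hom)) (h.tau_k₁ h.admissible_unit hE p.1 p.2.1 p.2.2)
    rw [map_vec] at e1
    have e2 := CStarBimod.left_tmul (B := B) p.1 p.2.1
    have e3 := rhoB_elT (B := B) (hE' := h.isBimod hE) h.covariant h.admissible.one_mem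
      h.admissible_unit.decomposable hE.decomposable p.1 p.2.1 p.2.2
    have e4 := congrArg (op ((h.tau h.admissible_unit hE).hom ≫
      h.map (isAdmissible_itp h.admissible_unit hE) hE (CStarBimod.leftIso E).hom))
      (tmap_k₁ h.eps.hom (𝟙 (h.obj hE)) (h.ketA h.admissible_unit p.1) (h.vec hE p.2.1 p.2.2))
    exact e3.trans ((congrArg (fun x => h.vec hE x p.2.2) e2).symm.trans (e1.symm.trans e4.symm))

lemma tau_right_unitality : (CStarBaseBimod.rightIso (h.obj hE)).hom =
    tmap (𝟙 (h.obj hE)) h.eps.hom ≫ (h.tau hE h.admissible_unit).hom ≫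
      h.map _ _ (CStarBimod.rightIso E).hom :=
  CStarBaseBimod.hom_ext_of_total (h.total_k₁_ketA hE h.admissible_unit) fun p => by
    refine (right_k₁ (X := h.obj hE) (h.ketA hE p.1) _).trans ?_
    have e1 := congrArg (op (h.map (isAdmissible_itp hE h.admissible_unit) hE
      (CStarBimod.rightIso E).hom)) (h.tau_k₁ hE h.admissible_unit p.1 p.2.1 p.2.2)
    rw [map_vec] at e1
    have e2 := CStarBimod.right_tmul (B := B) p.1 p.2.1
    have e3 : indA π E p.1 (unitKet π (p.2.1 : B) p.2.2) = indKet π E (E.rmul p.2.1 p.1) p.2.2 :=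
      congrArg (fun T : K →L[ℂ] IndSpace π E => T p.2.2) (indA_comp_unitKet p.1 (p.2.1 : B))
    have e4 := congrArg (op ((h.tau hE h.admissible_unit).hom ≫
      h.map (isAdmissible_itp hE h.admissible_unit) hE (CStarBimod.rightIso E).hom))
      (tmap_k₁ (𝟙 (h.obj hE)) h.eps.hom (h.ketA hE p.1) (h.vec h.admissible_unit p.2.1 p.2.2))
    exact e3.trans ((congrArg (fun x => h.vec hE x p.2.2) e2).symm.trans (e1.symm.trans e4.symm))

end IsAdmissibleRep

end Main

end

theorem mainTheorem1 {B : Type u} [NonUnitalCStarAlgebra B] [PartialOrder B] [StarOrderedRing B]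
    (hB : (CStarBimod.unit B).IsDecomposable) (Θ : InvSemigroup B) (hΘ : Θ.IsAdmissible)
    {K : Type v} [NormedAddCommGroup K] [InnerProductSpace ℂ K] [CompleteSpace K]
    (π : B →⋆ₙₐ[ℂ] (K →L[ℂ] K)) (υ : Θ.carrier → (K →L[ℂ] K)) (hcov : IsCovariant Θ π υ)
    (hπ : Function.Injective π) :
    ∃ hbase : IsCStarBase (indAlpha π (CStarBimod.unit B) υ) (indBeta π (CStarBimod.unit B) υ),
    ∃ hbim : ∀ E : CStarBimod B, E.IsAdmissible Θ →
      IsCStarBaseBimod (indBase π υ hbase) (IndSpace π E) (indBeta π E υ) (indAlpha π E υ),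
    ∃ hrel : CStarBaseBimod.RelWellDefined (indBase π υ hbase),
    ∃ d₁ : MonoidalData (CStarBimod B) CStarBimod.itp (CStarBimod.unit B),
    ∃ d₂ : MonoidalData (CStarBaseBimod (indBase π υ hbase)) hrel.tensor hrel.unit,
      CStarBimod.IsItpStructure d₁ ∧ CStarBaseBimod.IsRelStructure hrel d₂ ∧
      letI := d₁.toMonoidalCategory
      letI := d₂.toMonoidalCategory
      ∃ _ : (CStarBimod.admissible Θ).IsMonoidal,
      ∃ φ : FunctorData (CStarBimod.admissible Θ).FullSubcategory
        (CStarBaseBimod (indBase π υ hbase))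
        (fun E => indBimod π υ (indBase π υ hbase) E.obj (hbim E.obj E.property)),
        (∀ {E F : (CStarBimod.admissible Θ).FullSubcategory} (T : E ⟶ F) (ξ : E.obj) (ζ : K),
          CStarBaseBimod.op (φ.map T) (indTmul π ξ ζ) =
            indTmul π (CStarBimod.op T.hom ξ) ζ) ∧
        φ.toFunctor.Full ∧ φ.toFunctor.Faithful ∧
        ∃ _ : φ.toFunctor.Monoidal,
          (∀ (E F : (CStarBimod.admissible Θ).FullSubcategory) (ξ : E.obj)
            (θ : Θ.carrier), ∀ η ∈ F.obj.homog θ.1,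
            ∀ (a : indAlpha π E.obj υ) (d : indBeta π F.obj υ),
            IsIndMap π (CStarBimod.ket ξ) (.id ℂ K) a.1 →
            IsIndMap π (CStarBimod.ket' η) (star (υ θ)) d.1 →
            ∀ (b : B) (ζ : K),
              CStarBaseBimod.op (Functor.LaxMonoidal.μ φ.toFunctor E F)
                  (CStarBaseBimod.relTmul
                    (X := indBimod π υ (indBase π υ hbase) E.obj (hbim E.obj E.property))
                    (Y := indBimod π υ (indBase π υ hbase) F.obj (hbim F.obj F.property)) a
                    (indTmul π (E := CStarBimod.unit B) b ζ) d) =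
                indTmul π (E := CStarBimod.itp E.obj F.obj)
                  (CStarBimod.tmul ξ (F.obj.lmul b η)) (star (υ θ) ζ)) ∧
          ∀ x : IndSpace π (CStarBimod.unit B),
            CStarBaseBimod.op (Functor.LaxMonoidal.ε φ.toFunctor) x = x := by
  have h : IsAdmissibleRep Θ π υ := ⟨hB, hΘ, hcov, hπ⟩
  refine ⟨h.isBase, fun E hE => h.isBimod hE, CStarBaseBimod.relWellDefined _,
    CStarBimod.itpMonoidalData B, CStarBaseBimod.relMonoidalData _,
    CStarBimod.isItpStructure_itpMonoidalData, CStarBaseBimod.isRelStructure_relMonoidalData _, ?_⟩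
  let _ := (CStarBimod.itpMonoidalData B).toMonoidalCategory
  let _ := (CStarBaseBimod.relMonoidalData (indBase π υ h.isBase)).toMonoidalCategory
  have hmon : (CStarBimod.admissible Θ).IsMonoidal :=
    { prop_unit := h.admissible_unit
      prop_tensor := fun _ _ hE hF => CStarBimod.isAdmissible_itp hE hF }
  let φ : FunctorData (CStarBimod.admissible Θ).FullSubcategory
      (CStarBaseBimod (indBase π υ h.isBase)) (fun E => h.obj E.property) :=
    { map := fun {E F} T => h.map E.property F.property T.hom
      map_id := fun E => h.map_id E.property
      map_comp := fun {E F G} S T => h.map_comp E.property F.property G.property S.hom T.hom }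
  let core : φ.toFunctor.CoreMonoidal :=
    { εIso := h.eps
      μIso := fun E F => h.tau E.property F.property
      μIso_hom_natural_left := fun {E F} f G => by
        have e := h.tau_natural E.property G.property F.property G.property f.hom (𝟙 G.obj)
        rw [h.map_id] at e
        exact e
      μIso_hom_natural_right := fun {E F} G f => by
        have e := h.tau_natural G.property E.property G.property F.property (𝟙 G.obj) f.hom
        rw [h.map_id] at e
        exact e
      associativity := fun E F G => h.tau_associativity E.property F.property G.property
      left_unitality := fun E => h.tau_left_unitality E.property
      right_unitality := fun E => h.tau_right_unitality E.property }
  refine ⟨hmon, φ, fun {E F} T ξ ζ => h.map_vec E.property F.property T.hom ξ ζ, ⟨?_⟩, ⟨?_⟩,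
    core.toMonoidal, ?_, fun x => rfl⟩
  · intro E F R
    obtain ⟨T, hT⟩ := (h.map_bijective E.property F.property).2 R
    exact ⟨ObjectProperty.homMk T, hT⟩
  · intro E F S T e
    exact ObjectProperty.hom_ext _ ((h.map_bijective E.property F.property).1 e)
  · rintro E F ξ θ η hη ⟨a, ha'⟩ ⟨d, hd'⟩ ha hd b ζ
    obtain rfl := isIndMap_ket_iff.1 ha
    obtain rfl := (isIndMap_ket'_iff hcov hη).1 hd
    have e1 : indB π υ F.obj θ η (unitKet π b ζ) =
        indKet π F.obj (F.obj.lmul b η) (((υ θ)†) ζ) :=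
      congrArg (fun T : K →L[ℂ] IndSpace π F.obj => T ζ) (indB_comp_unitKet hcov hη b)
    have e2 := CStarBaseBimod.relTmul_eq_k₁ (h.ketA E.property ξ) (unitKet π b ζ)
      (h.ketB F.property θ hη)
    have e3 := h.tau_k₁ E.property F.property ξ (F.obj.lmul b η) (((υ θ)†) ζ)
    exact (congrArg (CStarBaseBimod.op (h.tau E.property F.property).hom) (e2.trans
      (congrArg (CStarBaseBimod.k₁ (h.obj E.property) (h.obj F.property)
        (h.ketA E.property ξ)) e1))).trans e3
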